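/- **Theorem (Global convergence of the PINN objective).** *Setting.* Let $\Omega\subset\mathbb{R}^d$ be compact with $C^{3,\alpha}$ boundary for some $\alpha\in(0,1)$. Let $\eta\in C^3_b(\mathbb{R}^d)$ satisfy $\eta>0$ in the interior of $\Omega$, $\eta=0$ and $\nabla\eta\neq0$ on $\partial\Omega$. Let $\mu$ be a finite measure on $\Omega$, equivalent to Lebesgue measure on $\Omega$, whose Radon–Nikodym derivative has bounded logarithm. Let $\mathcal{H}^2$ be the space of $f\in L^2(\mu)$ whose weak derivatives $D_\alpha f$, $|\alpha|\le 2$, lie in $L^2(\mu)$, with norm $\sum_{|\alpha|\le2}\|D_\alpha f\|_{L^2(\mu)}$, and let $\mathcal{H}^2_{(0)}=\mathcal{H}^2\cap\mathcal{H}^1_0$. Let $\mathcal{A}$ be a second-order linear differential operator with measurable coefficients such that, for some $k>0$ and all $f_1,f_2\in\mathcal{H}^2$, $|\mathcal{A}f_1(x)-\mathcal{A}f_2(x)|\le k\sum_{|\alpha|\le 2}|D_\alpha f_1(x)-D_\alpha f_2(x)|$ for almost every $x\in\Omega$. Let $\sigma\in C^4_b(\mathbb{R})$ be non-constant. Let $(c,w,b)$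 be a random vector in $\mathbb{R}\times\mathbb{R}^d\times\mathbb{R}$ with $c$ bounded, $\mathbb{E}[c]=0$, $\mathbb{P}((w,b)\in D)>0$ for every nonempty open $D\subseteq\mathbb{R}^{d+1}$, $\mathbb{E}[|w_k|^4]<\infty$ for all $k$, and $\mathbb{E}[|b|]<\infty$. Write $\phi_{c,w,b}(x)=c\,\eta(x)\,\sigma(w\cdot x+b)$ and $$U(x,y)=\mathbb{E}\big[\nabla_{c,w,b}\mathcal{A}\phi_{c,w,b}(x)\cdot\nabla_{c,w,b}\phi_{c,w,b}(y)\big],\qquad B(x,y)=\mathbb{E}\big[\nabla_{c,w,b}\phi_{c,w,b}(x)\cdot\nabla_{c,w,b}\phi_{c,w,b}(y)\big].$$ Let $x_1,\dots,x_M$ be observation points in the interior of $\Omega$, $\mu_{\mathbf{x}}=\frac1M\sum_i\delta_{x_i}$, and for $f\in L^2(\mu)$, $\mathbf v\in\mathbb{R}^M\equiv L^2(\mu_{\mathbf{x}})$ put $$\mathcal{U}f(y)=\int_\Omega f(x)U(x,y)\,d\mu(x),\quad \mathcal{B}\mathbf v(y)=\frac1M\sum_i v_iB(x_i,y),\quad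 \mathcal{S}=\mathcal{A}\,\mathcal{U},$$ $$\bar{\mathcal U}f=\big(\mathcal{U}f(x_j)\big)_{j},\quad \bar{\mathcal B}\mathbf v=\big(\mathcal{B}\mathbf v(x_j)\big)_{j},\quad \bar{\mathcal U}^*\mathbf v(x)=\frac1M\sum_i v_iU(x,x_i),\quad \mathcal{V}=\begin{bmatrix}\mathcal{S}&\bar{\mathcal U}^*\\ \bar{\mathcal U}&\bar{\mathcal B}\end{bmatrix}.$$ *Statement.* Let $u\in\mathcal{H}^2_{(0)}$ be a solution of $\mathcal{A}u=g$ in $\Omega$, $u=0$ on $\partial\Omega$, where the observed value $u(x_i)$ is the limit of the averages of $u$ over balls $B(x_i,r)$ as $r\downarrow0$. Let $Q_t$, $t\ge0$, be a solution in $\mathcal{H}^2_{(0)}$ of the wide-limit equation $$\frac{dQ_t}{dt}=-\mathcal{U}[\mathcal{A}Q_t-g]-\mathcal{B}[Q_t-u],\qquad Q_0=0,$$ the derivative being taken both in the norm of $\mathcal{H}^2$ and at every point of $\Omega$. Then the pair $F_t=\big(\mathcal{A}Q_t-g,\ (Q_t(x_i)-u(x_i))_{i}\big)$ satisfies $\frac{d}{dt}F_t=-\mathcal{V}F_t$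 in $L^2(\mu)\times\mathbb{R}^M$ for all $t\ge0$ (one-sided derivative at $t=0$), and $$\lim_{t\to\infty}\Big(\|\mathcal{A}Q_t-g\|^2_{L^2(\mu)}+\|Q_t-u\|^2_{L^2(\mu_{\mathbf{x}})}\Big)=0 .$$ -/

import Mathlib

open MeasureTheory Filter Topology Set
open scoped ENNReal NNReal ContDiff

noncomputable section

namespace PINN

/-- The ambient Euclidean space `ℝ^d`. -/
abbrev Space (d : ℕ) := EuclideanSpace ℝ (Fin d)

/-- The parameters `(c, w, b)` of a single hidden unit. -/
abbrev Param (d : ℕ) := ℝ × Space d × ℝ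

/-! ### Smoothness classes and smooth domains -/

/-- `f ∈ C_b^k`: `f` is `k` times continuously differentiable and `f` and its derivatives up to
order `k` are bounded. -/
def IsCb {E : Type*} [NormedAddCommGroup E] [NormedSpace ℝ E] (k : ℕ) (f : E → ℝ) : Prop :=
  ContDiff ℝ k f ∧ ∀ j ≤ k, ∃ C : ℝ, ∀ x, ‖iteratedFDeriv ℝ j f x‖ ≤ C

/-- The boundary of `Ω` is of class `C^{3,α}` for some `α ∈ (0,1)`: near each boundary point, `Ω`
is the superlevel set `{ρ ≥ 0}` of a `C^{3,α}` function `ρ` with nonvanishing gradient (so that `Ω`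
lies locally on one side of its boundary). -/
def HasC3HolderBoundary {d : ℕ} (Ω : Set (Space d)) : Prop :=
  ∃ α : ℝ≥0, 0 < α ∧ α < 1 ∧ ∀ p ∈ frontier Ω, ∃ r > 0, ∃ ρ : Space d → ℝ,
    ContDiff ℝ 3 ρ ∧
    (∃ C : ℝ≥0, HolderOnWith C α (iteratedFDeriv ℝ 3 ρ) (Metric.ball p r)) ∧
    fderiv ℝ ρ p ≠ 0 ∧
    Ω ∩ Metric.ball p r = {x | 0 ≤ ρ x} ∩ Metric.ball p r

/-- The auxiliary function `η ∈ C_b^3(ℝ^d)`: positive in the interior of `Ω`, zero on the boundary,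
with first derivative not vanishing at the boundary (as `η = 0` on the boundary, this says that its
normal derivative is nonzero there). -/
structure IsAuxiliary {d : ℕ} (Ω : Set (Space d)) (η : Space d → ℝ) : Prop where
  isCb : IsCb 3 η
  pos : ∀ x ∈ interior Ω, 0 < η x
  zero : ∀ x ∈ frontier Ω, η x = 0
  fderiv_ne_zero : ∀ x ∈ frontier Ω, fderiv ℝ η x ≠ 0

/-- The sampling measure: a finite measure on `Ω`, equivalent to Lebesgue measure on `Ω`, such that
the logarithm of its Radon-Nikodym derivative is bounded. -/
structure IsSampling {d : ℕ} (Ω : Set (Space d)) (μ : Measure (Space d)) : Prop where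
  finite : IsFiniteMeasure μ
  ac : μ ≪ volume.restrict Ω
  ac_symm : volume.restrict Ω ≪ μ
  log_bound : ∃ C : ℝ, ∀ᵐ x ∂(volume.restrict Ω),
    |Real.log (μ.rnDeriv (volume.restrict Ω) x).toReal| ≤ C

/-! ### Weak derivatives and Sobolev spaces -/

/-- The classical partial derivative `∂_i f (x)`. -/
def pderiv {d : ℕ} (i : Fin d) (f : Space d → ℝ) (x : Space d) : ℝ :=
  lineDeriv ℝ f x (EuclideanSpace.single i 1)

/-- `φ ∈ C_c^∞(O)`. -/
def IsTest {d : ℕ} (O : Set (Space d)) (φ : Space d → ℝ) : Prop :=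
  ContDiff ℝ ∞ φ ∧ HasCompactSupport φ ∧ tsupport φ ⊆ O

/-- `g` is the weak `i`-th partial derivative of `f` on the (open) set `O`. -/
def HasWeakPartial {d : ℕ} (O : Set (Space d)) (i : Fin d) (f g : Space d → ℝ) : Prop :=
  LocallyIntegrableOn f O ∧ LocallyIntegrableOn g O ∧
    ∀ φ : Space d → ℝ, IsTest O φ →
      ∫ x in O, f x * pderiv i φ x = - ∫ x in O, g x * φ x

/-- Weak partial derivatives are unique almost everywhere. -/
theorem HasWeakPartial.ae_eq {d : ℕ} {O : Set (Space d)} (hO : IsOpen O) {i : Fin d}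
    {f g₁ g₂ : Space d → ℝ} (h₁ : HasWeakPartial O i f g₁) (h₂ : HasWeakPartial O i f g₂) :
    ∀ᵐ x ∂(volume : Measure (Space d)), x ∈ O → g₁ x = g₂ x := by
  have key := hO.ae_eq_zero_of_integral_contDiff_smul_eq_zero (μ := volume)
    (f := fun x => g₁ x - g₂ x) (h₁.2.1.sub h₂.2.1) (by
      intro φ hφ hc hs
      have e : ∀ g : Space d → ℝ, ∫ x, φ x • g x = ∫ x in O, g x * φ x := by
        intro g
        rw [← setIntegral_eq_integral_of_forall_compl_eq_zero (s := O)]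
        · simp [mul_comm]
        · intro x hx
          have : φ x = 0 := image_eq_zero_of_notMem_tsupport (fun h => hx (hs h))
          simp [this]
      have int : ∀ g : Space d → ℝ, LocallyIntegrableOn g O → Integrable (fun x => φ x • g x) := by
        intro g hg
        have hk : IntegrableOn g (tsupport φ) := hg.integrableOn_compact_subset hs hc
        have h2 : IntegrableOn (fun x => φ x • g x) (tsupport φ) :=
          hk.continuousOn_smul hφ.continuous.continuousOn hc
        refine (integrableOn_iff_integrable_of_support_subset ?_).1 h2
        intro x hx
        by_contra hcon
        exact hx (by simp [image_eq_zero_of_notMem_tsupport hcon])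
      have s := h₁.2.2 φ ⟨hφ, hc, hs⟩
      rw [h₂.2.2 φ ⟨hφ, hc, hs⟩, neg_inj] at s
      simp only [smul_sub]
      rw [integral_sub (int _ h₁.2.1) (int _ h₂.2.1), e, e, s, sub_self])
  filter_upwards [key] with x hx hxO
  exact sub_eq_zero.1 (hx hxO)

open Classical in
/-- The weak `i`-th partial derivative of `f` on `O` (zero if there is none); it is determined
almost everywhere on `O`. -/
def weakPartial {d : ℕ} (O : Set (Space d)) (i : Fin d) (f : Space d → ℝ) : Space d → ℝ :=
  if h : ∃ g, HasWeakPartial O i f g then h.choose else 0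

theorem HasWeakPartial.ae_eq_weakPartial {d : ℕ} {O : Set (Space d)} (hO : IsOpen O) {i : Fin d}
    {f g : Space d → ℝ} (h : HasWeakPartial O i f g) :
    ∀ᵐ x ∂(volume : Measure (Space d)), x ∈ O → g x = weakPartial O i f x := by
  have hex : ∃ g, HasWeakPartial O i f g := ⟨g, h⟩
  have : HasWeakPartial O i f (weakPartial O i f) := by
    unfold weakPartial
    rw [dif_pos hex]
    exact hex.choose_spec
  exact h.ae_eq hO this

/-- `f ∈ 𝓗^1 = H^1(Ω, μ)`: `f` and its first weak derivatives are in `L²(μ)`. -/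
def MemH1 {d : ℕ} (Ω : Set (Space d)) (μ : Measure (Space d)) (f : Space d → ℝ) : Prop :=
  MemLp f 2 μ ∧ ∀ i, ∃ g, HasWeakPartial (interior Ω) i f g ∧ MemLp g 2 μ

/-- `f ∈ 𝓗^2 = H^2(Ω, μ)`: `f` and its weak derivatives of order at most two are in `L²(μ)`. -/
def MemH2 {d : ℕ} (Ω : Set (Space d)) (μ : Measure (Space d)) (f : Space d → ℝ) : Prop :=
  MemH1 Ω μ f ∧ ∀ i, MemH1 Ω μ (weakPartial (interior Ω) i f)

/-- `f ∈ 𝓗^1_0`: `f` is a limit in `𝓗^1` of smooth functions with compact support in the interior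
of `Ω`. -/
def MemH10 {d : ℕ} (Ω : Set (Space d)) (μ : Measure (Space d)) (f : Space d → ℝ) : Prop :=
  MemH1 Ω μ f ∧ ∃ φ : ℕ → Space d → ℝ, (∀ n, IsTest (interior Ω) (φ n)) ∧
    Tendsto (fun n => eLpNorm (φ n - f) 2 μ) atTop (𝓝 0) ∧
    ∀ i, Tendsto (fun n => eLpNorm (pderiv i (φ n) - weakPartial (interior Ω) i f) 2 μ) atTop (𝓝 0)

/-- `f ∈ 𝓗^2_{(0)} = 𝓗^2 ∩ 𝓗^1_0`. -/
def MemH2Zero {d : ℕ} (Ω : Set (Space d)) (μ : Measure (Space d)) (f : Space d → ℝ) : Prop :=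
  MemH2 Ω μ f ∧ MemH10 Ω μ f

open Classical in
/-- The `𝓗^2` norm: the sum of the `L²(μ)` norms of the weak derivatives of order at most two
(infinite for a function that is not in `𝓗^2`). -/
def h2Norm {d : ℕ} (Ω : Set (Space d)) (μ : Measure (Space d)) (f : Space d → ℝ) : ℝ≥0∞ :=
  if MemH2 Ω μ f then
    eLpNorm f 2 μ + ∑ i, eLpNorm (weakPartial (interior Ω) i f) 2 μ
      + ∑ i, ∑ j, eLpNorm (weakPartial (interior Ω) i (weakPartial (interior Ω) j f)) 2 μ
  else ⊤

/-! ### Second-order linear differential operators -/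

/-- The coefficients of a second-order linear differential operator
`𝒜 f = ∑_{i,j} a_{ij} ∂_i ∂_j f + ∑_i a_i ∂_i f + a f`. -/
structure DiffOp (d : ℕ) where
  /-- coefficient of order zero -/
  a₀ : Space d → ℝ
  /-- coefficients of order one -/
  a₁ : Fin d → Space d → ℝ
  /-- coefficients of order two -/
  a₂ : Fin d → Fin d → Space d → ℝ

/-- `𝒜 f` for a classically twice differentiable function `f`. -/
def DiffOp.classical {d : ℕ} (A : DiffOp d) (f : Space d → ℝ) (x : Space d) : ℝ :=
  A.a₀ x * f x + ∑ i, A.a₁ i x * pderiv i f x + ∑ i, ∑ j, A.a₂ i j x * pderiv i (pderiv j f) x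

/-- `𝒜 f` for `f ∈ 𝓗^2`, with weak derivatives on the interior of `Ω`. -/
def DiffOp.weak {d : ℕ} (A : DiffOp d) (Ω : Set (Space d)) (f : Space d → ℝ) (x : Space d) : ℝ :=
  A.a₀ x * f x + ∑ i, A.a₁ i x * weakPartial (interior Ω) i f x
    + ∑ i, ∑ j, A.a₂ i j x * weakPartial (interior Ω) i (weakPartial (interior Ω) j f) x

/-- The standing assumptions on `𝒜`: its coefficients are measurable and it satisfies the Lipschitz
condition `|𝒜 f₁(x) - 𝒜 f₂(x)| ≤ k ∑_{|α| ≤ 2} |D_α f₁(x) - D_α f₂(x)|` on `𝓗^2`. -/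
structure DiffOp.IsAdmissible {d : ℕ} (A : DiffOp d) (Ω : Set (Space d)) (μ : Measure (Space d)) :
    Prop where
  meas₀ : AEMeasurable A.a₀ μ
  meas₁ : ∀ i, AEMeasurable (A.a₁ i) μ
  meas₂ : ∀ i j, AEMeasurable (A.a₂ i j) μ
  lipschitz : ∃ k : ℝ, 0 < k ∧ ∀ f₁ f₂ : Space d → ℝ, MemH2 Ω μ f₁ → MemH2 Ω μ f₂ →
    ∀ᵐ x ∂μ, |A.weak Ω f₁ x - A.weak Ω f₂ x| ≤
      k * (|f₁ x - f₂ x|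
        + ∑ i, |weakPartial (interior Ω) i f₁ x - weakPartial (interior Ω) i f₂ x|
        + ∑ i, ∑ j, |weakPartial (interior Ω) i (weakPartial (interior Ω) j f₁) x
            - weakPartial (interior Ω) i (weakPartial (interior Ω) j f₂) x|)

/-- `u` is a (strong Sobolev) solution of `𝒜 u = g` in `Ω`, `u = 0` on `∂Ω`. -/
def IsSolution {d : ℕ} (A : DiffOp d) (Ω : Set (Space d)) (μ : Measure (Space d))
    (g u : Space d → ℝ) : Prop :=
  MemH2Zero Ω μ u ∧ ∀ᵐ x ∂μ, A.weak Ω u x = g x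

/-! ### The network, its kernels and the limiting operators -/

/-- The law `ν` of the initial parameters `(c, w, b)` of a hidden unit: `c` is bounded and centred,
`(w, b)` has full support, the fourth moments of the `w_k` and the first moment of `b` are finite.
No independence of `c`, `w` and `b` is required. -/
structure IsInitialLaw {d : ℕ} (ν : Measure (Param d)) : Prop where
  prob : IsProbabilityMeasure ν
  bounded : ∃ K : ℝ, ∀ᵐ θ ∂ν, |θ.1| < K
  centred : ∫ θ, θ.1 ∂ν = 0
  full_support : ∀ D : Set (Space d × ℝ), IsOpen D → D.Nonempty → 0 < ν {θ | θ.2 ∈ D}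
  moment_w : ∀ k, Integrable (fun θ => |θ.2.1 k| ^ 4) ν
  moment_b : Integrable (fun θ => |θ.2.2|) ν

/-- The function `x ↦ c η(x) σ(w · x + b)` computed by one hidden unit with parameters `(c, w, b)`,
multiplied by `η`. -/
def unit {d : ℕ} (η : Space d → ℝ) (σ : ℝ → ℝ) (θ : Param d) (x : Space d) : ℝ :=
  θ.1 * η x * σ (inner ℝ θ.2.1 x + θ.2.2)

/-- The product `∇_{c,w,b} F · ∇_{c,w,b} G` of the gradients at the parameter `θ`. -/
def gradDot {d : ℕ} (F G : Param d → ℝ) (θ : Param d) : ℝ :=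
  lineDeriv ℝ F θ (1, 0, 0) * lineDeriv ℝ G θ (1, 0, 0)
    + ∑ i, lineDeriv ℝ F θ (0, EuclideanSpace.single i 1, 0)
        * lineDeriv ℝ G θ (0, EuclideanSpace.single i 1, 0)
    + lineDeriv ℝ F θ (0, 0, 1) * lineDeriv ℝ G θ (0, 0, 1)

/-- The kernel `U(x,y) = 𝔼[∇ 𝒜[c η σ_{w,b}](x) · ∇ [c η σ_{w,b}](y)]`. -/
def kernelU {d : ℕ} (A : DiffOp d) (η : Space d → ℝ) (σ : ℝ → ℝ) (ν : Measure (Param d))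
    (x y : Space d) : ℝ :=
  ∫ θ, gradDot (fun θ' => A.classical (unit η σ θ') x) (fun θ' => unit η σ θ' y) θ ∂ν

/-- The kernel `B(x,y) = 𝔼[∇ [c η σ_{w,b}](x) · ∇ [c η σ_{w,b}](y)]`. -/
def kernelB {d : ℕ} (η : Space d → ℝ) (σ : ℝ → ℝ) (ν : Measure (Param d)) (x y : Space d) : ℝ :=
  ∫ θ, gradDot (fun θ' => unit η σ θ' x) (fun θ' => unit η σ θ' y) θ ∂ν

/-- The operator `(𝒰 f)(y) = ∫ f(x) U(x,y) dμ(x)`. -/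
def opU {d : ℕ} (A : DiffOp d) (η : Space d → ℝ) (σ : ℝ → ℝ) (ν : Measure (Param d))
    (μ : Measure (Space d)) (f : Space d → ℝ) (y : Space d) : ℝ :=
  ∫ x, f x * kernelU A η σ ν x y ∂μ

/-- The operator `𝒮 = 𝒜 𝒰`. -/
def opS {d : ℕ} (A : DiffOp d) (η : Space d → ℝ) (σ : ℝ → ℝ) (ν : Measure (Param d))
    (μ : Measure (Space d)) (f : Space d → ℝ) : Space d → ℝ :=
  A.classical (opU A η σ ν μ f)

/-- The operator `(ℬ v)(y) = (1/M) ∑_i v_i B(x_i, y)`. -/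
def opB {d M : ℕ} (η : Space d → ℝ) (σ : ℝ → ℝ) (ν : Measure (Param d)) (X : Fin M → Space d)
    (v : Fin M → ℝ) (y : Space d) : ℝ :=
  (M : ℝ)⁻¹ * ∑ i, v i * kernelB η σ ν (X i) y

/-- The adjoint `(𝒰̄* v)(x) = (1/M) ∑_i v_i U(x, x_i)` of `𝒰̄ : L²(μ) → L²(μ_𝐱)`,
`𝒰̄ f = ((𝒰 f)(x_1), …, (𝒰 f)(x_M))`. -/
def opUBarStar {d M : ℕ} (A : DiffOp d) (η : Space d → ℝ) (σ : ℝ → ℝ) (ν : Measure (Param d))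
    (X : Fin M → Space d) (v : Fin M → ℝ) (x : Space d) : ℝ :=
  (M : ℝ)⁻¹ * ∑ i, v i * kernelU A η σ ν x (X i)

/-- The block operator `𝒱 = [[𝒮, 𝒰̄*], [𝒰̄, ℬ̄]]` on `L²(μ) × ℝ^M`. -/
def opV {d M : ℕ} (A : DiffOp d) (η : Space d → ℝ) (σ : ℝ → ℝ) (ν : Measure (Param d))
    (μ : Measure (Space d)) (X : Fin M → Space d) (F : (Space d → ℝ) × (Fin M → ℝ)) :
    (Space d → ℝ) × (Fin M → ℝ) :=
  (opS A η σ ν μ F.1 + opUBarStar A η σ ν X F.2,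
    fun j => opU A η σ ν μ F.1 (X j) + opB η σ ν X F.2 (X j))

/-- The empirical measure `μ_𝐱 = (1/M) ∑_i δ_{x_i}` of the observation points. -/
def obsMeasure {d M : ℕ} (X : Fin M → Space d) : Measure (Space d) :=
  (M : ℝ≥0∞)⁻¹ • ∑ i, Measure.dirac (X i)

/-- The pair `(𝒜 q - g, (q(x_i) - u(x_i))_i)` of the PDE residual and the observation errors. -/
def residual {d M : ℕ} (A : DiffOp d) (Ω : Set (Space d)) (X : Fin M → Space d)
    (g u q : Space d → ℝ) : (Space d → ℝ) × (Fin M → ℝ) :=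
  (A.weak Ω q - g, fun i => q (X i) - u (X i))

/-- The right-hand side `-𝒰[𝒜 q - g] - ℬ[q - u]` of the wide-limit equation. -/
def limitField {d M : ℕ} (A : DiffOp d) (Ω : Set (Space d)) (η : Space d → ℝ) (σ : ℝ → ℝ)
    (ν : Measure (Param d)) (μ : Measure (Space d)) (X : Fin M → Space d)
    (g u q : Space d → ℝ) (y : Space d) : ℝ :=
  - opU A η σ ν μ (residual A Ω X g u q).1 y - opB η σ ν X (residual A Ω X g u q).2 y

/-- `Q` solves the wide-limit equation `dQ_t/dt = -𝒰[𝒜 Q_t - g] - ℬ[Q_t - u]`, `Q_0 = 0`, in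
`𝓗^2_{(0)}`. The derivative is one in the `𝓗^2` norm and also holds at every point `y ∈ Ω`;
derivatives at `t = 0` are one-sided. -/
structure IsWideLimit {d M : ℕ} (A : DiffOp d) (Ω : Set (Space d)) (η : Space d → ℝ) (σ : ℝ → ℝ)
    (ν : Measure (Param d)) (μ : Measure (Space d)) (X : Fin M → Space d)
    (g u : Space d → ℝ) (Q : ℝ → Space d → ℝ) : Prop where
  init : ∀ y ∈ Ω, Q 0 y = 0
  mem : ∀ t, 0 ≤ t → MemH2Zero Ω μ (Q t)
  deriv_h2 : ∀ t, 0 ≤ t →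
    Tendsto (fun s => h2Norm Ω μ
        ((s - t)⁻¹ • (Q s - Q t) - limitField A Ω η σ ν μ X g u (Q t)))
      (𝓝[Ici 0 \ {t}] t) (𝓝 0)
  deriv_pointwise : ∀ t, 0 ≤ t → ∀ y ∈ Ω,
    HasDerivWithinAt (fun s => Q s y) (limitField A Ω η σ ν μ X g u (Q t) y) (Ici 0) t

/-- The curve `F` in `L²(μ) × ℝ^M` has derivative `F'` at the time `t ≥ 0` (one-sided at `0`). -/
def HasL2Deriv {d M : ℕ} (μ : Measure (Space d)) (F : ℝ → (Space d → ℝ) × (Fin M → ℝ))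
    (F' : (Space d → ℝ) × (Fin M → ℝ)) (t : ℝ) : Prop :=
  Tendsto (fun s => eLpNorm ((s - t)⁻¹ • ((F s).1 - (F t).1) - F'.1) 2 μ)
      (𝓝[Ici 0 \ {t}] t) (𝓝 0) ∧
    HasDerivWithinAt (fun s => (F s).2) F'.2 (Ici 0) t

/-- `u(p)` is the value of `u` at `p` in the sense of the precise representative: the limit of the
averages of `u` over small balls around `p`. -/
def HasPreciseValue {d : ℕ} (u : Space d → ℝ) (p : Space d) : Prop :=
  Tendsto (fun r : ℝ => ⨍ y in Metric.ball p r, u y) (𝓝[>] 0) (𝓝 (u p))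

end PINN

end

/-! ### Classical and weak partial derivatives, pairings in `L²` -/

namespace PINN

variable {d : ℕ}

/-! The residual `F = (𝒜Q - g, (Q(x_i) - u(x_i))_i)` solves a linear equation `F' = -𝒱F`, because
`𝒜` is bounded from `𝓗²` to `L²(μ)` and may be applied to the difference quotients of `Q`
(`Setting.hasL2Deriv_residual`). By Fubini the bilinear form of `𝒱` is `∑_κ 𝔼[ℓ_κ(F) ℓ_κ(G)]`, where
`κ` runs over the coordinate directions of the parameter space and `ℓ_κ(F)` pairs `F` with `(𝒜 ∂_κφ,
(∂_κφ(x_i))_i)` (`Setting.pairing_field`). Hence `𝒱` is symmetric and positive semidefinite on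
`L²(μ) × L²(μ_𝐱)`, and bounded by the Hellinger-Toeplitz theorem. Such a flow tends to zero as soon
as its initial value is orthogonal to the kernel of `𝒱` (`tendsto_zero_of_flow`). Since `Q_0 = 0`,
the initial value is `-(𝒜u, (u(x_i))_i)`. So the claim becomes: every `F` on which the quadratic
form of `𝒱` vanishes annihilates `(𝒜u, (u(x_i))_i)`. Solvability of the equation enters here, in
that `g` is of the form `𝒜u`.

Let the form vanish at `F`. Its component in the direction of `c` shows that `F` annihilates `(𝒜q,
(q(x_i))_i)` for `q = η σ(w·x+b)` and almost all `(w,b)`, hence for all of them by continuity and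
full support (`Setting.testFun_ridge_eq_zero`). The set of `p` such that `ηp` is annihilated is
closed under superposition and under bounded pointwise convergence of 2-jets on `Ω`. Smearing `σ` in
the bias gives smooth activations. Their rescaled Taylor remainders give all powers of `w·x`,
because a bounded nonconstant function has no identically vanishing derivative. The powers give
plane waves, Fourier inversion gives `C_c^∞`, and mollification gives `C_c²`
(`Setting.annihilates_of_hasCompactSupport`).

It remains to pass from `η C_c²` to `u ∈ 𝓗²₍₀₎`, in a topology that controls `𝒜u` in `L²(μ)` and the
observed values (`Setting.pairing_eq_zero`). A finite family of bumps along the boundary splits `u`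
into pieces. The interior piece is mollified with radial kernels, which converge wherever the limit
of the averages over balls exists, and is then divided by `η`.

A boundary piece `z` avoids the observation points. Hardy's inequality puts `v = z/η` in `L²`, and a
second Hardy inequality, applied to the derivatives of `v` along a cone of directions in which `η`
increases, puts `∇v` in `L²` (`exists_isQuotient`). The second derivatives of `v` need not be square
integrable, but `η D²v` is. Mollifying `v` with kernels that look only inward gives smooth `p_n`,
and `ηp_n → z` in `H²`. The term `η D²p_n` is handled by a commutator that vanishes in the limit
(`tendsto_commutator`, `exists_boundary_approx`). -/

/-- The `i`-th standard basis vector. -/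
noncomputable abbrev bvec (i : Fin d) : Space d := EuclideanSpace.single i 1

theorem pderiv_eq_fderiv {f : Space d → ℝ} {x : Space d} (hf : DifferentiableAt ℝ f x) (i : Fin d) :
    pderiv i f x = fderiv ℝ f x (bvec i) := hf.lineDeriv_eq_fderiv

theorem pderiv_eq_fderiv' {f : Space d → ℝ} (hf : Differentiable ℝ f) (i : Fin d) :
    pderiv i f = fun x => fderiv ℝ f x (bvec i) := funext fun x => pderiv_eq_fderiv (hf x) i

theorem contDiff_pderiv {f : Space d → ℝ} {n m : ℕ∞ω} (hf : ContDiff ℝ n f) (h : m + 1 ≤ n)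
    (i : Fin d) : ContDiff ℝ m (pderiv i f) := by
  have h1 : n ≠ 0 := by
    rintro rfl
    have : (1 : ℕ∞ω) ≤ 0 := le_trans le_add_self h
    simp at this
  rw [pderiv_eq_fderiv' (hf.differentiable h1)]
  exact (hf.fderiv_right h).clm_apply contDiff_const

theorem continuous_pderiv {f : Space d → ℝ} (hf : ContDiff ℝ 1 f) (i : Fin d) :
    Continuous (pderiv i f) := (contDiff_pderiv (m := 0) hf (by simp) i).continuous

theorem pderiv_add {f g : Space d → ℝ} {x : Space d} (hf : DifferentiableAt ℝ f x)
    (hg : DifferentiableAt ℝ g x) (i : Fin d) :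
    pderiv i (fun y => f y + g y) x = pderiv i f x + pderiv i g x := by
  rw [pderiv_eq_fderiv hf, pderiv_eq_fderiv hg, pderiv_eq_fderiv (hf.fun_add hg), fderiv_fun_add hf hg]
  rfl

theorem pderiv_mul {f g : Space d → ℝ} {x : Space d} (hf : DifferentiableAt ℝ f x)
    (hg : DifferentiableAt ℝ g x) (i : Fin d) :
    pderiv i (fun y => f y * g y) x = pderiv i f x * g x + f x * pderiv i g x := by
  rw [pderiv_eq_fderiv hf, pderiv_eq_fderiv hg, pderiv_eq_fderiv (hf.fun_mul hg), fderiv_fun_mul hf hg]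
  simp; ring

theorem pderiv_const_mul {f : Space d → ℝ} {x : Space d} (hf : DifferentiableAt ℝ f x) (c : ℝ)
    (i : Fin d) : pderiv i (fun y => c * f y) x = c * pderiv i f x := by
  rw [pderiv_eq_fderiv hf, pderiv_eq_fderiv (hf.const_mul c), fderiv_const_mul hf]
  simp

theorem pderiv_const (c : ℝ) (i : Fin d) : pderiv i (fun _ => c) = fun _ => 0 := by
  funext x
  rw [pderiv_eq_fderiv (differentiableAt_const c)]
  simp

theorem pderiv_coord (i j : Fin d) (x : Space d) :
    pderiv i (fun y : Space d => y j) x = if j = i then 1 else 0 := by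
  have h : HasFDerivAt (fun y : Space d => y j) (EuclideanSpace.proj j : Space d →L[ℝ] ℝ) x :=
    (EuclideanSpace.proj j : Space d →L[ℝ] ℝ).hasFDerivAt
  rw [pderiv_eq_fderiv h.differentiableAt, h.fderiv]
  simp [bvec]

theorem pderiv_comp {f : Space d → ℝ} {s : ℝ → ℝ} {x : Space d} (hs : DifferentiableAt ℝ s (f x))
    (hf : DifferentiableAt ℝ f x) (i : Fin d) :
    pderiv i (fun y => s (f y)) x = deriv s (f x) * pderiv i f x := by
  have h := (hs.hasDerivAt.comp_hasFDerivAt x hf.hasFDerivAt)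
  rw [pderiv_eq_fderiv hf, pderiv_eq_fderiv (f := fun y => s (f y)) h.differentiableAt]
  have : fderiv ℝ (fun y => s (f y)) x = deriv s (f x) • fderiv ℝ f x := h.fderiv
  rw [this]; simp

theorem pderiv_comm {f : Space d → ℝ} (hf : ContDiff ℝ 2 f) (i j : Fin d) (x : Space d) :
    pderiv i (pderiv j f) x = pderiv j (pderiv i f) x := by
  have h1 : Differentiable ℝ f := hf.differentiable (by simp)
  have h2 : Differentiable ℝ (fderiv ℝ f) := (hf.fderiv_right (m := 1) (by norm_num)).differentiable (by simp)
  have key : ∀ i j : Fin d, pderiv i (pderiv j f) x = fderiv ℝ (fderiv ℝ f) x (bvec i) (bvec j) := by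
    intro i j
    have h3 : HasFDerivAt (fun y => fderiv ℝ f y (bvec j))
        ((fderiv ℝ (fderiv ℝ f) x).flip (bvec j)) x := by
      have := (h2 x).hasFDerivAt.clm_apply (hasFDerivAt_const (bvec j) x)
      simpa using this
    rw [pderiv_eq_fderiv' h1, pderiv_eq_fderiv h3.differentiableAt, h3.fderiv]
    rfl
  rw [key, key]
  exact second_derivative_symmetric (fun y => (h1 y).hasFDerivAt) (h2 x).hasFDerivAt _ _

theorem pderiv_congr_of_eventuallyEq {f g : Space d → ℝ} {x : Space d} (h : f =ᶠ[𝓝 x] g)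
    (i : Fin d) : pderiv i f x = pderiv i g x := h.lineDeriv_eq

theorem pderiv_eq_zero_of_notMem_tsupport {f : Space d → ℝ} {x : Space d} (h : x ∉ tsupport f)
    (i : Fin d) : pderiv i f x = 0 := by
  have h1 : f =ᶠ[𝓝 x] fun _ => 0 := notMem_tsupport_iff_eventuallyEq.1 h
  rw [pderiv_congr_of_eventuallyEq h1, pderiv_const]

theorem tsupport_pderiv_subset (f : Space d → ℝ) (i : Fin d) : tsupport (pderiv i f) ⊆ tsupport f :=
  closure_minimal (fun x hx => by
    by_contra h
    exact hx (pderiv_eq_zero_of_notMem_tsupport h i)) (isClosed_tsupport f)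

theorem hasCompactSupport_pderiv {f : Space d → ℝ} (h : HasCompactSupport f) (i : Fin d) :
    HasCompactSupport (pderiv i f) :=
  h.of_isClosed_subset (isClosed_tsupport _) (tsupport_pderiv_subset f i)

/-- Integration by parts. -/
theorem integral_mul_pderiv {f g : Space d → ℝ} (hf : ContDiff ℝ 1 f) (hg : ContDiff ℝ 1 g)
    (hc : HasCompactSupport f ∨ HasCompactSupport g) (i : Fin d) :
    ∫ x, f x * pderiv i g x = - ∫ x, pderiv i f x * g x := by
  have hfd : Differentiable ℝ f := hf.differentiable (by simp)
  have hgd : Differentiable ℝ g := hg.differentiable (by simp)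
  have e1 := pderiv_eq_fderiv' hfd i
  have e2 := pderiv_eq_fderiv' hgd i
  have c1 := continuous_pderiv hf i
  have c2 := continuous_pderiv hg i
  have := integral_mul_fderiv_eq_neg_fderiv_mul_of_integrable (μ := (volume : Measure (Space d)))
    (f := f) (g := g) (v := bvec i) ?_ ?_ ?_ (fun x _ => hfd x) (fun x _ => hgd x)
  · rw [e1, e2]; exact this
  · have : (fun x => (fderiv ℝ f x) (bvec i) * g x) = pderiv i f * g := by rw [e1]; rfl
    rw [this]
    refine (c1.mul hg.continuous).integrable_of_hasCompactSupport ?_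
    rcases hc with h | h
    · exact (hasCompactSupport_pderiv h i).mul_right
    · exact h.mul_left
  · have : (fun x => f x * (fderiv ℝ g x) (bvec i)) = f * pderiv i g := by rw [e2]; rfl
    rw [this]
    refine (hf.continuous.mul c2).integrable_of_hasCompactSupport ?_
    rcases hc with h | h
    · exact h.mul_right
    · exact (hasCompactSupport_pderiv h i).mul_left
  · refine (hf.continuous.mul hg.continuous).integrable_of_hasCompactSupport ?_
    rcases hc with h | h
    · exact h.mul_right
    · exact h.mul_left

theorem setIntegral_mul_of_tsupport_subset {O : Set (Space d)} {f φ : Space d → ℝ}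
    (h : tsupport φ ⊆ O) : ∫ x in O, f x * φ x = ∫ x, f x * φ x :=
  setIntegral_eq_integral_of_forall_compl_eq_zero fun x hx => by
    rw [image_eq_zero_of_notMem_tsupport fun h' => hx (h h'), mul_zero]

theorem HasWeakPartial.of_contDiff {f : Space d → ℝ} (hf : ContDiff ℝ 1 f) (O : Set (Space d))
    (i : Fin d) : HasWeakPartial O i f (pderiv i f) := by
  refine ⟨hf.continuous.locallyIntegrable.locallyIntegrableOn O,
    (continuous_pderiv hf i).locallyIntegrable.locallyIntegrableOn O, fun φ hφ => ?_⟩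
  rw [setIntegral_mul_of_tsupport_subset ((tsupport_pderiv_subset φ i).trans hφ.2.2),
    setIntegral_mul_of_tsupport_subset hφ.2.2]
  exact integral_mul_pderiv hf (hφ.1.of_le (by exact_mod_cast le_top)) (Or.inr hφ.2.1) i

section L2

variable {α : Type*} [MeasurableSpace α] {μ : Measure α}

theorem abs_integral_mul_le {f g : α → ℝ} (hf : AEStronglyMeasurable f μ)
    (hg : AEStronglyMeasurable g μ) :
    ENNReal.ofReal |∫ x, f x * g x ∂μ| ≤ eLpNorm f 2 μ * eLpNorm g 2 μ := by
  have h1 := eLpNorm_smul_le_mul_eLpNorm (p := 2) (q := 2) (r := 1) hg hf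
  have h2 : ENNReal.ofReal |∫ x, f x * g x ∂μ| ≤ ∫⁻ x, ‖f x * g x‖ₑ ∂μ := by
    rw [← Real.norm_eq_abs, ofReal_norm]
    exact enorm_integral_le_lintegral_enorm _
  rw [eLpNorm_one_eq_lintegral_enorm] at h1
  exact h2.trans h1

theorem tendsto_integral_mul_of_eLpNorm {f : ℕ → α → ℝ} {F g : α → ℝ} (hf : ∀ n, MemLp (f n) 2 μ)
    (hF : MemLp F 2 μ) (hg : MemLp g 2 μ)
    (h : Tendsto (fun n => eLpNorm (f n - F) 2 μ) atTop (𝓝 0)) :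
    Tendsto (fun n => ∫ x, f n x * g x ∂μ) atTop (𝓝 (∫ x, F x * g x ∂μ)) := by
  rw [tendsto_iff_norm_sub_tendsto_zero]
  have h0 : Tendsto (fun n => (eLpNorm (f n - F) 2 μ * eLpNorm g 2 μ).toReal) atTop (𝓝 0) := by
    have := ENNReal.Tendsto.mul_const h (Or.inr hg.2.ne)
    rw [zero_mul] at this
    exact (ENNReal.tendsto_toReal ENNReal.zero_ne_top).comp this
  refine squeeze_zero (fun _ => norm_nonneg _) (fun n => ?_) h0
  have e : ∫ x, f n x * g x ∂μ - ∫ x, F x * g x ∂μ = ∫ x, (f n - F) x * g x ∂μ := by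
    have := integral_sub ((hf n).integrable_mul hg) (hF.integrable_mul hg)
    simp only [Pi.mul_apply] at this
    rw [← this]
    simp [sub_mul]
  rw [e, Real.norm_eq_abs]
  have := abs_integral_mul_le (((hf n).sub hF).1) hg.1
  refine (ENNReal.ofReal_le_iff_le_toReal (ENNReal.mul_ne_top ((hf n).sub hF).2.ne hg.2.ne)).1 this

theorem eLpNorm_tendsto_add {f g : ℕ → α → ℝ} {F G : α → ℝ} (hf : ∀ n, AEStronglyMeasurable (f n) μ)
    (hg : ∀ n, AEStronglyMeasurable (g n) μ) (hF : AEStronglyMeasurable F μ)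
    (hG : AEStronglyMeasurable G μ)
    (h1 : Tendsto (fun n => eLpNorm (f n - F) 2 μ) atTop (𝓝 0))
    (h2 : Tendsto (fun n => eLpNorm (g n - G) 2 μ) atTop (𝓝 0)) :
    Tendsto (fun n => eLpNorm ((f n + g n) - (F + G)) 2 μ) atTop (𝓝 0) := by
  have h3 := h1.add h2
  rw [add_zero] at h3
  refine tendsto_of_tendsto_of_tendsto_of_le_of_le tendsto_const_nhds h3 (fun _ => zero_le)
    fun n => ?_
  have : (f n + g n) - (F + G) = (f n - F) + (g n - G) := by abel
  simp only [this]
  exact eLpNorm_add_le ((hf n).sub hF) ((hg n).sub hG) (by norm_num)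

theorem eLpNorm_tendsto_mul_bdd {f : ℕ → α → ℝ} {F b : α → ℝ} {C : ℝ} (hb : ∀ᵐ x ∂μ, |b x| ≤ C)
    (h : Tendsto (fun n => eLpNorm (f n - F) 2 μ) atTop (𝓝 0)) :
    Tendsto (fun n => eLpNorm (b * f n - b * F) 2 μ) atTop (𝓝 0) := by
  have h3 := ENNReal.Tendsto.const_mul h (Or.inr (ENNReal.ofReal_ne_top (r := C)))
  rw [mul_zero] at h3
  refine tendsto_of_tendsto_of_tendsto_of_le_of_le tendsto_const_nhds h3 (fun _ => zero_le)
    fun n => ?_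
  refine eLpNorm_le_mul_eLpNorm_of_ae_le_mul ?_ 2
  filter_upwards [hb] with x hx
  simp only [Pi.sub_apply, Pi.mul_apply, Real.norm_eq_abs, ← mul_sub, abs_mul]
  gcongr

theorem _root_.MeasureTheory.MemLp.bdd_mul_of_ae {f b : α → ℝ} {C : ℝ} (hf : MemLp f 2 μ) (hbm : AEStronglyMeasurable b μ)
    (hb : ∀ᵐ x ∂μ, |b x| ≤ C) : MemLp (fun x => b x * f x) 2 μ := by
  refine MemLp.of_le_mul (c := C) hf (hbm.mul hf.1) ?_
  filter_upwards [hb] with x hx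
  simp only [Real.norm_eq_abs, abs_mul]
  gcongr

end L2

theorem IsTest.pderiv {O : Set (Space d)} {φ : Space d → ℝ} (h : IsTest O φ) (i : Fin d) :
    IsTest O (pderiv i φ) :=
  ⟨contDiff_pderiv h.1 (by simp) i, hasCompactSupport_pderiv h.2.1 i,
    (tsupport_pderiv_subset φ i).trans h.2.2⟩

theorem _root_.MeasureTheory.MemLp.locallyIntegrableOn_restrict {O : Set (Space d)} {f : Space d → ℝ}
    (hf : MemLp f 2 (volume.restrict O)) : LocallyIntegrableOn f O := by
  intro x _
  refine ⟨O ∩ Metric.ball x 1, inter_mem_nhdsWithin _ (Metric.ball_mem_nhds x one_pos), ?_⟩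
  have h1 : MemLp f 2 ((volume.restrict O).restrict (Metric.ball x 1)) := hf.restrict _
  rw [Measure.restrict_restrict Metric.isOpen_ball.measurableSet, inter_comm] at h1
  have : IsFiniteMeasure ((volume : Measure (Space d)).restrict (O ∩ Metric.ball x 1)) :=
    ⟨by rw [Measure.restrict_apply_univ]
        exact lt_of_le_of_lt (measure_mono inter_subset_right) Metric.isBounded_ball.measure_lt_top⟩
  exact h1.integrable (by norm_num)

theorem _root_.MeasureTheory.LocallyIntegrableOn.integrable_mul_test {O : Set (Space d)} {f φ : Space d → ℝ}
    (hf : LocallyIntegrableOn f O) (hφ : IsTest O φ) :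
    Integrable (fun x => f x * φ x) (volume.restrict O) := by
  have hk : IntegrableOn f (tsupport φ) := hf.integrableOn_compact_subset hφ.2.2 hφ.2.1
  have h2 : IntegrableOn (fun x => f x * φ x) (tsupport φ) :=
    hk.mul_continuousOn hφ.1.continuous.continuousOn hφ.2.1
  have h3 : Integrable (fun x => f x * φ x) := by
    refine (integrableOn_iff_integrable_of_support_subset ?_).1 h2
    intro x hx
    by_contra hcon
    exact hx (by simp [image_eq_zero_of_notMem_tsupport hcon])
  exact h3.restrict

theorem HasWeakPartial.sub {O : Set (Space d)} {i : Fin d} {f₁ f₂ g₁ g₂ : Space d → ℝ}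
    (h₁ : HasWeakPartial O i f₁ g₁) (h₂ : HasWeakPartial O i f₂ g₂) :
    HasWeakPartial O i (f₁ - f₂) (g₁ - g₂) := by
  refine ⟨h₁.1.sub h₂.1, h₁.2.1.sub h₂.2.1, fun φ hφ => ?_⟩
  simp only [Pi.sub_apply, sub_mul]
  rw [integral_sub (h₁.1.integrable_mul_test (hφ.pderiv i)) (h₂.1.integrable_mul_test (hφ.pderiv i)),
    integral_sub (h₁.2.1.integrable_mul_test hφ) (h₂.2.1.integrable_mul_test hφ), h₁.2.2 φ hφ,
    h₂.2.2 φ hφ]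
  ring

theorem HasWeakPartial.const_smul {O : Set (Space d)} {i : Fin d} {f g : Space d → ℝ} (c : ℝ)
    (h : HasWeakPartial O i f g) : HasWeakPartial O i (c • f) (c • g) := by
  refine ⟨h.1.smul c, h.2.1.smul c, fun φ hφ => ?_⟩
  simp only [Pi.smul_apply, smul_eq_mul, mul_assoc, integral_const_mul]
  rw [h.2.2 φ hφ]; ring

theorem LocallyIntegrableOn.congr_ae_restrict {O : Set (Space d)} {f f' : Space d → ℝ} (hO : IsOpen O)
    (h : LocallyIntegrableOn f O) (he : f =ᵐ[volume.restrict O] f') : LocallyIntegrableOn f' O := by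
  rw [locallyIntegrableOn_iff hO.isLocallyClosed] at h ⊢
  intro k hk hkc
  exact (h k hk hkc).congr (ae_mono (Measure.restrict_mono hk le_rfl) he)

theorem HasWeakPartial.congr {O : Set (Space d)} (hO : IsOpen O) {i : Fin d}
    {f f' g g' : Space d → ℝ} (h : HasWeakPartial O i f g) (hf : f =ᵐ[volume.restrict O] f')
    (hg : g =ᵐ[volume.restrict O] g') : HasWeakPartial O i f' g' := by
  refine ⟨LocallyIntegrableOn.congr_ae_restrict hO h.1 hf,
    LocallyIntegrableOn.congr_ae_restrict hO h.2.1 hg, fun φ hφ => ?_⟩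
  have e1 : (fun x => f x * pderiv i φ x) =ᵐ[volume.restrict O] fun x => f' x * pderiv i φ x :=
    hf.mono fun x hx => by simp [hx]
  have e2 : (fun x => g x * φ x) =ᵐ[volume.restrict O] fun x => g' x * φ x :=
    hg.mono fun x hx => by simp [hx]
  rw [← integral_congr_ae e1, h.2.2 φ hφ, ← integral_congr_ae e2]

theorem HasWeakPartial.weakPartial_ae {O : Set (Space d)} (hO : IsOpen O) {i : Fin d}
    {f g : Space d → ℝ} (h : HasWeakPartial O i f g) : weakPartial O i f =ᵐ[volume.restrict O] g := by
  rw [EventuallyEq, ae_restrict_iff' hO.measurableSet]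
  exact (h.ae_eq_weakPartial hO).mono fun x hx hxO => (hx hxO).symm

theorem HasWeakPartial.weakPartial {O : Set (Space d)} (hO : IsOpen O) {i : Fin d}
    {f g : Space d → ℝ} (h : HasWeakPartial O i f g) : HasWeakPartial O i f (weakPartial O i f) :=
  h.congr hO EventuallyEq.rfl (h.weakPartial_ae hO).symm

end PINN

/-! ### The sampling measure, `𝓗²` through explicit jets, and bounds for `𝒜` -/

namespace PINN

variable {d : ℕ}

/-- For a fixed `v ≠ 0` the map `x ↦ η(x) v` vanishes on the frontier, so it is approximated there
by the zero map with constant `0`. This forces its derivative to vanish at almost every point of the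
frontier, while the hypothesis on `∇η` says that it vanishes nowhere on it. The result identifies
Lebesgue measure on `Ω` with that on the interior, where weak derivatives live. -/
theorem IsAuxiliary.volume_frontier {Ω : Set (Space d)} {η : Space d → ℝ} (hη : IsAuxiliary Ω η) :
    volume (frontier Ω) = 0 := by
  rcases (frontier Ω).eq_empty_or_nonempty with h | ⟨p, hp⟩
  · simp [h]
  obtain ⟨v, hv⟩ : ∃ v, fderiv ℝ η p v ≠ 0 := by
    by_contra! h
    exact hη.fderiv_ne_zero p hp (ContinuousLinearMap.ext h)
  have hv0 : v ≠ 0 := by rintro rfl; simp at hv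
  have hd : Differentiable ℝ η := hη.isCb.1.differentiable (by simp)
  have happ : ApproximatesLinearOn (fun x => η x • v) (0 : Space d →L[ℝ] Space d) (frontier Ω) 0 := by
    intro x hx y hy
    simp [hη.zero x hx, hη.zero y hy]
  have := happ.norm_fderiv_sub_le volume isClosed_frontier.measurableSet
    (fun x => (fderiv ℝ η x).smulRight v)
    (fun x _ => ((hd x).hasFDerivAt.smul_const v).hasFDerivWithinAt)
  rw [ae_restrict_iff' isClosed_frontier.measurableSet] at this
  refine measure_mono_null (fun x hx => ?_) (ae_iff.1 this)
  simp only [mem_ofPred_eq, Classical.not_imp, not_le]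
  refine ⟨hx, ?_⟩
  rw [sub_zero, nnnorm_pos]
  intro h0
  refine hη.fderiv_ne_zero x hx (ContinuousLinearMap.ext fun w => ?_)
  have := DFunLike.congr_fun h0 w
  simpa [hv0] using this

theorem restrict_eq_restrict_interior {Ω : Set (Space d)} (h : volume (frontier Ω) = 0) :
    (volume : Measure (Space d)).restrict Ω = volume.restrict (interior Ω) :=
  Measure.restrict_congr_set (interior_ae_eq_of_null_frontier h).symm

/-- `μ` and `ν` are bounded by multiples of each other. -/
def Comparable {α : Type*} [MeasurableSpace α] (μ ν : Measure α) : Prop :=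
  ∃ C : ℝ≥0, μ ≤ (C : ℝ≥0∞) • ν ∧ ν ≤ (C : ℝ≥0∞) • μ

theorem Comparable.symm {α : Type*} [MeasurableSpace α] {μ ν : Measure α} (h : Comparable μ ν) :
    Comparable ν μ := let ⟨C, h1, h2⟩ := h; ⟨C, h2, h1⟩

theorem Comparable.ac {α : Type*} [MeasurableSpace α] {μ ν : Measure α} (h : Comparable μ ν) :
    μ ≪ ν := by
  obtain ⟨C, h1, h2⟩ := h
  exact Measure.absolutelyContinuous_of_le_smul h1

theorem Comparable.memLp {α : Type*} [MeasurableSpace α] {μ ν : Measure α} (h : Comparable μ ν)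
    {f : α → ℝ} (hf : MemLp f 2 μ) : MemLp f 2 ν := by
  obtain ⟨C, h1, h2⟩ := h
  exact hf.of_measure_le_smul ENNReal.coe_ne_top h2

theorem Comparable.tendsto {α ι : Type*} [MeasurableSpace α] {μ ν : Measure α} (h : Comparable μ ν)
    {l : Filter ι} {f : ι → α → ℝ} (hf : Tendsto (fun n => eLpNorm (f n) 2 μ) l (𝓝 0)) :
    Tendsto (fun n => eLpNorm (f n) 2 ν) l (𝓝 0) := by
  obtain ⟨C, h1, h2⟩ := h
  have h3 := ENNReal.Tendsto.const_mul (a := (C : ℝ≥0∞) ^ (1 / (2 : ℝ≥0∞)).toReal) hf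
    (Or.inr (ENNReal.rpow_ne_top_of_nonneg (by positivity) ENNReal.coe_ne_top))
  rw [mul_zero] at h3
  refine tendsto_of_tendsto_of_tendsto_of_le_of_le tendsto_const_nhds h3 (fun _ => zero_le)
    fun n => ?_
  refine (eLpNorm_mono_measure (f n) h2).trans ?_
  rw [eLpNorm_smul_measure_of_ne_top (by norm_num)]
  rfl

/-- A density whose logarithm is bounded by `C` lies between `exp (-C)` and `exp C`. Positivity and
finiteness almost everywhere are needed first, because `Real.log` takes the value `0` at `0` and
`toReal` hides infinite values. -/
theorem IsSampling.comparable {Ω : Set (Space d)} {μ : Measure (Space d)} (hμ : IsSampling Ω μ)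
    (h0 : volume (frontier Ω) = 0) : Comparable μ (volume.restrict (interior Ω)) := by
  rw [← restrict_eq_restrict_interior h0]
  have := hμ.finite
  obtain ⟨C, hC⟩ := hμ.log_bound
  set ν := (volume : Measure (Space d)).restrict Ω
  have e := Measure.withDensity_rnDeriv_eq μ ν hμ.ac
  have hpos := Measure.rnDeriv_pos' (μ := ν) (ν := μ) hμ.ac_symm
  have htop := Measure.rnDeriv_lt_top μ ν
  have hexp : ∀ᵐ x ∂ν, ENNReal.ofReal (Real.exp (-C)) ≤ μ.rnDeriv ν x ∧
      μ.rnDeriv ν x ≤ ENNReal.ofReal (Real.exp C) := by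
    filter_upwards [hC, hpos, htop] with x h1 h2 h3
    have hp : 0 < (μ.rnDeriv ν x).toReal := ENNReal.toReal_pos h2.ne' h3.ne
    rw [abs_le] at h1
    constructor
    · rw [ENNReal.ofReal_le_iff_le_toReal h3.ne]
      exact (Real.le_log_iff_exp_le hp).1 h1.1
    · rw [← ENNReal.ofReal_toReal h3.ne]
      exact ENNReal.ofReal_le_ofReal ((Real.log_le_iff_le_exp hp).1 h1.2)
  have h1 : μ ≤ ENNReal.ofReal (Real.exp C) • ν := by
    rw [← e, ← withDensity_const]
    exact withDensity_mono (hexp.mono fun x hx => hx.2)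
  have h2 : ENNReal.ofReal (Real.exp (-C)) • ν ≤ μ := by
    conv_rhs => rw [← e]
    rw [← withDensity_const]
    exact withDensity_mono (hexp.mono fun x hx => hx.1)
  refine ⟨(Real.exp C).toNNReal, h1, ?_⟩
  calc ν = (ENNReal.ofReal (Real.exp C) * ENNReal.ofReal (Real.exp (-C))) • ν := by
        rw [← ENNReal.ofReal_mul (Real.exp_pos _).le, ← Real.exp_add]; simp
    _ = ENNReal.ofReal (Real.exp C) • (ENNReal.ofReal (Real.exp (-C)) • ν) := by rw [smul_smul]
    _ ≤ ENNReal.ofReal (Real.exp C) • μ := by gcongr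

/-- `f` has first and second weak partial derivatives `G` and `H` on `O`, all of them in `L²(O)`. -/
structure IsH2 (O : Set (Space d)) (f : Space d → ℝ) (G : Fin d → Space d → ℝ)
    (H : Fin d → Fin d → Space d → ℝ) : Prop where
  memLp : MemLp f 2 (volume.restrict O)
  memLp₁ : ∀ i, MemLp (G i) 2 (volume.restrict O)
  memLp₂ : ∀ i j, MemLp (H i j) 2 (volume.restrict O)
  weak₁ : ∀ i, HasWeakPartial O i f (G i)
  weak₂ : ∀ i j, HasWeakPartial O i (G j) (H i j)

theorem IsH2.sub {O : Set (Space d)} {f₁ f₂ : Space d → ℝ} {G₁ G₂ : Fin d → Space d → ℝ}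
    {H₁ H₂ : Fin d → Fin d → Space d → ℝ} (h₁ : IsH2 O f₁ G₁ H₁) (h₂ : IsH2 O f₂ G₂ H₂) :
    IsH2 O (f₁ - f₂) (G₁ - G₂) (H₁ - H₂) :=
  ⟨h₁.1.sub h₂.1, fun i => (h₁.2 i).sub (h₂.2 i), fun i j => (h₁.3 i j).sub (h₂.3 i j),
    fun i => (h₁.4 i).sub (h₂.4 i), fun i j => (h₁.5 i j).sub (h₂.5 i j)⟩

theorem IsH2.const_smul {O : Set (Space d)} {f : Space d → ℝ} {G : Fin d → Space d → ℝ}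
    {H : Fin d → Fin d → Space d → ℝ} (c : ℝ) (h : IsH2 O f G H) : IsH2 O (c • f) (c • G) (c • H) :=
  ⟨h.1.const_smul c, fun i => (h.2 i).const_smul c, fun i j => (h.3 i j).const_smul c,
    fun i => (h.4 i).const_smul c, fun i j => (h.5 i j).const_smul c⟩

theorem IsH2.congr {O : Set (Space d)} (hO : IsOpen O) {f f' : Space d → ℝ} {G : Fin d → Space d → ℝ}
    {H : Fin d → Fin d → Space d → ℝ} (h : IsH2 O f G H) (he : f =ᵐ[volume.restrict O] f') :
    IsH2 O f' G H :=
  ⟨(memLp_congr_ae he).1 h.1, h.2, h.3, fun i => (h.4 i).congr hO he EventuallyEq.rfl, h.5⟩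

theorem IsH2.ae_weakPartial {O : Set (Space d)} (hO : IsOpen O) {f : Space d → ℝ}
    {G : Fin d → Space d → ℝ} {H : Fin d → Fin d → Space d → ℝ} (h : IsH2 O f G H) (i : Fin d) :
    weakPartial O i f =ᵐ[volume.restrict O] G i := (h.4 i).weakPartial_ae hO

theorem IsH2.hasWeakPartial₂ {O : Set (Space d)} (hO : IsOpen O) {f : Space d → ℝ}
    {G : Fin d → Space d → ℝ} {H : Fin d → Fin d → Space d → ℝ} (h : IsH2 O f G H) (i j : Fin d) :
    HasWeakPartial O i (weakPartial O j f) (H i j) :=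
  (h.5 i j).congr hO (h.ae_weakPartial hO j).symm EventuallyEq.rfl

theorem IsH2.ae_weakPartial₂ {O : Set (Space d)} (hO : IsOpen O) {f : Space d → ℝ}
    {G : Fin d → Space d → ℝ} {H : Fin d → Fin d → Space d → ℝ} (h : IsH2 O f G H) (i j : Fin d) :
    weakPartial O i (weakPartial O j f) =ᵐ[volume.restrict O] H i j :=
  (h.hasWeakPartial₂ hO i j).weakPartial_ae hO

theorem IsH2.memH2 {Ω : Set (Space d)} {μ : Measure (Space d)}
    (hμ : Comparable μ (volume.restrict (interior Ω))) {f : Space d → ℝ}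
    {G : Fin d → Space d → ℝ} {H : Fin d → Fin d → Space d → ℝ} (h : IsH2 (interior Ω) f G H) :
    MemH2 Ω μ f :=
  ⟨⟨hμ.symm.memLp h.1, fun i => ⟨G i, h.4 i, hμ.symm.memLp (h.2 i)⟩⟩, fun j =>
    ⟨hμ.symm.memLp ((memLp_congr_ae (h.ae_weakPartial isOpen_interior j)).2 (h.2 j)),
      fun i => ⟨H i j, h.hasWeakPartial₂ isOpen_interior i j, hμ.symm.memLp (h.3 i j)⟩⟩⟩

theorem MemH2.isH2 {Ω : Set (Space d)} {μ : Measure (Space d)}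
    (hμ : Comparable μ (volume.restrict (interior Ω))) {f : Space d → ℝ} (h : MemH2 Ω μ f) :
    IsH2 (interior Ω) f (fun i => weakPartial (interior Ω) i f)
      (fun i j => weakPartial (interior Ω) i (weakPartial (interior Ω) j f)) := by
  have hO : IsOpen (interior Ω) := isOpen_interior
  refine ⟨hμ.memLp h.1.1, fun i => hμ.memLp (h.2 i).1, fun i j => ?_, fun i => ?_, fun i j => ?_⟩
  · obtain ⟨g, hg, hm⟩ := (h.2 j).2 i
    exact (memLp_congr_ae (hg.weakPartial_ae hO)).2 (hμ.memLp hm)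
  · obtain ⟨g, hg, hm⟩ := h.1.2 i
    exact hg.weakPartial hO
  · obtain ⟨g, hg, hm⟩ := (h.2 j).2 i
    exact hg.weakPartial hO

theorem exists_bound_of_isCompact {Ω : Set (Space d)} (hΩ : IsCompact Ω) {f : Space d → ℝ}
    (hf : Continuous f) : ∃ C, 0 ≤ C ∧ ∀ x ∈ Ω, |f x| ≤ C := by
  obtain ⟨C, hC⟩ := hΩ.exists_bound_of_continuousOn hf.continuousOn
  exact ⟨max C 0, le_max_right _ _, fun x hx => (hC x hx).trans (le_max_left _ _)⟩

theorem isFiniteMeasure_restrict_interior {Ω : Set (Space d)} (hΩ : IsCompact Ω) :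
    IsFiniteMeasure ((volume : Measure (Space d)).restrict (interior Ω)) :=
  ⟨by rw [Measure.restrict_apply_univ]
      exact lt_of_le_of_lt (measure_mono interior_subset) hΩ.measure_lt_top⟩

theorem memLp_interior_of_continuous {Ω : Set (Space d)} (hΩ : IsCompact Ω) {f : Space d → ℝ}
    (hf : Continuous f) : MemLp f 2 (volume.restrict (interior Ω)) := by
  have := isFiniteMeasure_restrict_interior hΩ
  obtain ⟨C, -, hC⟩ := exists_bound_of_isCompact hΩ hf
  refine MemLp.of_bound hf.aestronglyMeasurable C ?_
  exact (ae_restrict_mem isOpen_interior.measurableSet).mono fun x hx => hC x (interior_subset hx)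

theorem IsH2.of_contDiff {Ω : Set (Space d)} (hΩ : IsCompact Ω) {q : Space d → ℝ}
    (hq : ContDiff ℝ 2 q) : IsH2 (interior Ω) q (fun i => pderiv i q)
      (fun i j => pderiv i (pderiv j q)) := by
  have h1 : ∀ i, ContDiff ℝ 1 (pderiv i q) := fun i => contDiff_pderiv hq (by norm_num) i
  exact ⟨memLp_interior_of_continuous hΩ hq.continuous,
    fun i => memLp_interior_of_continuous hΩ (h1 i).continuous,
    fun i j => memLp_interior_of_continuous hΩ (continuous_pderiv (h1 j) i),
    fun i => HasWeakPartial.of_contDiff (hq.of_le (by norm_num)) _ i,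
    fun i j => HasWeakPartial.of_contDiff (h1 j) _ i⟩

/-- The sum of the absolute values of a `2`-jet. -/
noncomputable def jetSum (f : Space d → ℝ) (G : Fin d → Space d → ℝ)
    (H : Fin d → Fin d → Space d → ℝ) (x : Space d) : ℝ :=
  |f x| + ∑ i, |G i x| + ∑ i, ∑ j, |H i j x|

/-- The sum of the absolute values of the partial derivatives of order at most two. -/
noncomputable def jetAbs (q : Space d → ℝ) : Space d → ℝ :=
  jetSum q (fun i => pderiv i q) (fun i j => pderiv i (pderiv j q))

theorem DiffOp.weak_ae (A : DiffOp d) {Ω : Set (Space d)} {f : Space d → ℝ}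
    {G : Fin d → Space d → ℝ} {H : Fin d → Fin d → Space d → ℝ} (h : IsH2 (interior Ω) f G H) :
    A.weak Ω f =ᵐ[volume.restrict (interior Ω)] fun x =>
      A.a₀ x * f x + ∑ i, A.a₁ i x * G i x + ∑ i, ∑ j, A.a₂ i j x * H i j x := by
  have h1 := ae_all_iff.2 fun i => h.ae_weakPartial isOpen_interior i
  have h2 := ae_all_iff.2 fun i => ae_all_iff.2 fun j => h.ae_weakPartial₂ isOpen_interior i j
  filter_upwards [h1, h2] with x h1 h2
  simp only [DiffOp.weak, h1, h2]

theorem DiffOp.weak_ae_classical (A : DiffOp d) {Ω : Set (Space d)} (hΩ : IsCompact Ω)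
    {q : Space d → ℝ} (hq : ContDiff ℝ 2 q) :
    A.weak Ω q =ᵐ[volume.restrict (interior Ω)] A.classical q :=
  A.weak_ae (IsH2.of_contDiff hΩ hq)

theorem DiffOp.weak_sub (A : DiffOp d) {Ω : Set (Space d)} {f₁ f₂ : Space d → ℝ}
    {G₁ G₂ : Fin d → Space d → ℝ} {H₁ H₂ : Fin d → Fin d → Space d → ℝ}
    (h₁ : IsH2 (interior Ω) f₁ G₁ H₁) (h₂ : IsH2 (interior Ω) f₂ G₂ H₂) :
    A.weak Ω (f₁ - f₂) =ᵐ[volume.restrict (interior Ω)] A.weak Ω f₁ - A.weak Ω f₂ := by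
  filter_upwards [A.weak_ae h₁, A.weak_ae h₂, A.weak_ae (h₁.sub h₂)] with x e1 e2 e3
  simp only [Pi.sub_apply, e1, e2, e3, mul_sub, Finset.sum_sub_distrib]
  ring

theorem DiffOp.weak_const_smul (A : DiffOp d) {Ω : Set (Space d)} {f : Space d → ℝ}
    {G : Fin d → Space d → ℝ} {H : Fin d → Fin d → Space d → ℝ} (c : ℝ)
    (h : IsH2 (interior Ω) f G H) :
    A.weak Ω (c • f) =ᵐ[volume.restrict (interior Ω)] c • A.weak Ω f := by
  filter_upwards [A.weak_ae h, A.weak_ae (h.const_smul c)] with x e1 e3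
  simp only [Pi.smul_apply, smul_eq_mul, e1, e3, mul_add, Finset.mul_sum]
  congr 1
  · congr 1
    · ring
    · exact Finset.sum_congr rfl fun i _ => by ring
  · exact Finset.sum_congr rfl fun i _ => Finset.sum_congr rfl fun j _ => by ring

theorem isH2_zero (O : Set (Space d)) : IsH2 O (0 : Space d → ℝ) 0 0 := by
  have h : ∀ i, HasWeakPartial O i (0 : Space d → ℝ) 0 := fun i => by
    have := HasWeakPartial.of_contDiff (contDiff_const (c := (0 : ℝ)) (n := 1) (E := Space d)) O i
    rw [pderiv_const] at this
    exact this
  exact ⟨MemLp.zero, fun _ => MemLp.zero, fun _ _ => MemLp.zero, h, fun i _ => h i⟩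

/-- The Lipschitz condition bounds `𝒜` on `𝓗^2`. -/
theorem DiffOp.IsAdmissible.abs_weak_le {A : DiffOp d} {Ω : Set (Space d)} {μ : Measure (Space d)}
    (hA : A.IsAdmissible Ω μ) (hμ : Comparable μ (volume.restrict (interior Ω))) :
    ∃ k : ℝ, 0 < k ∧ ∀ f G H, IsH2 (interior Ω) f G H →
      ∀ᵐ x ∂(volume.restrict (interior Ω)), |A.weak Ω f x| ≤ k * jetSum f G H x := by
  obtain ⟨k, hk, hL⟩ := hA.lipschitz
  refine ⟨k, hk, fun f G H h => ?_⟩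
  have h0 := isH2_zero (interior Ω)
  have hl := hμ.symm.ac.ae_le (hL f 0 (h.memH2 hμ) (h0.memH2 hμ))
  have e0 := A.weak_ae h0
  have h1 := ae_all_iff.2 fun i => h.ae_weakPartial isOpen_interior i
  have h2 := ae_all_iff.2 fun i => ae_all_iff.2 fun j => h.ae_weakPartial₂ isOpen_interior i j
  have h3 := ae_all_iff.2 fun i => h0.ae_weakPartial isOpen_interior i
  have h4 := ae_all_iff.2 fun i => ae_all_iff.2 fun j => h0.ae_weakPartial₂ isOpen_interior i j
  filter_upwards [hl, e0, h1, h2, h3, h4] with x hl e0 h1 h2 h3 h4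
  simp only [h1, h2, h3, h4, e0] at hl
  simpa [jetSum] using hl

theorem contDiff_coord (j : Fin d) {n : ℕ∞ω} : ContDiff ℝ n (fun y : Space d => y j) :=
  (EuclideanSpace.proj j : Space d →L[ℝ] ℝ).contDiff

theorem pderiv_coord' (i j : Fin d) :
    pderiv i (fun y : Space d => y j) = fun _ => if j = i then 1 else 0 := funext (pderiv_coord i j)

/-- The coefficients of an admissible operator are bounded, up to symmetrization in the second
order. -/
theorem DiffOp.IsAdmissible.coeff_bdd {A : DiffOp d} {Ω : Set (Space d)} (hΩ : IsCompact Ω)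
    {μ : Measure (Space d)}
    (hA : A.IsAdmissible Ω μ) (hμ : Comparable μ (volume.restrict (interior Ω))) :
    ∃ C : ℝ, 0 ≤ C ∧ ∀ᵐ x ∂(volume.restrict (interior Ω)), |A.a₀ x| ≤ C ∧ (∀ i, |A.a₁ i x| ≤ C) ∧
      ∀ i j, |A.a₂ i j x + A.a₂ j i x| ≤ C := by
  obtain ⟨k, hk, hk'⟩ := hA.abs_weak_le hμ
  have key : ∀ q : Space d → ℝ, ContDiff ℝ 2 q → ∃ C, 0 ≤ C ∧
      ∀ᵐ x ∂(volume.restrict (interior Ω)), |A.classical q x| ≤ C := by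
    intro q hq
    have h := IsH2.of_contDiff hΩ hq
    have hc : Continuous (jetAbs q) := by
      have h1 : ∀ i, ContDiff ℝ 1 (pderiv i q) := fun i => contDiff_pderiv hq (by norm_num) i
      have h2 : ∀ i j, Continuous (pderiv i (pderiv j q)) := fun i j => continuous_pderiv (h1 j) i
      have h3 := hq.continuous
      have h4 := fun i => (h1 i).continuous
      unfold jetAbs jetSum
      fun_prop
    obtain ⟨C, hC0, hC⟩ := exists_bound_of_isCompact hΩ hc
    refine ⟨k * C, by positivity, ?_⟩
    filter_upwards [hk' _ _ _ h, A.weak_ae_classical hΩ hq,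
      ae_restrict_mem isOpen_interior.measurableSet] with x h1 h2 h3
    rw [← h2]
    refine h1.trans ?_
    gcongr
    exact (le_abs_self _).trans (hC x (interior_subset h3))
  obtain ⟨R, hR0, hR⟩ := exists_bound_of_isCompact hΩ (continuous_norm (E := Space d))
  have hR' : ∀ x ∈ interior Ω, ∀ i, |x i| ≤ R := fun x hx i =>
    (PiLp.norm_apply_le x i).trans ((le_abs_self _).trans (hR x (interior_subset hx)))
  -- The coefficients are read off from the values of `𝒜` on `1`, `y_i` and `y_i y_j`. The symmetric
  -- Hessian of `y_i y_j` reveals only `a_ij + a_ji`.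
  obtain ⟨C0, hC0, h0⟩ := key (fun _ => 1) contDiff_const
  choose C1 hC1 h1 using fun i => key (fun y => y i) (contDiff_coord i)
  choose C2 hC2 h2 using fun i j => key (fun y => y i * y j) ((contDiff_coord i).mul (contDiff_coord j))
  have p1 : ∀ i j : Fin d, pderiv j (fun y : Space d => y i) = fun _ => if i = j then 1 else 0 :=
    fun i j => pderiv_coord' j i
  have p2 : ∀ i j l : Fin d, pderiv l (fun y : Space d => y i * y j) =
      fun y => (if i = l then 1 else 0) * y j + y i * (if j = l then 1 else 0) := by
    intro i j l
    funext y
    rw [pderiv_mul ((contDiff_coord i (n := 1)).differentiable (by simp) y)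
      ((contDiff_coord j (n := 1)).differentiable (by simp) y), pderiv_coord, pderiv_coord]
  have p3 : ∀ i j l m : Fin d, pderiv m (pderiv l (fun y : Space d => y i * y j)) =
      fun y => (if i = l then 1 else 0) * (if j = m then 1 else 0) +
        (if i = m then 1 else 0) * (if j = l then 1 else 0) := by
    intro i j l m
    funext y
    have hd : ∀ i : Fin d, DifferentiableAt ℝ (fun y : Space d => y i) y :=
      fun i => (contDiff_coord i (n := 1)).differentiable (by simp) y
    rw [p2, pderiv_add ((hd j).const_mul _) ((hd i).mul_const _), pderiv_const_mul (hd j),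
      pderiv_mul (hd i) (differentiableAt_const _), pderiv_const, pderiv_coord, pderiv_coord]
    ring
  set C1s := ∑ i, C1 i
  set C2s := ∑ i, ∑ j, C2 i j
  have hC1s : ∀ i, C1 i ≤ C1s := fun i =>
    Finset.single_le_sum (f := C1) (fun i _ => hC1 i) (Finset.mem_univ i)
  have hC2s : ∀ i j, C2 i j ≤ C2s := fun i j =>
    (Finset.single_le_sum (f := C2 i) (fun j _ => hC2 i j) (Finset.mem_univ j)).trans
    (Finset.single_le_sum (f := fun i => ∑ j, C2 i j)
      (fun i _ => Finset.sum_nonneg fun j _ => hC2 i j) (Finset.mem_univ i))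
  have hC1s0 : 0 ≤ C1s := Finset.sum_nonneg fun i _ => hC1 i
  have hC2s0 : 0 ≤ C2s := Finset.sum_nonneg fun i _ => Finset.sum_nonneg fun j _ => hC2 i j
  -- The lower order terms are subtracted with `|y_i| ≤ R` on `Ω`: `a₀ y_i` costs `C0 * R`, `a₀ y_i
  -- y_j` costs `C0 * (R * R)`, and the two first order terms of `𝒜(y_i y_j)` cost `B1 * R` each.
  set B1 := C1s + C0 * R
  have hB1 : 0 ≤ B1 := by positivity
  set B2 := C2s + C0 * (R * R) + 2 * (B1 * R)
  have hB2 : 0 ≤ B2 := by positivity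
  refine ⟨C0 + B1 + B2, by positivity, ?_⟩
  filter_upwards [h0, ae_all_iff.2 h1, ae_all_iff.2 fun i => ae_all_iff.2 (h2 i),
    ae_restrict_mem isOpen_interior.measurableSet] with x h0 h1 h2 hx
  have e0 : |A.a₀ x| ≤ C0 := by simpa [DiffOp.classical, pderiv_const] using h0
  have hmul : ∀ {a b c e : ℝ}, |a| ≤ c → |b| ≤ e → |a * b| ≤ c * e := fun {a b c e} h h' => by
    rw [abs_mul]; exact mul_le_mul h h' (abs_nonneg _) ((abs_nonneg _).trans h)
  have e1 : ∀ i, |A.a₁ i x| ≤ B1 := by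
    intro i
    have := h1 i
    simp only [DiffOp.classical, p1, pderiv_const, mul_zero, Finset.sum_const_zero, add_zero,
      mul_ite, mul_one, Finset.sum_ite_eq, Finset.mem_univ, if_true] at this
    have h3 := hmul e0 (hR' x hx i)
    have h4 := hC1s i
    rw [abs_le] at this h3 ⊢
    constructor <;> linarith [this.1, this.2, h3.1, h3.2]
  refine ⟨by linarith, fun i => (e1 i).trans (by linarith), fun i j => ?_⟩
  have := h2 i j
  have s2 : ∑ l, ∑ m, A.a₂ l m x * pderiv l (pderiv m fun y : Space d => y i * y j) x =
      A.a₂ i j x + A.a₂ j i x := by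
    simp only [p3, mul_add, Finset.sum_add_distrib]
    simp [Finset.sum_ite_eq, add_comm]
  have s1 : ∑ l, A.a₁ l x * pderiv l (fun y : Space d => y i * y j) x =
      A.a₁ i x * x j + A.a₁ j x * x i := by
    simp only [p2, mul_add, Finset.sum_add_distrib]
    simp [Finset.sum_ite_eq]
  rw [DiffOp.classical, s2, s1] at this
  have h3 := hmul e0 (hmul (hR' x hx i) (hR' x hx j))
  have h4 := hC2s i j
  have h5 := hmul (e1 i) (hR' x hx j)
  have h6 := hmul (e1 j) (hR' x hx i)
  rw [abs_le] at this h3 h5 h6 ⊢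
  constructor <;> linarith [this.1, this.2, h3.1, h3.2, h5.1, h5.2, h6.1, h6.2]

/-- Almost everywhere, `𝒜 q` is bounded by the `2`-jet of `q`, for all `C²` functions `q` at once. -/
theorem DiffOp.IsAdmissible.abs_classical_le {A : DiffOp d} {Ω : Set (Space d)} (hΩ : IsCompact Ω)
    {μ : Measure (Space d)}
    (hA : A.IsAdmissible Ω μ) (hμ : Comparable μ (volume.restrict (interior Ω))) :
    ∃ C : ℝ, 0 ≤ C ∧ ∀ᵐ x ∂μ, x ∈ interior Ω ∧
      ∀ q : Space d → ℝ, ContDiff ℝ 2 q → |A.classical q x| ≤ C * jetAbs q x := by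
  obtain ⟨C, hC0, hC⟩ := hA.coeff_bdd hΩ hμ
  refine ⟨C, hC0, hμ.ac.ae_le ?_⟩
  -- The exceptional set comes from the coefficients alone. It therefore serves all `q`, including
  -- families of functions depending on the random parameter.
  filter_upwards [hC, ae_restrict_mem isOpen_interior.measurableSet] with x hx hxO
  refine ⟨hxO, fun q hq => ?_⟩
  obtain ⟨h0, h1, h2⟩ := hx
  -- Only the symmetrized coefficients are bounded, and they suffice because the Hessian of a `C²`
  -- function is symmetric.
  have e : ∑ i, ∑ j, A.a₂ i j x * pderiv i (pderiv j q) x =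
      ∑ i, ∑ j, 2⁻¹ * ((A.a₂ i j x + A.a₂ j i x) * pderiv i (pderiv j q) x) := by
    have s : ∑ i, ∑ j, A.a₂ i j x * pderiv i (pderiv j q) x =
        ∑ i, ∑ j, A.a₂ j i x * pderiv i (pderiv j q) x := by
      rw [Finset.sum_comm]
      exact Finset.sum_congr rfl fun i _ => Finset.sum_congr rfl fun j _ => by rw [pderiv_comm hq]
    simp only [← Finset.mul_sum, add_mul, Finset.sum_add_distrib]
    rw [← s]; ring
  rw [DiffOp.classical, e]
  simp only [jetAbs, jetSum, mul_add, Finset.mul_sum]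
  refine (abs_add_three _ _ _).trans ?_
  gcongr
  · rw [abs_mul]; gcongr
  · refine (Finset.abs_sum_le_sum_abs _ _).trans (Finset.sum_le_sum fun i _ => ?_)
    rw [abs_mul]; gcongr; exact h1 i
  · refine (Finset.abs_sum_le_sum_abs _ _).trans (Finset.sum_le_sum fun i _ => ?_)
    refine (Finset.abs_sum_le_sum_abs _ _).trans (Finset.sum_le_sum fun j _ => ?_)
    rw [abs_mul, abs_mul]
    have : |(2⁻¹ : ℝ)| ≤ 1 := by norm_num [abs_of_pos]
    calc |(2⁻¹ : ℝ)| * (|A.a₂ i j x + A.a₂ j i x| * |pderiv i (pderiv j q) x|)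
        ≤ 1 * (C * |pderiv i (pderiv j q) x|) := by gcongr; exact h2 i j
      _ = _ := one_mul _

end PINN

/-! ### Calculus of 2-jets, ridge functions, and parameter integrals -/

namespace PINN

variable {d : ℕ}

/-! ### Jets of sums and products -/

theorem contDiff_one_pderiv {q : Space d → ℝ} (hq : ContDiff ℝ 2 q) (i : Fin d) :
    ContDiff ℝ 1 (pderiv i q) := contDiff_pderiv hq (by norm_num) i

theorem differentiable_of_contDiff_two {q : Space d → ℝ} (hq : ContDiff ℝ 2 q) :
    Differentiable ℝ q := hq.differentiable (by simp)

theorem differentiable_pderiv {q : Space d → ℝ} (hq : ContDiff ℝ 2 q) (i : Fin d) :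
    Differentiable ℝ (pderiv i q) := (contDiff_one_pderiv hq i).differentiable (by simp)

theorem pderiv₂_add {p q : Space d → ℝ} (hp : ContDiff ℝ 2 p) (hq : ContDiff ℝ 2 q) (i j : Fin d)
    (x : Space d) : pderiv i (pderiv j fun y => p y + q y) x =
      pderiv i (pderiv j p) x + pderiv i (pderiv j q) x := by
  have : pderiv j (fun y => p y + q y) = fun y => pderiv j p y + pderiv j q y := funext fun y =>
    pderiv_add (differentiable_of_contDiff_two hp y) (differentiable_of_contDiff_two hq y) j
  rw [this, pderiv_add (differentiable_pderiv hp j x) (differentiable_pderiv hq j x)]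

theorem pderiv₂_const_mul {q : Space d → ℝ} (hq : ContDiff ℝ 2 q) (c : ℝ) (i j : Fin d)
    (x : Space d) : pderiv i (pderiv j fun y => c * q y) x = c * pderiv i (pderiv j q) x := by
  have : pderiv j (fun y => c * q y) = fun y => c * pderiv j q y := funext fun y =>
    pderiv_const_mul (differentiable_of_contDiff_two hq y) c j
  rw [this, pderiv_const_mul (differentiable_pderiv hq j x)]

theorem pderiv₂_mul {p q : Space d → ℝ} (hp : ContDiff ℝ 2 p) (hq : ContDiff ℝ 2 q) (i j : Fin d)
    (x : Space d) : pderiv i (pderiv j fun y => p y * q y) x =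
      pderiv i (pderiv j p) x * q x + pderiv j p x * pderiv i q x + pderiv i p x * pderiv j q x
        + p x * pderiv i (pderiv j q) x := by
  have hp1 := differentiable_of_contDiff_two hp
  have hq1 := differentiable_of_contDiff_two hq
  have hp2 := differentiable_pderiv hp j
  have hq2 := differentiable_pderiv hq j
  have : pderiv j (fun y => p y * q y) = fun y => pderiv j p y * q y + p y * pderiv j q y :=
    funext fun y => pderiv_mul (hp1 y) (hq1 y) j
  rw [this, pderiv_add ((hp2 x).fun_mul (hq1 x)) ((hp1 x).fun_mul (hq2 x)), pderiv_mul (hp2 x) (hq1 x),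
    pderiv_mul (hp1 x) (hq2 x)]
  ring

theorem DiffOp.classical_add (A : DiffOp d) {p q : Space d → ℝ} (hp : ContDiff ℝ 2 p)
    (hq : ContDiff ℝ 2 q) (x : Space d) :
    A.classical (fun y => p y + q y) x = A.classical p x + A.classical q x := by
  simp only [DiffOp.classical, pderiv₂_add hp hq, mul_add, Finset.sum_add_distrib,
    pderiv_add (differentiable_of_contDiff_two hp x) (differentiable_of_contDiff_two hq x)]
  ring

theorem DiffOp.classical_const_mul (A : DiffOp d) {q : Space d → ℝ} (hq : ContDiff ℝ 2 q) (c : ℝ)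
    (x : Space d) : A.classical (fun y => c * q y) x = c * A.classical q x := by
  simp only [DiffOp.classical, pderiv₂_const_mul hq, mul_add, Finset.mul_sum,
    pderiv_const_mul (differentiable_of_contDiff_two hq x)]
  congr 1
  · congr 1
    · ring
    · exact Finset.sum_congr rfl fun i _ => by ring
  · exact Finset.sum_congr rfl fun i _ => Finset.sum_congr rfl fun j _ => by ring

theorem jetAbs_nonneg (q : Space d → ℝ) (x : Space d) : 0 ≤ jetAbs q x := by
  unfold jetAbs jetSum; positivity

theorem abs_le_jetAbs (q : Space d → ℝ) (x : Space d) : |q x| ≤ jetAbs q x := by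
  unfold jetAbs jetSum
  rw [add_assoc]
  exact le_add_of_nonneg_right (by positivity)

theorem abs_pderiv_le_jetAbs (q : Space d → ℝ) (i : Fin d) (x : Space d) :
    |pderiv i q x| ≤ jetAbs q x := by
  have h1 : |pderiv i q x| ≤ ∑ i, |pderiv i q x| :=
    Finset.single_le_sum (f := fun i => |pderiv i q x|) (fun _ _ => abs_nonneg _) (Finset.mem_univ i)
  have h2 : 0 ≤ ∑ i, ∑ j, |pderiv i (pderiv j q) x| := by positivity
  have h3 := abs_nonneg (q x)
  unfold jetAbs jetSum
  linarith

theorem abs_pderiv₂_le_jetAbs (q : Space d → ℝ) (i j : Fin d) (x : Space d) :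
    |pderiv i (pderiv j q) x| ≤ jetAbs q x := by
  have h1 : |pderiv i (pderiv j q) x| ≤ ∑ j, |pderiv i (pderiv j q) x| :=
    Finset.single_le_sum (f := fun j => |pderiv i (pderiv j q) x|) (fun _ _ => abs_nonneg _)
      (Finset.mem_univ j)
  have h2 : ∑ j, |pderiv i (pderiv j q) x| ≤ ∑ i, ∑ j, |pderiv i (pderiv j q) x| :=
    Finset.single_le_sum (f := fun i => ∑ j, |pderiv i (pderiv j q) x|) (fun _ _ => by positivity)
      (Finset.mem_univ i)
  have h3 := abs_nonneg (q x)
  have h4 : 0 ≤ ∑ i, |pderiv i q x| := by positivity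
  unfold jetAbs jetSum
  linarith

theorem jetAbs_add_le {p q : Space d → ℝ} (hp : ContDiff ℝ 2 p) (hq : ContDiff ℝ 2 q)
    (x : Space d) : jetAbs (fun y => p y + q y) x ≤ jetAbs p x + jetAbs q x := by
  simp only [jetAbs, jetSum, pderiv₂_add hp hq,
    pderiv_add (differentiable_of_contDiff_two hp x) (differentiable_of_contDiff_two hq x)]
  have h1 := abs_add_le (p x) (q x)
  have h2 : ∑ i, |pderiv i p x + pderiv i q x| ≤ ∑ i, (|pderiv i p x| + |pderiv i q x|) :=
    Finset.sum_le_sum fun i _ => abs_add_le _ _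
  have h3 : ∑ i, ∑ j, |pderiv i (pderiv j p) x + pderiv i (pderiv j q) x| ≤
      ∑ i, ∑ j, (|pderiv i (pderiv j p) x| + |pderiv i (pderiv j q) x|) :=
    Finset.sum_le_sum fun i _ => Finset.sum_le_sum fun j _ => abs_add_le _ _
  simp only [Finset.sum_add_distrib] at h2 h3
  linarith

theorem jetAbs_const_mul {q : Space d → ℝ} (hq : ContDiff ℝ 2 q) (c : ℝ) (x : Space d) :
    jetAbs (fun y => c * q y) x = |c| * jetAbs q x := by
  simp only [jetAbs, jetSum, pderiv₂_const_mul hq, mul_add, Finset.mul_sum, abs_mul,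
    pderiv_const_mul (differentiable_of_contDiff_two hq x)]

theorem continuous_jetAbs {q : Space d → ℝ} (hq : ContDiff ℝ 2 q) : Continuous (jetAbs q) := by
  have h2 : ∀ i j, Continuous (pderiv i (pderiv j q)) :=
    fun i j => continuous_pderiv (contDiff_one_pderiv hq j) i
  have h3 := hq.continuous
  have h4 := fun i => (contDiff_one_pderiv hq i).continuous
  unfold jetAbs jetSum
  fun_prop

theorem jetAbs_le_of_forall {q : Space d → ℝ} {x : Space d} {B : ℝ} (h0 : |q x| ≤ B)
    (h1 : ∀ i, |pderiv i q x| ≤ B) (h2 : ∀ i j, |pderiv i (pderiv j q) x| ≤ B) :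
    jetAbs q x ≤ (1 + d + d * d) * B := by
  have s1 : ∑ i, |pderiv i q x| ≤ ∑ _i : Fin d, B := Finset.sum_le_sum fun i _ => h1 i
  have s2 : ∑ i, ∑ j, |pderiv i (pderiv j q) x| ≤ ∑ _i : Fin d, ∑ _j : Fin d, B :=
    Finset.sum_le_sum fun i _ => Finset.sum_le_sum fun j _ => h2 i j
  simp only [Finset.sum_const, Finset.card_univ, Fintype.card_fin, nsmul_eq_mul] at s1 s2
  unfold jetAbs jetSum
  linarith

/-! ### Ridge functions -/

/-- The affine function `y ↦ w · y + b`. -/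
noncomputable def affine (w : Space d) (b : ℝ) (y : Space d) : ℝ := inner ℝ w y + b

theorem contDiff_affine (w : Space d) (b : ℝ) {n : ℕ∞ω} : ContDiff ℝ n (affine w b) :=
  ((innerSL ℝ w).contDiff).add contDiff_const

theorem pderiv_affine (w : Space d) (b : ℝ) (i : Fin d) (x : Space d) :
    pderiv i (affine w b) x = w i := by
  have h : HasFDerivAt (affine w b) (innerSL ℝ w) x := ((innerSL ℝ w).hasFDerivAt).add_const b
  rw [pderiv_eq_fderiv h.differentiableAt, h.fderiv]
  simp [bvec, EuclideanSpace.inner_single_right]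

@[fun_prop]
theorem continuous_affine_comp {X : Type*} [TopologicalSpace X] {w y : X → Space d} {b : X → ℝ}
    (hw : Continuous w) (hb : Continuous b) (hy : Continuous y) :
    Continuous fun t => affine (w t) (b t) (y t) := by
  unfold affine; fun_prop

/-- The function `y ↦ ζ(y) s(w · y + b)`. -/
noncomputable def ridge (ζ : Space d → ℝ) (s : ℝ → ℝ) (w : Space d) (b : ℝ) (y : Space d) : ℝ :=
  ζ y * s (affine w b y)

theorem contDiff_comp_affine {s : ℝ → ℝ} {n : ℕ∞ω} (hs : ContDiff ℝ n s) (w : Space d) (b : ℝ) :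
    ContDiff ℝ n fun y => s (affine w b y) := hs.comp (contDiff_affine w b)

theorem contDiff_ridge {ζ : Space d → ℝ} {s : ℝ → ℝ} {n : ℕ∞ω} (hζ : ContDiff ℝ n ζ)
    (hs : ContDiff ℝ n s) (w : Space d) (b : ℝ) : ContDiff ℝ n (ridge ζ s w b) :=
  hζ.mul (contDiff_comp_affine hs w b)

theorem pderiv_comp_affine {s : ℝ → ℝ} (hs : ContDiff ℝ 1 s) (w : Space d) (b : ℝ) (i : Fin d) :
    pderiv i (fun y => s (affine w b y)) = fun y => w i * deriv s (affine w b y) := by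
  funext x
  rw [pderiv_comp (hs.differentiable (by simp) _)
    ((contDiff_affine w b (n := 1)).differentiable (by simp) x), pderiv_affine, mul_comm]

theorem contDiff_deriv_of {s : ℝ → ℝ} {n m : ℕ∞ω} (hs : ContDiff ℝ n s) (h : m + 1 ≤ n) :
    ContDiff ℝ m (deriv s) := (contDiff_succ_iff_deriv.1 (hs.of_le h)).2.2

theorem pderiv₂_comp_affine {s : ℝ → ℝ} (hs : ContDiff ℝ 2 s) (w : Space d) (b : ℝ) (i j : Fin d)
    (x : Space d) : pderiv i (pderiv j fun y => s (affine w b y)) x =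
      w i * w j * deriv (deriv s) (affine w b x) := by
  have h1 : ContDiff ℝ 1 (deriv s) := contDiff_deriv_of hs (by norm_num)
  rw [pderiv_comp_affine (hs.of_le (by norm_num)), pderiv_const_mul
    ((contDiff_comp_affine h1 w b).differentiable (by simp) x), pderiv_comp_affine h1]
  ring

theorem pderiv_ridge {ζ : Space d → ℝ} {s : ℝ → ℝ} (hζ : ContDiff ℝ 2 ζ) (hs : ContDiff ℝ 2 s)
    (w : Space d) (b : ℝ) (i : Fin d) (x : Space d) :
    pderiv i (ridge ζ s w b) x =
      pderiv i ζ x * s (affine w b x) + ζ x * (w i * deriv s (affine w b x)) := by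
  have : ridge ζ s w b = fun y => ζ y * s (affine w b y) := rfl
  rw [this, pderiv_mul (differentiable_of_contDiff_two hζ x)
    (differentiable_of_contDiff_two (contDiff_comp_affine hs w b) x),
    pderiv_comp_affine (hs.of_le (by norm_num))]

theorem pderiv₂_ridge {ζ : Space d → ℝ} {s : ℝ → ℝ} (hζ : ContDiff ℝ 2 ζ) (hs : ContDiff ℝ 2 s)
    (w : Space d) (b : ℝ) (i j : Fin d) (x : Space d) :
    pderiv i (pderiv j (ridge ζ s w b)) x =
      pderiv i (pderiv j ζ) x * s (affine w b x)
        + (pderiv j ζ x * w i + pderiv i ζ x * w j) * deriv s (affine w b x)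
        + ζ x * (w i * w j) * deriv (deriv s) (affine w b x) := by
  have : ridge ζ s w b = fun y => ζ y * s (affine w b y) := rfl
  rw [this, pderiv₂_mul hζ (contDiff_comp_affine hs w b), pderiv₂_comp_affine hs,
    pderiv_comp_affine (hs.of_le (by norm_num)), pderiv_comp_affine (hs.of_le (by norm_num))]
  ring

theorem continuous_ridge_uncurry {ζ : Space d → ℝ} {s : ℝ → ℝ} (hζ : Continuous ζ)
    (hs : Continuous s) :
    Continuous fun p : (Space d × ℝ) × Space d => ridge ζ s p.1.1 p.1.2 p.2 := by
  unfold ridge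
  fun_prop

theorem continuous_pderiv_ridge_uncurry {ζ : Space d → ℝ} {s : ℝ → ℝ} (hζ : ContDiff ℝ 2 ζ)
    (hs : ContDiff ℝ 2 s) (i : Fin d) :
    Continuous fun p : (Space d × ℝ) × Space d => pderiv i (ridge ζ s p.1.1 p.1.2) p.2 := by
  simp only [pderiv_ridge hζ hs]
  have h1 := hs.continuous
  have h2 := hs.continuous_deriv (by norm_num)
  have h3 := hζ.continuous
  have h4 := (contDiff_one_pderiv hζ i).continuous
  fun_prop

theorem continuous_pderiv₂_ridge_uncurry {ζ : Space d → ℝ} {s : ℝ → ℝ} (hζ : ContDiff ℝ 2 ζ)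
    (hs : ContDiff ℝ 2 s) (i j : Fin d) :
    Continuous fun p : (Space d × ℝ) × Space d =>
      pderiv i (pderiv j (ridge ζ s p.1.1 p.1.2)) p.2 := by
  simp only [pderiv₂_ridge hζ hs]
  have h1 := hs.continuous
  have h2 := hs.continuous_deriv (by norm_num)
  have h2' := (contDiff_deriv_of (m := 1) hs (by norm_num)).continuous_deriv (by norm_num)
  have h3 := hζ.continuous
  have h4 := fun i => (contDiff_one_pderiv hζ i).continuous
  have h5 := continuous_pderiv (contDiff_one_pderiv hζ j) i
  fun_prop

theorem abs_coord_le (w : Space d) (i : Fin d) : |w i| ≤ ‖w‖ := PiLp.norm_apply_le w i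

/-- The jet of a ridge function grows at most quadratically in the weight. -/
theorem jetAbs_ridge_le {ζ : Space d → ℝ} {s : ℝ → ℝ} (hζ : ContDiff ℝ 2 ζ) (hs : ContDiff ℝ 2 s)
    {Cs : ℝ} (h0 : ∀ z, |s z| ≤ Cs) (h1 : ∀ z, |deriv s z| ≤ Cs) (h2 : ∀ z, |deriv (deriv s) z| ≤ Cs)
    (w : Space d) (b : ℝ) (x : Space d) :
    jetAbs (ridge ζ s w b) x ≤ (1 + d + d * d) * (jetAbs ζ x * Cs * (4 * (1 + ‖w‖) ^ 2)) := by
  have hC : 0 ≤ Cs := (abs_nonneg _).trans (h0 0)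
  have hJ := jetAbs_nonneg ζ x
  have hw := norm_nonneg w
  have b1 : (1 : ℝ) ≤ (1 + ‖w‖) ^ 2 := by nlinarith
  have b2 : ‖w‖ ≤ (1 + ‖w‖) ^ 2 := by nlinarith
  have b3 : ‖w‖ * ‖w‖ ≤ (1 + ‖w‖) ^ 2 := by nlinarith
  set W := (1 + ‖w‖) ^ 2
  have hJC : 0 ≤ jetAbs ζ x * Cs := by positivity
  have t0 : ∀ {a z : ℝ}, |a| ≤ jetAbs ζ x → |z| ≤ Cs → |a * z| ≤ jetAbs ζ x * Cs * W := by
    intro a z ha hz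
    rw [abs_mul]
    calc |a| * |z| ≤ jetAbs ζ x * Cs := by gcongr
      _ ≤ jetAbs ζ x * Cs * W := le_mul_of_one_le_right hJC b1
  have t1 : ∀ {a z : ℝ} (i : Fin d), |a| ≤ jetAbs ζ x → |z| ≤ Cs →
      |a * w i * z| ≤ jetAbs ζ x * Cs * W := by
    intro a z i ha hz
    rw [abs_mul, abs_mul]
    calc |a| * |w i| * |z| ≤ jetAbs ζ x * ‖w‖ * Cs := by gcongr; exact abs_coord_le w i
      _ = jetAbs ζ x * Cs * ‖w‖ := by ring
      _ ≤ jetAbs ζ x * Cs * W := by gcongr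
  have t2 : ∀ {a z : ℝ} (i j : Fin d), |a| ≤ jetAbs ζ x → |z| ≤ Cs →
      |a * (w i * w j) * z| ≤ jetAbs ζ x * Cs * W := by
    intro a z i j ha hz
    rw [abs_mul, abs_mul, abs_mul]
    calc |a| * (|w i| * |w j|) * |z| ≤ jetAbs ζ x * (‖w‖ * ‖w‖) * Cs := by
          gcongr
          · exact abs_coord_le w i
          · exact abs_coord_le w j
      _ = jetAbs ζ x * Cs * (‖w‖ * ‖w‖) := by ring
      _ ≤ jetAbs ζ x * Cs * W := by gcongr
  have hB : 0 ≤ jetAbs ζ x * Cs * W := by positivity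
  refine jetAbs_le_of_forall ?_ (fun i => ?_) (fun i j => ?_)
  · exact (t0 (abs_le_jetAbs ζ x) (h0 _)).trans (by linarith)
  · rw [pderiv_ridge hζ hs]
    have e1 := t0 (abs_pderiv_le_jetAbs ζ i x) (h0 (affine w b x))
    have e2 := t1 i (abs_le_jetAbs ζ x) (h1 (affine w b x))
    rw [mul_assoc] at e2
    refine (abs_add_le _ _).trans ?_
    linarith
  -- The second derivative splits into four terms of the same size, whence the factor `4` in the
  -- bound.
  · rw [pderiv₂_ridge hζ hs, add_mul]
    have e1 := t0 (abs_pderiv₂_le_jetAbs ζ i j x) (h0 (affine w b x))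
    have e2 := t1 i (abs_pderiv_le_jetAbs ζ j x) (h1 (affine w b x))
    have e3 := t1 j (abs_pderiv_le_jetAbs ζ i x) (h1 (affine w b x))
    have e4 := t2 i j (abs_le_jetAbs ζ x) (h2 (affine w b x))
    refine (abs_add_three _ _ _).trans ?_
    have := abs_add_le (pderiv j ζ x * w i * deriv s (affine w b x))
      (pderiv i ζ x * w j * deriv s (affine w b x))
    linarith

/-! ### Differentiation under the integral sign -/

theorem fderiv_eq_sum_pderiv {f : Space d → ℝ} {x : Space d} (hf : DifferentiableAt ℝ f x) :
    fderiv ℝ f x = ∑ i, pderiv i f x • (EuclideanSpace.proj i : Space d →L[ℝ] ℝ) := by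
  ext v
  have hv : v = ∑ i, v i • bvec i := by
    conv_lhs => rw [← (EuclideanSpace.basisFun (Fin d) ℝ).sum_repr v]
    simp [bvec]
  conv_lhs => rw [hv]
  simp only [map_sum, map_smul, pderiv_eq_fderiv hf, smul_eq_mul, sum_apply, smul_apply]
  exact Finset.sum_congr rfl fun i _ => mul_comm _ _

theorem contDiff_succ_of_pderiv {f : Space d → ℝ} (n : ℕ) (hf : Differentiable ℝ f)
    (h : ∀ i, ContDiff ℝ n (pderiv i f)) : ContDiff ℝ (n + 1) f := by
  refine contDiff_succ_iff_fderiv.2 ⟨hf, by simp, ?_⟩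
  have : fderiv ℝ f = fun x => ∑ i, pderiv i f x • (EuclideanSpace.proj i : Space d →L[ℝ] ℝ) :=
    funext fun x => fderiv_eq_sum_pderiv (hf x)
  rw [this]
  exact ContDiff.sum fun i _ => (h i).smul contDiff_const

/-- Differentiability is local, so domination on each bounded set suffices: around `x` one uses the
bound for radius `‖x‖ + 1`. Allowing the bound to depend on `R` matters because the parameter
derivatives of a unit may grow in `y`. -/
theorem contDiff_integral_of_dominated {Θ : Type*} [MeasurableSpace Θ] {ν : Measure Θ}
    {G : Θ → Space d → ℝ} (hG : ∀ θ, ContDiff ℝ 1 (G θ))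
    (hm : ∀ y, AEStronglyMeasurable (fun θ => G θ y) ν)
    (hm' : ∀ i y, AEStronglyMeasurable (fun θ => pderiv i (G θ) y) ν)
    (hb : ∀ R : ℝ, ∃ B : Θ → ℝ, Integrable B ν ∧ ∀ᵐ θ ∂ν, ∀ y, ‖y‖ ≤ R → |G θ y| ≤ B θ ∧
      ∀ i, |pderiv i (G θ) y| ≤ B θ) :
    ContDiff ℝ 1 (fun y => ∫ θ, G θ y ∂ν) ∧
      ∀ i, pderiv i (fun y => ∫ θ, G θ y ∂ν) = fun y => ∫ θ, pderiv i (G θ) y ∂ν := by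
  have hd : ∀ θ, Differentiable ℝ (G θ) := fun θ => (hG θ).differentiable (by simp)
  have hball : ∀ x : Space d, ∀ y ∈ Metric.ball x 1, ‖y‖ ≤ ‖x‖ + 1 := fun x y hy => by
    have := norm_le_norm_add_norm_sub' y x
    rw [Metric.mem_ball, dist_eq_norm] at hy
    linarith
  have hnorm : ∀ i, ‖(EuclideanSpace.proj i : Space d →L[ℝ] ℝ)‖ ≤ 1 := fun i =>
    ContinuousLinearMap.opNorm_le_bound _ zero_le_one fun v => by
      simpa using abs_coord_le v i
  have hfd : ∀ θ y, fderiv ℝ (G θ) y =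
      ∑ i, pderiv i (G θ) y • (EuclideanSpace.proj i : Space d →L[ℝ] ℝ) :=
    fun θ y => fderiv_eq_sum_pderiv (hd θ y)
  have hbd : ∀ θ y, ‖fderiv ℝ (G θ) y‖ ≤ ∑ i, |pderiv i (G θ) y| := fun θ y => by
    rw [hfd]
    refine (norm_sum_le _ _).trans (Finset.sum_le_sum fun i _ => ?_)
    rw [norm_smul]
    exact mul_le_of_le_one_right (abs_nonneg _) (hnorm i)
  have hfm : ∀ y, AEStronglyMeasurable (fun θ => fderiv ℝ (G θ) y) ν := fun y => by
    simp only [hfd]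
    have : (fun θ => ∑ i, pderiv i (G θ) y • (EuclideanSpace.proj i : Space d →L[ℝ] ℝ)) =
      ∑ i, fun θ => pderiv i (G θ) y • (EuclideanSpace.proj i : Space d →L[ℝ] ℝ) := by
        ext1 θ; simp
    rw [this]
    exact Finset.aestronglyMeasurable_sum _ fun i _ => (hm' i y).smul_const _
  have hI : ∀ i y, Integrable (fun θ => pderiv i (G θ) y) ν := fun i y => by
    obtain ⟨B, hB, hb⟩ := hb ‖y‖
    exact hB.mono' (hm' i y) (hb.mono fun θ h => (h y le_rfl).2 i)
  have key : ∀ x, HasFDerivAt (fun y => ∫ θ, G θ y ∂ν) (∫ θ, fderiv ℝ (G θ) x ∂ν) x := fun x => by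
    obtain ⟨B, hB, hb⟩ := hb (‖x‖ + 1)
    refine hasFDerivAt_integral_of_dominated_of_fderiv_le (F := fun y θ => G θ y)
      (bound := fun θ => d * B θ) (Metric.ball_mem_nhds x one_pos)
      (Eventually.of_forall hm) ?_ (hfm x) ?_ (hB.const_mul _)
      (Eventually.of_forall fun θ y _ => (hd θ y).hasFDerivAt)
    · exact hB.mono' (hm x) (hb.mono fun θ h => (h x (by linarith)).1)
    · filter_upwards [hb] with θ h y hy
      refine (hbd θ y).trans ?_
      calc ∑ i, |pderiv i (G θ) y| ≤ ∑ _i : Fin d, B θ :=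
            Finset.sum_le_sum fun i _ => (h y (hball x y hy)).2 i
        _ = d * B θ := by simp
  have hdiff : Differentiable ℝ (fun y => ∫ θ, G θ y ∂ν) := fun x => (key x).differentiableAt
  have hp : ∀ i, pderiv i (fun y => ∫ θ, G θ y ∂ν) = fun y => ∫ θ, pderiv i (G θ) y ∂ν := fun i => by
    funext x
    rw [pderiv_eq_fderiv (hdiff x), (key x).fderiv]
    have hint : Integrable (fun θ => fderiv ℝ (G θ) x) ν := by
      refine (integrable_finsetSum' Finset.univ fun i _ => (hI i x).abs).mono' (hfm x)
        (Eventually.of_forall fun θ => ?_)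
      simpa using hbd θ x
    rw [ContinuousLinearMap.integral_apply hint]
    exact integral_congr_ae (Eventually.of_forall fun θ => (pderiv_eq_fderiv (hd θ x) i).symm)
  refine ⟨contDiff_succ_of_pderiv 0 hdiff fun i => ?_, hp⟩
  rw [hp]
  refine contDiff_zero.2 (continuous_iff_continuousAt.2 fun x => ?_)
  obtain ⟨B, hB, hb⟩ := hb (‖x‖ + 1)
  refine continuousAt_of_dominated (Eventually.of_forall (hm' i)) ?_ hB
    (Eventually.of_forall fun θ => (continuous_pderiv (hG θ) i).continuousAt)
  filter_upwards [Metric.ball_mem_nhds x one_pos] with y hy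
  exact hb.mono fun θ h => (h y (hball x y hy)).2 i

theorem contDiff_two_integral_of_dominated {Θ : Type*} [MeasurableSpace Θ] {ν : Measure Θ}
    {G : Θ → Space d → ℝ} (hG : ∀ θ, ContDiff ℝ 2 (G θ))
    (hm : ∀ y, AEStronglyMeasurable (fun θ => G θ y) ν)
    (hm' : ∀ i y, AEStronglyMeasurable (fun θ => pderiv i (G θ) y) ν)
    (hm'' : ∀ i j y, AEStronglyMeasurable (fun θ => pderiv i (pderiv j (G θ)) y) ν)
    (hb : ∀ R : ℝ, ∃ B : Θ → ℝ, Integrable B ν ∧ ∀ᵐ θ ∂ν, ∀ y, ‖y‖ ≤ R → jetAbs (G θ) y ≤ B θ) :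
    ContDiff ℝ 2 (fun y => ∫ θ, G θ y ∂ν) ∧
      (∀ i, pderiv i (fun y => ∫ θ, G θ y ∂ν) = fun y => ∫ θ, pderiv i (G θ) y ∂ν) ∧
      ∀ i j, pderiv i (pderiv j (fun y => ∫ θ, G θ y ∂ν)) =
        fun y => ∫ θ, pderiv i (pderiv j (G θ)) y ∂ν := by
  obtain ⟨h1, h2⟩ := contDiff_integral_of_dominated (fun θ => (hG θ).of_le (by norm_num)) hm hm'
    (fun R => let ⟨B, hB, hb⟩ := hb R
      ⟨B, hB, hb.mono fun θ h y hy => ⟨(abs_le_jetAbs _ _).trans (h y hy), fun i =>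
        (abs_pderiv_le_jetAbs _ i _).trans (h y hy)⟩⟩)
  have h3 := fun j => contDiff_integral_of_dominated (G := fun θ => pderiv j (G θ))
    (fun θ => contDiff_one_pderiv (hG θ) j) (hm' j) (fun i => hm'' i j)
    (fun R => let ⟨B, hB, hb⟩ := hb R
      ⟨B, hB, hb.mono fun θ h y hy => ⟨(abs_pderiv_le_jetAbs _ j _).trans (h y hy), fun i =>
        (abs_pderiv₂_le_jetAbs _ i j _).trans (h y hy)⟩⟩)
  refine ⟨?_, h2, fun i j => ?_⟩
  · refine contDiff_succ_of_pderiv 1 (h1.differentiable (by simp)) fun j => ?_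
    rw [h2]; exact_mod_cast (h3 j).1
  · rw [h2]; exact (h3 j).2 i

end PINN

/-! ### Parameter gradients of a hidden unit and their growth in the weight -/

namespace PINN

variable {d : ℕ}

/-! ### Parameter derivatives of a hidden unit -/

/-- The derivative of `unit η σ θ y` with respect to `θ` in the direction `v`. -/
noncomputable def psi (η : Space d → ℝ) (σ : ℝ → ℝ) (v θ : Param d) (y : Space d) : ℝ :=
  v.1 * ridge η σ θ.2.1 θ.2.2 y
    + θ.1 * ridge (fun y => η y * affine v.2.1 v.2.2 y) (deriv σ) θ.2.1 θ.2.2 y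

theorem affine_line (θ v : Param d) (y : Space d) (t : ℝ) :
    affine (θ + t • v).2.1 (θ + t • v).2.2 y =
      affine θ.2.1 θ.2.2 y + t * affine v.2.1 v.2.2 y := by
  simp [affine, inner_add_left, inner_smul_left]; ring

theorem hasDerivAt_comp_line {s : ℝ → ℝ} (hs : ContDiff ℝ 1 s) (θ v : Param d) (y : Space d) :
    HasDerivAt (fun t : ℝ => s (affine (θ + t • v).2.1 (θ + t • v).2.2 y))
      (deriv s (affine θ.2.1 θ.2.2 y) * affine v.2.1 v.2.2 y) 0 := by
  simp only [affine_line]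
  have h1 : HasDerivAt (fun t : ℝ => affine θ.2.1 θ.2.2 y + t * affine v.2.1 v.2.2 y)
      (affine v.2.1 v.2.2 y) 0 := by
    simpa using ((hasDerivAt_id (0 : ℝ)).mul_const (affine v.2.1 v.2.2 y)).const_add
      (affine θ.2.1 θ.2.2 y)
  have h2 : HasDerivAt s (deriv s (affine θ.2.1 θ.2.2 y))
      (affine θ.2.1 θ.2.2 y + 0 * affine v.2.1 v.2.2 y) := by
    rw [zero_mul, add_zero]
    exact (hs.differentiable (by simp) _).hasDerivAt
  exact h2.comp 0 h1

theorem hasDerivAt_fst_line (θ v : Param d) :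
    HasDerivAt (fun t : ℝ => (θ + t • v).1) v.1 0 := by
  simpa using ((hasDerivAt_id (0 : ℝ)).mul_const v.1).const_add θ.1

theorem hasDerivAt_weight_line (θ v : Param d) (i : Fin d) :
    HasDerivAt (fun t : ℝ => (θ + t • v).2.1 i) (v.2.1 i) 0 := by
  simpa using ((hasDerivAt_id (0 : ℝ)).mul_const (v.2.1 i)).const_add (θ.2.1 i)

theorem unit_eq (η : Space d → ℝ) (σ : ℝ → ℝ) (θ : Param d) :
    unit η σ θ = fun y => θ.1 * ridge η σ θ.2.1 θ.2.2 y := by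
  funext y; simp [unit, ridge, affine, mul_assoc]

theorem contDiff_mul_affine {η : Space d → ℝ} {n : ℕ∞ω} (hη : ContDiff ℝ n η) (v : Param d) :
    ContDiff ℝ n fun y => η y * affine v.2.1 v.2.2 y := hη.mul (contDiff_affine _ _)

theorem contDiff_psi {η : Space d → ℝ} {σ : ℝ → ℝ} {n m : ℕ∞ω} (hη : ContDiff ℝ n η)
    (hσ : ContDiff ℝ m σ) (h : n + 1 ≤ m) (v θ : Param d) : ContDiff ℝ n (psi η σ v θ) :=
  (contDiff_const.mul (contDiff_ridge hη (hσ.of_le (le_self_add.trans h)) _ _)).add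
    (contDiff_const.mul (contDiff_ridge (contDiff_mul_affine hη v) (contDiff_deriv_of hσ h) _ _))

section Line

variable {η : Space d → ℝ} {σ : ℝ → ℝ} (hη : ContDiff ℝ 2 η) (hσ : ContDiff ℝ 4 σ)

include hη hσ

omit hη in
theorem hasLineDerivAt_unit (v θ : Param d) (y : Space d) :
    HasLineDerivAt ℝ (fun θ' => unit η σ θ' y) (psi η σ v θ y) θ v := by
  unfold HasLineDerivAt
  simp only [unit_eq, ridge]
  have h := (hasDerivAt_fst_line θ v).mul
    ((hasDerivAt_comp_line (hσ.of_le (by norm_num)) θ v y).const_mul (η y))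
  simp only [zero_smul, add_zero] at h
  refine h.congr_deriv ?_
  simp only [psi, ridge]; ring

theorem pderiv_unit (θ : Param d) (i : Fin d) (x : Space d) : pderiv i (unit η σ θ) x =
    θ.1 * (pderiv i η x * σ (affine θ.2.1 θ.2.2 x)
      + η x * (θ.2.1 i * deriv σ (affine θ.2.1 θ.2.2 x))) := by
  have hσ2 : ContDiff ℝ 2 σ := hσ.of_le (by norm_num)
  rw [unit_eq, pderiv_const_mul (differentiable_of_contDiff_two (contDiff_ridge hη hσ2 _ _) x),
    pderiv_ridge hη hσ2]

theorem pderiv₂_unit (θ : Param d) (i j : Fin d) (x : Space d) :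
    pderiv i (pderiv j (unit η σ θ)) x =
    θ.1 * (pderiv i (pderiv j η) x * σ (affine θ.2.1 θ.2.2 x)
        + (pderiv j η x * θ.2.1 i + pderiv i η x * θ.2.1 j) * deriv σ (affine θ.2.1 θ.2.2 x)
        + η x * (θ.2.1 i * θ.2.1 j) * deriv (deriv σ) (affine θ.2.1 θ.2.2 x)) := by
  have hσ2 : ContDiff ℝ 2 σ := hσ.of_le (by norm_num)
  rw [unit_eq, pderiv₂_const_mul (contDiff_ridge hη hσ2 _ _), pderiv₂_ridge hη hσ2]

/-- Derivatives in `θ` and in `x` commute; this is checked by computing both orders from the closed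
form of the ridge functions. Together with its second order analogue it lets `𝒜` pass through the
parameter gradient in the kernel `U`. -/
theorem hasLineDerivAt_pderiv_unit (v θ : Param d) (i : Fin d) (x : Space d) :
    HasLineDerivAt ℝ (fun θ' => pderiv i (unit η σ θ') x) (pderiv i (psi η σ v θ) x) θ v := by
  have hσ2 : ContDiff ℝ 2 σ := hσ.of_le (by norm_num)
  have hσ1 : ContDiff ℝ 3 (deriv σ) := contDiff_deriv_of hσ (by norm_num)
  have hσ12 : ContDiff ℝ 2 (deriv σ) := hσ1.of_le (by norm_num)
  have hζ := contDiff_mul_affine hη v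
  unfold HasLineDerivAt
  simp only [pderiv_unit hη hσ]
  have z0 := hasDerivAt_comp_line (hσ.of_le (by norm_num)) θ v x
  have z1 := hasDerivAt_comp_line (hσ1.of_le (by norm_num)) θ v x
  have h := (hasDerivAt_fst_line θ v).mul ((z0.const_mul (pderiv i η x)).add
    (((hasDerivAt_weight_line θ v i).mul z1).const_mul (η x)))
  simp only [zero_smul, add_zero, Pi.add_apply, Pi.mul_apply] at h
  refine h.congr_deriv ?_
  have e : psi η σ v θ = fun y => v.1 * ridge η σ θ.2.1 θ.2.2 y + θ.1 *
    ridge (fun y => η y * affine v.2.1 v.2.2 y) (deriv σ) θ.2.1 θ.2.2 y := rfl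
  have r1 := contDiff_ridge hη hσ2 θ.2.1 θ.2.2
  have r2 := contDiff_ridge hζ hσ12 θ.2.1 θ.2.2
  rw [e, pderiv_add ((differentiable_of_contDiff_two r1 x).const_mul _)
    ((differentiable_of_contDiff_two r2 x).const_mul _),
    pderiv_const_mul (differentiable_of_contDiff_two r1 x),
    pderiv_const_mul (differentiable_of_contDiff_two r2 x), pderiv_ridge hη hσ2,
    pderiv_ridge hζ hσ12, pderiv_mul (differentiable_of_contDiff_two hη x)
    (differentiable_of_contDiff_two (contDiff_affine _ _) x), pderiv_affine]
  ring

theorem hasLineDerivAt_pderiv₂_unit (v θ : Param d) (i j : Fin d) (x : Space d) :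
    HasLineDerivAt ℝ (fun θ' => pderiv i (pderiv j (unit η σ θ')) x)
      (pderiv i (pderiv j (psi η σ v θ)) x) θ v := by
  have hσ2 : ContDiff ℝ 2 σ := hσ.of_le (by norm_num)
  have hσ1 : ContDiff ℝ 3 (deriv σ) := contDiff_deriv_of hσ (by norm_num)
  have hσ12 : ContDiff ℝ 2 (deriv σ) := hσ1.of_le (by norm_num)
  have hσ3 : ContDiff ℝ 2 (deriv (deriv σ)) := contDiff_deriv_of hσ1 (by norm_num)
  have hζ := contDiff_mul_affine hη v
  unfold HasLineDerivAt
  simp only [pderiv₂_unit hη hσ]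
  have z0 := hasDerivAt_comp_line (hσ.of_le (by norm_num)) θ v x
  have z1 := hasDerivAt_comp_line (hσ1.of_le (by norm_num)) θ v x
  have z2 := hasDerivAt_comp_line (hσ3.of_le (by norm_num)) θ v x
  have w := hasDerivAt_weight_line θ v
  have h := (hasDerivAt_fst_line θ v).mul (((z0.const_mul (pderiv i (pderiv j η) x)).add
    ((((w i).const_mul (pderiv j η x)).add ((w j).const_mul (pderiv i η x))).mul z1)).add
    ((((w i).mul (w j)).const_mul (η x)).mul z2))
  simp only [zero_smul, add_zero, Pi.add_apply, Pi.mul_apply] at h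
  refine h.congr_deriv ?_
  have e : psi η σ v θ = fun y => v.1 * ridge η σ θ.2.1 θ.2.2 y + θ.1 *
    ridge (fun y => η y * affine v.2.1 v.2.2 y) (deriv σ) θ.2.1 θ.2.2 y := rfl
  have r1 := contDiff_ridge hη hσ2 θ.2.1 θ.2.2
  have r2 := contDiff_ridge hζ hσ12 θ.2.1 θ.2.2
  have ea : ∀ j, pderiv j (affine v.2.1 v.2.2) = fun _ => v.2.1 j :=
    fun j => funext fun y => pderiv_affine _ _ _ _
  have hd1 := differentiable_of_contDiff_two hη x
  have hd2 := differentiable_of_contDiff_two (contDiff_affine v.2.1 v.2.2) x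
  rw [e, pderiv₂_add (contDiff_const.mul r1) (contDiff_const.mul r2),
    pderiv₂_const_mul r1, pderiv₂_const_mul r2, pderiv₂_ridge hη hσ2,
    pderiv₂_ridge hζ hσ12, pderiv₂_mul hη (contDiff_affine _ _), pderiv_mul hd1 hd2,
    pderiv_mul hd1 hd2, ea, ea, pderiv_const]
  ring

/-- The operator `𝒜` commutes with the derivatives in the parameters. -/
theorem hasLineDerivAt_classical_unit (A : DiffOp d) (v θ : Param d) (x : Space d) :
    HasLineDerivAt ℝ (fun θ' => A.classical (unit η σ θ') x) (A.classical (psi η σ v θ) x) θ v := by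
  have h0 := hasLineDerivAt_unit (η := η) hσ v θ x
  have h1 := fun i => hasLineDerivAt_pderiv_unit hη hσ v θ i x
  have h2 := fun i j => hasLineDerivAt_pderiv₂_unit hη hσ v θ i j x
  unfold HasLineDerivAt at *
  unfold DiffOp.classical
  exact ((h0.const_mul _).add (HasDerivAt.fun_sum fun i _ => (h1 i).const_mul _)).add
    (HasDerivAt.fun_sum fun i _ => HasDerivAt.fun_sum fun j _ => (h2 i j).const_mul _)

end Line

/-- The coordinate directions of the parameter space. -/
noncomputable def dir : Option (Option (Fin d)) → Param d
  | none => (1, 0, 0)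
  | some none => (0, 0, 1)
  | some (some i) => (0, EuclideanSpace.single i 1, 0)

theorem gradDot_eq_sum (F G : Param d → ℝ) (θ : Param d) :
    gradDot F G θ = ∑ κ, lineDeriv ℝ F θ (dir κ) * lineDeriv ℝ G θ (dir κ) := by
  simp only [Fintype.sum_option, dir, gradDot]; ring

/-- With `𝒜` moved onto `psi`, both kernels are expectations of sums of products of one function of
`x` and one of `y`. This Gram structure is the source of the symmetry and positivity of `𝒱`. -/
theorem kernelU_eq {η : Space d → ℝ} {σ : ℝ → ℝ} (hη : ContDiff ℝ 2 η) (hσ : ContDiff ℝ 4 σ)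
    (A : DiffOp d) (ν : Measure (Param d)) (x y : Space d) : kernelU A η σ ν x y =
      ∫ θ, ∑ κ, A.classical (psi η σ (dir κ) θ) x * psi η σ (dir κ) θ y ∂ν := by
  unfold kernelU
  simp only [gradDot_eq_sum, (hasLineDerivAt_classical_unit hη hσ A _ _ x).lineDeriv,
    (hasLineDerivAt_unit hσ _ _ y).lineDeriv]

theorem kernelB_eq {η : Space d → ℝ} {σ : ℝ → ℝ} (hσ : ContDiff ℝ 4 σ)
    (ν : Measure (Param d)) (x y : Space d) : kernelB η σ ν x y =
      ∫ θ, ∑ κ, psi η σ (dir κ) θ x * psi η σ (dir κ) θ y ∂ν := by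
  unfold kernelB
  simp only [gradDot_eq_sum, (hasLineDerivAt_unit hσ _ _ _).lineDeriv]

/-! ### Bounds -/

theorem IsCb.exists_bound {k : ℕ} {σ : ℝ → ℝ} (hσ : IsCb k σ) :
    ∃ C, ∀ j ≤ k, ∀ z, |iteratedDeriv j σ z| ≤ C := by
  choose C hC using hσ.2
  have hn : ∀ j (hj : j ≤ k), 0 ≤ C j hj := fun j hj => (norm_nonneg _).trans (hC j hj 0)
  refine ⟨∑ j : Fin (k + 1), C j (by omega), fun j hj z => ?_⟩
  have h1 := hC j hj z
  rw [norm_iteratedFDeriv_eq_norm_iteratedDeriv, Real.norm_eq_abs] at h1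
  exact h1.trans (Finset.single_le_sum (f := fun j : Fin (k + 1) => C j (by omega))
    (fun j _ => hn _ _) (Finset.mem_univ ⟨j, by omega⟩))

/-- The quadratic growth rate of the jets of a hidden unit in its weight. -/
noncomputable def growth (θ : Param d) : ℝ := (1 + ‖θ.2.1‖) ^ 2

theorem one_le_growth (θ : Param d) : 1 ≤ growth θ := by
  have := norm_nonneg θ.2.1
  unfold growth; nlinarith

/-- The square of the growth rate is `(1 + ‖w‖)^4`, so this is exactly what the fourth moments of
the weights provide; `‖w‖` is dominated by `∑ |w_k|`. -/
theorem IsInitialLaw.integrable_growth_sq {ν : Measure (Param d)} (hν : IsInitialLaw ν) :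
    Integrable (fun θ => growth θ ^ 2) ν := by
  have := hν.prob
  have h1 : ∀ k, MemLp (fun θ : Param d => θ.2.1 k) 4 ν := fun k => by
    have hm : AEStronglyMeasurable (fun θ : Param d => θ.2.1 k) ν :=
      Continuous.aestronglyMeasurable (by fun_prop)
    have := (integrable_norm_rpow_iff hm (p := 4) (by norm_num) (by norm_num)).1
    refine this ((hν.moment_w k).congr (Eventually.of_forall fun θ => ?_))
    simp only [Real.norm_eq_abs]
    have : ((4 : ℝ≥0∞)).toReal = ((4 : ℕ) : ℝ) := by norm_num
    rw [this, Real.rpow_natCast]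
  have h2 : MemLp (fun θ : Param d => 1 + ‖θ.2.1‖) 4 ν := by
    have h3 : MemLp (fun θ : Param d => ∑ k, |θ.2.1 k|) 4 ν :=
      memLp_finsetSum Finset.univ fun k _ => (h1 k).abs
    have h4 : MemLp (fun θ : Param d => ‖θ.2.1‖) 4 ν := by
      refine h3.mono (Continuous.aestronglyMeasurable (by fun_prop))
        (Eventually.of_forall fun θ => ?_)
      rw [norm_norm, Real.norm_of_nonneg (by positivity)]
      rw [EuclideanSpace.norm_eq, Real.sqrt_le_left (by positivity)]
      simp only [Real.norm_eq_abs]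
      exact Finset.sum_sq_le_sq_sum_of_nonneg fun i _ => abs_nonneg _
    exact (memLp_const (1 : ℝ)).add h4
  have h3 := h2.integrable_norm_rpow (by norm_num) (by norm_num)
  refine h3.congr (Eventually.of_forall fun θ => ?_)
  have : ((4 : ℝ≥0∞)).toReal = ((4 : ℕ) : ℝ) := by norm_num
  simp only [this]
  rw [Real.rpow_natCast, Real.norm_of_nonneg (by positivity), growth]
  ring

/-- `psi` is a combination of two ridge functions: one with profile `σ`, and one with profile `σ'`
multiplied by `c`. The affine factor coming from the direction `v` is independent of `θ` and is
absorbed into the amplitude, so the growth in the weight stays quadratic. Bounds up to the third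
derivative of `σ` and on `c` are used. -/
theorem jetAbs_psi_le {η : Space d → ℝ} {σ : ℝ → ℝ} (hη : ContDiff ℝ 2 η) (hσ : IsCb 4 σ) (K : ℝ)
    (v : Param d) : ∃ h : Space d → ℝ, Continuous h ∧ (∀ x, 0 ≤ h x) ∧
      ∀ θ : Param d, |θ.1| < K → ∀ x, jetAbs (psi η σ v θ) x ≤ h x * growth θ := by
  obtain ⟨C, hC⟩ := hσ.exists_bound
  have e2 : deriv σ = iteratedDeriv 1 σ := iteratedDeriv_one.symm
  have hσ2 : ContDiff ℝ 2 σ := hσ.1.of_le (by norm_num)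
  have hσ12 : ContDiff ℝ 2 (deriv σ) := contDiff_deriv_of hσ.1 (by norm_num)
  have hζ := contDiff_mul_affine hη v
  have hs : ∀ j, deriv (iteratedDeriv j σ) = iteratedDeriv (j + 1) σ :=
    fun j => iteratedDeriv_succ.symm
  have b1 := fun w b x => jetAbs_ridge_le (Cs := C) hη hσ2 (by simpa using hC 0 (by norm_num))
    (by rw [e2]; exact hC 1 (by norm_num)) (by rw [e2, hs]; exact hC 2 (by norm_num)) w b x
  have b2 := fun w b x => jetAbs_ridge_le (Cs := C) hζ hσ12 (by rw [e2]; exact hC 1 (by norm_num))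
    (by rw [e2, hs]; exact hC 2 (by norm_num)) (by rw [e2, hs, hs]; exact hC 3 (by norm_num)) w b x
  have hC0 : 0 ≤ C := (abs_nonneg _).trans (hC 0 (by norm_num) 0)
  have n1 := jetAbs_nonneg η
  have n2 := jetAbs_nonneg (fun y => η y * affine v.2.1 v.2.2 y)
  refine ⟨fun x => |v.1| * ((1 + d + d * d) * (jetAbs η x * C * 4)) + |K| * ((1 + d + d * d) *
    (jetAbs (fun y => η y * affine v.2.1 v.2.2 y) x * C * 4)), ?_, fun x => ?_, fun θ hθ x => ?_⟩
  · have := continuous_jetAbs hη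
    have := continuous_jetAbs hζ
    fun_prop
  · have := n1 x; have := n2 x; positivity
  · have r1 := contDiff_ridge hη hσ2 θ.2.1 θ.2.2
    have r2 := contDiff_ridge hζ hσ12 θ.2.1 θ.2.2
    have := jetAbs_add_le (contDiff_const (c := v.1).mul r1) (contDiff_const (c := θ.1).mul r2) x
    rw [jetAbs_const_mul r1, jetAbs_const_mul r2] at this
    refine this.trans ?_
    have hK : |θ.1| ≤ |K| := hθ.le.trans (le_abs_self K)
    have t1 := mul_le_mul_of_nonneg_left (b1 θ.2.1 θ.2.2 x) (abs_nonneg v.1)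
    have t2 := mul_le_mul hK (b2 θ.2.1 θ.2.2 x) (jetAbs_nonneg _ _) (abs_nonneg K)
    refine (add_le_add t1 t2).trans (le_of_eq ?_)
    unfold growth; ring

section Continuity

variable {η : Space d → ℝ} {σ : ℝ → ℝ} (hη : ContDiff ℝ 2 η) (hσ : ContDiff ℝ 4 σ)

include hη hσ

theorem continuous_psi_uncurry (v : Param d) :
    Continuous fun p : Param d × Space d => psi η σ v p.1 p.2 := by
  have hσ12 : ContDiff ℝ 2 (deriv σ) := contDiff_deriv_of hσ (by norm_num)
  have h1 := hη.continuous
  have h2 := hσ.continuous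
  have h3 := hσ12.continuous
  unfold psi ridge
  fun_prop

theorem pderiv_psi (v θ : Param d) (i : Fin d) (x : Space d) : pderiv i (psi η σ v θ) x =
    v.1 * pderiv i (ridge η σ θ.2.1 θ.2.2) x + θ.1 *
      pderiv i (ridge (fun y => η y * affine v.2.1 v.2.2 y) (deriv σ) θ.2.1 θ.2.2) x := by
  have hσ2 : ContDiff ℝ 2 σ := hσ.of_le (by norm_num)
  have hσ12 : ContDiff ℝ 2 (deriv σ) := contDiff_deriv_of hσ (by norm_num)
  have r1 := contDiff_ridge hη hσ2 θ.2.1 θ.2.2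
  have r2 := contDiff_ridge (contDiff_mul_affine hη v) hσ12 θ.2.1 θ.2.2
  have e : psi η σ v θ = fun y => v.1 * ridge η σ θ.2.1 θ.2.2 y + θ.1 *
    ridge (fun y => η y * affine v.2.1 v.2.2 y) (deriv σ) θ.2.1 θ.2.2 y := rfl
  rw [e, pderiv_add ((differentiable_of_contDiff_two r1 x).const_mul _)
    ((differentiable_of_contDiff_two r2 x).const_mul _),
    pderiv_const_mul (differentiable_of_contDiff_two r1 x),
    pderiv_const_mul (differentiable_of_contDiff_two r2 x)]

theorem pderiv₂_psi (v θ : Param d) (i j : Fin d) (x : Space d) :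
    pderiv i (pderiv j (psi η σ v θ)) x =
    v.1 * pderiv i (pderiv j (ridge η σ θ.2.1 θ.2.2)) x + θ.1 *
      pderiv i (pderiv j (ridge (fun y => η y * affine v.2.1 v.2.2 y) (deriv σ) θ.2.1 θ.2.2)) x := by
  have hσ2 : ContDiff ℝ 2 σ := hσ.of_le (by norm_num)
  have hσ12 : ContDiff ℝ 2 (deriv σ) := contDiff_deriv_of hσ (by norm_num)
  have r1 := contDiff_ridge hη hσ2 θ.2.1 θ.2.2
  have r2 := contDiff_ridge (contDiff_mul_affine hη v) hσ12 θ.2.1 θ.2.2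
  have e : psi η σ v θ = fun y => v.1 * ridge η σ θ.2.1 θ.2.2 y + θ.1 *
    ridge (fun y => η y * affine v.2.1 v.2.2 y) (deriv σ) θ.2.1 θ.2.2 y := rfl
  rw [e, pderiv₂_add (contDiff_const.mul r1) (contDiff_const.mul r2),
    pderiv₂_const_mul r1, pderiv₂_const_mul r2]

theorem continuous_pderiv_psi_uncurry (v : Param d) (i : Fin d) :
    Continuous fun p : Param d × Space d => pderiv i (psi η σ v p.1) p.2 := by
  have hσ2 : ContDiff ℝ 2 σ := hσ.of_le (by norm_num)
  have hσ12 : ContDiff ℝ 2 (deriv σ) := contDiff_deriv_of hσ (by norm_num)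
  simp only [pderiv_psi hη hσ]
  have c : Continuous fun p : Param d × Space d => (p.1.2, p.2) := by fun_prop
  have h1 := (continuous_pderiv_ridge_uncurry hη hσ2 i).comp c
  have h2 := (continuous_pderiv_ridge_uncurry (contDiff_mul_affine hη v) hσ12 i).comp c
  exact (continuous_const.mul h1).add ((by fun_prop : Continuous fun p : Param d × Space d => p.1.1).mul h2)

theorem continuous_pderiv₂_psi_uncurry (v : Param d) (i j : Fin d) :
    Continuous fun p : Param d × Space d => pderiv i (pderiv j (psi η σ v p.1)) p.2 := by
  have hσ2 : ContDiff ℝ 2 σ := hσ.of_le (by norm_num)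
  have hσ12 : ContDiff ℝ 2 (deriv σ) := contDiff_deriv_of hσ (by norm_num)
  simp only [pderiv₂_psi hη hσ]
  have c : Continuous fun p : Param d × Space d => (p.1.2, p.2) := by fun_prop
  have h1 := (continuous_pderiv₂_ridge_uncurry hη hσ2 i j).comp c
  have h2 := (continuous_pderiv₂_ridge_uncurry (contDiff_mul_affine hη v) hσ12 i j).comp c
  exact (continuous_const.mul h1).add ((by fun_prop : Continuous fun p : Param d × Space d => p.1.1).mul h2)

theorem continuous_classical_psi_param (A : DiffOp d) (v : Param d) (x : Space d) :
    Continuous fun θ : Param d => A.classical (psi η σ v θ) x := by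
  have c : Continuous fun θ : Param d => (θ, x) := by fun_prop
  have h0 := (continuous_psi_uncurry hη hσ v).comp c
  have h1 := fun i => (continuous_pderiv_psi_uncurry hη hσ v i).comp c
  have h2 := fun i j => (continuous_pderiv₂_psi_uncurry hη hσ v i j).comp c
  simp only [Function.comp_def] at h0 h1 h2
  unfold DiffOp.classical
  fun_prop

end Continuity

end PINN

/-! ### The operators `𝒰`, `ℬ` and `𝒱` as expectations of pairings -/

namespace PINN

variable {d : ℕ}

/-- The constant depends on `x` through the values of the coefficients, and in return there is no
exceptional set. This gives integrability in `θ` at every single point `x`, as needed for kernels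
that are defined pointwise. -/
theorem DiffOp.abs_classical_le_coeff (A : DiffOp d) (q : Space d → ℝ) (x : Space d) :
    |A.classical q x| ≤
      (|A.a₀ x| + ∑ i, |A.a₁ i x| + ∑ i, ∑ j, |A.a₂ i j x|) * jetAbs q x := by
  simp only [DiffOp.classical, add_mul, Finset.sum_mul]
  refine (abs_add_three _ _ _).trans ?_
  gcongr
  · rw [abs_mul]; gcongr; exact abs_le_jetAbs q x
  · refine (Finset.abs_sum_le_sum_abs _ _).trans (Finset.sum_le_sum fun i _ => ?_)
    rw [abs_mul]; gcongr; exact abs_pderiv_le_jetAbs q i x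
  · refine (Finset.abs_sum_le_sum_abs _ _).trans (Finset.sum_le_sum fun i _ => ?_)
    refine (Finset.abs_sum_le_sum_abs _ _).trans (Finset.sum_le_sum fun j _ => ?_)
    rw [abs_mul]; gcongr; exact abs_pderiv₂_le_jetAbs q i j x

theorem DiffOp.classical_sum (A : DiffOp d) {ι : Type*} (s : Finset ι) {q : ι → Space d → ℝ}
    (hq : ∀ k, ContDiff ℝ 2 (q k)) (x : Space d) :
    A.classical (fun y => ∑ k ∈ s, q k y) x = ∑ k ∈ s, A.classical (q k) x := by
  classical
  induction s using Finset.induction_on with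
  | empty => simp [DiffOp.classical, pderiv_const]
  | insert a s ha ih =>
    simp only [Finset.sum_insert ha]
    rw [A.classical_add (hq a) (ContDiff.sum fun k _ => hq k), ih]

/-- The standing assumptions on the network, on the domain and on the operator that enter the
kernels. -/
structure Setting (Ω : Set (Space d)) (μ : Measure (Space d)) (A : DiffOp d) (η : Space d → ℝ)
    (σ : ℝ → ℝ) (ν : Measure (Param d)) : Prop where
  compact : IsCompact Ω
  finite : IsFiniteMeasure μ
  comparable : Comparable μ (volume.restrict (interior Ω))
  adm : A.IsAdmissible Ω μ
  smooth_aux : ContDiff ℝ 3 η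
  act : IsCb 4 σ
  law : IsInitialLaw ν

namespace Setting

variable {Ω : Set (Space d)} {μ : Measure (Space d)} {A : DiffOp d} {η : Space d → ℝ}
    {σ : ℝ → ℝ} {ν : Measure (Param d)}

theorem aux₂ (S : Setting Ω μ A η σ ν) : ContDiff ℝ 2 η := S.smooth_aux.of_le (by norm_num)

theorem contDiff_psi (S : Setting Ω μ A η σ ν) (v θ : Param d) : ContDiff ℝ 2 (psi η σ v θ) :=
  PINN.contDiff_psi S.aux₂ S.act.1 (by norm_num) v θ

theorem bounds (S : Setting Ω μ A η σ ν) (v : Param d) : ∃ h : Space d → ℝ, Continuous h ∧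
    (∀ x, 0 ≤ h x) ∧ ∀ᵐ θ ∂ν, ∀ x, jetAbs (psi η σ v θ) x ≤ h x * growth θ := by
  obtain ⟨K, hK⟩ := S.law.bounded
  obtain ⟨h, h1, h2, h3⟩ := jetAbs_psi_le S.aux₂ S.act K v
  exact ⟨h, h1, h2, hK.mono fun θ hθ => h3 θ hθ⟩

/-- Uniformity in `x` comes from compactness of `Ω` and the bounds on the coefficients. The null set
of points `x` must not depend on `θ`, since the estimate is one for the product measure;
`abs_classical_le` was stated for all functions at once for this reason. -/
theorem bounds_classical (S : Setting Ω μ A η σ ν) (v : Param d) : ∃ C : ℝ, 0 ≤ C ∧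
    ∀ᵐ p ∂(ν.prod μ), |A.classical (psi η σ v p.1) p.2| ≤ C * growth p.1 := by
  have := S.finite
  have := S.law.prob
  obtain ⟨h, h1, h2, h3⟩ := S.bounds v
  obtain ⟨B, hB0, hB⟩ := exists_bound_of_isCompact S.compact h1
  obtain ⟨C, hC0, hC⟩ := S.adm.abs_classical_le S.compact S.comparable
  refine ⟨C * B, by positivity, ?_⟩
  filter_upwards [Measure.quasiMeasurePreserving_fst.ae h3, Measure.quasiMeasurePreserving_snd.ae hC]
    with p hp1 hp2
  have hg := one_le_growth p.1
  have := hB p.2 (interior_subset hp2.1)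
  calc _ ≤ C * jetAbs (psi η σ v p.1) p.2 := hp2.2 _ (S.contDiff_psi v p.1)
    _ ≤ C * (B * growth p.1) := by
        gcongr
        refine (hp1 p.2).trans ?_
        gcongr
        exact (le_abs_self _).trans this
    _ = _ := by ring

theorem aestronglyMeasurable_classical (S : Setting Ω μ A η σ ν) {q : Space d → ℝ}
    (hq : ContDiff ℝ 2 q) : AEStronglyMeasurable (A.classical q) μ := by
  have h0 := hq.continuous.aestronglyMeasurable (μ := μ)
  have h1 := fun i => (contDiff_one_pderiv hq i).continuous.aestronglyMeasurable (μ := μ)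
  have h2 := fun i j => (continuous_pderiv (contDiff_one_pderiv hq j) i).aestronglyMeasurable (μ := μ)
  have m0 := S.adm.meas₀.aestronglyMeasurable
  have m1 := fun i => (S.adm.meas₁ i).aestronglyMeasurable
  have m2 := fun i j => (S.adm.meas₂ i j).aestronglyMeasurable
  unfold DiffOp.classical
  fun_prop

theorem aestronglyMeasurable_classical_psi (S : Setting Ω μ A η σ ν) (v : Param d) :
    AEStronglyMeasurable (fun p : Param d × Space d => A.classical (psi η σ v p.1) p.2)
      (ν.prod μ) := by
  have := S.finite
  have := S.law.prob
  have h0 := (continuous_psi_uncurry S.aux₂ S.act.1 v).aestronglyMeasurable (μ := ν.prod μ)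
  have h1 := fun i =>
    (continuous_pderiv_psi_uncurry S.aux₂ S.act.1 v i).aestronglyMeasurable (μ := ν.prod μ)
  have h2 := fun i j =>
    (continuous_pderiv₂_psi_uncurry S.aux₂ S.act.1 v i j).aestronglyMeasurable (μ := ν.prod μ)
  have m0 := S.adm.meas₀.aestronglyMeasurable.comp_snd (μ := ν)
  have m1 := fun i => (S.adm.meas₁ i).aestronglyMeasurable.comp_snd (μ := ν)
  have m2 := fun i j => (S.adm.meas₂ i j).aestronglyMeasurable.comp_snd (μ := ν)
  unfold DiffOp.classical
  fun_prop

end Setting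

/-- `m` grows at most quadratically in the weight. -/
structure IsGrowth (ν : Measure (Param d)) (m : Param d → ℝ) : Prop where
  meas : AEStronglyMeasurable m ν
  bound : ∃ C : ℝ, 0 ≤ C ∧ ∀ᵐ θ ∂ν, |m θ| ≤ C * growth θ

theorem IsGrowth.add {ν : Measure (Param d)} {m n : Param d → ℝ} (hm : IsGrowth ν m)
    (hn : IsGrowth ν n) : IsGrowth ν fun θ => m θ + n θ := by
  obtain ⟨C, hC, h⟩ := hm.bound
  obtain ⟨C', hC', h'⟩ := hn.bound
  refine ⟨hm.meas.add hn.meas, C + C', by positivity, ?_⟩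
  filter_upwards [h, h'] with θ h h'
  rw [add_mul]
  exact (abs_add_le _ _).trans (add_le_add h h')

theorem IsGrowth.const_mul {ν : Measure (Param d)} {m : Param d → ℝ} (hm : IsGrowth ν m) (c : ℝ) :
    IsGrowth ν fun θ => c * m θ := by
  obtain ⟨C, hC, h⟩ := hm.bound
  refine ⟨hm.meas.const_mul c, |c| * C, by positivity, ?_⟩
  filter_upwards [h] with θ h
  rw [abs_mul, mul_assoc]
  gcongr

theorem IsGrowth.zero (ν : Measure (Param d)) : IsGrowth ν fun _ => 0 :=
  ⟨aestronglyMeasurable_const, 0, le_rfl, Eventually.of_forall fun θ => by simp⟩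

theorem IsGrowth.sum {ν : Measure (Param d)} {ι : Type*} (s : Finset ι) {m : ι → Param d → ℝ}
    (hm : ∀ k, IsGrowth ν (m k)) : IsGrowth ν fun θ => ∑ k ∈ s, m k θ := by
  classical
  induction s using Finset.induction_on with
  | empty => simpa using IsGrowth.zero ν
  | insert a s ha ih =>
    simp only [Finset.sum_insert ha]
    exact (hm a).add ih

/-- Two factors of quadratic growth have a product of quartic growth, which the fourth moments
integrate. -/
theorem IsGrowth.integrable_mul {ν : Measure (Param d)} (hν : IsInitialLaw ν) {m n : Param d → ℝ}
    (hm : IsGrowth ν m) (hn : IsGrowth ν n) : Integrable (fun θ => m θ * n θ) ν := by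
  obtain ⟨C, hC, h⟩ := hm.bound
  obtain ⟨C', hC', h'⟩ := hn.bound
  refine (hν.integrable_growth_sq.const_mul (C * C')).mono' (hm.meas.mul hn.meas) ?_
  filter_upwards [h, h'] with θ h h'
  rw [Real.norm_eq_abs, abs_mul]
  have := one_le_growth θ
  calc |m θ| * |n θ| ≤ (C * growth θ) * (C' * growth θ) := by gcongr
    _ = _ := by ring

/-- The function `y ↦ 𝔼[m(θ) ∂_v φ_θ(y)]`. -/
noncomputable def avg (η : Space d → ℝ) (σ : ℝ → ℝ) (ν : Measure (Param d)) (v : Param d)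
    (m : Param d → ℝ) (y : Space d) : ℝ := ∫ θ, m θ * psi η σ v θ y ∂ν

namespace Setting

variable {Ω : Set (Space d)} {μ : Measure (Space d)} {A : DiffOp d} {η : Space d → ℝ}
    {σ : ℝ → ℝ} {ν : Measure (Param d)}

theorem isGrowth_of_le_jetAbs (S : Setting Ω μ A η σ ν) (v : Param d) {n : Param d → ℝ}
    (hn : Continuous n) (x : Space d) {c : ℝ} (hc : 0 ≤ c)
    (h : ∀ θ, |n θ| ≤ c * jetAbs (psi η σ v θ) x) : IsGrowth ν n := by
  obtain ⟨g, g1, g2, g3⟩ := S.bounds v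
  refine ⟨hn.aestronglyMeasurable, c * g x, mul_nonneg hc (g2 x), ?_⟩
  filter_upwards [g3] with θ hθ
  rw [mul_assoc]
  exact (h θ).trans (mul_le_mul_of_nonneg_left (hθ x) hc)

theorem isGrowth_psi (S : Setting Ω μ A η σ ν) (v : Param d) (x : Space d) :
    IsGrowth ν fun θ => psi η σ v θ x :=
  S.isGrowth_of_le_jetAbs v ((continuous_psi_uncurry S.aux₂ S.act.1 v).comp
    (by fun_prop : Continuous fun θ : Param d => (θ, x))) x zero_le_one
    fun θ => by rw [one_mul]; exact abs_le_jetAbs _ x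

theorem isGrowth_pderiv_psi (S : Setting Ω μ A η σ ν) (v : Param d) (i : Fin d) (x : Space d) :
    IsGrowth ν fun θ => pderiv i (psi η σ v θ) x := by
  have c : Continuous fun θ : Param d => (θ, x) := by fun_prop
  have h := (continuous_pderiv_psi_uncurry S.aux₂ S.act.1 v i).comp c
  simp only [Function.comp_def] at h
  refine S.isGrowth_of_le_jetAbs v h x zero_le_one fun θ => ?_
  rw [one_mul]
  exact abs_pderiv_le_jetAbs (psi η σ v θ) i x

theorem isGrowth_pderiv₂_psi (S : Setting Ω μ A η σ ν) (v : Param d) (i j : Fin d) (x : Space d) :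
    IsGrowth ν fun θ => pderiv i (pderiv j (psi η σ v θ)) x := by
  have c : Continuous fun θ : Param d => (θ, x) := by fun_prop
  have h := (continuous_pderiv₂_psi_uncurry S.aux₂ S.act.1 v i j).comp c
  simp only [Function.comp_def] at h
  refine S.isGrowth_of_le_jetAbs v h x zero_le_one fun θ => ?_
  rw [one_mul]
  exact abs_pderiv₂_le_jetAbs (psi η σ v θ) i j x

theorem isGrowth_classical_psi (S : Setting Ω μ A η σ ν) (v : Param d) (x : Space d) :
    IsGrowth ν fun θ => A.classical (psi η σ v θ) x :=
  S.isGrowth_of_le_jetAbs v (continuous_classical_psi_param S.aux₂ S.act.1 A v x) x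
    (by positivity) fun θ => A.abs_classical_le_coeff _ x

/-- On each ball the jet of `m(θ) psi(θ, ·)` is at most a constant times `growth θ ^ 2`, which is
integrable. So two derivatives, and with them `𝒜`, pass under the expectation. -/
theorem avg_spec (S : Setting Ω μ A η σ ν) (v : Param d) {m : Param d → ℝ} (hm : IsGrowth ν m) :
    ContDiff ℝ 2 (avg η σ ν v m) ∧
      ∀ x, A.classical (avg η σ ν v m) x = ∫ θ, m θ * A.classical (psi η σ v θ) x ∂ν := by
  have hψ := fun θ => S.contDiff_psi v θ
  have p1 : ∀ θ i y, pderiv i (fun y => m θ * psi η σ v θ y) y = m θ * pderiv i (psi η σ v θ) y :=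
    fun θ i y => pderiv_const_mul (differentiable_of_contDiff_two (hψ θ) y) _ _
  have p2 : ∀ θ i j y, pderiv i (pderiv j (fun y => m θ * psi η σ v θ y)) y =
      m θ * pderiv i (pderiv j (psi η σ v θ)) y :=
    fun θ i j y => pderiv₂_const_mul (hψ θ) _ _ _ _
  obtain ⟨h0, h1, h2⟩ := contDiff_two_integral_of_dominated (ν := ν)
    (G := fun θ y => m θ * psi η σ v θ y) (fun θ => contDiff_const.mul (hψ θ))
    (fun y => hm.meas.mul (S.isGrowth_psi v y).meas)
    (fun i y => by simp only [p1]; exact hm.meas.mul (S.isGrowth_pderiv_psi v i y).meas)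
    (fun i j y => by simp only [p2]; exact hm.meas.mul (S.isGrowth_pderiv₂_psi v i j y).meas)
    (fun R => by
      obtain ⟨g, g1, g2, g3⟩ := S.bounds v
      obtain ⟨B, hB0, hB⟩ := exists_bound_of_isCompact (isCompact_closedBall (0 : Space d) R) g1
      obtain ⟨C, hC0, hC⟩ := hm.bound
      refine ⟨fun θ => C * B * growth θ ^ 2, S.law.integrable_growth_sq.const_mul _, ?_⟩
      filter_upwards [g3, hC] with θ h3 hC y hy
      rw [jetAbs_const_mul (hψ θ)]
      have h4 := (le_abs_self _).trans (hB y (by simpa using hy))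
      have h5 := one_le_growth θ
      calc |m θ| * jetAbs (psi η σ v θ) y ≤ (C * growth θ) * (B * growth θ) := by
            gcongr
            · exact jetAbs_nonneg _ _
            · exact (h3 y).trans (by gcongr)
        _ = _ := by ring)
  refine ⟨h0, fun x => ?_⟩
  have i0 := hm.integrable_mul S.law (S.isGrowth_psi v x)
  have i1 := fun i => hm.integrable_mul S.law (S.isGrowth_pderiv_psi v i x)
  have i2 := fun i j => hm.integrable_mul S.law (S.isGrowth_pderiv₂_psi v i j x)
  have e : avg η σ ν v m = fun y => ∫ θ, m θ * psi η σ v θ y ∂ν := rfl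
  rw [e]
  simp only [DiffOp.classical, h2, p2]
  simp only [h1, p1]
  rw [← integral_const_mul]
  simp only [← integral_const_mul]
  rw [← integral_finsetSum _ fun i _ => (i1 i).const_mul _]
  have : ∀ i, ∑ j, ∫ θ, A.a₂ i j x * (m θ * pderiv i (pderiv j (psi η σ v θ)) x) ∂ν =
      ∫ θ, ∑ j, A.a₂ i j x * (m θ * pderiv i (pderiv j (psi η σ v θ)) x) ∂ν := fun i =>
    (integral_finsetSum _ fun j _ => (i2 i j).const_mul _).symm
  simp only [this]
  rw [← integral_finsetSum _ fun i _ => integrable_finsetSum _ fun j _ => (i2 i j).const_mul _]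
  have j1 : Integrable (fun θ => ∑ i, A.a₁ i x * (m θ * pderiv i (psi η σ v θ) x)) ν :=
    integrable_finsetSum _ fun i _ => (i1 i).const_mul _
  have j2 : Integrable (fun θ => ∑ i, ∑ j,
      A.a₂ i j x * (m θ * pderiv i (pderiv j (psi η σ v θ)) x)) ν :=
    integrable_finsetSum _ fun i _ => integrable_finsetSum _ fun j _ => (i2 i j).const_mul _
  have j0 : Integrable (fun θ => A.a₀ x * (m θ * psi η σ v θ x) +
      ∑ i, A.a₁ i x * (m θ * pderiv i (psi η σ v θ) x)) ν := (i0.const_mul _).add j1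
  rw [← integral_add (i0.const_mul _) j1, ← integral_add j0 j2]
  refine integral_congr_ae (Eventually.of_forall fun θ => ?_)
  simp only [mul_add, Finset.mul_sum]
  congr 1
  · congr 1
    · ring
    · exact Finset.sum_congr rfl fun i _ => by ring
  · exact Finset.sum_congr rfl fun i _ => Finset.sum_congr rfl fun j _ => by ring

end Setting

/-- The pairing `⟨f, 𝒜 ∂_v φ_θ⟩` in `L²(μ)`. -/
noncomputable def pairU (A : DiffOp d) (η : Space d → ℝ) (σ : ℝ → ℝ) (μ : Measure (Space d))
    (v : Param d) (f : Space d → ℝ) (θ : Param d) : ℝ :=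
  ∫ x, f x * A.classical (psi η σ v θ) x ∂μ

/-- The pairing `(1/M) ∑_i a_i ∂_v φ_θ(x_i)`. -/
noncomputable def pairB {M : ℕ} (η : Space d → ℝ) (σ : ℝ → ℝ) (X : Fin M → Space d)
    (v : Param d) (a : Fin M → ℝ) (θ : Param d) : ℝ :=
  (M : ℝ)⁻¹ * ∑ i, a i * psi η σ v θ (X i)

namespace Setting

variable {Ω : Set (Space d)} {μ : Measure (Space d)} {A : DiffOp d} {η : Space d → ℝ}
    {σ : ℝ → ℝ} {ν : Measure (Param d)} {M : ℕ}

theorem isGrowth_pairB (S : Setting Ω μ A η σ ν) (X : Fin M → Space d) (v : Param d)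
    (a : Fin M → ℝ) : IsGrowth ν (pairB η σ X v a) :=
  (IsGrowth.sum _ fun i => (S.isGrowth_psi v (X i)).const_mul (a i)).const_mul _

/-- This is the integrability behind every use of Fubini between `θ` and `x`: the integrand is
dominated by a multiple of `growth θ ^ 2 * |f x|`. -/
theorem integrable_mul_classical_psi (S : Setting Ω μ A η σ ν) (v : Param d) {f : Space d → ℝ}
    (hf : Integrable f μ) {n : Param d → ℝ} (hn : IsGrowth ν n) :
    Integrable (fun p : Param d × Space d => n p.1 * (f p.2 * A.classical (psi η σ v p.1) p.2))
      (ν.prod μ) := by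
  have := S.finite
  have := S.law.prob
  obtain ⟨C, hC, h⟩ := S.bounds_classical v
  obtain ⟨B, hB, h'⟩ := hn.bound
  refine ((S.law.integrable_growth_sq.mul_prod hf.abs).const_mul (C * B)).mono'
    (hn.meas.comp_fst.mul (hf.1.comp_snd.mul (S.aestronglyMeasurable_classical_psi v))) ?_
  filter_upwards [h, Measure.quasiMeasurePreserving_fst.ae h'] with p h h'
  rw [Real.norm_eq_abs, abs_mul, abs_mul]
  have := one_le_growth p.1
  calc _ ≤ (B * growth p.1) * (|f p.2| * (C * growth p.1)) := by gcongr
    _ = _ := by ring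

theorem isGrowth_pairU (S : Setting Ω μ A η σ ν) (v : Param d) {f : Space d → ℝ}
    (hf : Integrable f μ) : IsGrowth ν (pairU A η σ μ v f) := by
  have := S.finite
  have := S.law.prob
  obtain ⟨C, hC, h⟩ := S.bounds_classical v
  refine ⟨(hf.1.comp_snd.mul (S.aestronglyMeasurable_classical_psi v)).integral_prod_right',
    C * ∫ x, |f x| ∂μ, by positivity, ?_⟩
  filter_upwards [Measure.ae_ae_of_ae_prod h] with θ h
  have hg := one_le_growth θ
  calc |pairU A η σ μ v f θ| ≤ ∫ x, C * growth θ * |f x| ∂μ := by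
        rw [← Real.norm_eq_abs]
        refine norm_integral_le_of_norm_le (hf.abs.const_mul (C * growth θ)) ?_
        filter_upwards [h] with x hx
        rw [Real.norm_eq_abs, abs_mul, mul_comm]
        gcongr
    _ = C * (∫ x, |f x| ∂μ) * growth θ := by rw [integral_const_mul]; ring

/-- Integrating in `x` before `θ` exposes `𝒰 f` as an average of the functions `psi(θ, ·)`, weighted
by the pairing of `f` with `𝒜 psi(θ, ·)`. In this form its smoothness and its image under `𝒜` come
from `avg_spec`. -/
theorem opU_eq (S : Setting Ω μ A η σ ν) {f : Space d → ℝ} (hf : Integrable f μ) (y : Space d) :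
    opU A η σ ν μ f y = ∑ κ, avg η σ ν (dir κ) (pairU A η σ μ (dir κ) f) y := by
  have := S.finite
  have := S.law.prob
  have hint := fun κ => S.integrable_mul_classical_psi (dir κ) hf (S.isGrowth_psi (dir κ) y)
  have hi : ∀ κ, Integrable (fun θ => pairU A η σ μ (dir κ) f θ * psi η σ (dir κ) θ y) ν :=
    fun κ => (S.isGrowth_pairU (dir κ) hf).integrable_mul S.law (S.isGrowth_psi (dir κ) y)
  have e1 : ∀ x, f x * kernelU A η σ ν x y =
      ∑ κ, ∫ θ, psi η σ (dir κ) θ y * (f x * A.classical (psi η σ (dir κ) θ) x) ∂ν := by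
    intro x
    rw [kernelU_eq S.aux₂ S.act.1, integral_finsetSum, Finset.mul_sum]
    · refine Finset.sum_congr rfl fun κ _ => ?_
      rw [← integral_const_mul]
      exact integral_congr_ae (Eventually.of_forall fun θ => by ring)
    · exact fun κ _ => (S.isGrowth_classical_psi (dir κ) x).integrable_mul S.law
        (S.isGrowth_psi (dir κ) y)
  unfold opU
  simp only [e1]
  rw [integral_finsetSum _ fun κ _ => (hint κ).integral_prod_right]
  refine Finset.sum_congr rfl fun κ _ => ?_
  rw [← integral_integral_swap (f := fun θ x =>
    psi η σ (dir κ) θ y * (f x * A.classical (psi η σ (dir κ) θ) x)) (hint κ)]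
  simp only [integral_const_mul]
  exact integral_congr_ae (Eventually.of_forall fun θ => mul_comm _ _)

theorem opB_eq (S : Setting Ω μ A η σ ν) (X : Fin M → Space d) (a : Fin M → ℝ) (y : Space d) :
    opB η σ ν X a y = ∑ κ, avg η σ ν (dir κ) (pairB η σ X (dir κ) a) y := by
  have hi : ∀ κ i, Integrable (fun θ => psi η σ (dir κ) θ (X i) * psi η σ (dir κ) θ y) ν :=
    fun κ i => (S.isGrowth_psi (dir κ) (X i)).integrable_mul S.law (S.isGrowth_psi (dir κ) y)
  simp only [opB, kernelB_eq S.act.1]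
  simp only [integral_finsetSum _ fun κ _ => hi κ _]
  simp only [Finset.mul_sum, avg, pairB]
  rw [Finset.sum_comm]
  refine Finset.sum_congr rfl fun κ _ => ?_
  simp only [Finset.sum_mul]
  rw [integral_finsetSum]
  · refine Finset.sum_congr rfl fun i _ => ?_
    rw [← integral_const_mul, ← integral_const_mul]
    exact integral_congr_ae (Eventually.of_forall fun θ => by ring)
  · intro i _
    refine ((hi κ i).const_mul ((M : ℝ)⁻¹ * a i)).congr (Eventually.of_forall fun θ => ?_)
    simp only; ring

theorem opUBarStar_eq (S : Setting Ω μ A η σ ν) (X : Fin M → Space d) (a : Fin M → ℝ)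
    (x : Space d) : opUBarStar A η σ ν X a x =
      ∑ κ, ∫ θ, pairB η σ X (dir κ) a θ * A.classical (psi η σ (dir κ) θ) x ∂ν := by
  have hi : ∀ κ i, Integrable (fun θ => A.classical (psi η σ (dir κ) θ) x *
      psi η σ (dir κ) θ (X i)) ν := fun κ i =>
    (S.isGrowth_classical_psi (dir κ) x).integrable_mul S.law (S.isGrowth_psi (dir κ) (X i))
  simp only [opUBarStar, kernelU_eq S.aux₂ S.act.1]
  simp only [integral_finsetSum _ fun κ _ => hi κ _]
  simp only [Finset.mul_sum, pairB]
  rw [Finset.sum_comm]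
  refine Finset.sum_congr rfl fun κ _ => ?_
  simp only [Finset.sum_mul]
  rw [integral_finsetSum]
  · refine Finset.sum_congr rfl fun i _ => ?_
    rw [← integral_const_mul, ← integral_const_mul]
    exact integral_congr_ae (Eventually.of_forall fun θ => by ring)
  · intro i _
    refine ((hi κ i).const_mul ((M : ℝ)⁻¹ * a i)).congr (Eventually.of_forall fun θ => ?_)
    simp only; ring

end Setting

/-- The pairing of `(f, a) ∈ L²(μ) × ℝ^M` with the parameter derivative of
`(𝒜 φ_θ, (φ_θ(x_i))_i)`. -/
noncomputable def pair {M : ℕ} (A : DiffOp d) (η : Space d → ℝ) (σ : ℝ → ℝ)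
    (μ : Measure (Space d)) (X : Fin M → Space d) (v : Param d)
    (F : (Space d → ℝ) × (Fin M → ℝ)) (θ : Param d) : ℝ :=
  pairU A η σ μ v F.1 θ + pairB η σ X v F.2 θ

/-- The function `𝒰 f + ℬ a`. -/
noncomputable def field {M : ℕ} (A : DiffOp d) (η : Space d → ℝ) (σ : ℝ → ℝ) (ν : Measure (Param d))
    (μ : Measure (Space d)) (X : Fin M → Space d) (F : (Space d → ℝ) × (Fin M → ℝ))
    (y : Space d) : ℝ := opU A η σ ν μ F.1 y + opB η σ ν X F.2 y

namespace Setting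

variable {Ω : Set (Space d)} {μ : Measure (Space d)} {A : DiffOp d} {η : Space d → ℝ}
    {σ : ℝ → ℝ} {ν : Measure (Param d)} {M : ℕ}

theorem isGrowth_pair (S : Setting Ω μ A η σ ν) (X : Fin M → Space d) (v : Param d)
    {F : (Space d → ℝ) × (Fin M → ℝ)} (hF : Integrable F.1 μ) :
    IsGrowth ν (pair A η σ μ X v F) := (S.isGrowth_pairU v hF).add (S.isGrowth_pairB X v F.2)

theorem field_eq (S : Setting Ω μ A η σ ν) (X : Fin M → Space d)
    {F : (Space d → ℝ) × (Fin M → ℝ)} (hF : Integrable F.1 μ) (y : Space d) :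
    field A η σ ν μ X F y = ∑ κ, ∫ θ, pair A η σ μ X (dir κ) F θ * psi η σ (dir κ) θ y ∂ν := by
  rw [field, S.opU_eq hF, S.opB_eq, ← Finset.sum_add_distrib]
  refine Finset.sum_congr rfl fun κ _ => ?_
  simp only [pair, add_mul, avg]
  rw [integral_add]
  · exact (S.isGrowth_pairU (dir κ) hF).integrable_mul S.law (S.isGrowth_psi (dir κ) y)
  · exact (S.isGrowth_pairB X (dir κ) F.2).integrable_mul S.law (S.isGrowth_psi (dir κ) y)

theorem contDiff_opU (S : Setting Ω μ A η σ ν) {f : Space d → ℝ} (hf : Integrable f μ) :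
    ContDiff ℝ 2 (opU A η σ ν μ f) := by
  rw [funext fun y => S.opU_eq hf y]
  exact ContDiff.sum fun κ _ => (S.avg_spec (dir κ) (S.isGrowth_pairU (dir κ) hf)).1

theorem contDiff_opB (S : Setting Ω μ A η σ ν) (X : Fin M → Space d) (a : Fin M → ℝ) :
    ContDiff ℝ 2 (opB η σ ν X a) := by
  rw [funext fun y => S.opB_eq X a y]
  exact ContDiff.sum fun κ _ => (S.avg_spec (dir κ) (S.isGrowth_pairB X (dir κ) a)).1

theorem contDiff_field (S : Setting Ω μ A η σ ν) (X : Fin M → Space d)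
    {F : (Space d → ℝ) × (Fin M → ℝ)} (hF : Integrable F.1 μ) :
    ContDiff ℝ 2 (field A η σ ν μ X F) := (S.contDiff_opU hF).add (S.contDiff_opB X F.2)

theorem classical_field (S : Setting Ω μ A η σ ν) (X : Fin M → Space d)
    {F : (Space d → ℝ) × (Fin M → ℝ)} (hF : Integrable F.1 μ) (x : Space d) :
    A.classical (field A η σ ν μ X F) x =
      ∑ κ, ∫ θ, pair A η σ μ X (dir κ) F θ * A.classical (psi η σ (dir κ) θ) x ∂ν := by
  have e : field A η σ ν μ X F =
      fun y => ∑ κ, avg η σ ν (dir κ) (pair A η σ μ X (dir κ) F) y :=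
    funext fun y => S.field_eq X hF y
  rw [e, A.classical_sum _ fun κ => (S.avg_spec (dir κ) (S.isGrowth_pair X (dir κ) hF)).1]
  exact Finset.sum_congr rfl fun κ _ =>
    (S.avg_spec (dir κ) (S.isGrowth_pair X (dir κ) hF)).2 x

/-- The block operator is the pair of `𝒜` and the evaluations applied to `𝒰 f + ℬ a`. -/
theorem opV_eq (S : Setting Ω μ A η σ ν) (X : Fin M → Space d)
    {F : (Space d → ℝ) × (Fin M → ℝ)} (hF : Integrable F.1 μ) :
    opV A η σ ν μ X F =
      (A.classical (field A η σ ν μ X F), fun j => field A η σ ν μ X F (X j)) := by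
  refine Prod.ext (funext fun x => ?_) rfl
  have e : field A η σ ν μ X F = fun y => opU A η σ ν μ F.1 y + opB η σ ν X F.2 y := rfl
  simp only [opV, Pi.add_apply, opS]
  rw [e, A.classical_add (S.contDiff_opU hF) (S.contDiff_opB X F.2), S.opUBarStar_eq X F.2 x]
  congr 1
  rw [funext fun y => S.opB_eq X F.2 y, A.classical_sum _ fun κ =>
    (S.avg_spec (dir κ) (S.isGrowth_pairB X (dir κ) F.2)).1]
  exact Finset.sum_congr rfl fun κ _ =>
    ((S.avg_spec (dir κ) (S.isGrowth_pairB X (dir κ) F.2)).2 x).symm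

end Setting

end PINN

/-! ### Boundedness of `𝒜` on `𝓗²` and the equation for the residual -/

namespace PINN

variable {d : ℕ}

theorem eLpNorm_jetSum_le {μ : Measure (Space d)} {f : Space d → ℝ}
    {G : Fin d → Space d → ℝ} {H : Fin d → Fin d → Space d → ℝ} (hf : AEStronglyMeasurable f μ)
    (hG : ∀ i, AEStronglyMeasurable (G i) μ) (hH : ∀ i j, AEStronglyMeasurable (H i j) μ) :
    eLpNorm (jetSum f G H) 2 μ ≤
      eLpNorm f 2 μ + ∑ i, eLpNorm (G i) 2 μ + ∑ i, ∑ j, eLpNorm (H i j) 2 μ := by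
  have e : jetSum f G H = (fun x => |f x|) + (∑ i, fun x => |G i x|) + ∑ i, ∑ j, fun x => |H i j x| := by
    ext x; simp [jetSum]
  have m0 : AEStronglyMeasurable (fun x => |f x|) μ := hf.norm
  have m1 : ∀ i, AEStronglyMeasurable (fun x => |G i x|) μ := fun i => (hG i).norm
  have m2 : ∀ i j, AEStronglyMeasurable (fun x => |H i j x|) μ := fun i j => (hH i j).norm
  have s1 : AEStronglyMeasurable (∑ i, fun x => |G i x|) μ :=
    Finset.aestronglyMeasurable_sum _ fun i _ => m1 i
  have s2 : ∀ i, AEStronglyMeasurable (∑ j, fun x => |H i j x|) μ := fun i =>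
    Finset.aestronglyMeasurable_sum _ fun j _ => m2 i j
  have s3 : AEStronglyMeasurable (∑ i, ∑ j, fun x => |H i j x|) μ :=
    Finset.aestronglyMeasurable_sum _ fun i _ => s2 i
  have n : ∀ h : Space d → ℝ, eLpNorm (fun x => |h x|) 2 μ = eLpNorm h 2 μ := fun h => eLpNorm_norm h
  rw [e]
  refine (eLpNorm_add_le (m0.add s1) s3 (by norm_num)).trans (add_le_add
    ((eLpNorm_add_le m0 s1 (by norm_num)).trans (add_le_add (n f).le ?_)) ?_)
  · refine (eLpNorm_sum_le (fun i _ => m1 i) (by norm_num)).trans ?_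
    exact Finset.sum_le_sum fun i _ => (n _).le
  · refine (eLpNorm_sum_le (fun i _ => s2 i) (by norm_num)).trans ?_
    refine Finset.sum_le_sum fun i _ => (eLpNorm_sum_le (fun j _ => m2 i j) (by norm_num)).trans ?_
    exact Finset.sum_le_sum fun j _ => (n _).le

/-- The pointwise Lipschitz bound, compared with the zero function and integrated, makes `𝒜` bounded
from `𝓗²` to `L²(μ)`. Any representatives `G`, `H` of the weak derivatives are allowed. -/
theorem DiffOp.IsAdmissible.exists_eLpNorm_weak_le {A : DiffOp d} {Ω : Set (Space d)}
    {μ : Measure (Space d)}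
    (hA : A.IsAdmissible Ω μ) (hμ : Comparable μ (volume.restrict (interior Ω))) :
    ∃ k : ℝ≥0, ∀ f G H, IsH2 (interior Ω) f G H → eLpNorm (A.weak Ω f) 2 μ ≤
      k * (eLpNorm f 2 μ + ∑ i, eLpNorm (G i) 2 μ + ∑ i, ∑ j, eLpNorm (H i j) 2 μ) := by
  obtain ⟨k, hk, h⟩ := hA.abs_weak_le hμ
  refine ⟨k.toNNReal, fun f G H hf => ?_⟩
  refine (eLpNorm_le_mul_eLpNorm_of_ae_le_mul (g := jetSum f G H) (c := k) ?_ 2).trans ?_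
  · refine hμ.ac.ae_le ((h f G H hf).mono fun x hx => ?_)
    rwa [Real.norm_eq_abs, Real.norm_of_nonneg (by unfold jetSum; positivity)]
  · exact mul_le_mul_right (eLpNorm_jetSum_le (hμ.symm.memLp hf.1).1
      (fun i => (hμ.symm.memLp (hf.2 i)).1) fun i j => (hμ.symm.memLp (hf.3 i j)).1) _

theorem DiffOp.IsAdmissible.memLp_weak {A : DiffOp d} {Ω : Set (Space d)}
    {μ : Measure (Space d)} (hA : A.IsAdmissible Ω μ)
    (hμ : Comparable μ (volume.restrict (interior Ω))) {f : Space d → ℝ}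
    {G : Fin d → Space d → ℝ} {H : Fin d → Fin d → Space d → ℝ} (hf : IsH2 (interior Ω) f G H) :
    MemLp (A.weak Ω f) 2 μ := by
  obtain ⟨k, hk⟩ := hA.exists_eLpNorm_weak_le hμ
  refine ⟨?_, (hk f G H hf).trans_lt ?_⟩
  · have m0 := hA.meas₀.aestronglyMeasurable
    have m1 := fun i => (hA.meas₁ i).aestronglyMeasurable
    have m2 := fun i j => (hA.meas₂ i j).aestronglyMeasurable
    have h0 := (hμ.symm.memLp hf.1).1
    have h1 := fun i => (hμ.symm.memLp (hf.2 i)).1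
    have h2 := fun i j => (hμ.symm.memLp (hf.3 i j)).1
    refine AEStronglyMeasurable.congr ?_ (hμ.ac.ae_eq (A.weak_ae hf)).symm
    fun_prop
  · refine ENNReal.mul_lt_top ENNReal.coe_lt_top (ENNReal.add_lt_top.2 ⟨ENNReal.add_lt_top.2
      ⟨(hμ.symm.memLp hf.1).2, ?_⟩, ?_⟩)
    · exact ENNReal.sum_lt_top.2 fun i _ => (hμ.symm.memLp (hf.2 i)).2
    · exact ENNReal.sum_lt_top.2 fun i _ => ENNReal.sum_lt_top.2 fun j _ =>
        (hμ.symm.memLp (hf.3 i j)).2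

namespace Setting

variable {Ω : Set (Space d)} {μ : Measure (Space d)} {A : DiffOp d} {η : Space d → ℝ}
    {σ : ℝ → ℝ} {ν : Measure (Param d)} {M : ℕ}

theorem memLp_residual (S : Setting Ω μ A η σ ν) {X : Fin M → Space d} {g u q : Space d → ℝ}
    (hu : IsSolution A Ω μ g u) (hq : MemH2Zero Ω μ q) :
    MemLp (residual A Ω X g u q).1 2 μ := by
  have h1 := S.adm.memLp_weak S.comparable (hq.1.isH2 S.comparable)
  have h2 := S.adm.memLp_weak S.comparable (hu.1.1.isH2 S.comparable)
  exact h1.sub ((memLp_congr_ae hu.2).1 h2)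

theorem integrable_residual (S : Setting Ω μ A η σ ν) {X : Fin M → Space d} {g u q : Space d → ℝ}
    (hu : IsSolution A Ω μ g u) (hq : MemH2Zero Ω μ q) :
    Integrable (residual A Ω X g u q).1 μ := by
  have := S.finite
  exact (S.memLp_residual hu hq).integrable (by norm_num)

theorem limitField_eq (X : Fin M → Space d) (g u q : Space d → ℝ) :
    limitField A Ω η σ ν μ X g u q = fun y => - field A η σ ν μ X (residual A Ω X g u q) y := by
  funext y
  simp only [limitField, field]; ring

/-- The residual of a solution of the wide-limit equation satisfies `dF/dt = -𝒱 F`. -/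
theorem hasL2Deriv_residual (S : Setting Ω μ A η σ ν) {X : Fin M → Space d}
    (hX : ∀ i, X i ∈ interior Ω) {g u : Space d → ℝ}
    (hu : IsSolution A Ω μ g u) {Q : ℝ → Space d → ℝ} (hQ : IsWideLimit A Ω η σ ν μ X g u Q)
    {t : ℝ} (ht : 0 ≤ t) :
    HasL2Deriv μ (fun s => residual A Ω X g u (Q s))
      (- opV A η σ ν μ X (residual A Ω X g u (Q t))) t := by
  have hint := S.integrable_residual (X := X) hu (hQ.mem t ht)
  have hV := S.opV_eq X hint
  set N := field A η σ ν μ X (residual A Ω X g u (Q t)) with hN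
  have hNc : ContDiff ℝ 2 N := S.contDiff_field X hint
  have hl : limitField A Ω η σ ν μ X g u (Q t) = fun y => - N y := limitField_eq X g u (Q t)
  rw [hV]
  constructor
  -- `𝒜` is linear and bounded, so the error of the difference quotient of the residual in `L²(μ)`
  -- is at most `k` times the error of that of `Q` in `𝓗²`. The constant `g` cancels in differences.
  · obtain ⟨k, hk⟩ := S.adm.exists_eLpNorm_weak_le S.comparable
    have h0 := ENNReal.Tendsto.const_mul (a := (k : ℝ≥0∞)) (hQ.deriv_h2 t ht)
      (Or.inr ENNReal.coe_ne_top)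
    rw [mul_zero] at h0
    refine tendsto_of_tendsto_of_tendsto_of_le_of_le' tendsto_const_nhds h0
      (Eventually.of_forall fun _ => zero_le) ?_
    filter_upwards [self_mem_nhdsWithin] with s hs
    have hs0 : 0 ≤ s := hs.1
    have hs := (hQ.mem s hs0).1.isH2 S.comparable
    have ht' := (hQ.mem t ht).1.isH2 S.comparable
    have hsm := (hs.sub ht').const_smul (s - t)⁻¹
    have hneg : ContDiff ℝ 2 fun y => -N y := hNc.neg
    have hf := IsH2.of_contDiff S.compact hneg
    have hd := hsm.sub hf
    -- The right-hand side of the equation is of class `C²`, so the error lies in `𝓗²` and `h2Norm`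
    -- takes its finite branch.
    rw [hl, h2Norm, if_pos (hd.memH2 S.comparable)]
    have hd' := (hd.memH2 S.comparable).isH2 S.comparable
    refine le_trans (le_of_eq (eLpNorm_congr_ae ?_)) (hk _ _ _ hd')
    have e3 := A.weak_sub hsm hf
    have e4 := A.weak_const_smul (s - t)⁻¹ (hs.sub ht')
    have e5 := A.weak_sub hs ht'
    have e6 := A.weak_ae_classical S.compact hneg
    have e7 : A.classical (fun y => -N y) = fun x => - A.classical N x := by
      funext x
      have := A.classical_const_mul hNc (-1) x
      simpa using this
    refine S.comparable.ac.ae_le ?_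
    filter_upwards [e3, e4, e5, e6] with x e3 e4 e5 e6
    simp only [Pi.sub_apply, Pi.smul_apply, smul_eq_mul] at e3 e4 e5 ⊢
    rw [e3, e4, e5, e6, e7]
    simp [residual]
  · refine hasDerivWithinAt_pi.2 fun j => ?_
    have h1 := hQ.deriv_pointwise t ht (X j) (interior_subset (hX j))
    rw [hl] at h1
    exact h1.sub_const _

end Setting

end PINN

/-! ### Semidefinite linear flows and the null vectors of `𝒱` -/

namespace PINN

section Flow

variable {H : Type*} [NormedAddCommGroup H] [InnerProductSpace ℝ H]

open scoped RealInnerProductSpace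

/-- The derivative of `‖F‖²` is `-2⟪V F, F⟫ ≤ 0`. -/
theorem norm_le_of_flow {V : H →L[ℝ] H} (hpos : ∀ x, 0 ≤ ⟪V x, x⟫) {F : ℝ → H}
    (hF : ∀ t, 0 ≤ t → HasDerivWithinAt F (-V (F t)) (Ici 0) t) {s t : ℝ} (hs : 0 ≤ s)
    (hst : s ≤ t) : ‖F t‖ ≤ ‖F s‖ := by
  have hd : ∀ t, 0 ≤ t → HasDerivWithinAt (fun t => ‖F t‖ ^ 2) (2 * ⟪F t, -V (F t)⟫) (Ici 0) t :=
    fun t ht => (hF t ht).norm_sq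
  have hanti : AntitoneOn (fun t => ‖F t‖ ^ 2) (Ici 0) := by
    refine antitoneOn_of_hasDerivWithinAt_nonpos (convex_Ici 0)
      (fun t ht => (hd t ht).continuousWithinAt)
      (fun t ht => (hd t (interior_subset ht)).mono interior_subset) (fun t _ => ?_)
    rw [inner_neg_right, real_inner_comm]
    linarith [hpos (F t)]
  have := hanti hs (hs.trans hst : (0 : ℝ) ≤ t) hst
  exact (sq_le_sq₀ (norm_nonneg _) (norm_nonneg _)).1 this

/-- The form `⟪V z, z⟫` decreases at rate `2‖V z‖²`, and `‖V z‖` is itself nonincreasing because `V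
z` solves the same equation. Up to time `T` the form therefore loses at least `2T ‖V z(T)‖²`. As it
stays nonnegative, `‖V z(T)‖² ≤ ⟪V z(0), z(0)⟫ / (2T)`. No spectral theorem is needed. -/
theorem tendsto_apply_flow {V : H →L[ℝ] H} (hsym : ∀ x y, ⟪V x, y⟫ = ⟪x, V y⟫)
    (hpos : ∀ x, 0 ≤ ⟪V x, x⟫) {z : ℝ → H}
    (hz : ∀ t, 0 ≤ t → HasDerivWithinAt z (-V (z t)) (Ici 0) t) :
    Tendsto (fun t => V (z t)) atTop (𝓝 0) := by
  have hVz : ∀ t, 0 ≤ t → HasDerivWithinAt (fun t => V (z t)) (-V (V (z t))) (Ici 0) t :=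
    fun t ht => by
      have := V.hasFDerivAt.comp_hasDerivWithinAt t (hz t ht)
      simpa [Function.comp_def] using this
  have key : ∀ T, 0 < T → ‖V (z T)‖ ^ 2 ≤ ⟪V (z 0), z 0⟫ / 2 * T⁻¹ := by
    intro T hT
    have hd : ∀ t, 0 ≤ t → HasDerivWithinAt (fun t => ⟪V (z t), z t⟫ + t * (2 * ‖V (z T)‖ ^ 2))
        (⟪V (z t), -V (z t)⟫ + ⟪-V (V (z t)), z t⟫ + 1 * (2 * ‖V (z T)‖ ^ 2)) (Ici 0) t :=
      fun t ht => ((hVz t ht).inner ℝ (hz t ht)).add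
        ((hasDerivWithinAt_id t _).mul_const (2 * ‖V (z T)‖ ^ 2))
    have hanti : AntitoneOn (fun t => ⟪V (z t), z t⟫ + t * (2 * ‖V (z T)‖ ^ 2)) (Icc 0 T) := by
      refine antitoneOn_of_hasDerivWithinAt_nonpos (convex_Icc 0 T)
        (fun t ht => ((hd t ht.1).continuousWithinAt).mono Icc_subset_Ici_self)
        (fun t ht => (hd t (interior_subset ht).1).mono
          (interior_subset.trans Icc_subset_Ici_self)) (fun t ht => ?_)
      have ht' := interior_subset ht
      have hle := norm_le_of_flow hpos hVz ht'.1 ht'.2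
      have hle2 : ‖V (z T)‖ ^ 2 ≤ ‖V (z t)‖ ^ 2 := by gcongr
      rw [inner_neg_left, hsym (V (z t)), inner_neg_right, real_inner_self_eq_norm_sq]
      linarith
    have h := hanti (left_mem_Icc.2 hT.le) (right_mem_Icc.2 hT.le) hT.le
    simp only [zero_mul, add_zero] at h
    rw [← div_eq_mul_inv, le_div_iff₀ hT]
    linarith [hpos (z T)]
  have h2 : Tendsto (fun t => ‖V (z t)‖ ^ 2) atTop (𝓝 0) := by
    have h3 : Tendsto (fun T : ℝ => ⟪V (z 0), z 0⟫ / 2 * T⁻¹) atTop (𝓝 0) := by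
      simpa using tendsto_inv_atTop_zero.const_mul (⟪V (z 0), z 0⟫ / 2)
    exact squeeze_zero' (Eventually.of_forall fun _ => by positivity)
      ((eventually_gt_atTop 0).mono key) h3
  have h4 := h2.sqrt
  simp only [Real.sqrt_sq (norm_nonneg _), Real.sqrt_zero] at h4
  exact tendsto_zero_iff_norm_tendsto_zero.2 h4

/-- The flow of `F' = -V F` for a positive semidefinite `V` tends to zero if it starts in the
orthogonal complement of the kernel of `V`. -/
theorem tendsto_zero_of_flow [CompleteSpace H] {V : H →L[ℝ] H} (hsym : ∀ x y, ⟪V x, y⟫ = ⟪x, V y⟫)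
    (hpos : ∀ x, 0 ≤ ⟪V x, x⟫) {F : ℝ → H}
    (hF : ∀ t, 0 ≤ t → HasDerivWithinAt F (-V (F t)) (Ici 0) t)
    (hker : ∀ z, ⟪V z, z⟫ = 0 → ⟪F 0, z⟫ = 0) : Tendsto F atTop (𝓝 0) := by
  -- A vector `z` orthogonal to the range satisfies `⟪V z, z⟫ = 0`, so `F 0` is orthogonal to it.
  -- Thus `F 0` lies in the double orthogonal complement of the range, which is its closure.
  have hcl : F 0 ∈ closure (range V) := by
    set K := LinearMap.range V.toLinearMap
    have h1 : F 0 ∈ Kᗮᗮ := by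
      rw [Submodule.mem_orthogonal]
      intro z hz
      rw [real_inner_comm]
      exact hker z ((Submodule.mem_orthogonal K z).1 hz _ ⟨z, rfl⟩)
    rw [Submodule.orthogonal_orthogonal_eq_closure] at h1
    exact h1
  rw [Metric.tendsto_atTop]
  intro ε hε
  obtain ⟨y, ⟨z0, rfl⟩, hy⟩ := Metric.mem_closure_iff.1 hcl (ε / 2) (by positivity)
  -- Let `z` be the flow started at `z0`. Then `V z` solves the same equation, tends to zero, and
  -- starts within `ε / 2` of `F 0`; the difference of the two solutions never grows.
  set z : ℝ → H := fun t => NormedSpace.exp (t • (-V)) z0 with hzdef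
  have hz : ∀ t, HasDerivAt z (-V (z t)) t := fun t => by
    have h1 := hasDerivAt_exp_smul_const' (𝕂 := ℝ) (-V) t
    have h2 := h1.clm_apply (hasDerivAt_const t z0)
    simpa [hzdef] using h2
  have hz0 : z 0 = z0 := by simp [hzdef]
  have hVz := tendsto_apply_flow hsym hpos fun t _ => (hz t).hasDerivWithinAt
  obtain ⟨N, hN⟩ := Metric.tendsto_atTop.1 hVz (ε / 2) (by positivity)
  refine ⟨max N 0, fun t ht => ?_⟩
  have hD : ∀ t, 0 ≤ t → HasDerivWithinAt (fun t => F t - V (z t)) (-V (F t - V (z t))) (Ici 0) t :=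
    fun t ht => by
      have h3 := V.hasFDerivAt.comp_hasDerivWithinAt t ((hz t).hasDerivWithinAt (s := Ici 0))
      have h4 := (hF t ht).sub h3
      refine HasDerivWithinAt.congr_deriv (f' := -V (F t) - V (-V (z t))) h4 ?_
      simp only [map_sub, map_neg]
      abel
  have h1 := norm_le_of_flow hpos hD le_rfl ((le_max_right _ _).trans ht)
  rw [hz0] at h1
  rw [dist_eq_norm] at hy
  have h2 := hN t ((le_max_left _ _).trans ht)
  rw [dist_zero_right] at h2 ⊢
  calc ‖F t‖ = ‖(F t - V (z t)) + V (z t)‖ := by rw [sub_add_cancel]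
    _ ≤ ‖F t - V (z t)‖ + ‖V (z t)‖ := norm_add_le _ _
    _ < ε := by linarith

end Flow

variable {d : ℕ}

/-- The functional `q ↦ ⟨f, 𝒜 q⟩ + (1/M) ∑_i a_i q(x_i)`. -/
noncomputable def testFun {M : ℕ} (A : DiffOp d) (μ : Measure (Space d)) (X : Fin M → Space d)
    (F : (Space d → ℝ) × (Fin M → ℝ)) (q : Space d → ℝ) : ℝ :=
  ∫ x, F.1 x * A.classical q x ∂μ + (M : ℝ)⁻¹ * ∑ i, F.2 i * q (X i)

/-- In the direction of the output weight the factor `c` disappears. This component of the gradient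
sees every ridge function, whatever the values of `c`. -/
theorem psi_dir_none (η : Space d → ℝ) (σ : ℝ → ℝ) (θ : Param d) :
    psi η σ (dir none) θ = ridge η σ θ.2.1 θ.2.2 := by
  funext y; simp [psi, dir, affine, ridge]

theorem continuous_ridge_param {ζ : Space d → ℝ} {s : ℝ → ℝ} (hζ : Continuous ζ)
    (hs : Continuous s) (x : Space d) :
    Continuous fun p : Space d × ℝ => ridge ζ s p.1 p.2 x := by
  have c : Continuous fun p : Space d × ℝ => (p, x) := by fun_prop
  have h := (continuous_ridge_uncurry hζ hs).comp c
  simp only [Function.comp_def] at h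
  exact h

theorem continuous_pderiv_ridge_param {ζ : Space d → ℝ} {s : ℝ → ℝ} (hζ : ContDiff ℝ 2 ζ)
    (hs : ContDiff ℝ 2 s) (x : Space d) (i : Fin d) :
    Continuous fun p : Space d × ℝ => pderiv i (ridge ζ s p.1 p.2) x := by
  have c : Continuous fun p : Space d × ℝ => (p, x) := by fun_prop
  have h := (continuous_pderiv_ridge_uncurry hζ hs i).comp c
  simp only [Function.comp_def] at h
  exact h

theorem continuous_pderiv₂_ridge_param {ζ : Space d → ℝ} {s : ℝ → ℝ} (hζ : ContDiff ℝ 2 ζ)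
    (hs : ContDiff ℝ 2 s) (x : Space d) (i j : Fin d) :
    Continuous fun p : Space d × ℝ => pderiv i (pderiv j (ridge ζ s p.1 p.2)) x := by
  have c : Continuous fun p : Space d × ℝ => (p, x) := by fun_prop
  have h := (continuous_pderiv₂_ridge_uncurry hζ hs i j).comp c
  simp only [Function.comp_def] at h
  exact h

namespace Setting

variable {Ω : Set (Space d)} {μ : Measure (Space d)} {A : DiffOp d} {η : Space d → ℝ}
    {σ : ℝ → ℝ} {ν : Measure (Param d)} {M : ℕ}

/-- Fubini turns the bilinear form of `𝒱` into a sum of `L²(ν)` inner products of the pairings of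
`F` and `G`. Symmetry, semidefiniteness and the description of the null vectors are all read off
from it. -/
theorem pairing_field (S : Setting Ω μ A η σ ν) (X : Fin M → Space d)
    {F G : (Space d → ℝ) × (Fin M → ℝ)} (hF : Integrable F.1 μ) (hG : Integrable G.1 μ) :
    testFun A μ X G (field A η σ ν μ X F) =
      ∑ κ, ∫ θ, pair A η σ μ X (dir κ) F θ * pair A η σ μ X (dir κ) G θ ∂ν := by
  have := S.finite
  have := S.law.prob
  have hP := fun κ => S.isGrowth_pair X (dir κ) hF
  have hU := fun κ => S.isGrowth_pairU (dir κ) hG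
  have hB := fun κ => S.isGrowth_pairB X (dir κ) G.2
  have hint := fun κ => S.integrable_mul_classical_psi (dir κ) hG (hP κ)
  have e1 : ∫ x, G.1 x * A.classical (field A η σ ν μ X F) x ∂μ =
      ∑ κ, ∫ θ, pair A η σ μ X (dir κ) F θ * pairU A η σ μ (dir κ) G.1 θ ∂ν := by
    simp only [S.classical_field X hF, Finset.mul_sum]
    have e : ∀ κ x, G.1 x * ∫ θ, pair A η σ μ X (dir κ) F θ * A.classical (psi η σ (dir κ) θ) x ∂ν =
        ∫ θ, pair A η σ μ X (dir κ) F θ * (G.1 x * A.classical (psi η σ (dir κ) θ) x) ∂ν := by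
      intro κ x
      rw [← integral_const_mul]
      exact integral_congr_ae (Eventually.of_forall fun θ => by ring)
    simp only [e]
    rw [integral_finsetSum _ fun κ _ => (hint κ).integral_prod_right]
    refine Finset.sum_congr rfl fun κ _ => ?_
    rw [← integral_integral_swap (f := fun θ x =>
      pair A η σ μ X (dir κ) F θ * (G.1 x * A.classical (psi η σ (dir κ) θ) x)) (hint κ)]
    simp only [integral_const_mul]
    rfl
  have e2 : (M : ℝ)⁻¹ * ∑ i, G.2 i * field A η σ ν μ X F (X i) =
      ∑ κ, ∫ θ, pair A η σ μ X (dir κ) F θ * pairB η σ X (dir κ) G.2 θ ∂ν := by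
    simp only [S.field_eq X hF, Finset.mul_sum, pairB]
    rw [Finset.sum_comm]
    refine Finset.sum_congr rfl fun κ _ => ?_
    have hi := fun i => (hP κ).integrable_mul S.law (S.isGrowth_psi (dir κ) (X i))
    rw [integral_finsetSum]
    · refine Finset.sum_congr rfl fun i _ => ?_
      rw [← integral_const_mul, ← integral_const_mul]
      exact integral_congr_ae (Eventually.of_forall fun θ => by ring)
    · intro i _
      refine ((hi i).const_mul ((M : ℝ)⁻¹ * G.2 i)).congr (Eventually.of_forall fun θ => ?_)
      simp only; ring
  rw [testFun, e1, e2, ← Finset.sum_add_distrib]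
  refine Finset.sum_congr rfl fun κ _ => ?_
  rw [← integral_add ((hP κ).integrable_mul S.law (hU κ)) ((hP κ).integrable_mul S.law (hB κ))]
  exact integral_congr_ae (Eventually.of_forall fun θ => by simp only [pair]; ring)

/-- If the quadratic form of `𝒱` vanishes at `F`, then `F` annihilates all `η σ(w · x + b)`. -/
theorem testFun_ridge_eq_zero (S : Setting Ω μ A η σ ν) (X : Fin M → Space d)
    {F : (Space d → ℝ) × (Fin M → ℝ)} (hF : Integrable F.1 μ)
    (h : testFun A μ X F (field A η σ ν μ X F) = 0) (w : Space d) (b : ℝ) :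
    testFun A μ X F (ridge η σ w b) = 0 := by
  have := S.finite
  have := S.law.prob
  have hP := fun κ => S.isGrowth_pair X (dir κ) hF
  rw [S.pairing_field X hF hF, Finset.sum_eq_zero_iff_of_nonneg fun κ _ =>
    integral_nonneg fun θ => mul_self_nonneg _] at h
  -- A sum of integrals of squares vanishes, so each integrand does; only the direction of `c` is
  -- needed.
  have h0 := h none (Finset.mem_univ _)
  rw [integral_eq_zero_iff_of_nonneg (fun θ => mul_self_nonneg _)
    ((hP none).integrable_mul S.law (hP none))] at h0
  have hae : ∀ᵐ θ ∂ν, testFun A μ X F (ridge η σ θ.2.1 θ.2.2) = 0 := by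
    filter_upwards [h0] with θ hθ
    have := mul_self_eq_zero.1 hθ
    simpa only [testFun, pair, pairU, pairB, psi_dir_none] using this
  have hη := S.aux₂
  have hσ2 : ContDiff ℝ 2 σ := S.act.1.of_le (by norm_num)
  have hcont : Continuous fun p : Space d × ℝ => testFun A μ X F (ridge η σ p.1 p.2) := by
    have c0 := continuous_ridge_param hη.continuous hσ2.continuous
    refine Continuous.add ?_ (continuous_const.mul (continuous_finsetSum _ fun i _ =>
      continuous_const.mul (c0 (X i))))
    obtain ⟨C, hC0, hC⟩ := S.adm.abs_classical_le S.compact S.comparable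
    obtain ⟨Cs, hCs⟩ := S.act.exists_bound
    have hs : ∀ j, deriv (iteratedDeriv j σ) = iteratedDeriv (j + 1) σ :=
      fun j => iteratedDeriv_succ.symm
    have e2 : deriv σ = iteratedDeriv 1 σ := iteratedDeriv_one.symm
    have hCs0 : 0 ≤ Cs := (abs_nonneg _).trans (hCs 0 (by norm_num) 0)
    have b1 := fun w b x => jetAbs_ridge_le (Cs := Cs) hη hσ2 (by simpa using hCs 0 (by norm_num))
      (by rw [e2]; exact hCs 1 (by norm_num)) (by rw [e2, hs]; exact hCs 2 (by norm_num)) w b x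
    obtain ⟨B, hB0, hB⟩ := exists_bound_of_isCompact S.compact (continuous_jetAbs hη)
    refine continuous_iff_continuousAt.2 fun p => ?_
    set D := C * ((1 + d + d * d) * (B * Cs * (4 * (1 + (‖p.1‖ + 1)) ^ 2)))
    refine continuousAt_of_dominated (bound := fun x => |F.1 x| * D) (Eventually.of_forall fun p =>
      hF.1.mul (S.aestronglyMeasurable_classical (contDiff_ridge hη hσ2 _ _))) ?_
      (hF.abs.mul_const _) (Eventually.of_forall fun x => ?_)
    · filter_upwards [Metric.ball_mem_nhds p one_pos] with p' hp'
      have hn : ‖p'.1‖ ≤ ‖p.1‖ + 1 := by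
        have h1 := norm_le_norm_add_norm_sub' p'.1 p.1
        have h2 : ‖p'.1 - p.1‖ ≤ dist p' p := by
          rw [dist_eq_norm]; exact norm_fst_le (p' - p)
        rw [Metric.mem_ball] at hp'
        linarith
      filter_upwards [hC] with x hx
      rw [Real.norm_eq_abs, abs_mul]
      gcongr
      refine (hx.2 _ (contDiff_ridge hη hσ2 _ _)).trans ?_
      refine mul_le_mul_of_nonneg_left ((b1 p'.1 p'.2 x).trans ?_) hC0
      have := (le_abs_self _).trans (hB x (interior_subset hx.1))
      have := jetAbs_nonneg η x
      gcongr
    · refine Continuous.continuousAt (continuous_const.mul ?_)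
      unfold DiffOp.classical
      have c0 := c0 x
      have c1 := continuous_pderiv_ridge_param hη hσ2 x
      have c2 := continuous_pderiv₂_ridge_param hη hσ2 x
      fun_prop
  -- A nonzero value at `(w, b)` would persist on an open set of parameters, which has positive
  -- mass, against the almost sure vanishing.
  by_contra hne
  have hopen : IsOpen {p : Space d × ℝ | testFun A μ X F (ridge η σ p.1 p.2) ≠ 0} :=
    isOpen_ne_fun hcont continuous_const
  have := S.law.full_support _ hopen ⟨(w, b), hne⟩
  exact this.ne' (ae_iff.1 hae)

end Setting

end PINN

/-! ### `𝒱` as a bounded symmetric operator on a Hilbert space -/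

namespace PINN

variable {d M : ℕ}

/-- The Hilbert space `L²(μ) × ℝ^M`. -/
abbrev PairSpace (μ : Measure (Space d)) (M : ℕ) :=
  WithLp 2 (Lp ℝ 2 μ × EuclideanSpace ℝ (Fin M))

/-- The inner product of `L²(μ) × L²(μ_𝐱)`. -/
noncomputable def couple (μ : Measure (Space d)) (F G : (Space d → ℝ) × (Fin M → ℝ)) : ℝ :=
  ∫ x, F.1 x * G.1 x ∂μ + (M : ℝ)⁻¹ * ∑ i, F.2 i * G.2 i

open Classical in
/-- The element of the Hilbert space represented by a pair `(f, a)`, where `ℝ^M` is identified with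
`L²(μ_𝐱)`. -/
noncomputable def emb (μ : Measure (Space d)) (F : (Space d → ℝ) × (Fin M → ℝ)) : PairSpace μ M :=
  WithLp.toLp 2 (if h : MemLp F.1 2 μ then h.toLp else 0, WithLp.toLp 2 fun i => (√M)⁻¹ * F.2 i)

/-- The pair `(f, a)` represented by an element of the Hilbert space. -/
noncomputable def rep {μ : Measure (Space d)} (z : PairSpace μ M) : (Space d → ℝ) × (Fin M → ℝ) :=
  (z.fst, fun i => √M * z.snd i)

variable {μ : Measure (Space d)}

theorem emb_of_memLp {F : (Space d → ℝ) × (Fin M → ℝ)} (hF : MemLp F.1 2 μ) :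
    emb μ F = WithLp.toLp 2 (hF.toLp, WithLp.toLp 2 fun i => (√M)⁻¹ * F.2 i) := by
  rw [emb, dif_pos hF]

theorem memLp_rep (z : PairSpace μ M) : MemLp (rep z).1 2 μ := Lp.memLp z.fst

theorem sqrt_natCast_pos (i : Fin M) : 0 < √(M : ℝ) :=
  Real.sqrt_pos.2 (by exact_mod_cast i.pos)

theorem rep_emb {F : (Space d → ℝ) × (Fin M → ℝ)} (hF : MemLp F.1 2 μ) :
    (rep (emb μ F)).1 =ᵐ[μ] F.1 ∧ (rep (emb μ F)).2 = F.2 := by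
  rw [emb_of_memLp hF]
  refine ⟨hF.coeFn_toLp, funext fun i => ?_⟩
  have := (sqrt_natCast_pos i).ne'
  change √(M : ℝ) * ((√M)⁻¹ * F.2 i) = F.2 i
  rw [mul_inv_cancel_left₀ this]

/-- The factors `(√M)⁻¹` in `emb` and `√M` in `rep` transport the weight `1/M` of `L²(μ_𝐱)` to the
Euclidean product of `ℝ^M`: their quotient is `1/M`. -/
theorem inner_emb {F : (Space d → ℝ) × (Fin M → ℝ)} (hF : MemLp F.1 2 μ) (z : PairSpace μ M) :
    inner ℝ (emb μ F) z = couple μ (rep z) F := by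
  rw [emb_of_memLp hF, WithLp.prod_inner_apply, couple]
  congr 1
  · rw [L2.inner_def]
    refine integral_congr_ae ?_
    filter_upwards [hF.coeFn_toLp] with x hx
    change inner ℝ (hF.toLp F.1 x) (z.fst x) = z.fst x * F.1 x
    rw [hx]; rfl
  · rw [PiLp.inner_apply, Finset.mul_sum]
    refine Finset.sum_congr rfl fun i _ => ?_
    have h1 := (sqrt_natCast_pos i).ne'
    have h2 : (M : ℝ) = √M * √M := (Real.mul_self_sqrt (Nat.cast_nonneg _)).symm
    have h3 : (M : ℝ)⁻¹ * √M = (√M)⁻¹ := by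
      nth_rewrite 1 [h2]
      field_simp
    change z.snd i * ((√M)⁻¹ * F.2 i) = (M : ℝ)⁻¹ * (√M * z.snd i * F.2 i)
    rw [← h3]
    ring

theorem norm_emb_sq {F : (Space d → ℝ) × (Fin M → ℝ)} (hF : MemLp F.1 2 μ) :
    ‖emb μ F‖ ^ 2 = (eLpNorm F.1 2 μ).toReal ^ 2 + (M : ℝ)⁻¹ * ∑ i, F.2 i ^ 2 := by
  rw [emb_of_memLp hF, WithLp.prod_norm_sq_eq_of_L2]
  congr 1
  · change ‖hF.toLp F.1‖ ^ 2 = _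
    rw [Lp.norm_toLp]
  · rw [EuclideanSpace.norm_sq_eq, Finset.mul_sum]
    refine Finset.sum_congr rfl fun i _ => ?_
    simp [mul_pow]

theorem eLpNorm_obsMeasure_sq (X : Fin M → Space d) (q : Space d → ℝ) :
    eLpNorm q 2 (obsMeasure X) ^ 2 = ENNReal.ofReal ((M : ℝ)⁻¹ * ∑ i, q (X i) ^ 2) := by
  -- Without observations the measure is `⊤ • 0 = 0` and the real inverse of `0` is `0`, so both
  -- sides vanish.
  rcases Nat.eq_zero_or_pos M with rfl | hM
  · simp [obsMeasure]
  have hM' : (0 : ℝ) < M := by exact_mod_cast hM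
  rw [eLpNorm_eq_lintegral_rpow_enorm_toReal (by norm_num) (by norm_num), ← ENNReal.rpow_natCast,
    ← ENNReal.rpow_mul, obsMeasure, lintegral_smul_measure, lintegral_finsetSum_measure]
  simp only [lintegral_dirac]
  rw [ENNReal.ofReal_mul (by positivity), ENNReal.ofReal_inv_of_pos hM', ENNReal.ofReal_natCast,
    ENNReal.ofReal_sum_of_nonneg fun _ _ => sq_nonneg _]
  norm_num
  refine congrArg _ (Finset.sum_congr rfl fun i _ => ?_)
  rw [← sq_abs, ENNReal.ofReal_pow (abs_nonneg _), ← Real.norm_eq_abs, ofReal_norm]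

/-- The distance in `Lp` between the classes of two functions is the `L²` norm of their difference.
So the first half of `HasL2Deriv` is convergence of slopes in `Lp`; the second half is transported
coordinatewise. -/
theorem hasDerivWithinAt_emb {F : ℝ → (Space d → ℝ) × (Fin M → ℝ)}
    {F' : (Space d → ℝ) × (Fin M → ℝ)} {t : ℝ} (ht : 0 ≤ t) (hF : ∀ t, 0 ≤ t → MemLp (F t).1 2 μ)
    (hF' : MemLp F'.1 2 μ) (h : HasL2Deriv μ F F' t) :
    HasDerivWithinAt (fun s => emb μ (F s)) (emb μ F') (Ici 0) t := by
  have h1 : HasDerivWithinAt (fun s => (emb μ (F s)).fst) (hF'.toLp) (Ici 0) t := by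
    rw [hasDerivWithinAt_iff_tendsto_slope, tendsto_iff_edist_tendsto_0]
    refine h.1.congr' ?_
    filter_upwards [self_mem_nhdsWithin] with s hs
    have hs0 : 0 ≤ s := hs.1
    rw [slope_def_module, emb_of_memLp (hF s hs0), emb_of_memLp (hF t ht)]
    change _ = edist ((s - t)⁻¹ • ((hF s hs0).toLp - (hF t ht).toLp)) hF'.toLp
    rw [← MemLp.toLp_sub, ← MemLp.toLp_const_smul, Lp.edist_toLp_toLp]
  have h2 : HasDerivWithinAt (fun s => WithLp.toLp 2 fun i => (√M)⁻¹ * (F s).2 i)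
      (WithLp.toLp 2 fun i => (√M)⁻¹ * F'.2 i : EuclideanSpace ℝ (Fin M)) (Ici 0) t := by
    have h3 : HasDerivWithinAt (fun s => fun i => (√M)⁻¹ * (F s).2 i) (fun i => (√M)⁻¹ * F'.2 i)
        (Ici 0) t := hasDerivWithinAt_pi.2 fun i => (hasDerivWithinAt_pi.1 h.2 i).const_mul _
    exact ((EuclideanSpace.equiv (Fin M) ℝ).symm.toContinuousLinearMap.hasFDerivAt
      (x := fun i => (√M)⁻¹ * (F t).2 i)).comp_hasDerivWithinAt t h3
  have h4 := ((WithLp.prodContinuousLinearEquiv 2 ℝ (Lp ℝ 2 μ)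
    (EuclideanSpace ℝ (Fin M))).symm.toContinuousLinearMap.hasFDerivAt
      (x := ((emb μ (F t)).fst, WithLp.toLp 2 fun i => (√M)⁻¹ * (F t).2 i))).comp_hasDerivWithinAt
        t (h1.prodMk h2)
  rw [emb_of_memLp hF']
  exact h4

theorem couple_congr {F F' G G' : (Space d → ℝ) × (Fin M → ℝ)} (h1 : F.1 =ᵐ[μ] F'.1)
    (h2 : F.2 = F'.2) (h3 : G.1 =ᵐ[μ] G'.1) (h4 : G.2 = G'.2) : couple μ F G = couple μ F' G' := by
  rw [couple, couple, h2, h4]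
  congr 1
  refine integral_congr_ae ?_
  filter_upwards [h1, h3] with x e1 e3
  rw [e1, e3]

theorem couple_add_left {F F' G : (Space d → ℝ) × (Fin M → ℝ)} (h1 : MemLp F.1 2 μ)
    (h2 : MemLp F'.1 2 μ) (h3 : MemLp G.1 2 μ) :
    couple μ (F + F') G = couple μ F G + couple μ F' G := by
  simp only [couple, Prod.fst_add, Prod.snd_add, Pi.add_apply, add_mul, Finset.sum_add_distrib]
  have e := integral_add (h1.integrable_mul h3) (h2.integrable_mul h3)
  simp only [Pi.mul_apply] at e
  rw [e]
  ring

theorem couple_smul_left (c : ℝ) (F G : (Space d → ℝ) × (Fin M → ℝ)) :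
    couple μ (c • F) G = c * couple μ F G := by
  simp only [couple, Prod.smul_fst, Prod.smul_snd, Pi.smul_apply, smul_eq_mul, mul_assoc,
    integral_const_mul, ← Finset.mul_sum]
  ring

theorem couple_comm (F G : (Space d → ℝ) × (Fin M → ℝ)) : couple μ F G = couple μ G F := by
  simp only [couple, mul_comm]

theorem rep_add (z w : PairSpace μ M) :
    (rep (z + w)).1 =ᵐ[μ] (rep z + rep w).1 ∧ (rep (z + w)).2 = (rep z + rep w).2 :=
  ⟨Lp.coeFn_add _ _, funext fun _ => mul_add _ _ _⟩

theorem rep_smul (c : ℝ) (z : PairSpace μ M) :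
    (rep (c • z)).1 =ᵐ[μ] (c • rep z).1 ∧ (rep (c • z)).2 = (c • rep z).2 :=
  ⟨Lp.coeFn_smul _ _, funext fun _ => mul_left_comm _ _ _⟩

theorem opU_congr {A : DiffOp d} {η : Space d → ℝ} {σ : ℝ → ℝ} {ν : Measure (Param d)}
    {f f' : Space d → ℝ} (h : f =ᵐ[μ] f') : opU A η σ ν μ f = opU A η σ ν μ f' :=
  funext fun _ => integral_congr_ae (h.mono fun x hx => by simp only [hx])

namespace Setting

variable {Ω : Set (Space d)} {A : DiffOp d} {η : Space d → ℝ}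
    {σ : ℝ → ℝ} {ν : Measure (Param d)}

theorem memLp_classical (S : Setting Ω μ A η σ ν) {q : Space d → ℝ} (hq : ContDiff ℝ 2 q) :
    MemLp (A.classical q) 2 μ :=
  (memLp_congr_ae (S.comparable.ac.ae_eq (A.weak_ae_classical S.compact hq))).1
    (S.adm.memLp_weak S.comparable (IsH2.of_contDiff S.compact hq))

theorem integrable_rep (S : Setting Ω μ A η σ ν) (z : PairSpace μ M) : Integrable (rep z).1 μ := by
  have := S.finite
  exact (memLp_rep z).integrable (by norm_num)

theorem memLp_opV (S : Setting Ω μ A η σ ν) (X : Fin M → Space d)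
    {F : (Space d → ℝ) × (Fin M → ℝ)} (hF : Integrable F.1 μ) :
    MemLp (opV A η σ ν μ X F).1 2 μ := by
  rw [S.opV_eq X hF]
  exact S.memLp_classical (S.contDiff_field X hF)

theorem couple_opV (S : Setting Ω μ A η σ ν) (X : Fin M → Space d)
    {F G : (Space d → ℝ) × (Fin M → ℝ)} (hF : Integrable F.1 μ) :
    couple μ G (opV A η σ ν μ X F) = testFun A μ X G (field A η σ ν μ X F) := by
  rw [S.opV_eq X hF]; rfl

theorem couple_opV_comm (S : Setting Ω μ A η σ ν) (X : Fin M → Space d)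
    {F G : (Space d → ℝ) × (Fin M → ℝ)} (hF : Integrable F.1 μ) (hG : Integrable G.1 μ) :
    couple μ G (opV A η σ ν μ X F) = couple μ F (opV A η σ ν μ X G) := by
  rw [S.couple_opV X hF, S.couple_opV X hG, S.pairing_field X hF hG, S.pairing_field X hG hF]
  simp only [mul_comm]

theorem couple_opV_self_nonneg (S : Setting Ω μ A η σ ν) (X : Fin M → Space d)
    {F : (Space d → ℝ) × (Fin M → ℝ)} (hF : Integrable F.1 μ) :
    0 ≤ couple μ F (opV A η σ ν μ X F) := by
  rw [S.couple_opV X hF, S.pairing_field X hF hF]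
  exact Finset.sum_nonneg fun κ _ => integral_nonneg fun θ => mul_self_nonneg _

theorem inner_opV (S : Setting Ω μ A η σ ν) (X : Fin M → Space d) (z w : PairSpace μ M) :
    inner ℝ (emb μ (opV A η σ ν μ X (rep z))) w = couple μ (rep z) (opV A η σ ν μ X (rep w)) := by
  rw [inner_emb (S.memLp_opV X (S.integrable_rep z)),
    S.couple_opV_comm X (S.integrable_rep z) (S.integrable_rep w)]

/-- The operator `𝒱` on the Hilbert space. -/
noncomputable def opVLin (S : Setting Ω μ A η σ ν) (X : Fin M → Space d) :
    PairSpace μ M →ₗ[ℝ] PairSpace μ M where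
  toFun z := emb μ (opV A η σ ν μ X (rep z))
  map_add' z z' := by
    -- Tested against `w`, the symmetry of the form moves `𝒱` onto `w`, and additivity becomes that
    -- of `couple` in its first argument. Homogeneity is obtained in the same way.
    refine ext_inner_right ℝ fun w => ?_
    have hw := S.memLp_opV X (S.integrable_rep w)
    rw [inner_add_left, S.inner_opV, S.inner_opV, S.inner_opV,
      ← couple_add_left (memLp_rep z) (memLp_rep z') hw]
    exact couple_congr (rep_add z z').1 (rep_add z z').2 ae_eq_rfl rfl
  map_smul' c z := by
    refine ext_inner_right ℝ fun w => ?_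
    rw [RingHom.id_apply, real_inner_smul_left, S.inner_opV, S.inner_opV, ← couple_smul_left]
    exact couple_congr (rep_smul c z).1 (rep_smul c z).2 ae_eq_rfl rfl

theorem isSymmetric_opVLin (S : Setting Ω μ A η σ ν) (X : Fin M → Space d) :
    (S.opVLin X).IsSymmetric := fun z w => by
  rw [real_inner_comm (S.opVLin X w)]
  change inner ℝ (emb μ _) w = inner ℝ (emb μ _) z
  rw [S.inner_opV, inner_emb (S.memLp_opV X (S.integrable_rep w))]

/-- The limiting dynamics drives the residual to zero if the solution `u` is annihilated by
everything that annihilates the functions `η σ(w · x + b)`. -/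
theorem tendsto_residual (S : Setting Ω μ A η σ ν) {X : Fin M → Space d}
    (hX : ∀ i, X i ∈ interior Ω) {g u : Space d → ℝ}
    (hu : IsSolution A Ω μ g u) {Q : ℝ → Space d → ℝ} (hQ : IsWideLimit A Ω η σ ν μ X g u Q)
    (hker : ∀ F : (Space d → ℝ) × (Fin M → ℝ), MemLp F.1 2 μ →
      (∀ w b, testFun A μ X F (ridge η σ w b) = 0) →
        couple μ F (A.weak Ω u, fun i => u (X i)) = 0) :
    Tendsto (fun t => eLpNorm (A.weak Ω (Q t) - g) 2 μ ^ 2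
        + eLpNorm (Q t - u) 2 (obsMeasure X) ^ 2) atTop (𝓝 0) := by
  have := S.finite
  have hO : IsOpen (interior Ω) := isOpen_interior
  -- A symmetric operator defined on a whole Hilbert space is continuous (Hellinger-Toeplitz), which
  -- replaces an estimate of the kernels.
  set V : PairSpace μ M →L[ℝ] PairSpace μ M :=
    ⟨S.opVLin X, (S.isSymmetric_opVLin X).continuous⟩ with hV
  have hR : ∀ t, 0 ≤ t → MemLp (residual A Ω X g u (Q t)).1 2 μ := fun t ht =>
    S.memLp_residual hu (hQ.mem t ht)
  have hRV : ∀ t, 0 ≤ t → V (emb μ (residual A Ω X g u (Q t))) =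
      emb μ (opV A η σ ν μ X (residual A Ω X g u (Q t))) := by
    intro t ht
    have e := rep_emb (hR t ht)
    change emb μ (opV A η σ ν μ X _) = _
    rw [opV, opS, opU_congr e.1, e.2]
    rfl
  have hneg : ∀ F : (Space d → ℝ) × (Fin M → ℝ), MemLp F.1 2 μ → emb μ (-F) = - emb μ F := by
    intro F hF
    refine ext_inner_right ℝ fun w => ?_
    rw [inner_neg_left, inner_emb hF, inner_emb (F := -F) hF.neg, couple_comm, couple_comm _ F,
      ← neg_one_smul ℝ F, couple_smul_left, neg_one_mul]
  have hlim : Tendsto (fun t => emb μ (residual A Ω X g u (Q t))) atTop (𝓝 0) := by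
    refine tendsto_zero_of_flow (V := V) (fun z w => S.isSymmetric_opVLin X z w) (fun z => ?_)
      (fun t ht => ?_) (fun z hz => ?_)
    · change 0 ≤ inner ℝ (emb μ _) z
      rw [S.inner_opV]
      exact S.couple_opV_self_nonneg X (S.integrable_rep z)
    · have hi := (hR t ht).integrable (by norm_num)
      rw [hRV t ht, ← hneg _ (S.memLp_opV X hi)]
      exact hasDerivWithinAt_emb ht hR (S.memLp_opV X hi).neg (S.hasL2Deriv_residual hX hu hQ ht)
    · have hz' : inner ℝ (emb μ (opV A η σ ν μ X (rep z))) z = 0 := hz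
      rw [S.inner_opV, S.couple_opV X (S.integrable_rep z)] at hz'
      have h0 := hker (rep z) (memLp_rep z) (S.testFun_ridge_eq_zero X (S.integrable_rep z) hz')
      -- Since `Q 0` vanishes on `Ω` and `g = 𝒜u` almost everywhere, the initial residual is `-(𝒜u,
      -- (u(x_i))_i)`, so `hker` gives its orthogonality to `z`.
      rw [inner_emb (hR 0 le_rfl), couple_comm, ← neg_eq_zero, ← neg_one_mul, ← couple_smul_left,
        couple_comm]
      refine Eq.trans ?_ h0
      have hQ0 := (hQ.mem 0 le_rfl).1.isH2 S.comparable
      have hq : (0 : Space d → ℝ) =ᵐ[volume.restrict (interior Ω)] Q 0 := by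
        rw [Filter.EventuallyEq, ae_restrict_iff' hO.measurableSet]
        -- `Q 0` is prescribed only on `Ω`, so its zero jet is carried over from the zero function
        -- by equality almost everywhere on the interior.
        exact Eventually.of_forall fun x hx => (hQ.init x (interior_subset hx)).symm
      have hz : IsH2 (interior Ω) (Q 0) 0 0 := (isH2_zero (interior Ω)).congr hO hq
      have hw := S.comparable.ac.ae_eq (A.weak_ae hz)
      refine couple_congr ae_eq_rfl rfl ?_ (funext fun i => ?_)
      · filter_upwards [hw, hu.2, S.comparable.ac.ae_eq hq] with x e1 e2 e3
        simp only [residual, Prod.smul_fst, Pi.smul_apply, Pi.sub_apply, e1, e2, ← e3]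
        simp
      · simp [residual, hQ.init _ (interior_subset (hX i))]
  have h2 : Tendsto (fun t => ‖emb μ (residual A Ω X g u (Q t))‖ ^ 2) atTop (𝓝 0) := by
    simpa using hlim.norm.pow 2
  have h3 := ENNReal.tendsto_ofReal h2
  rw [ENNReal.ofReal_zero] at h3
  refine h3.congr' ?_
  filter_upwards [eventually_ge_atTop 0] with t ht
  rw [norm_emb_sq (hR t ht), ENNReal.ofReal_add (by positivity) (by positivity),
    eLpNorm_obsMeasure_sq, ENNReal.ofReal_pow ENNReal.toReal_nonneg,
    ENNReal.ofReal_toReal (hR t ht).2.ne]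
  rfl

end Setting

end PINN

/-! ### Stability of annihilation under limits, superpositions and linear combinations -/

namespace PINN

variable {d M : ℕ}

theorem jetAbs_mul_le {p q : Space d → ℝ} (hp : ContDiff ℝ 2 p) (hq : ContDiff ℝ 2 q)
    (x : Space d) :
    jetAbs (fun y => p y * q y) x ≤ (1 + d + d * d) * (4 * (jetAbs p x * jetAbs q x)) := by
  have hP := jetAbs_nonneg p x
  have hQ := jetAbs_nonneg q x
  have key : ∀ a b : ℝ, |a| ≤ jetAbs p x → |b| ≤ jetAbs q x → |a * b| ≤ jetAbs p x * jetAbs q x :=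
    fun a b ha hb => by rw [abs_mul]; gcongr
  have h0 := abs_le_jetAbs p x
  have h1 := fun i => abs_pderiv_le_jetAbs p i x
  have h2 := fun i j => abs_pderiv₂_le_jetAbs p i j x
  have k0 := abs_le_jetAbs q x
  have k1 := fun i => abs_pderiv_le_jetAbs q i x
  have k2 := fun i j => abs_pderiv₂_le_jetAbs q i j x
  have hPQ : 0 ≤ jetAbs p x * jetAbs q x := by positivity
  refine jetAbs_le_of_forall ?_ (fun i => ?_) fun i j => ?_
  · linarith [key _ _ h0 k0]
  · rw [pderiv_mul (differentiable_of_contDiff_two hp x) (differentiable_of_contDiff_two hq x)]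
    refine (abs_add_le _ _).trans ?_
    linarith [key _ _ h0 (k1 i), key _ _ (h1 i) k0]
  · rw [pderiv₂_mul hp hq]
    refine (abs_add_le _ _).trans (le_trans (add_le_add ((abs_add_le _ _).trans
      (add_le_add (abs_add_le _ _) le_rfl)) le_rfl) ?_)
    linarith [key _ _ h0 (k2 i j), key _ _ (h2 i j) k0, key _ _ (h1 i) (k1 j), key _ _ (h1 j) (k1 i)]

/-- Bounded pointwise convergence of `2`-jets on `K`. -/
structure JetTendsto (K : Set (Space d)) (q : ℕ → Space d → ℝ) (q' : Space d → ℝ) : Prop where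
  smooth : ∀ n, ContDiff ℝ 2 (q n)
  smooth' : ContDiff ℝ 2 q'
  tendsto₀ : ∀ x ∈ K, Tendsto (fun n => q n x) atTop (𝓝 (q' x))
  tendsto₁ : ∀ i, ∀ x ∈ K, Tendsto (fun n => pderiv i (q n) x) atTop (𝓝 (pderiv i q' x))
  tendsto₂ : ∀ i j, ∀ x ∈ K,
    Tendsto (fun n => pderiv i (pderiv j (q n)) x) atTop (𝓝 (pderiv i (pderiv j q') x))
  bounded : ∃ B, ∀ n, ∀ x ∈ K, jetAbs (q n) x ≤ B

theorem JetTendsto.mul_left {K : Set (Space d)} (hK : IsCompact K) {q : ℕ → Space d → ℝ}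
    {q' p : Space d → ℝ} (h : JetTendsto K q q') (hp : ContDiff ℝ 2 p) :
    JetTendsto K (fun n y => p y * q n y) fun y => p y * q' y := by
  have dp := differentiable_of_contDiff_two hp
  have dq := fun n => differentiable_of_contDiff_two (h.smooth n)
  have dq' := differentiable_of_contDiff_two h.smooth'
  refine ⟨fun n => hp.mul (h.smooth n), hp.mul h.smooth', fun x hx =>
    (h.tendsto₀ x hx).const_mul _, fun i x hx => ?_, fun i j x hx => ?_, ?_⟩
  · simp only [pderiv_mul (dp x) (dq _ x), pderiv_mul (dp x) (dq' x)]
    exact ((h.tendsto₀ x hx).const_mul _).add ((h.tendsto₁ i x hx).const_mul _)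
  · simp only [pderiv₂_mul hp (h.smooth _), pderiv₂_mul hp h.smooth']
    exact ((((h.tendsto₀ x hx).const_mul _).add ((h.tendsto₁ i x hx).const_mul _)).add
      ((h.tendsto₁ j x hx).const_mul _)).add ((h.tendsto₂ i j x hx).const_mul _)
  · obtain ⟨B, hB⟩ := h.bounded
    obtain ⟨C, hC0, hC⟩ := exists_bound_of_isCompact hK (continuous_jetAbs hp)
    refine ⟨(1 + d + d * d) * (4 * (C * B)), fun n x hx => (jetAbs_mul_le hp (h.smooth n) x).trans ?_⟩
    have h1 := jetAbs_nonneg (q n) x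
    have h2 := hB n x hx
    have h3 := (le_abs_self _).trans (hC x hx)
    gcongr

/-- A family of functions whose `2`-jets are continuous and dominated by an integrable function. -/
structure JetFamily {Θ : Type*} [TopologicalSpace Θ] [MeasurableSpace Θ] (ρ : Measure Θ)
    (q : Θ → Space d → ℝ) : Prop where
  smooth : ∀ θ, ContDiff ℝ 2 (q θ)
  cont₀ : Continuous fun p : Θ × Space d => q p.1 p.2
  cont₁ : ∀ i, Continuous fun p : Θ × Space d => pderiv i (q p.1) p.2
  cont₂ : ∀ i j, Continuous fun p : Θ × Space d => pderiv i (pderiv j (q p.1)) p.2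
  bounded : ∀ R : ℝ, ∃ B : Θ → ℝ, Integrable B ρ ∧ ∀ᵐ θ ∂ρ, ∀ y, ‖y‖ ≤ R → jetAbs (q θ) y ≤ B θ

section JetFamily

variable {Θ : Type*} [TopologicalSpace Θ] [MeasurableSpace Θ] {ρ : Measure Θ}
  {q : Θ → Space d → ℝ}

theorem JetFamily.mul_left (h : JetFamily ρ q) {p : Space d → ℝ} (hp : ContDiff ℝ 2 p) :
    JetFamily ρ fun θ y => p y * q θ y := by
  have dp := differentiable_of_contDiff_two hp
  have dq := fun n => differentiable_of_contDiff_two (h.smooth n)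
  have p0 := hp.continuous
  have p1 := fun i => (contDiff_one_pderiv hp i).continuous
  have p2 := fun i j => continuous_pderiv (contDiff_one_pderiv hp j) i
  have c0 := h.cont₀
  have c1 := h.cont₁
  have c2 := h.cont₂
  refine ⟨fun θ => hp.mul (h.smooth θ), by fun_prop, fun i => ?_, fun i j => ?_, fun R => ?_⟩
  · simp only [pderiv_mul (dp _) (dq _ _)]
    fun_prop
  · simp only [pderiv₂_mul hp (h.smooth _)]
    fun_prop
  · obtain ⟨B, hBi, hB⟩ := h.bounded R
    obtain ⟨C, hC0, hC⟩ := exists_bound_of_isCompact (isCompact_closedBall (0 : Space d) R)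
      (continuous_jetAbs hp)
    refine ⟨fun θ => (1 + d + d * d) * (4 * (C * B θ)), ((hBi.const_mul C).const_mul 4).const_mul _, ?_⟩
    filter_upwards [hB] with θ hθ y hy
    refine (jetAbs_mul_le hp (h.smooth θ) y).trans ?_
    have h1 := jetAbs_nonneg (q θ) y
    have h2 := hθ y hy
    have h3 := (le_abs_self _).trans (hC y (by simpa using hy))
    gcongr

variable [OpensMeasurableSpace Θ]

theorem JetFamily.integral (h : JetFamily ρ q) :
    ContDiff ℝ 2 (fun y => ∫ θ, q θ y ∂ρ) ∧
      (∀ i, pderiv i (fun y => ∫ θ, q θ y ∂ρ) = fun y => ∫ θ, pderiv i (q θ) y ∂ρ) ∧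
      ∀ i j, pderiv i (pderiv j (fun y => ∫ θ, q θ y ∂ρ)) =
        fun y => ∫ θ, pderiv i (pderiv j (q θ)) y ∂ρ := by
  have c : ∀ y : Space d, Continuous fun θ : Θ => (θ, y) := fun y => by fun_prop
  refine contDiff_two_integral_of_dominated h.smooth (fun y => ?_) (fun i y => ?_)
    (fun i j y => ?_) h.bounded
  · exact (h.cont₀.comp (c y)).aestronglyMeasurable
  · exact ((h.cont₁ i).comp (c y)).aestronglyMeasurable
  · exact ((h.cont₂ i j).comp (c y)).aestronglyMeasurable

theorem JetFamily.integrable_of_le (h : JetFamily ρ q) {D : (Space d → ℝ) → Space d → ℝ}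
    (hD : ∀ q x, |D q x| ≤ jetAbs q x) (hc : Continuous fun p : Θ × Space d => D (q p.1) p.2)
    (y : Space d) : Integrable (fun θ => D (q θ) y) ρ := by
  obtain ⟨B, hBi, hB⟩ := h.bounded ‖y‖
  have c : Continuous fun θ : Θ => (θ, y) := by fun_prop
  exact hBi.mono' (hc.comp c).aestronglyMeasurable
    (hB.mono fun θ hθ => (hD _ _).trans (hθ y le_rfl))

theorem JetFamily.integrable₀ (h : JetFamily ρ q) (y : Space d) : Integrable (fun θ => q θ y) ρ :=
  h.integrable_of_le (D := fun q => q) abs_le_jetAbs h.cont₀ y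

theorem JetFamily.classical_integral (h : JetFamily ρ q) (A : DiffOp d) (y : Space d) :
    A.classical (fun y => ∫ θ, q θ y ∂ρ) y = ∫ θ, A.classical (q θ) y ∂ρ := by
  obtain ⟨-, e1, e2⟩ := h.integral
  have i0 := h.integrable₀ y
  have i1 := fun i => h.integrable_of_le (fun q x => abs_pderiv_le_jetAbs q i x) (h.cont₁ i) y
  have i2 := fun i j => h.integrable_of_le (D := fun q => pderiv i (pderiv j q))
    (fun q x => abs_pderiv₂_le_jetAbs q i j x) (h.cont₂ i j) y
  have j1 := fun i => (i1 i).const_mul (A.a₁ i y)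
  have j2 := fun i j => (i2 i j).const_mul (A.a₂ i j y)
  have s1 : Integrable (fun θ => ∑ i, A.a₁ i y * pderiv i (q θ) y) ρ :=
    integrable_finsetSum _ fun i _ => j1 i
  have s2 : ∀ i, Integrable (fun θ => ∑ j, A.a₂ i j y * pderiv i (pderiv j (q θ)) y) ρ := fun i =>
    integrable_finsetSum _ fun j _ => j2 i j
  have s3 : Integrable (fun θ => ∑ i, ∑ j, A.a₂ i j y * pderiv i (pderiv j (q θ)) y) ρ :=
    integrable_finsetSum _ fun i _ => s2 i
  have j0 := i0.const_mul (A.a₀ y)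
  have s4 : Integrable (fun θ => A.a₀ y * q θ y + ∑ i, A.a₁ i y * pderiv i (q θ) y) ρ := j0.add s1
  simp only [DiffOp.classical, e2]
  simp only [e1]
  rw [integral_add s4 s3, integral_add j0 s1,
    integral_finsetSum _ fun i _ => j1 i, integral_finsetSum _ fun i _ => s2 i]
  simp only [integral_finsetSum _ fun j _ => j2 _ j, integral_const_mul]

end JetFamily

namespace Setting

variable {Ω : Set (Space d)} {μ : Measure (Space d)} {A : DiffOp d} {η : Space d → ℝ}
    {σ : ℝ → ℝ} {ν : Measure (Param d)} {X : Fin M → Space d} {F : (Space d → ℝ) × (Fin M → ℝ)}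

/-- Convergence of jets at a point gives convergence of `𝒜q` there, and the bound on the jets,
multiplied by the integrable function `F.1`, dominates. Uniform convergence is not required, which
keeps the later approximations elementary. -/
theorem tendsto_testFun (S : Setting Ω μ A η σ ν) (hX : ∀ i, X i ∈ interior Ω)
    (hF : Integrable F.1 μ) {q : ℕ → Space d → ℝ} {q' : Space d → ℝ} (h : JetTendsto Ω q q') :
    Tendsto (fun n => testFun A μ X F (q n)) atTop (𝓝 (testFun A μ X F q')) := by
  obtain ⟨C, hC0, hC⟩ := S.adm.abs_classical_le S.compact S.comparable
  obtain ⟨B, hB⟩ := h.bounded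
  refine Tendsto.add ?_ ((tendsto_finsetSum _ fun i _ =>
    (h.tendsto₀ (X i) (interior_subset (hX i))).const_mul _).const_mul _)
  refine tendsto_integral_of_dominated_convergence (fun x => |F.1 x| * (C * B))
    (fun n => hF.1.mul (S.aestronglyMeasurable_classical (h.smooth n))) (hF.abs.mul_const _)
    (fun n => ?_) ?_
  · filter_upwards [hC] with x hx
    rw [Real.norm_eq_abs, abs_mul]
    have := hx.2 _ (h.smooth n)
    have := hB n x (interior_subset hx.1)
    refine mul_le_mul_of_nonneg_left (le_trans (hx.2 _ (h.smooth n)) ?_) (abs_nonneg _)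
    gcongr
  · filter_upwards [hC] with x hx
    have hx' := interior_subset hx.1
    refine Tendsto.const_mul _ ?_
    exact (((h.tendsto₀ x hx').const_mul _).add (tendsto_finsetSum _ fun i _ =>
      (h.tendsto₁ i x hx').const_mul _)).add (tendsto_finsetSum _ fun i _ =>
        tendsto_finsetSum _ fun j _ => (h.tendsto₂ i j x hx').const_mul _)

/-- A superposition of annihilated functions is annihilated: `𝒜` passes under the integral by
domination of the jets, and Fubini exchanges it with the integral against `F.1`. It is used for
smearing in the bias and for Fourier inversion. -/
theorem testFun_integral (S : Setting Ω μ A η σ ν) (hF : Integrable F.1 μ)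
    {Θ : Type*} [TopologicalSpace Θ] [MeasurableSpace Θ] [OpensMeasurableSpace Θ]
    [SecondCountableTopology Θ] {ρ : Measure Θ} [SFinite ρ] {q : Θ → Space d → ℝ}
    (h : JetFamily ρ q) :
    testFun A μ X F (fun y => ∫ θ, q θ y ∂ρ) = ∫ θ, testFun A μ X F (q θ) ∂ρ := by
  have := S.finite
  obtain ⟨C, hC0, hC⟩ := S.adm.abs_classical_le S.compact S.comparable
  obtain ⟨R, -, hR⟩ := exists_bound_of_isCompact S.compact (continuous_norm (E := Space d))
  obtain ⟨B, hBi, hB⟩ := h.bounded R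
  have hint : Integrable (fun p : Θ × Space d => F.1 p.2 * A.classical (q p.1) p.2) (ρ.prod μ) := by
    refine ((hBi.mul_prod hF.abs).const_mul C).mono' (hF.1.comp_snd.mul ?_) ?_
    · have h0 := h.cont₀.aestronglyMeasurable (μ := ρ.prod μ)
      have h1 := fun i => (h.cont₁ i).aestronglyMeasurable (μ := ρ.prod μ)
      have h2 := fun i j => (h.cont₂ i j).aestronglyMeasurable (μ := ρ.prod μ)
      have m0 := S.adm.meas₀.aestronglyMeasurable.comp_snd (μ := ρ)
      have m1 := fun i => (S.adm.meas₁ i).aestronglyMeasurable.comp_snd (μ := ρ)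
      have m2 := fun i j => (S.adm.meas₂ i j).aestronglyMeasurable.comp_snd (μ := ρ)
      unfold DiffOp.classical
      fun_prop
    · filter_upwards [Measure.quasiMeasurePreserving_fst.ae hB,
        Measure.quasiMeasurePreserving_snd.ae hC] with p h1 h2
      have h3 := h1 p.2 ((le_abs_self _).trans (hR _ (interior_subset h2.1)))
      rw [Real.norm_eq_abs, abs_mul]
      calc _ ≤ |F.1 p.2| * (C * B p.1) := by
            refine mul_le_mul_of_nonneg_left ((h2.2 _ (h.smooth _)).trans ?_) (abs_nonneg _)
            gcongr
        _ = _ := by ring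
  simp only [testFun, h.classical_integral]
  have hs : Integrable (fun θ => (M : ℝ)⁻¹ * ∑ i, F.2 i * q θ (X i)) ρ :=
    (integrable_finsetSum _ fun i _ => (h.integrable₀ (X i)).const_mul _).const_mul _
  rw [integral_add hint.integral_prod_left hs, integral_const_mul,
    integral_finsetSum _ fun i _ => (h.integrable₀ (X i)).const_mul _]
  simp only [integral_const_mul]
  congr 1
  rw [integral_integral_swap (f := fun θ x => F.1 x * A.classical (q θ) x) hint]
  simp only [integral_const_mul]

end Setting

/-- `F` annihilates `η q`. -/
structure Annihilates (A : DiffOp d) (η : Space d → ℝ) (μ : Measure (Space d))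
    (X : Fin M → Space d) (F : (Space d → ℝ) × (Fin M → ℝ)) (q : Space d → ℝ) : Prop where
  smooth : ContDiff ℝ 2 q
  eq_zero : testFun A μ X F (fun y => η y * q y) = 0

namespace Setting

variable {Ω : Set (Space d)} {μ : Measure (Space d)} {A : DiffOp d} {η : Space d → ℝ}
    {σ : ℝ → ℝ} {ν : Measure (Param d)} {X : Fin M → Space d} {F : (Space d → ℝ) × (Fin M → ℝ)}

theorem annihilates_of_tendsto (S : Setting Ω μ A η σ ν) (hX : ∀ i, X i ∈ interior Ω)
    (hF : Integrable F.1 μ) {q : ℕ → Space d → ℝ} {q' : Space d → ℝ} (h : JetTendsto Ω q q')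
    (hq : ∀ n, Annihilates A η μ X F (q n)) : Annihilates A η μ X F q' := by
  refine ⟨h.smooth', ?_⟩
  have h1 := S.tendsto_testFun hX hF (h.mul_left S.compact S.aux₂)
  simp only [(hq _).eq_zero] at h1
  exact (tendsto_nhds_unique h1 tendsto_const_nhds)

theorem annihilates_integral (S : Setting Ω μ A η σ ν)
    (hF : Integrable F.1 μ) {Θ : Type*} [TopologicalSpace Θ] [MeasurableSpace Θ]
    [OpensMeasurableSpace Θ] [SecondCountableTopology Θ] {ρ : Measure Θ} [SFinite ρ]
    {q : Θ → Space d → ℝ} (h : JetFamily ρ q) (hq : ∀ θ, Annihilates A η μ X F (q θ)) :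
    Annihilates A η μ X F fun y => ∫ θ, q θ y ∂ρ := by
  refine ⟨h.integral.1, ?_⟩
  have h1 := S.testFun_integral (X := X) hF (h.mul_left S.aux₂)
  simp only [(hq _).eq_zero, integral_const_mul, integral_zero] at h1
  exact h1

theorem testFun_const_mul {q : Space d → ℝ} (hq : ContDiff ℝ 2 q) (c : ℝ) :
    testFun A μ X F (fun y => c * q y) = c * testFun A μ X F q := by
  simp only [testFun, A.classical_const_mul hq, mul_left_comm _ c, integral_const_mul,
    ← Finset.mul_sum]
  ring

theorem testFun_add (S : Setting Ω μ A η σ ν) (hF : MemLp F.1 2 μ) {p q : Space d → ℝ}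
    (hp : ContDiff ℝ 2 p) (hq : ContDiff ℝ 2 q) :
    testFun A μ X F (fun y => p y + q y) = testFun A μ X F p + testFun A μ X F q := by
  have e := integral_add (hF.integrable_mul (S.memLp_classical hp))
    (hF.integrable_mul (S.memLp_classical hq))
  simp only [Pi.mul_apply] at e
  simp only [testFun, A.classical_add hp hq, mul_add, Finset.sum_add_distrib, e]
  ring

theorem annihilates_const_mul (S : Setting Ω μ A η σ ν) {q : Space d → ℝ}
    (hq : Annihilates A η μ X F q) (c : ℝ) : Annihilates A η μ X F fun y => c * q y := by
  refine ⟨contDiff_const.mul hq.smooth, ?_⟩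
  simp only [mul_left_comm _ c]
  rw [testFun_const_mul (S.aux₂.mul hq.smooth), hq.eq_zero, mul_zero]

theorem annihilates_add (S : Setting Ω μ A η σ ν) (hF : MemLp F.1 2 μ) {p q : Space d → ℝ}
    (hp : Annihilates A η μ X F p) (hq : Annihilates A η μ X F q) :
    Annihilates A η μ X F fun y => p y + q y := by
  refine ⟨hp.smooth.add hq.smooth, ?_⟩
  simp only [mul_add]
  rw [S.testFun_add hF (S.aux₂.mul hp.smooth) (S.aux₂.mul hq.smooth), hp.eq_zero, hq.eq_zero,
    add_zero]

theorem annihilates_zero (S : Setting Ω μ A η σ ν) {q : Space d → ℝ}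
    (hq : Annihilates A η μ X F q) : Annihilates A η μ X F fun _ => 0 := by
  simpa using S.annihilates_const_mul hq 0

end Setting

end PINN

/-! ### Analysis on the line: Taylor remainders, waves, smeared activations -/

namespace PINN

/-! ### Locally bounded pointwise convergence on the line -/

/-- Pointwise convergence which is bounded on bounded sets. -/
structure LocBddTendsto (s : ℕ → ℝ → ℝ) (s' : ℝ → ℝ) : Prop where
  tendsto : ∀ z, Tendsto (fun n => s n z) atTop (𝓝 (s' z))
  bounded : ∀ R : ℝ, ∃ B, ∀ n z, |z| ≤ R → |s n z| ≤ B

/-- The remainder of the Taylor expansion of `z ↦ τ (b + l z)` at `0`, divided by `l ^ k`. -/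
noncomputable def taylorRem (τ : ℝ → ℝ) (b l : ℝ) (k : ℕ) (z : ℝ) : ℝ :=
  (τ (b + l * z) - ∑ j ∈ Finset.range k, iteratedDeriv j τ b * ((l * z) ^ j / j.factorial)) / l ^ k

/-- `τ` is smooth with bounded derivatives of all orders. -/
structure IsCbSmooth (τ : ℝ → ℝ) : Prop where
  smooth : ContDiff ℝ ∞ τ
  bounded : ∀ k, ∃ C, ∀ z, |iteratedDeriv k τ z| ≤ C

theorem IsCbSmooth.deriv {τ : ℝ → ℝ} (h : IsCbSmooth τ) : IsCbSmooth (deriv τ) :=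
  ⟨(contDiff_infty_iff_deriv.1 h.smooth).2, fun k => by
    obtain ⟨C, hC⟩ := h.bounded (k + 1)
    exact ⟨C, fun z => by rw [← iteratedDeriv_succ']; exact hC z⟩⟩

theorem IsCbSmooth.differentiable {τ : ℝ → ℝ} (h : IsCbSmooth τ) : Differentiable ℝ τ :=
  h.smooth.differentiable (by simp)

theorem taylorRem_zero (τ : ℝ → ℝ) (b l z : ℝ) : taylorRem τ b l 0 z = τ (b + l * z) := by
  simp [taylorRem]

theorem taylorRem_succ_at_zero (τ : ℝ → ℝ) (b l : ℝ) (k : ℕ) : taylorRem τ b l (k + 1) 0 = 0 := by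
  simp [taylorRem, Finset.sum_range_succ']

theorem hasDerivAt_comp_affine {τ : ℝ → ℝ} (hτ : Differentiable ℝ τ) (b l z : ℝ) :
    HasDerivAt (fun z => τ (b + l * z)) (l * deriv τ (b + l * z)) z := by
  have h2 : HasDerivAt (fun z : ℝ => b + l * z) l z := by
    simpa using ((hasDerivAt_id z).const_mul l).const_add b
  have h3 := (hτ (b + l * z)).hasDerivAt.comp z h2
  rw [mul_comm]
  exact h3

/-- Differentiation in `z` lowers the order of the remainder by one and replaces `τ` by `τ'`, with
no leftover power of `l`. Every estimate on remainders and on their derivatives is an induction on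
this. -/
theorem hasDerivAt_taylorRem_succ {τ : ℝ → ℝ} (hτ : Differentiable ℝ τ) (b : ℝ) {l : ℝ}
    (hl : l ≠ 0) (k : ℕ) (z : ℝ) :
    HasDerivAt (taylorRem τ b l (k + 1)) (taylorRem (deriv τ) b l k z) z := by
  have h1 : ∀ j : ℕ, HasDerivAt (fun z : ℝ => iteratedDeriv (j + 1) τ b *
      ((l * z) ^ (j + 1) / (j + 1).factorial))
      (iteratedDeriv (j + 1) τ b * (l * ((l * z) ^ j / j.factorial))) z := fun j => by
    have h := (((hasDerivAt_id z).const_mul l).pow (j + 1)).div_const ((j + 1).factorial : ℝ)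
    refine (h.const_mul (iteratedDeriv (j + 1) τ b)).congr_deriv ?_
    have := Nat.factorial_ne_zero j
    simp only [Nat.factorial_succ, id]
    push_cast
    field_simp
  have h2 := (((hasDerivAt_comp_affine hτ b l z).sub (HasDerivAt.fun_sum
    fun j (_ : j ∈ Finset.range k) => h1 j)).sub_const (τ b)).div_const (l ^ (k + 1))
  have e : taylorRem τ b l (k + 1) = fun z => (τ (b + l * z) - ∑ j ∈ Finset.range k,
      iteratedDeriv (j + 1) τ b * ((l * z) ^ (j + 1) / (j + 1).factorial) - τ b) / l ^ (k + 1) := by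
    funext z
    simp only [taylorRem, Finset.sum_range_succ']
    simp [sub_sub]
  rw [e]
  refine HasDerivAt.congr_deriv h2 ?_
  simp only [taylorRem, iteratedDeriv_succ', mul_left_comm _ l, ← Finset.mul_sum, ← mul_sub]
  rw [pow_succ, mul_comm (l ^ k), mul_div_mul_left _ _ hl]

/-- The mean value inequality integrates the bound for `τ'`, starting from the value zero at the
origin. The constant is independent of the scale `l`, which allows `l → 0`. -/
theorem abs_taylorRem_le {τ : ℝ → ℝ} (hτ : IsCbSmooth τ) (b : ℝ) (k : ℕ) :
    ∃ C, 0 ≤ C ∧ ∀ l ≠ 0, ∀ z, |taylorRem τ b l k z| ≤ C * |z| ^ k := by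
  induction k generalizing τ with
  | zero =>
    obtain ⟨C, hC⟩ := hτ.bounded 0
    refine ⟨C, (abs_nonneg _).trans (hC 0), fun l hl z => ?_⟩
    rw [taylorRem_zero]
    simpa using hC (b + l * z)
  | succ k ih =>
    obtain ⟨C, hC0, hC⟩ := ih hτ.deriv
    refine ⟨C, hC0, fun l hl z => ?_⟩
    have h := (convex_Icc (-|z|) |z|).norm_image_sub_le_of_norm_hasDerivWithin_le
      (f := taylorRem τ b l (k + 1)) (C := C * |z| ^ k) (x := 0) (y := z)
      (fun y _ => (hasDerivAt_taylorRem_succ hτ.differentiable b hl k y).hasDerivWithinAt)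
      (fun y hy => ?_) (by simp) (abs_le.1 le_rfl)
    · rw [taylorRem_succ_at_zero, sub_zero, sub_zero, Real.norm_eq_abs, Real.norm_eq_abs] at h
      rw [pow_succ, ← mul_assoc]
      exact h
    · refine (hC l hl y).trans ?_
      have := abs_le.2 hy
      gcongr

/-- A sequence of scales tending to zero. -/
noncomputable def scale (n : ℕ) : ℝ := 1 / ((n : ℝ) + 1)

theorem scale_ne_zero (n : ℕ) : scale n ≠ 0 := by unfold scale; positivity

theorem abs_scale_le (n : ℕ) : |scale n| ≤ 1 := by
  unfold scale
  rw [abs_of_nonneg (by positivity), div_le_one (by positivity)]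
  linarith [n.cast_nonneg (α := ℝ)]

theorem tendsto_scale : Tendsto scale atTop (𝓝 0) := tendsto_one_div_add_atTop_nhds_zero_nat

theorem LocBddTendsto.scale_mul {s : ℕ → ℝ → ℝ} {s' : ℝ → ℝ} (h : LocBddTendsto s s') :
    LocBddTendsto (fun n z => scale n * s n z) fun _ => 0 := by
  refine ⟨fun z => by simpa using tendsto_scale.mul (h.1 z), fun R => ?_⟩
  obtain ⟨B, hB⟩ := h.2 R
  refine ⟨B, fun n z hz => ?_⟩
  rw [abs_mul]
  nlinarith [abs_scale_le n, hB n z hz, abs_nonneg (scale n), abs_nonneg (s n z)]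

/-- Removing the `k`-th monomial from the remainder of order `k` leaves `scale n` times the
remainder of order `k + 1`, which is bounded uniformly in the scale. -/
theorem locBddTendsto_taylorRem {τ : ℝ → ℝ} (hτ : IsCbSmooth τ) (b : ℝ) (k : ℕ) :
    LocBddTendsto (fun n => taylorRem τ b (scale n) k)
      fun z => iteratedDeriv k τ b * (z ^ k / k.factorial) := by
  have bd : ∀ k, ∀ R : ℝ, ∃ B, ∀ n z, |z| ≤ R → |taylorRem τ b (scale n) k z| ≤ B := fun k R => by
    obtain ⟨C, hC0, hC⟩ := abs_taylorRem_le hτ b k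
    exact ⟨C * R ^ k, fun n z hz => (hC _ (scale_ne_zero n) z).trans (by gcongr)⟩
  refine ⟨fun z => ?_, bd k⟩
  have e : ∀ n, taylorRem τ b (scale n) k z - iteratedDeriv k τ b * (z ^ k / k.factorial) =
      scale n * taylorRem τ b (scale n) (k + 1) z := fun n => by
    have := scale_ne_zero n
    simp only [taylorRem, Finset.sum_range_succ, mul_pow]
    field_simp
    ring
  rw [← tendsto_sub_nhds_zero_iff]
  simp only [e]
  obtain ⟨B, hB⟩ := bd (k + 1) |z|
  refine squeeze_zero_norm (a := fun n => |scale n| * B) (fun n => ?_) ?_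
  · rw [Real.norm_eq_abs, abs_mul]
    exact mul_le_mul_of_nonneg_left (hB n z le_rfl) (abs_nonneg _)
  · simpa using tendsto_scale.abs.mul_const B

theorem deriv_taylorRem_zero {τ : ℝ → ℝ} (hτ : Differentiable ℝ τ) (b l : ℝ) :
    deriv (taylorRem τ b l 0) = fun z => l * taylorRem (deriv τ) b l 0 z := by
  have : taylorRem τ b l 0 = fun z => τ (b + l * z) := funext (taylorRem_zero τ b l)
  funext z
  rw [this, (hasDerivAt_comp_affine hτ b l z).deriv, taylorRem_zero]

theorem deriv_taylorRem_succ {τ : ℝ → ℝ} (hτ : Differentiable ℝ τ) (b : ℝ) {l : ℝ} (hl : l ≠ 0)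
    (k : ℕ) : deriv (taylorRem τ b l (k + 1)) = taylorRem (deriv τ) b l k :=
  funext fun z => (hasDerivAt_taylorRem_succ hτ b hl k z).deriv

theorem deriv_monomial_succ (c : ℝ) (k : ℕ) :
    deriv (fun z : ℝ => c * (z ^ (k + 1) / (k + 1).factorial)) =
      fun z => c * (z ^ k / k.factorial) := by
  funext z
  have h := (((hasDerivAt_id z).pow (k + 1)).div_const ((k + 1).factorial : ℝ)).const_mul c
  refine HasDerivAt.deriv (HasDerivAt.congr_deriv h ?_)
  have := Nat.factorial_ne_zero k
  simp only [Nat.factorial_succ, id]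
  push_cast
  field_simp

theorem deriv_monomial_zero (c : ℝ) :
    deriv (fun z : ℝ => c * (z ^ 0 / (Nat.factorial 0 : ℝ))) = fun _ => 0 := by
  funext z; simp

/-- For positive order the derivative is again a Taylor remainder, that of `τ'`. In order `0` the
chain rule leaves a factor `scale n`, which tends to zero in accordance with the constant limit. -/
theorem locBddTendsto_deriv_taylorRem {τ : ℝ → ℝ} (hτ : IsCbSmooth τ) (b : ℝ) (k : ℕ) :
    LocBddTendsto (fun n => deriv (taylorRem τ b (scale n) k))
      (deriv fun z => iteratedDeriv k τ b * (z ^ k / k.factorial)) := by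
  cases k with
  | zero =>
    rw [deriv_monomial_zero]
    simp only [deriv_taylorRem_zero hτ.differentiable]
    exact (locBddTendsto_taylorRem hτ.deriv b 0).scale_mul
  | succ k =>
    rw [deriv_monomial_succ]
    simp only [deriv_taylorRem_succ hτ.differentiable b (scale_ne_zero _), iteratedDeriv_succ']
    exact locBddTendsto_taylorRem hτ.deriv b k

theorem locBddTendsto_deriv₂_taylorRem {τ : ℝ → ℝ} (hτ : IsCbSmooth τ) (b : ℝ) (k : ℕ) :
    LocBddTendsto (fun n => deriv (deriv (taylorRem τ b (scale n) k)))
      (deriv (deriv fun z => iteratedDeriv k τ b * (z ^ k / k.factorial))) := by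
  cases k with
  | zero =>
    have e : ∀ n, deriv (fun z => scale n * taylorRem (deriv τ) b (scale n) 0 z) =
        fun z => scale n * deriv (taylorRem (deriv τ) b (scale n) 0) z := fun n => by
      funext z
      exact deriv_const_mul_field _
    rw [deriv_monomial_zero]
    simp only [deriv_taylorRem_zero hτ.differentiable, e, deriv_const']
    exact (locBddTendsto_deriv_taylorRem hτ.deriv b 0).scale_mul
  | succ k =>
    rw [deriv_monomial_succ]
    simp only [deriv_taylorRem_succ hτ.differentiable b (scale_ne_zero _), iteratedDeriv_succ']
    exact locBddTendsto_deriv_taylorRem hτ.deriv b k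

theorem contDiff_taylorRem {τ : ℝ → ℝ} (hτ : IsCbSmooth τ) (b l : ℝ) (k : ℕ) :
    ContDiff ℝ 2 (taylorRem τ b l k) := by
  have h1 : ContDiff ℝ 2 τ := contDiff_infty.1 hτ.smooth 2
  have h2 : ContDiff ℝ 2 fun z : ℝ => τ (b + l * z) := h1.comp (by fun_prop)
  unfold taylorRem
  fun_prop

/-- A bounded function with vanishing `k`-th derivative is constant. -/
theorem IsCbSmooth.const_of_iteratedDeriv_eq_zero {τ : ℝ → ℝ} (hτ : IsCbSmooth τ) (k : ℕ)
    (h : ∀ z, iteratedDeriv k τ z = 0) : ∃ a, ∀ z, τ z = a := by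
  induction k generalizing τ with
  | zero => exact ⟨0, by simpa using h⟩
  | succ k ih =>
    obtain ⟨c, hc⟩ := ih hτ.deriv fun z => by rw [← iteratedDeriv_succ']; exact h z
    have h1 : ∀ z, τ z - c * z = τ 0 - c * 0 := fun z => by
      refine is_const_of_deriv_eq_zero (f := fun z => τ z - c * z) ?_ (fun z => ?_) z 0
      · exact hτ.differentiable.sub (by fun_prop)
      · have h2 := (hτ.differentiable z).hasDerivAt.sub ((hasDerivAt_id z).const_mul c)
        rw [hc z] at h2
        exact (h2.congr_deriv (by simp)).deriv
    obtain ⟨C, hC⟩ := hτ.bounded 0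
    simp only [iteratedDeriv_zero] at hC
    -- Here `τ` is affine with slope `c`. If `c ≠ 0`, the values of `τ` at `(2C + 1) / c` and at `0`
    -- differ by `2C + 1`, too much for a function bounded by `C`.
    have hc0 : c = 0 := by
      by_contra hne
      have h2 := h1 ((2 * C + 1) / c)
      rw [mul_div_cancel₀ _ hne, mul_zero, sub_zero] at h2
      have h3 := abs_le.1 (hC ((2 * C + 1) / c))
      have h4 := abs_le.1 (hC 0)
      linarith
    exact ⟨τ 0, fun z => by have := h1 z; rw [hc0] at this; linarith⟩

/-! ### The Taylor polynomials of `z ↦ Re (ξ e^{iz})` -/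

/-- The function `z ↦ Re (ξ e^{iz})`. -/
noncomputable def wave (ξ : ℂ) (z : ℝ) : ℝ := (ξ * Complex.exp (Complex.I * z)).re

/-- The Taylor polynomials of `z ↦ Re (ξ e^{iz})`. -/
noncomputable def wavePoly (ξ : ℂ) (n : ℕ) (z : ℝ) : ℝ :=
  ∑ k ∈ Finset.range n, (ξ * Complex.I ^ k).re * (z ^ k / k.factorial)

theorem hasDerivAt_wave (ξ : ℂ) (z : ℝ) : HasDerivAt (wave ξ) (wave (ξ * Complex.I) z) z := by
  have h1 : HasDerivAt (fun z : ℂ => ξ * Complex.exp (Complex.I * z))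
      (ξ * (Complex.exp (Complex.I * z) * (Complex.I * 1))) (z : ℂ) :=
    (((hasDerivAt_id (z : ℂ)).const_mul Complex.I).cexp).const_mul ξ
  refine h1.real_of_complex.congr_deriv ?_
  simp only [wave]
  ring_nf

theorem deriv_wave (ξ : ℂ) : deriv (wave ξ) = wave (ξ * Complex.I) :=
  funext fun z => (hasDerivAt_wave ξ z).deriv

theorem continuous_wave_uncurry : Continuous fun p : ℂ × ℝ => wave p.1 p.2 := by
  unfold wave; fun_prop

theorem contDiff_wave (ξ : ℂ) (n : ℕ) : ContDiff ℝ n (wave ξ) := by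
  induction n generalizing ξ with
  | zero => exact contDiff_zero.2 (continuous_iff_continuousAt.2 fun z =>
      (hasDerivAt_wave ξ z).continuousAt)
  | succ n ih =>
    push_cast
    refine contDiff_succ_iff_deriv.2 ⟨fun z => (hasDerivAt_wave ξ z).differentiableAt, by simp, ?_⟩
    rw [deriv_wave]
    exact ih _

theorem abs_wave_le (ξ : ℂ) (z : ℝ) : |wave ξ z| ≤ ‖ξ‖ := by
  refine (Complex.abs_re_le_norm _).trans ?_
  rw [norm_mul, mul_comm Complex.I, Complex.norm_exp_ofReal_mul_I, mul_one]

theorem deriv_wavePoly_succ (ξ : ℂ) (n : ℕ) :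
    deriv (wavePoly ξ (n + 1)) = wavePoly (ξ * Complex.I) n := by
  have e : wavePoly ξ (n + 1) = fun z => ∑ k ∈ Finset.range n,
      (ξ * Complex.I ^ (k + 1)).re * (z ^ (k + 1) / (k + 1).factorial) + ξ.re := by
    funext z
    simp [wavePoly, Finset.sum_range_succ']
  funext z
  rw [e, deriv_add_const, deriv_fun_sum fun k _ => by fun_prop]
  simp only [deriv_monomial_succ, wavePoly]
  exact Finset.sum_congr rfl fun k _ => by rw [pow_succ', mul_assoc]

theorem contDiff_wavePoly (ξ : ℂ) (n : ℕ) {m : ℕ∞ω} : ContDiff ℝ m (wavePoly ξ n) := by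
  unfold wavePoly; fun_prop

/-- The partial sums of the exponential series are dominated by `‖ξ‖ exp R` on `|z| ≤ R`. The shift
`m` is there because each derivative of a Taylor polynomial costs one degree: a start at `n + 2`
leaves room for two. -/
theorem locBddTendsto_wavePoly (ξ : ℂ) (m : ℕ) :
    LocBddTendsto (fun n => wavePoly ξ (n + m)) (wave ξ) := by
  refine ⟨fun z => ?_, fun R => ⟨‖ξ‖ * Real.exp R, fun n z hz => ?_⟩⟩
  · have h := NormedSpace.expSeries_div_hasSum_exp (𝔸 := ℂ) (Complex.I * z)
    rw [← Complex.exp_eq_exp_ℂ] at h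
    have h2 := Complex.hasSum_re (h.mul_left ξ)
    have h3 := (h2.tendsto_sum_nat).comp (tendsto_add_atTop_nat m)
    refine h3.congr fun n => ?_
    simp only [Function.comp_apply, wavePoly]
    refine Finset.sum_congr rfl fun k _ => ?_
    have : ξ * ((Complex.I * z) ^ k / k.factorial) =
        ((z ^ k / k.factorial : ℝ) : ℂ) * (ξ * Complex.I ^ k) := by
      push_cast; rw [mul_pow]; ring
    rw [this, Complex.re_ofReal_mul, mul_comm]
  · have hR : 0 ≤ R := (abs_nonneg z).trans hz
    calc |wavePoly ξ (n + m) z| ≤ ∑ k ∈ Finset.range (n + m), ‖ξ‖ * (R ^ k / k.factorial) := by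
          refine (Finset.abs_sum_le_sum_abs _ _).trans (Finset.sum_le_sum fun k _ => ?_)
          have h1 : |(ξ * Complex.I ^ k).re| ≤ ‖ξ‖ :=
            (Complex.abs_re_le_norm _).trans (by simp)
          rw [abs_mul, abs_div, abs_pow, Nat.abs_cast]
          gcongr
      _ = ‖ξ‖ * ∑ k ∈ Finset.range (n + m), R ^ k / k.factorial := by rw [Finset.mul_sum]
      _ ≤ _ := by
          gcongr
          exact Real.sum_le_exp_of_nonneg hR _

/-! ### Smearing an activation function -/

/-- The convolution of `σ` with `φ`. -/
noncomputable def smear (σ φ : ℝ → ℝ) (z : ℝ) : ℝ := ∫ t, φ t * σ (z - t)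

theorem iteratedDeriv_smear {σ : ℝ → ℝ} (hσ : Continuous σ) (k : ℕ) {φ : ℝ → ℝ}
    (hφ : ContDiff ℝ ∞ φ) (hc : HasCompactSupport φ) :
    iteratedDeriv k (smear σ φ) = smear σ (iteratedDeriv k φ) := by
  induction k generalizing φ with
  | zero => simp
  | succ k ih =>
    have h : deriv (smear σ φ) = smear σ (deriv φ) := funext fun z =>
      (hc.hasDerivAt_convolution_left (ContinuousLinearMap.lsmul ℝ ℝ) (hφ.of_le (by simp))
        hσ.locallyIntegrable z).deriv
    rw [iteratedDeriv_succ', iteratedDeriv_succ', h, ih (contDiff_infty_iff_deriv.1 hφ).2 hc.deriv]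

/-- All derivatives fall on `φ`, so boundedness of `σ` alone bounds every derivative of the
convolution by the `L¹` norm of a derivative of `φ`. -/
theorem isCbSmooth_smear {σ : ℝ → ℝ} (hσ : Continuous σ) {C : ℝ} (hC : ∀ z, |σ z| ≤ C)
    {φ : ℝ → ℝ} (hφ : ContDiff ℝ ∞ φ) (hc : HasCompactSupport φ) : IsCbSmooth (smear σ φ) := by
  refine ⟨hc.contDiff_convolution_left (n := ⊤) (ContinuousLinearMap.lsmul ℝ ℝ) hφ
    hσ.locallyIntegrable, fun k => ⟨∫ t, |iteratedDeriv k φ t| * C, fun z => ?_⟩⟩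
  rw [iteratedDeriv_smear hσ k hφ hc, ← Real.norm_eq_abs]
  have hcont : Continuous (iteratedDeriv k φ) :=
    hφ.continuous_iteratedDeriv k (by exact_mod_cast le_top)
  have hc' : HasCompactSupport (iteratedDeriv k φ) := by
    clear hcont
    induction k generalizing φ with
    | zero => simpa using hc
    | succ k ih =>
      rw [iteratedDeriv_succ']
      exact ih (contDiff_infty_iff_deriv.1 hφ).2 hc.deriv
  refine norm_integral_le_of_norm_le ((hcont.integrable_of_hasCompactSupport hc').abs.mul_const C)
    (Eventually.of_forall fun t => ?_)
  rw [Real.norm_eq_abs, abs_mul]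
  exact mul_le_mul_of_nonneg_left (hC _) (abs_nonneg _)

/-- A sequence of bump functions shrinking to the origin. -/
noncomputable def bump {E : Type*} [NormedAddCommGroup E] (n : ℕ) : ContDiffBump (0 : E) where
  rIn := scale n / 2
  rOut := scale n
  rIn_pos := by unfold scale; positivity
  rIn_lt_rOut := by
    have : 0 < scale n := by unfold scale; positivity
    linarith

/-- Along shrinking bumps the smeared functions converge pointwise to `σ`; were all of them
constant, `σ` would be constant as well. -/
theorem exists_smear_nonconst {σ : ℝ → ℝ} (hσ : Continuous σ) (h : ¬ ∃ a, ∀ z, σ z = a) :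
    ∃ φ : ℝ → ℝ, ContDiff ℝ ∞ φ ∧ HasCompactSupport φ ∧ ¬ ∃ a, ∀ z, smear σ φ z = a := by
  by_contra hcon
  push Not at hcon
  have h1 : ∀ z, Tendsto (fun n => smear σ ((bump (E := ℝ) n).normed volume) z) atTop (𝓝 (σ z)) := fun z =>
    ContDiffBump.convolution_tendsto_right_of_continuous (φ := bump) (l := atTop) (μ := volume)
      tendsto_scale hσ z
  refine h ⟨σ 0, fun z => tendsto_nhds_unique (h1 z) ((h1 0).congr fun n => ?_)⟩
  obtain ⟨a, ha⟩ := hcon ((bump (E := ℝ) n).normed volume) (bump n).contDiff_normed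
    (bump n).hasCompactSupport_normed
  rw [ha, ha]

end PINN

/-! ### Universal approximation: from ridge functions to all of `C_c²` -/

namespace PINN

variable {d M : ℕ}

theorem jetAbs_comp_affine_le {s : ℝ → ℝ} (hs : ContDiff ℝ 2 s) {w : Space d} {b : ℝ} {y : Space d}
    {B : ℝ} (h0 : |s (affine w b y)| ≤ B) (h1 : |deriv s (affine w b y)| ≤ B)
    (h2 : |deriv (deriv s) (affine w b y)| ≤ B) :
    jetAbs (fun y => s (affine w b y)) y ≤ (1 + d + d * d) * ((1 + ‖w‖) ^ 2 * B) := by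
  have hB : 0 ≤ B := (abs_nonneg _).trans h0
  have hw := norm_nonneg w
  have h3 : (1 : ℝ) ≤ (1 + ‖w‖) ^ 2 := by nlinarith
  have hc := abs_coord_le w
  refine jetAbs_le_of_forall ?_ (fun i => ?_) fun i j => ?_
  · exact h0.trans (le_mul_of_one_le_left hB h3)
  · rw [pderiv_comp_affine (hs.of_le (by norm_num)), abs_mul]
    have : |w i| ≤ (1 + ‖w‖) ^ 2 := by nlinarith [hc i]
    gcongr
  · rw [pderiv₂_comp_affine hs, abs_mul, abs_mul]
    have : |w i| * |w j| ≤ (1 + ‖w‖) ^ 2 := by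
      have := mul_le_mul (hc i) (hc j) (abs_nonneg _) hw
      nlinarith
    gcongr

theorem jetTendsto_comp_affine {K : Set (Space d)} (hK : IsCompact K) {s : ℕ → ℝ → ℝ} {s' : ℝ → ℝ}
    (hs : ∀ n, ContDiff ℝ 2 (s n)) (hs' : ContDiff ℝ 2 s') (h0 : LocBddTendsto s s')
    (h1 : LocBddTendsto (fun n => deriv (s n)) (deriv s'))
    (h2 : LocBddTendsto (fun n => deriv (deriv (s n))) (deriv (deriv s'))) (w : Space d) (b : ℝ) :
    JetTendsto K (fun n y => s n (affine w b y)) fun y => s' (affine w b y) := by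
  refine ⟨fun n => contDiff_comp_affine (hs n) w b, contDiff_comp_affine hs' w b,
    fun x _ => h0.tendsto _, fun i x _ => ?_, fun i j x _ => ?_, ?_⟩
  · simp only [pderiv_comp_affine ((hs _).of_le (by norm_num)),
      pderiv_comp_affine (hs'.of_le (by norm_num))]
    exact (h1.tendsto _).const_mul _
  · simp only [pderiv₂_comp_affine (hs _), pderiv₂_comp_affine hs']
    exact (h2.tendsto _).const_mul _
  · obtain ⟨R, -, hR⟩ := exists_bound_of_isCompact hK (contDiff_affine w b (n := 0)).continuous
    obtain ⟨B0, hB0⟩ := h0.bounded R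
    obtain ⟨B1, hB1⟩ := h1.bounded R
    obtain ⟨B2, hB2⟩ := h2.bounded R
    refine ⟨(1 + d + d * d) * ((1 + ‖w‖) ^ 2 * max B0 (max B1 B2)), fun n x hx =>
      jetAbs_comp_affine_le (hs n) ?_ ?_ ?_⟩
    · exact (hB0 n _ (hR x hx)).trans (le_max_left _ _)
    · exact (hB1 n _ (hR x hx)).trans ((le_max_left _ _).trans (le_max_right _ _))
    · exact (hB2 n _ (hR x hx)).trans ((le_max_right _ _).trans (le_max_right _ _))

namespace Setting

variable {Ω : Set (Space d)} {μ : Measure (Space d)} {A : DiffOp d} {η : Space d → ℝ}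
    {σ : ℝ → ℝ} {ν : Measure (Param d)} {X : Fin M → Space d} {F : (Space d → ℝ) × (Fin M → ℝ)}

/-- The smeared ridge function is the superposition of the ridge functions with biases `b - t`,
weighted by `φ(t)`, and all biases are available. -/
theorem annihilates_smear (S : Setting Ω μ A η σ ν) (hF : Integrable F.1 μ)
    (h : ∀ w b, testFun A μ X F (ridge η σ w b) = 0) {φ : ℝ → ℝ} (hφ : ContDiff ℝ ∞ φ)
    (hc : HasCompactSupport φ) (w : Space d) (b : ℝ) :
    Annihilates A η μ X F fun y => smear σ φ (affine w b y) := by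
  have hσ : ContDiff ℝ 2 σ := S.act.1.of_le (by norm_num)
  have hφc := hφ.continuous
  have hσ0 := hσ.continuous
  have hσ1 := hσ.continuous_deriv (by norm_num)
  have hσ2 := (contDiff_deriv_of (m := 1) hσ (by norm_num)).continuous_deriv (by norm_num)
  have hq : ∀ t, ContDiff ℝ 2 fun y => σ (affine w (b - t) y) := fun t => contDiff_comp_affine hσ w _
  have ca : Continuous fun p : ℝ × Space d => affine w (b - p.1) p.2 :=
    continuous_affine_comp continuous_const (by fun_prop) continuous_snd
  obtain ⟨C, hC⟩ := S.act.exists_bound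
  have e1 : deriv σ = iteratedDeriv 1 σ := iteratedDeriv_one.symm
  have e2 : deriv (deriv σ) = iteratedDeriv 2 σ := by rw [iteratedDeriv_succ, ← e1]
  have hfam : JetFamily volume fun t y => φ t * σ (affine w (b - t) y) := by
    refine ⟨fun t => contDiff_const.mul (hq t), by fun_prop, fun i => ?_, fun i j => ?_, fun R =>
      ⟨fun t => |φ t| * ((1 + d + d * d) * ((1 + ‖w‖) ^ 2 * C)),
        (hφc.integrable_of_hasCompactSupport hc).abs.mul_const _,
        Eventually.of_forall fun t y _ => ?_⟩⟩
    · simp only [pderiv_const_mul (differentiable_of_contDiff_two (hq _) _),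
        pderiv_comp_affine (hσ.of_le (by norm_num))]
      fun_prop
    · simp only [pderiv₂_const_mul (hq _), pderiv₂_comp_affine hσ]
      fun_prop
    · rw [jetAbs_const_mul (hq t)]
      refine mul_le_mul_of_nonneg_left (jetAbs_comp_affine_le hσ ?_ ?_ ?_) (abs_nonneg _)
      · simpa using hC 0 (by norm_num) _
      · rw [e1]; exact hC 1 (by norm_num) _
      · rw [e2]; exact hC 2 (by norm_num) _
  have key := S.annihilates_integral (X := X) hF hfam fun t =>
    S.annihilates_const_mul ⟨hq t, h w (b - t)⟩ (φ t)
  have e : (fun y => smear σ φ (affine w b y)) = fun y => ∫ t, φ t * σ (affine w (b - t) y) := by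
    funext y
    simp only [smear, affine, add_sub_assoc]
  rw [e]
  exact key

/-- Shrinking the weight to `scale n • w`, subtracting the lower Taylor terms, which are annihilated
by strong induction, and dividing by `scale n ^ k` leaves the Taylor remainder of order `k`. Its
2-jet converges boundedly to that of the `k`-th Taylor monomial. -/
theorem annihilates_pow (S : Setting Ω μ A η σ ν) (hX : ∀ i, X i ∈ interior Ω)
    (hF : MemLp F.1 2 μ) {τ : ℝ → ℝ} (hτ : IsCbSmooth τ)
    (h : ∀ w b, Annihilates A η μ X F fun y => τ (affine w b y)) (w : Space d) (b : ℝ) (k : ℕ) :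
    Annihilates A η μ X F fun y => iteratedDeriv k τ b * (affine w 0 y ^ k / k.factorial) := by
  have := S.finite
  induction k using Nat.strong_induction_on with
  | _ k ih =>
    have hsum : ∀ (l : ℝ) (m : ℕ), m ≤ k → Annihilates A η μ X F fun y => ∑ j ∈ Finset.range m,
        iteratedDeriv j τ b * ((l * affine w 0 y) ^ j / j.factorial) := by
      intro l m
      induction m with
      | zero =>
        intro _
        simpa using S.annihilates_zero (h w b)
      | succ m ihm =>
        intro hm
        simp only [Finset.sum_range_succ]
        refine S.annihilates_add hF (ihm (by omega)) ?_
        convert! S.annihilates_const_mul (ih m (by omega)) (l ^ m) using 2 with y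
        rw [mul_pow]; ring
    refine S.annihilates_of_tendsto hX (hF.integrable (by norm_num))
      (jetTendsto_comp_affine S.compact (fun n => contDiff_taylorRem hτ b (scale n) k) ?_
        (locBddTendsto_taylorRem hτ b k) (locBddTendsto_deriv_taylorRem hτ b k)
        (locBddTendsto_deriv₂_taylorRem hτ b k) w 0) fun n => ?_
    · fun_prop
    · convert! S.annihilates_const_mul (S.annihilates_add hF (h (scale n • w) b)
        (S.annihilates_const_mul (hsum (scale n) k le_rfl) (-1))) ((scale n ^ k)⁻¹) using 2 with y
      simp only [taylorRem, affine, inner_smul_left, add_zero]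
      simp only [conj_trivial]
      rw [add_comm b]
      ring

/-- A smeared activation that is bounded and not constant has, for each `k`, a point `b` where its
`k`-th derivative is nonzero. Dividing by this number gives the bare power `(w·y)^k`; Taylor
polynomials and their limits then give all plane waves. The point `b` may change with `k`. -/
theorem annihilates_wave (S : Setting Ω μ A η σ ν) (hX : ∀ i, X i ∈ interior Ω)
    (hF : MemLp F.1 2 μ) (hσ : ¬ ∃ a, ∀ z, σ z = a)
    (h : ∀ w b, testFun A μ X F (ridge η σ w b) = 0) (w : Space d) (ξ : ℂ) :
    Annihilates A η μ X F fun y => wave ξ (affine w 0 y) := by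
  have := S.finite
  have hi : Integrable F.1 μ := hF.integrable (by norm_num)
  obtain ⟨C, hC⟩ := S.act.exists_bound
  have hC0 : ∀ z, |σ z| ≤ C := fun z => by simpa using hC 0 (by norm_num) z
  obtain ⟨φ, hφ, hc, hne⟩ := exists_smear_nonconst S.act.1.continuous hσ
  have hτ := isCbSmooth_smear S.act.1.continuous hC0 hφ hc
  have hpow : ∀ k : ℕ, Annihilates A η μ X F fun y => affine w 0 y ^ k / k.factorial := fun k => by
    obtain ⟨b, hb⟩ : ∃ b, iteratedDeriv k (smear σ φ) b ≠ 0 := by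
      by_contra hcon
      push Not at hcon
      exact hne (hτ.const_of_iteratedDeriv_eq_zero k hcon)
    have h1 := S.annihilates_const_mul (S.annihilates_pow hX hF hτ
      (fun w b => S.annihilates_smear hi h hφ hc w b) w b k) (iteratedDeriv k (smear σ φ) b)⁻¹
    simpa only [inv_mul_cancel_left₀ hb] using h1
  have hpoly : ∀ (ζ : ℂ) (n : ℕ), Annihilates A η μ X F fun y => wavePoly ζ n (affine w 0 y) := by
    intro ζ n
    induction n with
    | zero => simpa [wavePoly] using S.annihilates_zero (hpow 0)
    | succ n ihn =>
      simp only [wavePoly, Finset.sum_range_succ]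
      exact S.annihilates_add hF ihn (S.annihilates_const_mul (hpow n) _)
  refine S.annihilates_of_tendsto hX hi (jetTendsto_comp_affine S.compact
    (s := fun n => wavePoly ξ (n + 2)) (fun n => contDiff_wavePoly ξ _) (contDiff_wave ξ 2)
    (locBddTendsto_wavePoly ξ 2) ?_ ?_ w 0) fun n => hpoly ξ (n + 2)
  · simp only [deriv_wave, deriv_wavePoly_succ]
    exact locBddTendsto_wavePoly _ 1
  · simp only [deriv_wave, deriv_wavePoly_succ]
    exact locBddTendsto_wavePoly _ 0

-- By Fourier inversion `p` is a superposition of the plane waves `Re (p̂(ξ) e^{2πi ξ·y})`. Two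
-- derivatives in `y` cost a factor `(1 + 2π‖ξ‖)²`, which the Schwartz decay of `p̂` makes
-- integrable.
open scoped FourierTransform SchwartzMap in
theorem annihilates_of_isTest (S : Setting Ω μ A η σ ν) (hX : ∀ i, X i ∈ interior Ω)
    (hF : MemLp F.1 2 μ) (hσ : ¬ ∃ a, ∀ z, σ z = a)
    (h : ∀ w b, testFun A μ X F (ridge η σ w b) = 0) {p : Space d → ℝ} (hp : ContDiff ℝ ∞ p)
    (hc : HasCompactSupport p) : Annihilates A η μ X F p := by
  have := S.finite
  have hc' : HasCompactSupport fun x => (p x : ℂ) := hc.comp_left (g := fun t : ℝ => (t : ℂ)) (by simp)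
  set P : 𝓢(Space d, ℂ) := hc'.toSchwartzMap (Complex.ofRealCLM.contDiff.comp hp) with hP
  set G : 𝓢(Space d, ℂ) := 𝓕 P with hG
  have hGc : Continuous G := G.continuous
  have e : p = fun y => ∫ ξ, wave (G ξ) (affine ((2 * Real.pi) • ξ) 0 y) := by
    funext y
    have h1 : 𝓕⁻ (𝓕 (P : Space d → ℂ)) y = P y := by
      rw [P.continuous.fourierInv_fourier_eq P.integrable]
      rw [← SchwartzMap.fourier_coe]; exact (𝓕 P).integrable
    rw [Real.fourierInv_eq', ← SchwartzMap.fourier_coe] at h1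
    have h2 : p y = (P y).re := (Complex.ofReal_re (p y)).symm
    rw [h2, ← h1]
    have hint : Integrable fun v : Space d =>
        Complex.exp (↑(2 * Real.pi * inner ℝ v y) * Complex.I) • G v := by
      refine (G.integrable (μ := volume)).norm.mono' ?_ (Eventually.of_forall fun v => ?_)
      · exact (by fun_prop : Continuous fun v : Space d =>
          Complex.exp (↑(2 * Real.pi * inner ℝ v y) * Complex.I) • G v).aestronglyMeasurable
      · rw [norm_smul, Complex.norm_exp_ofReal_mul_I, one_mul]
    have h3 := integral_re (𝕜 := ℂ) hint
    refine Eq.trans h3.symm (integral_congr_ae (Eventually.of_forall fun v => ?_))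
    simp only [wave, affine, inner_smul_left, smul_eq_mul, add_zero]
    simp only [conj_trivial]
    rw [mul_comm, mul_comm Complex.I]
    rfl
  have ca : Continuous fun p : Space d × Space d => affine ((2 * Real.pi) • p.1) 0 p.2 :=
    continuous_affine_comp (by fun_prop) continuous_const continuous_snd
  have cw : ∀ c : ℂ, Continuous fun p : Space d × Space d =>
      wave (G p.1 * c) (affine ((2 * Real.pi) • p.1) 0 p.2) := fun c =>
    continuous_wave_uncurry.comp (by fun_prop : Continuous fun p : Space d × Space d =>
      (G p.1 * c, affine ((2 * Real.pi) • p.1) 0 p.2))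
  have hq : ∀ ξ : Space d, ContDiff ℝ 2 (wave (G ξ)) := fun ξ => contDiff_wave _ 2
  have hfam : JetFamily volume fun (ξ : Space d) y => wave (G ξ) (affine ((2 * Real.pi) • ξ) 0 y) := by
    refine ⟨fun ξ => contDiff_comp_affine (hq ξ) _ _, by simpa using cw 1, fun i => ?_,
      fun i j => ?_, fun R => ⟨fun ξ => (1 + d + d * d) * ((1 + ‖(2 * Real.pi) • ξ‖) ^ 2 * ‖G ξ‖),
        ?_, Eventually.of_forall fun ξ y _ => ?_⟩⟩
    · simp only [pderiv_comp_affine ((hq _).of_le (by norm_num)), deriv_wave]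
      have := cw Complex.I
      fun_prop
    · simp only [pderiv₂_comp_affine (hq _), deriv_wave, mul_assoc]
      have := cw (Complex.I * Complex.I)
      fun_prop
    · have i0 := G.integrable_pow_mul volume 0
      have i1 := (G.integrable_pow_mul volume 1).const_mul (2 * (2 * Real.pi))
      have i2 := (G.integrable_pow_mul volume 2).const_mul ((2 * Real.pi) ^ 2)
      refine (((i0.add i1).add i2).congr (Eventually.of_forall fun ξ => ?_)).const_mul _
      simp only [Pi.add_apply, norm_smul, Real.norm_of_nonneg Real.two_pi_pos.le]
      ring
    · refine jetAbs_comp_affine_le (hq ξ) (abs_wave_le _ _) ?_ ?_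
      · rw [deriv_wave]
        exact (abs_wave_le _ _).trans (by simp)
      · rw [deriv_wave, deriv_wave]
        exact (abs_wave_le _ _).trans (by simp)
  rw [e]
  exact S.annihilates_integral (hF.integrable (by norm_num)) hfam fun ξ => S.annihilates_wave hX hF hσ h _ _

end Setting

theorem pderiv_comp_sub (p : Space d → ℝ) (t : Space d) (i : Fin d) (y : Space d) :
    pderiv i (fun y => p (y - t)) y = pderiv i p (y - t) := by
  simp only [pderiv, lineDeriv, add_sub_right_comm]

theorem pderiv₂_comp_sub (p : Space d → ℝ) (t : Space d) (i j : Fin d) (y : Space d) :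
    pderiv i (pderiv j fun y => p (y - t)) y = pderiv i (pderiv j p) (y - t) := by
  rw [funext fun y => pderiv_comp_sub p t j y, pderiv_comp_sub]

theorem jetFamily_mollify {φ p : Space d → ℝ} (hφ : Continuous φ) (hc : HasCompactSupport φ)
    (hp : ContDiff ℝ 2 p) (hpc : HasCompactSupport p) :
    JetFamily volume fun t y => φ t * p (y - t) := by
  have hq : ∀ t, ContDiff ℝ 2 fun y => p (y - t) := fun t => hp.comp (by fun_prop)
  have p1 := fun i => (contDiff_one_pderiv hp i).continuous
  have p2 := fun i j => continuous_pderiv (contDiff_one_pderiv hp j) i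
  have p0 := hp.continuous
  have hJ : HasCompactSupport (jetAbs p) := by
    refine hpc.mono' fun x hx => ?_
    by_contra hn
    have h2 : ∀ i j, pderiv i (pderiv j p) x = 0 := fun i j =>
      pderiv_eq_zero_of_notMem_tsupport (fun h => hn (tsupport_pderiv_subset p j h)) i
    refine hx ?_
    simp [jetAbs, jetSum, image_eq_zero_of_notMem_tsupport hn,
      pderiv_eq_zero_of_notMem_tsupport hn, h2]
  obtain ⟨C, hC⟩ := (continuous_jetAbs hp).bounded_above_of_compact_support hJ
  refine ⟨fun t => contDiff_const.mul (hq t), by fun_prop, fun i => ?_, fun i j => ?_, fun R =>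
      ⟨fun t => |φ t| * C, (hφ.integrable_of_hasCompactSupport hc).abs.mul_const _,
        Eventually.of_forall fun t y _ => ?_⟩⟩
  · simp only [pderiv_const_mul (differentiable_of_contDiff_two (hq _) _), pderiv_comp_sub]
    fun_prop
  · simp only [pderiv₂_const_mul (hq _), pderiv₂_comp_sub]
    fun_prop
  · rw [jetAbs_const_mul (hq t)]
    refine mul_le_mul_of_nonneg_left ?_ (abs_nonneg _)
    have : jetAbs (fun y => p (y - t)) y = jetAbs p (y - t) := by
      simp only [jetAbs, jetSum, pderiv_comp_sub, pderiv₂_comp_sub]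
    rw [this]
    exact (le_abs_self _).trans (hC _)

/-- The derivatives fall on `p`, so each entry of the jet is the mollification of a continuous
function of compact support: it converges pointwise and is bounded by the supremum of that function.
-/
theorem jetTendsto_mollify {K : Set (Space d)} {p : Space d → ℝ} (hp : ContDiff ℝ 2 p)
    (hpc : HasCompactSupport p) :
    JetTendsto K (fun n y => ∫ t, (bump n).normed volume t * p (y - t)) p := by
  have h := fun n : ℕ => jetFamily_mollify (bump n).continuous_normed
    ((bump n).hasCompactSupport_normed (μ := volume)) hp hpc
  have p1 := fun i => (contDiff_one_pderiv hp i).continuous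
  have p2 := fun i j => continuous_pderiv (contDiff_one_pderiv hp j) i
  have lim : ∀ g : Space d → ℝ, Continuous g → ∀ x,
      Tendsto (fun n => ∫ t, (bump n).normed volume t * g (x - t)) atTop (𝓝 (g x)) := fun g hg x =>
    ContDiffBump.convolution_tendsto_right_of_continuous (φ := bump) (l := atTop) (μ := volume)
      tendsto_scale hg x
  have hq : ∀ t, ContDiff ℝ 2 fun y => p (y - t) := fun t => hp.comp (by fun_prop)
  have e1 : ∀ n i, pderiv i (fun y => ∫ t, (bump n).normed volume t * p (y - t)) =
      fun y => ∫ t, (bump n).normed volume t * pderiv i p (y - t) := fun n i => by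
    rw [(h n).integral.2.1]
    simp only [pderiv_const_mul (differentiable_of_contDiff_two (hq _) _), pderiv_comp_sub]
  have e2 : ∀ n i j, pderiv i (pderiv j fun y => ∫ t, (bump n).normed volume t * p (y - t)) =
      fun y => ∫ t, (bump n).normed volume t * pderiv i (pderiv j p) (y - t) := fun n i j => by
    rw [(h n).integral.2.2]
    simp only [pderiv₂_const_mul (hq _), pderiv₂_comp_sub]
  have bd : ∀ g : Space d → ℝ, Continuous g → HasCompactSupport g → ∃ C, ∀ n x,
      |∫ t, (bump n).normed volume t * g (x - t)| ≤ C := fun g hg hgc => by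
    obtain ⟨C, hC⟩ := hg.bounded_above_of_compact_support hgc
    refine ⟨C, fun n x => ?_⟩
    have hi := (bump (E := Space d) n).integrable_normed (μ := volume)
    have := norm_integral_le_of_norm_le (f := fun t => (bump n).normed volume t * g (x - t))
      (hi.mul_const C) (Eventually.of_forall fun t => by
        rw [norm_mul, Real.norm_of_nonneg ((bump n).nonneg_normed t)]
        exact mul_le_mul_of_nonneg_left (hC _) ((bump n).nonneg_normed t))
    rw [integral_mul_const, (bump n).integral_normed, one_mul] at this
    exact this
  refine ⟨fun n => (h n).integral.1, hp, fun x _ => lim p hp.continuous x, fun i x _ => ?_,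
    fun i j x _ => ?_, ?_⟩
  · simp only [e1]
    exact lim _ (p1 i) x
  · simp only [e2]
    exact lim _ (p2 i j) x
  · obtain ⟨C0, hC0⟩ := bd p hp.continuous hpc
    choose C1 hC1 using fun i => bd _ (p1 i) (hasCompactSupport_pderiv hpc i)
    choose C2 hC2 using fun i j => bd _ (p2 i j) (hasCompactSupport_pderiv (hasCompactSupport_pderiv hpc j) i)
    refine ⟨C0 + ∑ i, C1 i + ∑ i, ∑ j, C2 i j, fun n x _ => ?_⟩
    simp only [jetAbs, jetSum, e2]
    simp only [e1]
    have s1 := Finset.sum_le_sum fun i (_ : i ∈ Finset.univ) => hC1 i n x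
    have s2 := Finset.sum_le_sum fun i (_ : i ∈ Finset.univ) =>
      Finset.sum_le_sum fun j (_ : j ∈ Finset.univ) => hC2 i j n x
    exact add_le_add (add_le_add (hC0 n x) s1) s2

/-- Universal approximation: a functional which annihilates all `η σ(w · x + b)` annihilates all
`η p` with `p ∈ C²_c`. -/
theorem Setting.annihilates_of_hasCompactSupport {Ω : Set (Space d)} {μ : Measure (Space d)}
    {A : DiffOp d} {η : Space d → ℝ} {σ : ℝ → ℝ} {ν : Measure (Param d)} {X : Fin M → Space d}
    {F : (Space d → ℝ) × (Fin M → ℝ)} (S : Setting Ω μ A η σ ν) (hX : ∀ i, X i ∈ interior Ω)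
    (hF : MemLp F.1 2 μ) (hσ : ¬ ∃ a, ∀ z, σ z = a)
    (h : ∀ w b, testFun A μ X F (ridge η σ w b) = 0) {p : Space d → ℝ} (hp : ContDiff ℝ 2 p)
    (hc : HasCompactSupport p) : Annihilates A η μ X F p := by
  have := S.finite
  refine S.annihilates_of_tendsto hX (hF.integrable (by norm_num)) (jetTendsto_mollify hp hc)
    fun n => S.annihilates_of_isTest hX hF hσ h ?_ ?_
  · exact ((bump n).hasCompactSupport_normed (μ := volume)).contDiff_convolution_left (n := ⊤)
      (ContinuousLinearMap.lsmul ℝ ℝ) (bump n).contDiff_normed hp.continuous.locallyIntegrable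
  · exact ((bump n).hasCompactSupport_normed (μ := volume)).convolution
      (ContinuousLinearMap.lsmul ℝ ℝ) hc

end PINN

/-! ### Mollification in `L²` and of weak derivatives -/

namespace PINN

variable {d : ℕ}

/-- A mollifying kernel supported in the closed ball of radius `R`. -/
structure IsMollifier (K : Space d → ℝ) (R : ℝ) : Prop where
  smooth : ContDiff ℝ ∞ K
  nonneg : ∀ t, 0 ≤ K t
  integral_eq_one : ∫ t, K t = 1
  support : ∀ t, K t ≠ 0 → ‖t‖ ≤ R

/-- The convolution of `f` with the kernel `K`. -/
noncomputable def mol (K f : Space d → ℝ) (x : Space d) : ℝ := ∫ t, K t * f (x - t)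

theorem mol_eq_convolution (K f : Space d → ℝ) :
    mol K f = convolution K f (ContinuousLinearMap.lsmul ℝ ℝ) volume := rfl

variable {K f g : Space d → ℝ} {R : ℝ}

theorem IsMollifier.hasCompactSupport (hK : IsMollifier K R) : HasCompactSupport K :=
  HasCompactSupport.intro (isCompact_closedBall (0 : Space d) R) fun t ht => by
    by_contra h
    exact ht (by simpa using hK.support t h)

theorem IsMollifier.integrable (hK : IsMollifier K R) : Integrable K :=
  hK.smooth.continuous.integrable_of_hasCompactSupport hK.hasCompactSupport

theorem IsMollifier.lintegral (hK : IsMollifier K R) : ∫⁻ t, ENNReal.ofReal (K t) = 1 := by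
  rw [← ofReal_integral_eq_lintegral_ofReal hK.integrable (Eventually.of_forall hK.nonneg),
    hK.integral_eq_one, ENNReal.ofReal_one]

theorem contDiff_mol (hK : IsMollifier K R) (hf : LocallyIntegrable f) : ContDiff ℝ ∞ (mol K f) :=
  hK.hasCompactSupport.contDiff_convolution_left (n := ⊤) (ContinuousLinearMap.lsmul ℝ ℝ) hK.smooth hf

theorem integrable_mol (hK : IsMollifier K R) (hf : LocallyIntegrable f) (x : Space d) :
    Integrable fun t => K t * f (x - t) :=
  (hK.hasCompactSupport.convolutionExists_left (ContinuousLinearMap.lsmul ℝ ℝ)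
    hK.smooth.continuous hf) x

theorem eLpNorm_two_sq {α : Type*} [MeasurableSpace α] (μ : Measure α) (f : α → ℝ) :
    eLpNorm f 2 μ ^ 2 = ∫⁻ x, ‖f x‖ₑ ^ 2 ∂μ := by
  rw [eLpNorm_eq_lintegral_rpow_enorm_toReal (by norm_num) (by norm_num), ← ENNReal.rpow_natCast,
    ← ENNReal.rpow_mul]
  norm_num

theorem mol_congr (h : f =ᵐ[volume] g) (x : Space d) : mol K f x = mol K g x := by
  refine integral_congr_ae ?_
  have h1 := (quasiMeasurePreserving_sub_left (volume : Measure (Space d)) x).ae h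
  filter_upwards [h1] with t ht
  rw [ht]

theorem lintegral_sq_le_of_probability {α : Type*} [MeasurableSpace α] {ρ : Measure α}
    [IsProbabilityMeasure ρ] {F : α → ℝ≥0∞} (hF : AEMeasurable F ρ) :
    (∫⁻ x, F x ∂ρ) ^ 2 ≤ ∫⁻ x, F x ^ 2 ∂ρ := by
  have h := ENNReal.lintegral_mul_le_Lp_mul_Lq ρ (Real.HolderConjugate.two_two) hF
    (aemeasurable_const (b := (1 : ℝ≥0∞)))
  simp only [Pi.mul_apply, mul_one, ENNReal.one_rpow, lintegral_const, measure_univ] at h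
  calc (∫⁻ x, F x ∂ρ) ^ 2 ≤ ((∫⁻ x, F x ^ (2 : ℝ) ∂ρ) ^ (1 / 2 : ℝ)) ^ 2 := by gcongr
    _ = ∫⁻ x, F x ^ 2 ∂ρ := by
        rw [← ENNReal.rpow_natCast, ← ENNReal.rpow_mul]
        norm_num

/-- Young's inequality for convolutions with probability densities. -/
theorem eLpNorm_mol_le (hK : IsMollifier K R) (hf : AEStronglyMeasurable f) :
    eLpNorm (mol K f) 2 volume ≤ eLpNorm f 2 volume := by
  obtain ⟨f', hf', he⟩ := hf
  rw [eLpNorm_congr_ae he, show mol K f = mol K f' from funext (mol_congr he)]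
  have hk : Measurable fun t => ENNReal.ofReal (K t) :=
    hK.smooth.continuous.measurable.ennreal_ofReal
  have hF : Measurable fun x => ‖f' x‖ₑ := hf'.measurable.enorm
  set ρ : Measure (Space d) := volume.withDensity fun t => ENNReal.ofReal (K t) with hρ
  have : IsProbabilityMeasure ρ := ⟨by rw [hρ, withDensity_apply _ MeasurableSet.univ]; simpa using hK.lintegral⟩
  have key : ∀ x, ‖mol K f' x‖ₑ ^ 2 ≤ ∫⁻ t, ENNReal.ofReal (K t) * ‖f' (x - t)‖ₑ ^ 2 := by
    intro x
    have hm : Measurable fun t => ‖f' (x - t)‖ₑ := hF.comp (by fun_prop)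
    have h1 : ‖mol K f' x‖ₑ ≤ ∫⁻ t, ‖f' (x - t)‖ₑ ∂ρ := by
      rw [hρ, lintegral_withDensity_eq_lintegral_mul _ hk hm]
      refine (enorm_integral_le_lintegral_enorm _).trans (lintegral_mono fun t => ?_)
      rw [enorm_mul, Real.enorm_of_nonneg (hK.nonneg t)]
      rfl
    calc _ ≤ (∫⁻ t, ‖f' (x - t)‖ₑ ∂ρ) ^ 2 := by gcongr
      _ ≤ ∫⁻ t, ‖f' (x - t)‖ₑ ^ 2 ∂ρ := lintegral_sq_le_of_probability hm.aemeasurable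
      _ = _ := by rw [hρ, lintegral_withDensity_eq_lintegral_mul _ hk (hm.pow_const 2)]; rfl
  have h2 : eLpNorm (mol K f') 2 volume ^ 2 ≤ eLpNorm f' 2 volume ^ 2 := by
    rw [eLpNorm_two_sq, eLpNorm_two_sq]
    calc ∫⁻ x, ‖mol K f' x‖ₑ ^ 2 ≤ ∫⁻ x, ∫⁻ t, ENNReal.ofReal (K t) * ‖f' (x - t)‖ₑ ^ 2 :=
          lintegral_mono key
      _ = ∫⁻ t, ∫⁻ x, ENNReal.ofReal (K t) * ‖f' (x - t)‖ₑ ^ 2 := by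
          refine lintegral_lintegral_swap ?_
          have h3 : Measurable fun p : Space d × Space d => ‖f' (p.1 - p.2)‖ₑ :=
            hF.comp (by fun_prop)
          exact ((hk.comp measurable_snd).mul (h3.pow_const 2)).aemeasurable
      _ = ∫⁻ t, ENNReal.ofReal (K t) * ∫⁻ x, ‖f' x‖ₑ ^ 2 := by
          refine lintegral_congr fun t => ?_
          rw [lintegral_const_mul' _ _ ENNReal.ofReal_ne_top,
            lintegral_sub_right_eq_self (fun x => ‖f' x‖ₑ ^ 2) t]
      _ = _ := by rw [lintegral_mul_const _ hk, hK.lintegral, one_mul]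
  exact (ENNReal.pow_le_pow_left_iff (by norm_num)).1 h2

theorem mol_sub (hK : IsMollifier K R) (hf : LocallyIntegrable f) (hg : LocallyIntegrable g) :
    mol K (f - g) = mol K f - mol K g := by
  funext x
  simp only [mol, Pi.sub_apply, mul_sub]
  exact integral_sub (integrable_mol hK hf x) (integrable_mol hK hg x)

/-- `mol K f` at `x` depends only on the values of `f` near `x`. -/
theorem mol_congr_of_ball (hK : IsMollifier K R) {x : Space d}
    (h : ∀ y ∈ Metric.closedBall x R, f y = g y) : mol K f x = mol K g x := by
  refine integral_congr_ae (Eventually.of_forall fun t => ?_)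
  by_cases ht : K t = 0
  · simp [ht]
  · simp only
    rw [h (x - t) (by simpa using hK.support t ht)]

theorem mol_eq_zero_of_ball (hK : IsMollifier K R) {x : Space d}
    (h : ∀ y ∈ Metric.closedBall x R, f y = 0) : mol K f x = 0 := by
  rw [mol_congr_of_ball hK (g := fun _ => 0) h]
  simp [mol]

theorem tsupport_mol_subset (hK : IsMollifier K R) : 
    tsupport (mol K f) ⊆ Metric.cthickening R (tsupport f) :=
  closure_minimal (fun x hx => by
    by_contra h
    refine hx (mol_eq_zero_of_ball hK fun y hy => image_eq_zero_of_notMem_tsupport fun hy' => h ?_)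
    exact Metric.mem_cthickening_of_dist_le x y R _ hy' (by rwa [dist_comm, ← Metric.mem_closedBall]))
    Metric.isClosed_cthickening

theorem hasCompactSupport_mol (hK : IsMollifier K R) (hf : HasCompactSupport f) :
    HasCompactSupport (mol K f) :=
  HasCompactSupport.of_support_subset_isCompact (IsCompact.cthickening hf)
    (subset_closure.trans (tsupport_mol_subset hK))

/-- A three-epsilon argument: replace `f` by a continuous `h` of compact support, at a cost
controlled by Young's inequality, and use uniform continuity of `h`. Only shrinking of the supports
is required, not symmetry of the kernels, so it also applies to one-sided ones. -/
theorem tendsto_eLpNorm_mol {K : ℕ → Space d → ℝ} {R : ℕ → ℝ} (hK : ∀ n, IsMollifier (K n) (R n))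
    (hR : Tendsto R atTop (𝓝 0)) (hf : MemLp f 2 volume) :
    Tendsto (fun n => eLpNorm (mol (K n) f - f) 2 volume) atTop (𝓝 0) := by
  rw [ENNReal.tendsto_nhds_zero]
  intro ε hε
  have hε3 : ε / 3 ≠ 0 := by simp [hε.ne']
  obtain ⟨h, hc, hfh, hcont, hmem⟩ := hf.exists_hasCompactSupport_eLpNorm_sub_le (by norm_num) hε3
  have lf : LocallyIntegrable f := hf.locallyIntegrable (by norm_num)
  have lh : LocallyIntegrable h := hcont.locallyIntegrable
  set S := Metric.cthickening 1 (tsupport h) with hS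
  have hSc : IsCompact S := IsCompact.cthickening hc
  -- Once `R n < 1`, the difference `mol (K n) h - h` lives on `S`, so a uniform bound `δ` gives the
  -- `L²` bound `δ |S|^{1/2}`.
  obtain ⟨δ, hδ, hδε⟩ : ∃ δ : ℝ, 0 < δ ∧ ENNReal.ofReal δ * volume S ^ (1 / (2 : ℝ≥0∞)).toReal ≤ ε / 3 := by
    have h1 : Tendsto (fun δ : ℝ => ENNReal.ofReal δ * volume S ^ (1 / (2 : ℝ≥0∞)).toReal) (𝓝[>] 0) (𝓝 0) := by
      have h2 : Tendsto (fun δ : ℝ => ENNReal.ofReal δ) (𝓝[>] 0) (𝓝 0) := by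
        have := (ENNReal.continuous_ofReal.tendsto 0).mono_left (nhdsWithin_le_nhds (s := Ioi 0))
        simpa using this
      have h3 := ENNReal.Tendsto.mul_const h2
        (Or.inr (ENNReal.rpow_ne_top_of_nonneg (y := (1 / (2 : ℝ≥0∞)).toReal) (by positivity)
          (hSc.measure_lt_top (μ := volume)).ne))
      simpa using h3
    obtain ⟨δ, h2, h3⟩ := ((h1.eventually_le_const (pos_iff_ne_zero.2 hε3)).and self_mem_nhdsWithin).exists
    exact ⟨δ, h3, h2⟩
  obtain ⟨r, hr, hru⟩ := Metric.uniformContinuous_iff.1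
    (hc.uniformContinuous_of_continuous hcont) δ hδ
  have hRs : ∀ᶠ n in atTop, R n < min r 1 := hR.eventually_lt_const (by positivity)
  filter_upwards [hRs] with n hn
  have hn1 := (lt_min_iff.1 hn).1
  have hn2 := (lt_min_iff.1 hn).2
  have e : mol (K n) f - f = mol (K n) (f - h) + ((mol (K n) h - h) - (f - h)) := by
    rw [mol_sub (hK n) lf lh]; abel
  have m1 : AEStronglyMeasurable (mol (K n) (f - h)) volume :=
    (contDiff_mol (hK n) (lf.sub lh)).continuous.aestronglyMeasurable
  have m2 : AEStronglyMeasurable (mol (K n) h - h) volume :=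
    ((contDiff_mol (hK n) lh).continuous.sub hcont).aestronglyMeasurable
  have m3 := hf.1.sub hmem.1
  have b2 : eLpNorm (mol (K n) h - h) 2 volume ≤ ε / 3 := by
    have hz : ∀ x ∉ S, (mol (K n) h - h) x = 0 := fun x hx => by
      have h1 : h x = 0 := image_eq_zero_of_notMem_tsupport fun h' =>
        hx (Metric.self_subset_cthickening _ h')
      have h2 : mol (K n) h x = 0 := image_eq_zero_of_notMem_tsupport fun h' =>
        hx (Metric.cthickening_mono hn2.le _ (tsupport_mol_subset (hK n) h'))
      simp [h1, h2]
    have hb : ∀ x, ‖(mol (K n) h - h) x‖ ≤ δ := fun x => by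
      have h1 : h x = ∫ t, K n t * h x := by rw [integral_mul_const, (hK n).integral_eq_one, one_mul]
      have h2 : (mol (K n) h - h) x = ∫ t, K n t * (h (x - t) - h x) := by
        simp only [Pi.sub_apply, mul_sub]
        rw [integral_sub (integrable_mol (hK n) lh x) ((hK n).integrable.mul_const _), ← h1]
        rfl
      rw [h2]
      have h3 : ∫ t, K n t * δ = δ := by rw [integral_mul_const, (hK n).integral_eq_one, one_mul]
      rw [← h3]
      refine norm_integral_le_of_norm_le ((hK n).integrable.mul_const _) (Eventually.of_forall fun t => ?_)
      rw [norm_mul, Real.norm_of_nonneg ((hK n).nonneg t)]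
      by_cases ht : K n t = 0
      · simp [ht]
      · refine mul_le_mul_of_nonneg_left ?_ ((hK n).nonneg t)
        have := hru (a := x - t) (b := x) (by
          rw [dist_eq_norm]; simpa using ((hK n).support t ht).trans_lt hn1)
        rw [← dist_eq_norm]; exact this.le
    have e2 : eLpNorm (mol (K n) h - h) 2 volume = eLpNorm (mol (K n) h - h) 2 (volume.restrict S) := by
      rw [← eLpNorm_indicator_eq_eLpNorm_restrict hSc.measurableSet]
      congr 1
      funext x
      by_cases hx : x ∈ S
      · rw [indicator_of_mem hx]
      · rw [indicator_of_notMem hx, hz x hx]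
    rw [e2]
    refine (eLpNorm_le_of_ae_bound (C := δ) (Eventually.of_forall hb)).trans ?_
    rw [Measure.restrict_apply_univ, mul_comm]
    simpa using hδε
  rw [e]
  calc _ ≤ eLpNorm (mol (K n) (f - h)) 2 volume + (eLpNorm (mol (K n) h - h) 2 volume + eLpNorm (f - h) 2 volume) :=
        (eLpNorm_add_le m1 (m2.sub m3) (by norm_num)).trans
          (add_le_add le_rfl (eLpNorm_sub_le m2 m3 (by norm_num)))
    _ ≤ ε / 3 + (ε / 3 + ε / 3) := by
        gcongr
        exact (eLpNorm_mol_le (hK n) m3).trans hfh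
    _ = ε := by rw [← add_assoc, ENNReal.add_thirds]

theorem pderiv_mol_eq (hK : IsMollifier K R) (hf : LocallyIntegrable f) (i : Fin d) (x : Space d) :
    pderiv i (mol K f) x = ∫ t, pderiv i K t * f (x - t) := by
  have h1 : ContDiff ℝ 1 K := contDiff_infty.1 hK.smooth 1
  have hd : DifferentiableAt ℝ (mol K f) x :=
    ((contDiff_infty.1 (contDiff_mol hK hf) 1).differentiable (by simp)) x
  have h := hK.hasCompactSupport.hasFDerivAt_convolution_left (ContinuousLinearMap.lsmul ℝ ℝ)
    (μ := volume) h1 hf x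
  rw [← mol_eq_convolution] at h
  rw [pderiv_eq_fderiv hd, h.fderiv, convolution]
  have hi := (hK.hasCompactSupport.fderiv ℝ).convolutionExists_left
    ((ContinuousLinearMap.lsmul ℝ ℝ).precompL (Space d)) (h1.continuous_fderiv (by simp)) hf x
  rw [ContinuousLinearMap.integral_apply hi]
  refine integral_congr_ae (Eventually.of_forall fun t => ?_)
  simp only [ContinuousLinearMap.precompL_apply, ContinuousLinearMap.lsmul_apply, smul_eq_mul]
  rw [pderiv_eq_fderiv ((h1.differentiable (by simp)) t)]

/-- Mollification commutes with weak derivatives, away from the boundary. -/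
theorem pderiv_mol (hK : IsMollifier K R) {O : Set (Space d)} (hO : IsOpen O) {i : Fin d}
    (h : HasWeakPartial O i f g) (hf : LocallyIntegrable (O.indicator f)) {x : Space d}
    (hx : ∀ t ∈ tsupport K, x - t ∈ O) :
    pderiv i (mol K (O.indicator f)) x = mol K (O.indicator g) x := by
  have h1 : ContDiff ℝ 1 K := contDiff_infty.1 hK.smooth 1
  -- The function `K(x - ·)` itself serves as the test function; this is why `x - t` has to stay in
  -- `O` on the whole support of `K`.
  have hs : tsupport (fun y => K (x - y)) ⊆ O := by
    have hcl : IsClosed ((fun y => x - y) ⁻¹' tsupport K) :=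
      (isClosed_tsupport K).preimage (by fun_prop)
    have hcl2 : tsupport (fun y => K (x - y)) ⊆ (fun y => x - y) ⁻¹' tsupport K :=
      closure_minimal (fun y hy => subset_tsupport K hy) hcl
    refine hcl2.trans fun y hy => ?_
    simpa using hx _ hy
  have hφ : IsTest O fun y => K (x - y) := by
    refine ⟨hK.smooth.comp (contDiff_const.sub contDiff_id), ?_, hs⟩
    exact hK.hasCompactSupport.comp_homeomorph (Homeomorph.subLeft x)
  have e : ∀ y, pderiv i (fun y => K (x - y)) y = - pderiv i K (x - y) := fun y => by
    have hd := (h1.differentiable (by simp)) (x - y)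
    have h2 : HasFDerivAt (fun y => K (x - y)) ((fderiv ℝ K (x - y)).comp (-ContinuousLinearMap.id ℝ (Space d))) y :=
      hd.hasFDerivAt.comp y ((hasFDerivAt_id y).const_sub x)
    rw [pderiv_eq_fderiv h2.differentiableAt, h2.fderiv, pderiv_eq_fderiv hd]
    simp
  have key := h.2.2 _ hφ
  have ind : ∀ (u v : Space d → ℝ), ∫ y in O, u y * v y = ∫ y, v y * O.indicator u y := fun u v => by
    rw [← integral_indicator hO.measurableSet]
    refine integral_congr_ae (Eventually.of_forall fun y => ?_)
    by_cases hy : y ∈ O <;> simp [hy, mul_comm]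
  rw [ind, ind] at key
  rw [pderiv_mol_eq hK hf, mol,
    ← integral_sub_left_eq_self (fun t => pderiv i K t * O.indicator f (x - t)) volume x,
    ← integral_sub_left_eq_self (fun t => K t * O.indicator g (x - t)) volume x]
  simp only [sub_sub_cancel]
  simp only [e, neg_mul, integral_neg, neg_inj] at key
  exact key

end PINN

/-! ### Product rules and integration by parts for weak derivatives -/

namespace PINN

variable {d : ℕ}

theorem isMollifier_bump (n : ℕ) :
    IsMollifier (d := d) ((bump n).normed volume) (scale n) where
  smooth := (bump n).contDiff_normed
  nonneg := (bump n).nonneg_normed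
  integral_eq_one := (bump n).integral_normed
  support t ht := by
    have h : t ∈ Function.support ((bump n).normed (volume : Measure (Space d))) := ht
    rw [(bump n).support_normed_eq] at h
    exact (mem_ball_zero_iff.1 h).le

theorem exists_isTest_one_nhds {K O : Set (Space d)} (hK : IsCompact K) (hO : IsOpen O)
    (h : K ⊆ O) : ∃ ζ : Space d → ℝ, IsTest O ζ ∧ (∀ᶠ x in 𝓝ˢ K, ζ x = 1) ∧ ∀ x, ζ x ∈ Icc (0 : ℝ) 1 := by
  obtain ⟨δ, hδ, hs⟩ := hK.exists_cthickening_subset_open hO h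
  have hc : IsCompact (Metric.cthickening δ K) := hK.cthickening
  obtain ⟨f, h1, h0, hI⟩ := exists_contMDiffMap_one_nhds_of_subset_interior
    (modelWithCornersSelf ℝ (Space d)) (n := ⊤) hK.isClosed
    ((Metric.self_subset_thickening hδ K).trans (Metric.thickening_subset_interior_cthickening δ K))
  have hsub : tsupport (f : Space d → ℝ) ⊆ Metric.cthickening δ K :=
    closure_minimal (fun x hx => by
      by_contra hn
      exact hx (h0 x hn)) Metric.isClosed_cthickening
  exact ⟨f, ⟨f.contMDiff.contDiff, hc.of_isClosed_subset (isClosed_tsupport _) hsub,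
    hsub.trans hs⟩, h1, hI⟩

theorem _root_.MeasureTheory.LocallyIntegrableOn.integrable_mul_continuous {O : Set (Space d)}
    {f φ : Space d → ℝ} (hf : LocallyIntegrableOn f O) (hφ : Continuous φ)
    (hc : HasCompactSupport φ) (hs : tsupport φ ⊆ O) :
    Integrable (fun x => f x * φ x) := by
  have hk : IntegrableOn f (tsupport φ) := hf.integrableOn_compact_subset hs hc
  refine (integrableOn_iff_integrable_of_support_subset ?_).1 (hk.mul_continuousOn hφ.continuousOn hc)
  intro x hx
  by_contra hcon
  exact hx (by simp [image_eq_zero_of_notMem_tsupport hcon])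

/-- Weak derivatives may be tested with compactly supported functions of class `C^2`. -/
theorem HasWeakPartial.integral_eq {O : Set (Space d)} {i : Fin d}
    {f g ψ : Space d → ℝ} (h : HasWeakPartial O i f g) (hO : IsOpen O) (hψ : ContDiff ℝ 2 ψ)
    (hc : HasCompactSupport ψ) (hs : tsupport ψ ⊆ O) :
    ∫ x, f x * pderiv i ψ x = - ∫ x, g x * ψ x := by
  obtain ⟨δ, hδ, hδO⟩ := hc.exists_cthickening_subset_open hO hs
  set C := Metric.cthickening δ (tsupport ψ) with hC
  have hCc : IsCompact C := IsCompact.cthickening hc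
  -- The mollifications of `ψ` are legitimate test functions, eventually supported in one compact `C
  -- ⊆ O`, on which `f` and `g` are integrable; dominated convergence then removes the
  -- mollification.
  have jt := jetTendsto_mollify (K := univ) hψ hc
  set q : ℕ → Space d → ℝ := fun n => mol ((bump n).normed volume) ψ with hq
  have hsm : ∀ n, ContDiff ℝ ∞ (q n) := fun n =>
    contDiff_mol (isMollifier_bump n) hψ.continuous.locallyIntegrable
  obtain ⟨B, hB⟩ := jt.bounded
  have hB0 : ∀ n x, |q n x| ≤ B := fun n x => (abs_le_jetAbs _ _).trans (hB n x trivial)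
  have hB1 : ∀ n x, |pderiv i (q n) x| ≤ B := fun n x =>
    (abs_pderiv_le_jetAbs _ _ _).trans (hB n x trivial)
  have hsup : ∀ᶠ n in atTop, tsupport (q n) ⊆ C := by
    filter_upwards [tendsto_scale.eventually_le_const hδ] with n hn
    exact (tsupport_mol_subset (isMollifier_bump n)).trans (Metric.cthickening_mono hn _)
  have hqc : ∀ n, HasCompactSupport (q n) := fun n => hasCompactSupport_mol (isMollifier_bump n) hc
  have lim : ∀ (u : Space d → ℝ) (s : ℕ → Space d → ℝ) (s' : Space d → ℝ), LocallyIntegrableOn u O →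
      (∀ n, Continuous (s n)) → (∀ n, HasCompactSupport (s n)) → (∀ n x, |s n x| ≤ B) →
      (∀ᶠ n in atTop, tsupport (s n) ⊆ C) → (∀ x, Tendsto (fun n => s n x) atTop (𝓝 (s' x))) →
      Tendsto (fun n => ∫ x, u x * s n x) atTop (𝓝 (∫ x, u x * s' x)) := by
    intro u s s' hu h1 h2 h3 h4 h5
    have hi : Integrable (C.indicator fun x => |u x| * B) := by
      rw [integrable_indicator_iff hCc.measurableSet]
      exact (hu.integrableOn_compact_subset hδO hCc).abs.mul_const _
    refine tendsto_integral_filter_of_dominated_convergence _ ?_ ?_ hi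
      (Eventually.of_forall fun x => (h5 x).const_mul _)
    · filter_upwards [h4] with n hn
      exact (hu.integrable_mul_continuous (h1 n) (h2 n) (hn.trans hδO)).1
    · filter_upwards [h4] with n hn
      refine Eventually.of_forall fun x => ?_
      by_cases hx : x ∈ C
      · rw [indicator_of_mem hx, norm_mul, Real.norm_eq_abs, Real.norm_eq_abs]
        exact mul_le_mul_of_nonneg_left (h3 n x) (abs_nonneg _)
      · rw [indicator_of_notMem hx, image_eq_zero_of_notMem_tsupport fun h' => hx (hn h')]
        simp
  have hsm1 : ∀ n, ContDiff ℝ 1 (q n) := fun n => contDiff_infty.1 (hsm n) 1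
  have l1 := lim f (fun n => pderiv i (q n)) (pderiv i ψ) h.1 (fun n => continuous_pderiv (hsm1 n) i)
    (fun n => hasCompactSupport_pderiv (hqc n) i) hB1
    (hsup.mono fun n hn => (tsupport_pderiv_subset _ i).trans hn)
    (fun x => jt.tendsto₁ i x trivial)
  have l2 := lim g q ψ h.2.1 (fun n => (hsm n).continuous) hqc hB0 hsup
    (fun x => jt.tendsto₀ x trivial)
  refine tendsto_nhds_unique l1 (l2.neg.congr' ?_)
  filter_upwards [hsup] with n hn
  have ht : IsTest O (q n) := ⟨hsm n, hqc n, hn.trans hδO⟩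
  have := h.2.2 _ ht
  rw [setIntegral_mul_of_tsupport_subset ht.2.2,
    setIntegral_mul_of_tsupport_subset (ht.pderiv i).2.2] at this
  exact this.symm

theorem contDiff_mul_of_tsupport_subset {O : Set (Space d)} {n : ℕ∞ω} {m φ : Space d → ℝ} (hO : IsOpen O)
    (hm : ContDiffOn ℝ n m O) (hφ : ContDiff ℝ n φ) (hs : tsupport φ ⊆ O) :
    ContDiff ℝ n fun x => m x * φ x := by
  rw [contDiff_iff_contDiffAt]
  intro x
  by_cases hx : x ∈ O
  · exact (hm.contDiffAt (hO.mem_nhds hx)).mul hφ.contDiffAt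
  · have h1 : φ =ᶠ[𝓝 x] fun _ => 0 := notMem_tsupport_iff_eventuallyEq.1 fun h => hx (hs h)
    refine (contDiffAt_const (c := (0 : ℝ))).congr_of_eventuallyEq ?_
    filter_upwards [h1] with y hy
    simp [hy]

theorem tsupport_mul_subset_right' (m φ : Space d → ℝ) : tsupport (fun x => m x * φ x) ⊆ tsupport φ :=
  tsupport_mul_subset_right

theorem continuousOn_pderiv {O : Set (Space d)} {m : Space d → ℝ} (hO : IsOpen O)
    (hm : ContDiffOn ℝ 1 m O) (i : Fin d) : ContinuousOn (pderiv i m) O := by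
  have h1 : ContinuousOn (fun x => fderiv ℝ m x (bvec i)) O :=
    (hm.continuousOn_fderiv_of_isOpen hO le_rfl).clm_apply continuousOn_const
  refine h1.congr fun x hx => ?_
  exact pderiv_eq_fderiv ((hm.contDiffAt (hO.mem_nhds hx)).differentiableAt (by simp)) i

/-- The product rule, tested with a function supported in `O`. -/
theorem HasWeakPartial.integral_mul_eq {O : Set (Space d)} {i : Fin d} {f g m ψ : Space d → ℝ}
    (h : HasWeakPartial O i f g) (hO : IsOpen O) (hm : ContDiffOn ℝ 2 m O) (hψ : ContDiff ℝ 2 ψ)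
    (hc : HasCompactSupport (fun x => m x * ψ x)) (hs : tsupport (fun x => m x * ψ x) ⊆ O)
    (hsm : ContDiff ℝ 2 (fun x => m x * ψ x))
    (hi : Integrable fun x => (pderiv i m x * f x) * ψ x)
    (hi' : Integrable fun x => (m x * g x) * ψ x)
    (hout : ∀ x ∉ O, m x * pderiv i ψ x = 0 ∧ pderiv i m x * ψ x = 0) :
    ∫ x, (m x * f x) * pderiv i ψ x = - ∫ x, (pderiv i m x * f x + m x * g x) * ψ x := by
  have key := h.integral_eq hO hsm hc hs
  have e : ∀ x, pderiv i (fun x => m x * ψ x) x = pderiv i m x * ψ x + m x * pderiv i ψ x := fun x => by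
    by_cases hx : x ∈ O
    · exact pderiv_mul ((hm.contDiffAt (hO.mem_nhds hx)).differentiableAt (by simp))
        (hψ.differentiable (by simp) x) i
    · rw [pderiv_eq_zero_of_notMem_tsupport (fun h => hx (hs h)), (hout x hx).1, (hout x hx).2, add_zero]
  have hj : Integrable fun x => f x * pderiv i (fun x => m x * ψ x) x :=
    h.1.integrable_mul_continuous (continuous_pderiv (hsm.of_le (by norm_num)) i)
      (hasCompactSupport_pderiv hc i) ((tsupport_pderiv_subset _ i).trans hs)
  have e1 : (fun x => (m x * f x) * pderiv i ψ x) =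
      fun x => f x * pderiv i (fun x => m x * ψ x) x - (pderiv i m x * f x) * ψ x := by
    funext x; rw [e]; ring
  have e2 : (fun x => (pderiv i m x * f x + m x * g x) * ψ x) =
      fun x => (pderiv i m x * f x) * ψ x + (m x * g x) * ψ x := by
    funext x; ring
  have e3 : ∫ x, (m x * g x) * ψ x = ∫ x, g x * (m x * ψ x) :=
    integral_congr_ae (Eventually.of_forall fun x => by simp only; ring)
  rw [e1, e2, integral_sub hj hi, integral_add hi hi', key, e3]
  ring

/-- The factor is required to be smooth on `O` only, since the main use is `m = 1/η`, which blows up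
at the boundary. Times a test function it becomes a `C²` function on the whole space. -/
theorem HasWeakPartial.mul_left {O : Set (Space d)} {i : Fin d} {f g m : Space d → ℝ}
    (h : HasWeakPartial O i f g) (hO : IsOpen O) (hm : ContDiffOn ℝ 2 m O) :
    HasWeakPartial O i (fun x => m x * f x) (fun x => pderiv i m x * f x + m x * g x) := by
  have cm := hm.continuousOn
  have cm1 := continuousOn_pderiv hO (hm.of_le (by norm_num)) i
  have l1 : LocallyIntegrableOn (fun x => m x * f x) O := h.1.continuousOn_mul cm hO.isLocallyClosed
  have l2 : LocallyIntegrableOn (fun x => pderiv i m x * f x) O :=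
    h.1.continuousOn_mul cm1 hO.isLocallyClosed
  have l3 : LocallyIntegrableOn (fun x => m x * g x) O := h.2.1.continuousOn_mul cm hO.isLocallyClosed
  refine ⟨l1, l2.add l3, fun φ hφ => ?_⟩
  rw [setIntegral_mul_of_tsupport_subset hφ.2.2, setIntegral_mul_of_tsupport_subset (hφ.pderiv i).2.2]
  have h2 : ContDiff ℝ 2 φ := contDiff_infty.1 hφ.1 2
  have ts := tsupport_mul_subset_right' m φ
  refine h.integral_mul_eq hO hm h2 (hφ.2.1.of_isClosed_subset (isClosed_tsupport _) ts)
    (ts.trans hφ.2.2) (contDiff_mul_of_tsupport_subset hO hm h2 hφ.2.2)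
    (l2.integrable_mul_continuous hφ.1.continuous hφ.2.1 hφ.2.2)
    (l3.integrable_mul_continuous hφ.1.continuous hφ.2.1 hφ.2.2) fun x hx => ?_
  have hx' : x ∉ tsupport φ := fun h' => hx (hφ.2.2 h')
  simp [pderiv_eq_zero_of_notMem_tsupport hx', image_eq_zero_of_notMem_tsupport hx']

/-- A function on `O` times a function supported in `O` has weak derivatives on the whole space. -/
theorem HasWeakPartial.test_mul {O : Set (Space d)} {i : Fin d} {f g ζ : Space d → ℝ}
    (h : HasWeakPartial O i f g) (hO : IsOpen O) (hζ : ContDiff ℝ 2 ζ) (hc : HasCompactSupport ζ)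
    (hs : tsupport ζ ⊆ O) :
    HasWeakPartial univ i (fun x => ζ x * f x) (fun x => pderiv i ζ x * f x + ζ x * g x) := by
  have cp := continuous_pderiv (hζ.of_le (by norm_num)) i
  have l1 : Integrable (fun x => ζ x * f x) := by
    simpa only [mul_comm] using h.1.integrable_mul_continuous hζ.continuous hc hs
  have l2 : Integrable (fun x => pderiv i ζ x * f x) := by
    simpa only [mul_comm] using h.1.integrable_mul_continuous cp (hasCompactSupport_pderiv hc i)
      ((tsupport_pderiv_subset _ i).trans hs)
  have l3 : Integrable (fun x => ζ x * g x) := by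
    simpa only [mul_comm] using h.2.1.integrable_mul_continuous hζ.continuous hc hs
  refine ⟨l1.locallyIntegrable.locallyIntegrableOn _, (l2.add l3).locallyIntegrable.locallyIntegrableOn _,
    fun φ hφ => ?_⟩
  rw [setIntegral_univ, setIntegral_univ]
  have h2 : ContDiff ℝ 2 φ := contDiff_infty.1 hφ.1 2
  have ts : tsupport (fun x => ζ x * φ x) ⊆ tsupport ζ := tsupport_mul_subset_left
  refine h.integral_mul_eq hO hζ.contDiffOn h2 (hc.of_isClosed_subset (isClosed_tsupport _) ts)
    (ts.trans hs) (hζ.mul h2)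
    ((l2.locallyIntegrable.locallyIntegrableOn univ).integrable_mul_continuous hφ.1.continuous hφ.2.1
      (subset_univ _))
    ((l3.locallyIntegrable.locallyIntegrableOn univ).integrable_mul_continuous hφ.1.continuous hφ.2.1
      (subset_univ _)) fun x hx => ?_
  have hx' : x ∉ tsupport ζ := fun h' => hx (hs h')
  simp [pderiv_eq_zero_of_notMem_tsupport hx', image_eq_zero_of_notMem_tsupport hx']

/-- If `f n → F` and `g n → G` in `L²` and `b` is bounded, then `∫ f n * g n * b → ∫ F * G * b`. -/
theorem tendsto_integral_mul_mul {α : Type*} [MeasurableSpace α] {μ : Measure α} {f g : ℕ → α → ℝ}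
    {F G b : α → ℝ} {C : ℝ} (hf : ∀ n, MemLp (f n) 2 μ) (hg : ∀ n, MemLp (g n) 2 μ) (hF : MemLp F 2 μ)
    (hG : MemLp G 2 μ) (hb : AEStronglyMeasurable b μ) (hbC : ∀ x, |b x| ≤ C)
    (h1 : Tendsto (fun n => eLpNorm (f n - F) 2 μ) atTop (𝓝 0))
    (h2 : Tendsto (fun n => eLpNorm (g n - G) 2 μ) atTop (𝓝 0)) :
    Tendsto (fun n => ∫ x, f n x * (b x * g n x) ∂μ) atTop (𝓝 (∫ x, F x * (b x * G x) ∂μ)) := by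
  have hbC' : ∀ᵐ x ∂μ, |b x| ≤ C := Eventually.of_forall hbC
  have a1 := tendsto_integral_mul_of_eLpNorm hf hF (hG.bdd_mul_of_ae hb hbC') h1
  have a2 : Tendsto (fun n => ∫ x, F x * (b x * g n x) ∂μ) atTop (𝓝 (∫ x, F x * (b x * G x) ∂μ)) := by
    have := tendsto_integral_mul_of_eLpNorm (fun n => (hg n).bdd_mul_of_ae hb hbC')
      (hG.bdd_mul_of_ae hb hbC') hF (eLpNorm_tendsto_mul_bdd hbC' h2)
    simpa only [mul_comm] using this
  have a3 : Tendsto (fun n => ∫ x, (f n x - F x) * (b x * (g n x - G x)) ∂μ) atTop (𝓝 0) := by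
    have e1 := eLpNorm_tendsto_mul_bdd hbC' h2
    have e2 := ENNReal.Tendsto.mul h1 (Or.inr (by simp)) e1 (Or.inr (by simp))
    rw [zero_mul] at e2
    have e3 := (ENNReal.tendsto_toReal ENNReal.zero_ne_top).comp e2
    rw [ENNReal.toReal_zero] at e3
    refine squeeze_zero_norm (fun n => ?_) e3
    have m1 := (hf n).sub hF
    have m2 := ((hg n).bdd_mul_of_ae hb hbC').sub (hG.bdd_mul_of_ae hb hbC')
    have := abs_integral_mul_le m1.1 m2.1
    rw [← ENNReal.ofReal_toReal (ENNReal.mul_ne_top m1.2.ne m2.2.ne)] at this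
    have := (ENNReal.ofReal_le_ofReal_iff ENNReal.toReal_nonneg).1 this
    simp only [Pi.sub_apply, ← mul_sub] at this
    exact this
  have a4 := (a3.add a1).add (a2.sub (tendsto_const_nhds (x := ∫ x, F x * (b x * G x) ∂μ)))
  have i := fun {u v : α → ℝ} (hu : MemLp u 2 μ) (hv : MemLp v 2 μ) =>
    hu.integrable_mul (hv.bdd_mul_of_ae hb hbC')
  rw [sub_self, zero_add, add_zero] at a4
  refine a4.congr fun n => ?_
  have e : ∀ x, (f n x - F x) * (b x * (g n x - G x)) = f n x * (b x * g n x) - f n x * (b x * G x)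
      - (F x * (b x * g n x) - F x * (b x * G x)) := fun x => by ring
  simp only [e]
  have I1 := i (hf n) (hg n)
  have I2 := i (hf n) hG
  have I3 := i hF (hg n)
  have I4 := i hF hG
  have s1 := integral_sub (I1.sub I2) (I3.sub I4)
  have s2 := integral_sub I1 I2
  have s3 := integral_sub I3 I4
  simp only [Pi.mul_apply, Pi.sub_apply] at s1 s2 s3
  rw [s1, s2, s3]
  ring

/-- Integration by parts for the square of a function with a square-integrable weak derivative. -/
theorem HasWeakPartial.integral_sq_eq {i : Fin d} {f g : Space d → ℝ} {Ψ : Space d → ℝ}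
    (h : HasWeakPartial univ i f g) (hf : MemLp f 2 volume) (hg : MemLp g 2 volume)
    (hΨ : ContDiff ℝ 1 Ψ) (hc : HasCompactSupport Ψ) :
    ∫ x, f x * (pderiv i Ψ x * f x) = - (2 * ∫ x, f x * (Ψ x * g x)) := by
  have lf : LocallyIntegrable f := hf.locallyIntegrable (by norm_num)
  have lg : LocallyIntegrable g := hg.locallyIntegrable (by norm_num)
  have hK := fun n => isMollifier_bump (d := d) n
  -- For the smooth `F n` the identity is integration by parts applied to `(F n)²`; both sides pass
  -- to the limit because products of `L²`-convergent sequences with a bounded factor converge.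
  set F : ℕ → Space d → ℝ := fun n => mol ((bump n).normed volume) f
  set G : ℕ → Space d → ℝ := fun n => mol ((bump n).normed volume) g
  have sF : ∀ n, ContDiff ℝ 1 (F n) := fun n => contDiff_infty.1 (contDiff_mol (hK n) lf) 1
  have mF : ∀ n, MemLp (F n) 2 volume := fun n =>
    ⟨(sF n).continuous.aestronglyMeasurable, (eLpNorm_mol_le (hK n) hf.1).trans_lt hf.2⟩
  have mG : ∀ n, MemLp (G n) 2 volume := fun n =>
    ⟨(contDiff_mol (hK n) lg).continuous.aestronglyMeasurable, (eLpNorm_mol_le (hK n) hg.1).trans_lt hg.2⟩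
  have tF := tendsto_eLpNorm_mol hK tendsto_scale hf
  have tG := tendsto_eLpNorm_mol hK tendsto_scale hg
  have dF : ∀ n x, pderiv i (F n) x = G n x := fun n x => by
    have := pderiv_mol (hK n) isOpen_univ h (by simpa using lf) (x := x) (by simp)
    simpa only [indicator_univ] using this
  have cp := continuous_pderiv hΨ i
  obtain ⟨C, hC⟩ := hΨ.continuous.bounded_above_of_compact_support hc
  obtain ⟨C', hC'⟩ := cp.bounded_above_of_compact_support (hasCompactSupport_pderiv hc i)
  have l1 := tendsto_integral_mul_mul mF mF hf hf cp.aestronglyMeasurable hC' tF tF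
  have l2 := tendsto_integral_mul_mul mF mG hf hg hΨ.continuous.aestronglyMeasurable hC tF tG
  refine tendsto_nhds_unique l1 (((l2.const_mul 2).neg).congr fun n => ?_)
  have := integral_mul_pderiv ((sF n).mul (sF n)) hΨ (Or.inr hc) i
  have e1 : ∀ x, pderiv i (fun y => F n y * F n y) x = 2 * (F n x * G n x) := fun x => by
    have hd := (sF n).differentiable (by simp) x
    have := pderiv_mul hd hd i
    rw [this, dF]; ring
  rw [← integral_const_mul, show (∫ x, F n x * (pderiv i Ψ x * F n x)) = ∫ x, F n x * F n x * pderiv i Ψ x from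
    integral_congr_ae (Eventually.of_forall fun x => by simp only; ring), this]
  congr 1
  refine integral_congr_ae (Eventually.of_forall fun x => ?_)
  simp only
  rw [e1]; ring

theorem memLp_mul_of_compact {O : Set (Space d)} {f ζ : Space d → ℝ}
    (hf : ∀ C ⊆ O, IsCompact C → MemLp f 2 (volume.restrict C)) (hζ : Continuous ζ)
    (hc : HasCompactSupport ζ) (hs : tsupport ζ ⊆ O) : MemLp (fun x => ζ x * f x) 2 volume := by
  obtain ⟨B, hB⟩ := hζ.bounded_above_of_compact_support hc
  have h1 := (hf _ hs hc).bdd_mul_of_ae (b := ζ) hζ.aestronglyMeasurable (Eventually.of_forall hB)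
  rw [← memLp_indicator_iff_restrict (isClosed_tsupport ζ).measurableSet] at h1
  refine (memLp_congr_ae (Eventually.of_forall fun x => ?_)).1 h1
  by_cases hx : x ∈ tsupport ζ
  · rw [indicator_of_mem hx]
  · rw [indicator_of_notMem hx, image_eq_zero_of_notMem_tsupport hx, zero_mul]

/-- Multiplying `f` by a cutoff equal to one near the support of `Ψ` produces a function on the
whole space and changes neither side. Square integrability on compact subsets of `O` is therefore
enough. -/
theorem HasWeakPartial.integral_sq_eq_of_tsupport_subset {O : Set (Space d)} {i : Fin d}
    {f g : Space d → ℝ} {Ψ : Space d → ℝ} (h : HasWeakPartial O i f g) (hO : IsOpen O)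
    (hf : ∀ C ⊆ O, IsCompact C → MemLp f 2 (volume.restrict C))
    (hg : ∀ C ⊆ O, IsCompact C → MemLp g 2 (volume.restrict C))
    (hΨ : ContDiff ℝ 1 Ψ) (hc : HasCompactSupport Ψ) (hs : tsupport Ψ ⊆ O) :
    ∫ x, f x * (pderiv i Ψ x * f x) = - (2 * ∫ x, f x * (Ψ x * g x)) := by
  obtain ⟨ζ, hζ, h1, -⟩ := exists_isTest_one_nhds hc hO hs
  have hζ2 : ContDiff ℝ 2 ζ := contDiff_infty.1 hζ.1 2
  have key := (h.test_mul hO hζ2 hζ.2.1 hζ.2.2).integral_sq_eq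
    (memLp_mul_of_compact hf hζ.1.continuous hζ.2.1 hζ.2.2)
    ((memLp_mul_of_compact hf (hζ.pderiv i).1.continuous (hζ.pderiv i).2.1 (hζ.pderiv i).2.2).add
      (memLp_mul_of_compact hg hζ.1.continuous hζ.2.1 hζ.2.2)) hΨ hc
  have e1 : ∀ x ∈ tsupport Ψ, ζ x = 1 := fun x hx => h1.self_of_nhdsSet x hx
  have e2 : ∀ x ∈ tsupport Ψ, pderiv i ζ x = 0 := fun x hx => by
    have : ζ =ᶠ[𝓝 x] fun _ => 1 := h1.filter_mono (nhds_le_nhdsSet hx)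
    rw [pderiv_congr_of_eventuallyEq this, pderiv_const]
  rw [show (∫ x, f x * (pderiv i Ψ x * f x)) = ∫ x, ζ x * f x * (pderiv i Ψ x * (ζ x * f x)) from ?_, key,
    show (∫ x, f x * (Ψ x * g x)) = ∫ x, ζ x * f x * (Ψ x * (pderiv i ζ x * f x + ζ x * g x)) from ?_]
  · refine integral_congr_ae (Eventually.of_forall fun x => ?_)
    by_cases hx : x ∈ tsupport Ψ
    · simp [e1 x hx, e2 x hx]
    · simp [image_eq_zero_of_notMem_tsupport hx]
  · refine integral_congr_ae (Eventually.of_forall fun x => ?_)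
    by_cases hx : x ∈ tsupport Ψ
    · simp [e1 x hx]
    · simp [pderiv_eq_zero_of_notMem_tsupport hx]

end PINN

/-! ### Hardy's inequality: division by `η` in `H^1_0` -/

namespace PINN

variable {d : ℕ}

theorem HasWeakPartial.add {O : Set (Space d)} {i : Fin d} {f₁ f₂ g₁ g₂ : Space d → ℝ}
    (h₁ : HasWeakPartial O i f₁ g₁) (h₂ : HasWeakPartial O i f₂ g₂) :
    HasWeakPartial O i (f₁ + f₂) (g₁ + g₂) := by
  have := h₁.sub (h₂.const_smul (-1))
  simpa only [neg_smul, one_smul, sub_neg_eq_add] using this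

theorem HasWeakPartial.sum_smul {ι : Type*} (s : Finset ι) (c : ι → ℝ) {O : Set (Space d)} {i : Fin d}
    {f g : ι → Space d → ℝ} (h : ∀ k, HasWeakPartial O i (f k) (g k)) :
    HasWeakPartial O i (∑ k ∈ s, c k • f k) (∑ k ∈ s, c k • g k) := by
  classical
  induction s using Finset.induction_on with
  | empty => simpa using (isH2_zero O).4 i
  | insert a s ha ih =>
    rw [Finset.sum_insert ha, Finset.sum_insert ha]
    exact ((h a).const_smul (c a)).add ih

section L2

variable {α : Type*} [MeasurableSpace α] {μ : Measure α}

theorem memLp_of_tendsto_ae {f : ℕ → α → ℝ} {F : α → ℝ} {C : ℝ≥0∞} (hC : C ≠ ⊤)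
    (hf : ∀ n, AEStronglyMeasurable (f n) μ) (hb : ∀ᶠ n in atTop, eLpNorm (f n) 2 μ ≤ C)
    (h : ∀ᵐ x ∂μ, Tendsto (fun n => f n x) atTop (𝓝 (F x))) : MemLp F 2 μ := by
  refine ⟨aestronglyMeasurable_of_tendsto_ae atTop hf h, ?_⟩
  refine (Lp.eLpNorm_lim_le_liminf_eLpNorm hf F h).trans_lt (lt_of_le_of_lt ?_ hC.lt_top)
  exact liminf_le_of_frequently_le' hb.frequently

theorem ofReal_integral_sq {f : α → ℝ} (hf : MemLp f 2 μ) :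
    ENNReal.ofReal (∫ x, f x ^ 2 ∂μ) = eLpNorm f 2 μ ^ 2 := by
  rw [ofReal_integral_eq_lintegral_ofReal hf.integrable_sq (Eventually.of_forall fun x => sq_nonneg _)]
  have h1 := eLpNorm_two_sq μ f
  rw [h1]
  refine lintegral_congr fun x => ?_
  rw [← sq_abs, ENNReal.ofReal_pow (abs_nonneg _), ← Real.norm_eq_abs, ofReal_norm]

/-- Cauchy-Schwarz on the right, then division by `‖w‖`, which is legitimate because that norm is
already known to be finite. Both Hardy inequalities end this way, so each is first proved for
regularized functions. -/
theorem eLpNorm_le_of_integral_sq_le {w h : α → ℝ} {c C : ℝ} (hc : 0 < c) (hw : MemLp w 2 μ)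
    (hh : MemLp h 2 μ) (hle : c * ∫ x, w x ^ 2 ∂μ ≤ C * |∫ x, w x * h x ∂μ|) (hC : 0 ≤ C) :
    eLpNorm w 2 μ ≤ ENNReal.ofReal (C / c) * eLpNorm h 2 μ := by
  have h1 := abs_integral_mul_le hw.1 hh.1
  have h2 : eLpNorm w 2 μ ^ 2 ≤ ENNReal.ofReal (C / c) * (eLpNorm w 2 μ * eLpNorm h 2 μ) := by
    rw [← ofReal_integral_sq hw]
    calc _ ≤ ENNReal.ofReal (C / c * |∫ x, w x * h x ∂μ|) := by
          refine ENNReal.ofReal_le_ofReal ?_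
          rw [div_mul_eq_mul_div, le_div_iff₀ hc]
          linarith
      _ ≤ _ := by
          rw [ENNReal.ofReal_mul (by positivity)]
          gcongr
  rcases eq_or_ne (eLpNorm w 2 μ) 0 with h0 | h0
  · rw [h0]; exact zero_le
  · rw [pow_two, mul_left_comm] at h2
    exact (ENNReal.mul_le_mul_iff_right h0 hw.2.ne).1 h2

end L2

/-- The derivative of `f` in the direction `e`. -/
noncomputable def dirDeriv (e : Space d) (f : Space d → ℝ) (x : Space d) : ℝ := ∑ l, e l * pderiv l f x

theorem sum_smul_bvec (e : Space d) : ∑ l, e l • bvec l = e := by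
  ext j
  simp [bvec, Finset.sum_apply, Pi.single_apply]

theorem dirDeriv_eq_fderiv {f : Space d → ℝ} {x : Space d} (hf : DifferentiableAt ℝ f x) (e : Space d) :
    dirDeriv e f x = fderiv ℝ f x e := by
  conv_rhs => rw [← sum_smul_bvec e]
  simp [dirDeriv, pderiv_eq_fderiv hf]

theorem integral_pderiv_eq_zero {f : Space d → ℝ} (hf : ContDiff ℝ 1 f) (hc : HasCompactSupport f)
    (i : Fin d) : ∫ x, pderiv i f x = 0 := by
  have := integral_mul_pderiv (contDiff_const (c := (1 : ℝ))) hf (Or.inr hc) i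
  simpa [pderiv_const] using this

/-- The data of a neighbourhood `B` of a boundary point of `O` where `η` increases in the
direction `e`. -/
structure BoundaryPatch (O : Set (Space d)) (η : Space d → ℝ) (B : Set (Space d)) (e : Space d)
    (c : ℝ) : Prop where
  isOpen : IsOpen O
  smooth : ContDiff ℝ 3 η
  pos : ∀ x ∈ O, 0 < η x
  compact : ∀ δ > 0, IsCompact (O ∩ {x | δ ≤ η x})
  bounded : ∃ C, ∀ x ∈ O, |η x| ≤ C
  bounded₁ : ∀ i, ∃ C, ∀ x ∈ O, |pderiv i η x| ≤ C
  bounded₂ : ∀ i j, ∃ C, ∀ x ∈ O, |pderiv i (pderiv j η) x| ≤ C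
  c_pos : 0 < c
  le_dirDeriv : ∀ x ∈ B, c ≤ dirDeriv e η x

namespace BoundaryPatch

variable {O B : Set (Space d)} {η : Space d → ℝ} {e : Space d} {c : ℝ}

theorem contDiffOn_inv (P : BoundaryPatch O η B e c) : ContDiffOn ℝ 3 (fun x => (η x)⁻¹) O :=
  P.smooth.contDiffOn.inv fun x hx => (P.pos x hx).ne'

theorem dirDeriv_bdd (P : BoundaryPatch O η B e c) : ∃ C, ∀ x ∈ O, |dirDeriv e η x| ≤ C := by
  choose C hC using P.bounded₁
  refine ⟨∑ l, |e l| * C l, fun x hx => (Finset.abs_sum_le_sum_abs _ _).trans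
    (Finset.sum_le_sum fun l _ => ?_)⟩
  rw [abs_mul]
  exact mul_le_mul_of_nonneg_left (hC l x hx) (abs_nonneg _)

/-- Hardy's inequality for test functions. -/
theorem eLpNorm_div_le (P : BoundaryPatch O η B e c) {φ : Space d → ℝ} (hφ : IsTest O φ)
    (hB : tsupport φ ⊆ B) :
    eLpNorm (fun x => (η x)⁻¹ * φ x) 2 volume ≤ ENNReal.ofReal (2 / c) * eLpNorm (dirDeriv e φ) 2 volume := by
  have h1 : ContDiff ℝ 1 φ := contDiff_infty.1 hφ.1 1
  have hη1 : ContDiff ℝ 1 η := P.smooth.of_le (by norm_num)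
  set w : Space d → ℝ := fun x => (η x)⁻¹ * φ x with hw
  have ws : tsupport w ⊆ tsupport φ := tsupport_mul_subset_right' _ _
  have w1 : ContDiff ℝ 1 w :=
    contDiff_mul_of_tsupport_subset P.isOpen (P.contDiffOn_inv.of_le (by norm_num)) h1 hφ.2.2
  have wc : HasCompactSupport w := hφ.2.1.of_isClosed_subset (isClosed_tsupport _) ws
  have φw : ∀ x, φ x = η x * w x := fun x => by
    by_cases hx : x ∈ O
    · simp only [hw]; field_simp [(P.pos x hx).ne']
    · have h0 : x ∉ tsupport φ := fun h => hx (hφ.2.2 h)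
      rw [image_eq_zero_of_notMem_tsupport h0, image_eq_zero_of_notMem_tsupport fun h => h0 (ws h), mul_zero]
  have w1' := w1.differentiable (by simp)
  have η1' := hη1.differentiable (by simp)
  have ec : Continuous (dirDeriv e η) := continuous_finsetSum _ fun l _ => continuous_const.mul (continuous_pderiv hη1 l)
  have eφ : Continuous (dirDeriv e φ) := continuous_finsetSum _ fun l _ => continuous_const.mul (continuous_pderiv h1 l)
  -- With `φ = ηw`, the integrand is the derivative of `ηw²`, a `C¹` function of compact support.
  have key : ∀ l, ∫ x, (2 * w x * pderiv l φ x - pderiv l η x * w x ^ 2) = 0 := fun l => by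
    have := integral_pderiv_eq_zero (hη1.mul (w1.mul w1)) (HasCompactSupport.mul_left (HasCompactSupport.mul_left wc)) l
    rw [← this]
    refine integral_congr_ae (Eventually.of_forall fun x => ?_)
    simp only
    rw [show φ = fun x => η x * w x from funext φw, pderiv_mul (η1' x) (w1' x),
      pderiv_mul (η1' x) ((w1' x).fun_mul (w1' x)), pderiv_mul (w1' x) (w1' x)]
    ring
  have i1 : Integrable (fun x => w x * dirDeriv e φ x) :=
    (w1.continuous.mul eφ).integrable_of_hasCompactSupport wc.mul_right
  have i2 : Integrable (fun x => dirDeriv e η x * w x ^ 2) :=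
    (ec.mul (w1.continuous.pow 2)).integrable_of_hasCompactSupport
      (by simpa only [pow_two] using HasCompactSupport.mul_left (wc.mul_left))
  have key2 : ∫ x, dirDeriv e η x * w x ^ 2 = 2 * ∫ x, w x * dirDeriv e φ x := by
    have i3 : ∀ l, Integrable fun x => e l * (2 * w x * pderiv l φ x - pderiv l η x * w x ^ 2) := fun l => by
      have c1 := w1.continuous
      have c2 := continuous_pderiv h1 l
      have c3 := continuous_pderiv hη1 l
      refine Continuous.integrable_of_hasCompactSupport (by fun_prop) (wc.mono fun x hx => ?_)
      by_contra h0
      have h0' : w x = 0 := by simpa using h0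
      exact hx (by simp [h0'])
    have h0 : ∫ x, ∑ l, e l * (2 * w x * pderiv l φ x - pderiv l η x * w x ^ 2) = 0 := by
      rw [integral_finsetSum _ fun l _ => i3 l]
      simp only [integral_const_mul, key, mul_zero, Finset.sum_const_zero]
    have h2 : ∀ x, ∑ l, e l * (2 * w x * pderiv l φ x - pderiv l η x * w x ^ 2) =
        2 * (w x * dirDeriv e φ x) - dirDeriv e η x * w x ^ 2 := fun x => by
      simp only [dirDeriv, Finset.mul_sum, Finset.sum_mul, ← Finset.sum_sub_distrib]
      exact Finset.sum_congr rfl fun l _ => by ring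
    simp only [h2] at h0
    rw [integral_sub (i1.const_mul 2) i2, integral_const_mul] at h0
    linarith
  refine eLpNorm_le_of_integral_sq_le P.c_pos (w1.continuous.memLp_of_hasCompactSupport wc)
    (eφ.memLp_of_hasCompactSupport ?_) ?_ (by norm_num)
  · refine hφ.2.1.mono' fun x hx => ?_
    by_contra h0
    exact hx (by simp [dirDeriv, pderiv_eq_zero_of_notMem_tsupport h0])
  -- On the support of `w`, which lies in `B`, the function `η` grows at rate at least `c` in the
  -- direction `e`.
  · have h3 : c * ∫ x, w x ^ 2 ≤ ∫ x, dirDeriv e η x * w x ^ 2 := by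
      rw [← integral_const_mul]
      refine integral_mono ?_ i2 fun x => ?_
      · exact ((w1.continuous.pow 2).integrable_of_hasCompactSupport
          (by simpa only [pow_two] using wc.mul_left)).const_mul _
      · by_cases hx : x ∈ B
        · exact mul_le_mul_of_nonneg_right (P.le_dirDeriv x hx) (sq_nonneg _)
        · rw [image_eq_zero_of_notMem_tsupport fun h => hx (hB (ws h))]; simp
    rw [key2] at h3
    exact h3.trans (mul_le_mul_of_nonneg_left (le_abs_self _) (by norm_num))

/-- Hardy's inequality on `H^1_0`. -/
theorem memLp_div (P : BoundaryPatch O η B e c) {φ : ℕ → Space d → ℝ} {z : Space d → ℝ}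
    {G : Fin d → Space d → ℝ}
    (hφ : ∀ n, IsTest O (φ n)) (hB : ∀ n, tsupport (φ n) ⊆ B) (hz : MemLp z 2 (volume.restrict O))
    (hG : ∀ i, MemLp (G i) 2 (volume.restrict O))
    (h0 : Tendsto (fun n => eLpNorm (φ n - z) 2 (volume.restrict O)) atTop (𝓝 0))
    (h1 : ∀ i, Tendsto (fun n => eLpNorm (pderiv i (φ n) - G i) 2 (volume.restrict O)) atTop (𝓝 0)) :
    MemLp (fun x => (η x)⁻¹ * z x) 2 (volume.restrict O) := by
  have mφ : ∀ n, AEStronglyMeasurable (φ n) (volume.restrict O) := fun n => (hφ n).1.continuous.aestronglyMeasurable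
  have mp : ∀ n i, AEStronglyMeasurable (pderiv i (φ n)) (volume.restrict O) := fun n i =>
    ((hφ n).pderiv i).1.continuous.aestronglyMeasurable
  -- Along a subsequence converging almost everywhere, the quotients `φ/η` are bounded in `L²` by
  -- the inequality for test functions, and Fatou's lemma puts the limit in `L²`.
  obtain ⟨ns, hns, hae⟩ := (tendstoInMeasure_of_tendsto_eLpNorm (by norm_num) mφ hz.1 h0).exists_seq_tendsto_ae
  set D : ℝ≥0∞ := ∑ l, (‖e l‖ₑ * (eLpNorm (G l) 2 (volume.restrict O) + 1)) with hD
  have hDt : D ≠ ⊤ := ENNReal.sum_ne_top.2 fun l _ => ENNReal.mul_ne_top (by simp)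
    (ENNReal.add_ne_top.2 ⟨(hG l).2.ne, by simp⟩)
  have hev : ∀ᶠ n in atTop, ∀ l, eLpNorm (pderiv l (φ n) - G l) 2 (volume.restrict O) ≤ 1 :=
    eventually_all.2 fun l => (h1 l).eventually_le_const (by simp)
  refine memLp_of_tendsto_ae (C := ENNReal.ofReal (2 / c) * D) (ENNReal.mul_ne_top (by simp) hDt)
    (f := fun n x => (η x)⁻¹ * φ (ns n) x) (fun n => ?_) ?_ ?_
  · exact (P.smooth.continuous.measurable.inv.aestronglyMeasurable).mul (mφ _)
  · filter_upwards [hns.tendsto_atTop.eventually hev] with n hn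
    refine (eLpNorm_mono_measure _ Measure.restrict_le_self).trans ((P.eLpNorm_div_le (hφ _) (hB _)).trans ?_)
    gcongr
    have e1 : eLpNorm (dirDeriv e (φ (ns n))) 2 volume = eLpNorm (dirDeriv e (φ (ns n))) 2 (volume.restrict O) := by
      rw [← eLpNorm_indicator_eq_eLpNorm_restrict P.isOpen.measurableSet]
      congr 1
      funext x
      by_cases hx : x ∈ O
      · rw [indicator_of_mem hx]
      · rw [indicator_of_notMem hx]
        have : x ∉ tsupport (φ (ns n)) := fun h => hx ((hφ _).2.2 h)
        simp [dirDeriv, pderiv_eq_zero_of_notMem_tsupport this]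
    have e2 : dirDeriv e (φ (ns n)) = ∑ l, e l • pderiv l (φ (ns n)) := by
      funext x; simp [dirDeriv]
    rw [e1, e2]
    refine (eLpNorm_sum_le (fun l _ => (mp _ l).const_smul _) (by norm_num)).trans ?_
    refine Finset.sum_le_sum fun l _ => ?_
    rw [eLpNorm_const_smul]
    gcongr
    have e3 : pderiv l (φ (ns n)) = G l + (pderiv l (φ (ns n)) - G l) := by abel
    rw [e3]
    exact (eLpNorm_add_le (hG l).1 ((mp _ l).sub (hG l).1) (by norm_num)).trans (add_le_add le_rfl (hn l))
  · filter_upwards [hae] with x hx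
    exact hx.const_mul _

end BoundaryPatch

end PINN

/-! ### A second Hardy inequality, for functions `Y` with only `ηY` in `L²` -/

namespace PINN

variable {d : ℕ}

/-- A smooth step from `0` to `1`. -/
noncomputable def cut (s : ℝ) : ℝ := Real.smoothTransition (s - 1)

theorem contDiff_cut : ContDiff ℝ ∞ cut :=
  (Real.smoothTransition.contDiff (n := ⊤)).comp (contDiff_id.sub contDiff_const)

theorem cut_of_le_one {s : ℝ} (h : s ≤ 1) : cut s = 0 :=
  Real.smoothTransition.zero_of_nonpos (by linarith)

theorem cut_of_two_le {s : ℝ} (h : 2 ≤ s) : cut s = 1 :=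
  Real.smoothTransition.one_of_one_le (by linarith)

theorem abs_cut_le (s : ℝ) : |cut s| ≤ 1 := by
  rw [cut, abs_of_nonneg (Real.smoothTransition.nonneg _)]
  exact Real.smoothTransition.le_one _

theorem deriv_cut_of_lt_one {s : ℝ} (h : s < 1) : deriv cut s = 0 := by
  have : cut =ᶠ[𝓝 s] fun _ => 0 := (gt_mem_nhds h).mono fun t ht => cut_of_le_one (le_of_lt ht)
  rw [this.deriv_eq, deriv_const]

theorem deriv_cut_of_two_lt {s : ℝ} (h : 2 < s) : deriv cut s = 0 := by
  have : cut =ᶠ[𝓝 s] fun _ => 1 := (lt_mem_nhds h).mono fun t ht => cut_of_two_le (le_of_lt ht)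
  rw [this.deriv_eq, deriv_const]

/-- The derivative of the cutoff lives on `[1, 2]`, so `s cut'(s)` is bounded. Hence the term `(η/δ)
cut'(η/δ)` stays bounded uniformly as `δ → 0`. -/
theorem exists_abs_mul_deriv_cut_le : ∃ K, ∀ s, |s * deriv cut s| ≤ K := by
  have hc : Continuous fun s => s * deriv cut s :=
    continuous_id.mul (contDiff_cut.continuous_deriv (by simp))
  obtain ⟨K, hK⟩ := hc.bounded_above_of_compact_support
    (HasCompactSupport.intro (isCompact_Icc (a := (1 : ℝ)) (b := 2)) fun s hs => by
      rw [mem_Icc, not_and_or, not_le, not_le] at hs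
      rcases hs with h | h
      · rw [deriv_cut_of_lt_one h, mul_zero]
      · rw [deriv_cut_of_two_lt h, mul_zero])
  exact ⟨K, hK⟩

/-- The weight `t² / (t² + ε²)`. -/
noncomputable def wt (ε t : ℝ) : ℝ := t ^ 2 / (t ^ 2 + ε ^ 2)

theorem wt_nonneg (ε t : ℝ) : 0 ≤ wt ε t := by unfold wt; positivity

theorem wt_le_one (ε t : ℝ) : wt ε t ≤ 1 := by
  unfold wt
  exact div_le_one_of_le₀ (by nlinarith [sq_nonneg ε]) (by positivity)

theorem wt_le {ε : ℝ} (hε : 0 < ε) (t : ℝ) : wt ε t ≤ t ^ 2 / ε ^ 2 := by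
  unfold wt
  gcongr
  nlinarith [sq_nonneg t]

theorem continuous_wt {ε : ℝ} (hε : 0 < ε) : Continuous (wt ε) := by
  unfold wt
  exact (continuous_id.pow 2).div (by fun_prop) fun t => by positivity

/-- The logarithmic derivative of `t wt(t)` is `(t² + 3ε²) / (t² + ε²)` divided by `t`. The
numerical point is that this ratio is at most `3`, below the `4` that the equation for `Y`
contributes. -/
theorem hasDerivAt_mul_wt_mul_cut {ε δ : ℝ} (hε : 0 < ε) (hδ : 0 < δ) (t : ℝ) :
    HasDerivAt (fun t => t * wt ε t * cut (t / δ))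
      (wt ε t * ((t ^ 2 + 3 * ε ^ 2) / (t ^ 2 + ε ^ 2) * cut (t / δ) + t / δ * deriv cut (t / δ))) t := by
  have hp : t ^ 2 + ε ^ 2 ≠ 0 := by positivity
  have h1 : HasDerivAt (fun t : ℝ => t ^ 2) (2 * t) t := by simpa using hasDerivAt_pow 2 t
  have h2 := h1.div (h1.add_const (ε ^ 2)) hp
  have h3 := (hasDerivAt_id t).mul h2
  have h5 : HasDerivAt (fun t : ℝ => t / δ) (1 / δ) t := (hasDerivAt_id t).div_const δ
  have h4 : HasDerivAt (fun t => cut (t / δ)) (deriv cut (t / δ) * (1 / δ)) t :=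
    HasDerivAt.comp (h₂ := cut) t ((contDiff_cut.differentiable (by simp)) (t / δ)).hasDerivAt h5
  refine (h3.mul h4).congr_deriv ?_
  simp only [id, Pi.div_apply, wt, Pi.mul_apply]
  field_simp
  ring

theorem contDiff_mul_wt_mul_cut {ε : ℝ} (hε : 0 < ε) (δ : ℝ) :
    ContDiff ℝ 1 fun t => t * wt ε t * cut (t / δ) := by
  have h1 : ContDiff ℝ 1 (wt ε) := by
    unfold wt
    exact (contDiff_id.pow 2).div ((contDiff_id.pow 2).add contDiff_const) fun t => by positivity
  exact (contDiff_id.mul h1).mul ((contDiff_infty.1 contDiff_cut 1).comp (contDiff_id.div_const δ))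

theorem integrable_mul_mul_of_compact {O : Set (Space d)} {f g b : Space d → ℝ}
    (hf : ∀ C ⊆ O, IsCompact C → MemLp f 2 (volume.restrict C))
    (hg : ∀ C ⊆ O, IsCompact C → MemLp g 2 (volume.restrict C)) (hb : Continuous b)
    (hc : HasCompactSupport b) (hs : tsupport b ⊆ O) : Integrable fun x => f x * (b x * g x) := by
  have h1 := (hf _ hs hc).integrable_mul
    ((memLp_mul_of_compact hg hb hc hs).mono_measure (Measure.restrict_le_self (s := tsupport b)))
  refine (integrableOn_iff_integrable_of_support_subset (s := tsupport b) fun x hx => ?_).1 h1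
  by_contra h0
  exact hx (by simp [image_eq_zero_of_notMem_tsupport h0])

namespace BoundaryPatch

variable {O B : Set (Space d)} {η : Space d → ℝ} {e : Space d} {c : ℝ}

/-- The weight `η * wt ε η * cut (η / δ)`, set to zero outside `O`. -/
noncomputable def weight (O : Set (Space d)) (η : Space d → ℝ) (ε δ : ℝ) : Space d → ℝ :=
  O.indicator fun x => η x * wt ε (η x) * cut (η x / δ)

theorem tsupport_weight_subset (P : BoundaryPatch O η B e c) (ε : ℝ) {δ : ℝ} (hδ : 0 < δ) :
    tsupport (weight O η ε δ) ⊆ O ∩ {x | δ ≤ η x} :=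
  closure_minimal (fun x hx => by
    have hxO : x ∈ O := by
      by_contra h
      exact hx (indicator_of_notMem h _)
    refine ⟨hxO, ?_⟩
    by_contra h
    rw [mem_ofPred_eq, not_le] at h
    refine hx ?_
    rw [weight, indicator_of_mem hxO, cut_of_le_one ((div_le_one hδ).2 h.le), mul_zero])
    (P.compact δ hδ).isClosed

theorem weight_eventuallyEq (P : BoundaryPatch O η B e c) (ε δ : ℝ) {x : Space d} (hx : x ∈ O) :
    weight O η ε δ =ᶠ[𝓝 x] fun x => η x * wt ε (η x) * cut (η x / δ) :=
  mem_of_superset (P.isOpen.mem_nhds hx) fun _ hy => indicator_of_mem hy _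

theorem contDiff_weight (P : BoundaryPatch O η B e c) {ε δ : ℝ} (hε : 0 < ε) (hδ : 0 < δ) :
    ContDiff ℝ 1 (weight O η ε δ) := by
  rw [contDiff_iff_contDiffAt]
  intro x
  by_cases hx : x ∈ O
  · have h1 := (contDiff_mul_wt_mul_cut hε δ).comp (P.smooth.of_le (by norm_num) : ContDiff ℝ 1 η)
    exact h1.contDiffAt.congr_of_eventuallyEq (P.weight_eventuallyEq ε δ hx)
  · exact (contDiffAt_const (c := (0 : ℝ))).congr_of_eventuallyEq
      (notMem_tsupport_iff_eventuallyEq.1 fun h => hx (P.tsupport_weight_subset ε hδ h).1)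

theorem pderiv_weight (P : BoundaryPatch O η B e c) {ε δ : ℝ} (hε : 0 < ε) (hδ : 0 < δ) {x : Space d}
    (hx : x ∈ O) (l : Fin d) : pderiv l (weight O η ε δ) x =
      wt ε (η x) * ((η x ^ 2 + 3 * ε ^ 2) / (η x ^ 2 + ε ^ 2) * cut (η x / δ)
        + η x / δ * deriv cut (η x / δ)) * pderiv l η x := by
  have h := hasDerivAt_mul_wt_mul_cut hε hδ (η x)
  rw [pderiv_congr_of_eventuallyEq (P.weight_eventuallyEq ε δ hx),
    pderiv_comp h.differentiableAt (P.smooth.differentiable (by simp) x), h.deriv]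

/-- A function `Y` on `O` with `η ∂_e Y = h - 2 (∂_e η) Y`. -/
structure IsRadial (O : Set (Space d)) (η : Space d → ℝ) (B : Set (Space d)) (e : Space d)
    (Y : Space d → ℝ) (Y' : Fin d → Space d → ℝ) (h : Space d → ℝ) : Prop where
  weak : ∀ l, HasWeakPartial O l Y (Y' l)
  loc : ∀ C ⊆ O, IsCompact C → MemLp Y 2 (volume.restrict C)
  loc' : ∀ l, ∀ C ⊆ O, IsCompact C → MemLp (Y' l) 2 (volume.restrict C)
  memLp_mul : MemLp (fun x => η x * Y x) 2 (volume.restrict O)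
  memLp : MemLp h 2 (volume.restrict O)
  eq : ∀ x ∈ O, η x * ∑ l, e l * Y' l x = h x - 2 * dirDeriv e η x * Y x
  eq_zero : ∀ x ∈ O, x ∉ B → Y x = 0

variable {Y h : Space d → ℝ} {Y' : Fin d → Space d → ℝ}

/-- This is the vanishing integral of `∂_e(ΨY²)` for the weight `Ψ`, with `η ∂_e Y` eliminated by
the equation `η ∂_e Y = h - 2(∂_e η)Y`. That elimination produces the `-4`. The cutoff keeps
everything in a compact subset of `O`, where `Y` is square integrable. -/
theorem integral_radial_cut (P : BoundaryPatch O η B e c) (R : IsRadial O η B e Y Y' h) {ε δ : ℝ}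
    (hε : 0 < ε) (hδ : 0 < δ) :
    ∫ x in O, (Y x ^ 2 * dirDeriv e η x * wt ε (η x) * (((η x ^ 2 + 3 * ε ^ 2) / (η x ^ 2 + ε ^ 2) - 4)
      * cut (η x / δ) + η x / δ * deriv cut (η x / δ)) + 2 * (Y x * wt ε (η x) * h x) * cut (η x / δ)) = 0 := by
  set Ψ := weight O η ε δ with hΨ
  have s1 := P.contDiff_weight hε hδ
  have ts := P.tsupport_weight_subset ε hδ
  have hs : tsupport Ψ ⊆ O := ts.trans inter_subset_left
  have hc : HasCompactSupport Ψ := (P.compact δ hδ).of_isClosed_subset (isClosed_tsupport _) ts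
  have i1 : ∀ l, Integrable fun x => e l * (Y x * (pderiv l Ψ x * Y x)) := fun l =>
    (integrable_mul_mul_of_compact R.loc R.loc (continuous_pderiv s1 l) (hasCompactSupport_pderiv hc l)
      ((tsupport_pderiv_subset _ l).trans hs)).const_mul _
  have i2 : ∀ l, Integrable fun x => 2 * (e l * (Y x * (Ψ x * Y' l x))) := fun l =>
    ((integrable_mul_mul_of_compact R.loc (R.loc' l) s1.continuous hc hs).const_mul _).const_mul _
  have key : ∫ x, ∑ l, (e l * (Y x * (pderiv l Ψ x * Y x)) + 2 * (e l * (Y x * (Ψ x * Y' l x)))) = 0 := by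
    have h0 := integral_finsetSum Finset.univ fun l _ => (i1 l).add (i2 l)
    simp only [Pi.add_apply] at h0
    rw [h0]
    refine Finset.sum_eq_zero fun l _ => ?_
    rw [integral_add (i1 l) (i2 l), integral_const_mul, integral_const_mul, integral_const_mul,
      (R.weak l).integral_sq_eq_of_tsupport_subset P.isOpen R.loc (R.loc' l) s1 hc hs]
    ring
  rw [← setIntegral_eq_integral_of_forall_compl_eq_zero (s := O)] at key
  rw [← key]
  · refine setIntegral_congr_fun P.isOpen.measurableSet fun x hx => ?_
    have e1 : ∀ l, pderiv l Ψ x = _ := fun l => P.pderiv_weight hε hδ hx l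
    have e2 : Ψ x = η x * wt ε (η x) * cut (η x / δ) := indicator_of_mem hx _
    have e3 := R.eq x hx
    simp only [Finset.sum_add_distrib]
    have e4 : ∑ l, e l * (Y x * (pderiv l Ψ x * Y x)) = dirDeriv e η x * (Y x ^ 2 * (wt ε (η x) *
        ((η x ^ 2 + 3 * ε ^ 2) / (η x ^ 2 + ε ^ 2) * cut (η x / δ) + η x / δ * deriv cut (η x / δ)))) := by
      rw [dirDeriv, Finset.sum_mul]
      exact Finset.sum_congr rfl fun l _ => by rw [e1]; ring
    have e5 : ∑ l, 2 * (e l * (Y x * (Ψ x * Y' l x))) =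
        2 * (Y x * wt ε (η x) * cut (η x / δ)) * (h x - 2 * dirDeriv e η x * Y x) := by
      rw [← e3, Finset.mul_sum, Finset.mul_sum]
      exact Finset.sum_congr rfl fun l _ => by rw [e2]; ring
    rw [e4, e5]
    ring
  · intro x hx
    refine Finset.sum_eq_zero fun l _ => ?_
    have h0 : x ∉ tsupport Ψ := fun h => hx (hs h)
    rw [pderiv_eq_zero_of_notMem_tsupport h0, image_eq_zero_of_notMem_tsupport h0]
    ring

/-- The cutoff is removed by dominated convergence as `δ → 0` with `ε` fixed. At each point of `O`
the cutoff is eventually constant, so the term with its derivative leaves no trace. -/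
theorem integral_radial (P : BoundaryPatch O η B e c) (R : IsRadial O η B e Y Y' h) {ε : ℝ}
    (hε : 0 < ε) :
    Integrable (fun x => Y x ^ 2 * dirDeriv e η x * wt ε (η x)
        * ((η x ^ 2 + 3 * ε ^ 2) / (η x ^ 2 + ε ^ 2) - 4)) (volume.restrict O) ∧
    ∫ x in O, Y x ^ 2 * dirDeriv e η x * wt ε (η x) * ((η x ^ 2 + 3 * ε ^ 2) / (η x ^ 2 + ε ^ 2) - 4) =
      - (2 * ∫ x in O, Y x * wt ε (η x) * h x) := by
  obtain ⟨K, hK⟩ := exists_abs_mul_deriv_cut_le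
  obtain ⟨C, hC⟩ := P.dirDeriv_bdd
  obtain ⟨C', hC'⟩ := P.bounded
  have hO := P.isOpen.measurableSet
  have mη : AEStronglyMeasurable η (volume.restrict O) := P.smooth.continuous.aestronglyMeasurable
  have mY : AEStronglyMeasurable Y (volume.restrict O) := by
    refine (P.smooth.continuous.measurable.inv.aestronglyMeasurable.mul R.memLp_mul.1).congr ?_
    filter_upwards [ae_restrict_mem hO] with x hx
    simp only [Pi.mul_apply, Pi.inv_apply]
    field_simp [(P.pos x hx).ne']
  have mw : AEStronglyMeasurable (fun x => wt ε (η x)) (volume.restrict O) :=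
    ((continuous_wt hε).comp P.smooth.continuous).aestronglyMeasurable
  have me : AEStronglyMeasurable (dirDeriv e η) (volume.restrict O) :=
    (continuous_finsetSum _ fun l _ => continuous_const.mul
      (continuous_pderiv (P.smooth.of_le (by norm_num)) l)).aestronglyMeasurable
  have cη := P.smooth.continuous
  have mr : Continuous (fun x => (η x ^ 2 + 3 * ε ^ 2) / (η x ^ 2 + ε ^ 2) - 4) :=
    ((by fun_prop : Continuous fun x => η x ^ 2 + 3 * ε ^ 2).div (by fun_prop) fun x => by positivity).sub
      continuous_const
  have mc : ∀ δ : ℝ, Continuous fun x => cut (η x / δ) := fun δ => by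
    have := contDiff_cut.continuous
    fun_prop
  have mk : ∀ δ : ℝ, Continuous fun x => η x / δ * deriv cut (η x / δ) := fun δ => by
    have := contDiff_cut.continuous_deriv (by simp)
    fun_prop
  have hr : ∀ x, |(η x ^ 2 + 3 * ε ^ 2) / (η x ^ 2 + ε ^ 2) - 4| ≤ 4 := fun x => by
    have h1 : 0 ≤ (η x ^ 2 + 3 * ε ^ 2) / (η x ^ 2 + ε ^ 2) := by positivity
    have h2 : (η x ^ 2 + 3 * ε ^ 2) / (η x ^ 2 + ε ^ 2) ≤ 4 := by
      rw [div_le_iff₀ (by positivity)]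
      nlinarith [sq_nonneg (η x), sq_nonneg ε]
    rw [abs_le]; constructor <;> linarith
  have hK0 : 0 ≤ K := (abs_nonneg _).trans (hK 0)
  have I0 : Integrable (fun x => (η x * Y x) ^ 2) (volume.restrict O) := R.memLp_mul.integrable_sq
  have I1 : Integrable (fun x => (η x * Y x) * h x) (volume.restrict O) := R.memLp_mul.integrable_mul R.memLp
  -- The weight is at most `η²/ε²`, so for fixed `ε` integrability follows from `ηY ∈ L²`; square
  -- integrability of `Y` is not yet known.
  have b1 : ∀ x ∈ O, |Y x ^ 2 * dirDeriv e η x * wt ε (η x)| ≤ C / ε ^ 2 * (η x * Y x) ^ 2 := fun x hx => by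
    rw [abs_mul, abs_mul, abs_of_nonneg (sq_nonneg _), abs_of_nonneg (wt_nonneg _ _)]
    calc Y x ^ 2 * |dirDeriv e η x| * wt ε (η x) ≤ Y x ^ 2 * C * (η x ^ 2 / ε ^ 2) := by
          have := wt_le hε (η x)
          have := hC x hx
          have := wt_nonneg ε (η x)
          have : 0 ≤ C := (abs_nonneg _).trans (hC x hx)
          gcongr
      _ = _ := by ring
  have b2 : ∀ x ∈ O, |Y x * wt ε (η x) * h x| ≤ C' / ε ^ 2 * |(η x * Y x) * h x| := fun x hx => by
    rw [abs_mul, abs_mul, abs_of_nonneg (wt_nonneg _ _), abs_mul, abs_mul, abs_of_pos (P.pos x hx)]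
    calc |Y x| * wt ε (η x) * |h x| ≤ |Y x| * (C' * η x / ε ^ 2) * |h x| := by
          have h1 := wt_le hε (η x)
          have h2 : η x ≤ C' := (le_abs_self _).trans (hC' x hx)
          have h3 := P.pos x hx
          have h4 : η x ^ 2 / ε ^ 2 ≤ C' * η x / ε ^ 2 := by
            rw [pow_two]; gcongr
          gcongr
          exact h1.trans h4
      _ = _ := by ring
  have m1 : AEStronglyMeasurable (fun x => Y x ^ 2 * dirDeriv e η x * wt ε (η x)) (volume.restrict O) :=
    ((mY.pow 2).mul me).mul mw
  have m2 : AEStronglyMeasurable (fun x => Y x * wt ε (η x) * h x) (volume.restrict O) :=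
    (mY.mul mw).mul R.memLp.1
  have J1 : Integrable (fun x => Y x ^ 2 * dirDeriv e η x * wt ε (η x)) (volume.restrict O) :=
    (I0.const_mul (C / ε ^ 2)).mono' m1 ((ae_restrict_mem hO).mono b1)
  have J2 : Integrable (fun x => Y x * wt ε (η x) * h x) (volume.restrict O) :=
    (I1.abs.const_mul (C' / ε ^ 2)).mono' m2 ((ae_restrict_mem hO).mono b2)
  have J3 : Integrable (fun x => Y x ^ 2 * dirDeriv e η x * wt ε (η x)
        * ((η x ^ 2 + 3 * ε ^ 2) / (η x ^ 2 + ε ^ 2) - 4)) (volume.restrict O) :=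
    J1.mul_bdd (c := 4) mr.aestronglyMeasurable (Eventually.of_forall hr)
  refine ⟨J3, ?_⟩
  have hpos : ∀ n, 0 < scale n := fun n => by unfold scale; positivity
  have lim : Tendsto (fun n => ∫ x in O, (Y x ^ 2 * dirDeriv e η x * wt ε (η x) *
      (((η x ^ 2 + 3 * ε ^ 2) / (η x ^ 2 + ε ^ 2) - 4) * cut (η x / scale n)
        + η x / scale n * deriv cut (η x / scale n)) + 2 * (Y x * wt ε (η x) * h x) * cut (η x / scale n)))
      atTop (𝓝 (∫ x in O, (Y x ^ 2 * dirDeriv e η x * wt ε (η x) *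
      ((η x ^ 2 + 3 * ε ^ 2) / (η x ^ 2 + ε ^ 2) - 4) + 2 * (Y x * wt ε (η x) * h x)))) := by
    refine tendsto_integral_of_dominated_convergence (fun x => |Y x ^ 2 * dirDeriv e η x * wt ε (η x)| * (4 + K)
      + 2 * |Y x * wt ε (η x) * h x|) (fun n => ?_) ((J1.abs.mul_const _).add (J2.abs.const_mul 2)) (fun n => ?_) ?_
    · exact (m1.mul ((mr.mul (mc _)).add (mk _)).aestronglyMeasurable).add
        ((m2.const_mul 2).mul (mc _).aestronglyMeasurable)
    · refine Eventually.of_forall fun x => ?_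
      rw [Real.norm_eq_abs]
      refine (abs_add_le _ _).trans (add_le_add ?_ ?_)
      · rw [abs_mul]
        refine mul_le_mul_of_nonneg_left ((abs_add_le _ _).trans (add_le_add ?_ (hK _))) (abs_nonneg _)
        rw [abs_mul]
        exact (mul_le_mul (hr x) (abs_cut_le _) (abs_nonneg _) (by norm_num)).trans_eq (mul_one _)
      · rw [abs_mul, abs_mul, abs_two]
        exact (mul_le_mul_of_nonneg_left (abs_cut_le _) (by positivity)).trans_eq (mul_one _)
    · filter_upwards [ae_restrict_mem hO] with x hx
      have hx0 := P.pos x hx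
      refine tendsto_const_nhds.congr' ?_
      filter_upwards [tendsto_scale.eventually_lt_const (half_pos hx0)] with n hn
      have h2 : 2 < η x / scale n := by
        rw [lt_div_iff₀ (hpos n)]; linarith
      rw [deriv_cut_of_two_lt h2, cut_of_two_le h2.le]
      ring
  have := tendsto_nhds_unique lim (tendsto_const_nhds.congr fun n => (P.integral_radial_cut R hε (hpos n)).symm)
  rw [integral_add J3 (J2.const_mul 2), integral_const_mul] at this
  linarith

/-- A second Hardy inequality. -/
theorem memLp_radial (P : BoundaryPatch O η B e c) (R : IsRadial O η B e Y Y' h) :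
    MemLp Y 2 (volume.restrict O) := by
  have hO := P.isOpen.measurableSet
  have hpos : ∀ n, 0 < scale n := fun n => by unfold scale; positivity
  have cη := P.smooth.continuous
  -- The function `s n` is the square root of the weight `wt (scale n) η`. It lies in `[0, 1]` on
  -- `O` and increases to one there, so a bound on `s n * Y` independent of `n` passes to `Y` by
  -- Fatou's lemma.
  set s : ℕ → Space d → ℝ := fun n x => η x / √(η x ^ 2 + scale n ^ 2) with hs
  have cs : ∀ n, Continuous (s n) := fun n =>
    cη.div (by fun_prop) fun x => by have := hpos n; positivity
  have s2 : ∀ n x, s n x ^ 2 = wt (scale n) (η x) := fun n x => by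
    simp only [hs, wt]
    rw [div_pow, Real.sq_sqrt (by positivity)]
  have s1 : ∀ n x, |s n x| ≤ 1 := fun n x => by
    rw [← sq_le_one_iff_abs_le_one, s2]
    exact wt_le_one _ _
  have w1 : ∀ n, MemLp (fun x => s n x * Y x) 2 (volume.restrict O) := fun n => by
    have hb : ∀ᵐ x ∂(volume.restrict O), |(√(η x ^ 2 + scale n ^ 2))⁻¹| ≤ (scale n)⁻¹ :=
      Eventually.of_forall fun x => by
        rw [abs_of_nonneg (by positivity)]
        have := hpos n
        gcongr
        exact Real.le_sqrt_of_sq_le (by nlinarith [sq_nonneg (η x)])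
    have := R.memLp_mul.bdd_mul_of_ae (b := fun x => (√(η x ^ 2 + scale n ^ 2))⁻¹)
      (by fun_prop : Measurable fun x => (√(η x ^ 2 + scale n ^ 2))⁻¹).aestronglyMeasurable hb
    refine (memLp_congr_ae (Eventually.of_forall fun x => ?_)).1 this
    simp only [hs]; ring
  have w2 : ∀ n, MemLp (fun x => s n x * h x) 2 (volume.restrict O) := fun n =>
    R.memLp.bdd_mul_of_ae (cs n).aestronglyMeasurable (Eventually.of_forall (s1 n))
  refine memLp_of_tendsto_ae (C := ENNReal.ofReal (2 / c) * eLpNorm h 2 (volume.restrict O))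
    (ENNReal.mul_ne_top (by simp) R.memLp.2.ne) (fun n => (w1 n).1) (Eventually.of_forall fun n => ?_) ?_
  · have hle : eLpNorm (fun x => s n x * h x) 2 (volume.restrict O) ≤ eLpNorm h 2 (volume.restrict O) :=
      eLpNorm_mono fun x => by
        rw [norm_mul]
        exact mul_le_of_le_one_left (norm_nonneg _) (s1 n x)
    refine (eLpNorm_le_of_integral_sq_le (C := 2) P.c_pos (w1 n) (w2 n) ?_ (by norm_num)).trans (by gcongr)
    obtain ⟨J, e1⟩ := P.integral_radial R (hpos n)
    have e2 : ∫ x in O, s n x * Y x * (s n x * h x) = ∫ x in O, Y x * wt (scale n) (η x) * h x :=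
      integral_congr_ae (Eventually.of_forall fun x => by simp only; rw [← s2]; ring)
    have e3 : c * ∫ x in O, (s n x * Y x) ^ 2 ≤ ∫ x in O, -(Y x ^ 2 * dirDeriv e η x * wt (scale n) (η x)
        * ((η x ^ 2 + 3 * scale n ^ 2) / (η x ^ 2 + scale n ^ 2) - 4)) := by
      rw [← integral_const_mul]
      refine setIntegral_mono_on ((w1 n).integrable_sq.const_mul c) J.neg hO fun x hx => ?_
      by_cases hxB : x ∈ B
      -- This leaves `4 - 3 = 1` as a lower bound for the coefficient, hence coercivity with the
      -- constant `c`.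
      · have h1 : (η x ^ 2 + 3 * scale n ^ 2) / (η x ^ 2 + scale n ^ 2) ≤ 3 := by
          have := hpos n
          rw [div_le_iff₀ (by positivity)]
          nlinarith [sq_nonneg (η x)]
        rw [mul_pow, s2]
        have h2 := P.le_dirDeriv x hxB
        have h3 := wt_nonneg (scale n) (η x)
        have h4 := sq_nonneg (Y x)
        have h5 := P.c_pos
        calc c * (wt (scale n) (η x) * Y x ^ 2) ≤ dirDeriv e η x * (wt (scale n) (η x) * Y x ^ 2) * 1 := by
              rw [mul_one]; gcongr
          _ ≤ dirDeriv e η x * (wt (scale n) (η x) * Y x ^ 2) *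
              (4 - (η x ^ 2 + 3 * scale n ^ 2) / (η x ^ 2 + scale n ^ 2)) := by
              have : 0 ≤ dirDeriv e η x := h5.le.trans h2
              gcongr
              linarith
          _ = _ := by ring
      · rw [R.eq_zero x hx hxB]; simp
    rw [integral_neg, e1, neg_neg] at e3
    rw [e2]
    exact e3.trans (mul_le_mul_of_nonneg_left (le_abs_self _) (by norm_num))
  · filter_upwards [ae_restrict_mem hO] with x hx
    have hx0 := P.pos x hx
    have h1 : Tendsto (fun n => √(η x ^ 2 + scale n ^ 2)) atTop (𝓝 (η x)) := by
      have h2 : Tendsto (fun n => η x ^ 2 + scale n ^ 2) atTop (𝓝 (η x ^ 2 + 0 ^ 2)) :=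
        tendsto_const_nhds.add (tendsto_scale.pow 2)
      have h3 := h2.sqrt
      rwa [zero_pow two_ne_zero, add_zero, Real.sqrt_sq hx0.le] at h3
    have h4 := ((tendsto_const_nhds (x := η x)).div h1 hx0.ne').mul_const (Y x)
    rw [div_self hx0.ne', one_mul] at h4
    exact h4

end BoundaryPatch

end PINN

/-! ### The quotient `v = z/η` and its derivatives near the boundary -/

namespace PINN

variable {d : ℕ}

theorem contDiffOn_pderiv {O : Set (Space d)} {m : Space d → ℝ} {n n' : ℕ∞ω} (hO : IsOpen O)
    (hm : ContDiffOn ℝ n m O) (h : n' + 1 ≤ n) (i : Fin d) : ContDiffOn ℝ n' (pderiv i m) O := by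
  have h1 : ContDiffOn ℝ n' (fun x => fderiv ℝ m x (bvec i)) O :=
    (hm.fderiv_of_isOpen hO h).clm_apply contDiffOn_const
  refine h1.congr fun x hx => ?_
  have h2 : n ≠ 0 := by
    rintro rfl
    have : (1 : ℕ∞ω) ≤ 0 := le_trans le_add_self h
    simp at this
  exact pderiv_eq_fderiv ((hm.contDiffAt (hO.mem_nhds hx)).differentiableAt h2) i

theorem memLp_mul_restrict_compact {O C : Set (Space d)} {m f : Space d → ℝ} (hm : ContinuousOn m O)
    (hf : MemLp f 2 (volume.restrict O)) (hC : C ⊆ O) (hc : IsCompact C) :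
    MemLp (fun x => m x * f x) 2 (volume.restrict C) := by
  obtain ⟨B, hB⟩ := hc.exists_bound_of_continuousOn (hm.mono hC)
  exact (hf.mono_measure (Measure.restrict_mono hC le_rfl)).bdd_mul_of_ae (C := B)
    ((hm.mono hC).aestronglyMeasurable hc.measurableSet) ((ae_restrict_mem hc.measurableSet).mono hB)

theorem memLp_bdd_mul {O : Set (Space d)} (hO : IsOpen O) {m f : Space d → ℝ} (hm : Continuous m)
    (hf : MemLp f 2 (volume.restrict O)) (hb : ∃ C, ∀ x ∈ O, |m x| ≤ C) :
    MemLp (fun x => m x * f x) 2 (volume.restrict O) := by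
  obtain ⟨C, hC⟩ := hb
  exact hf.bdd_mul_of_ae hm.aestronglyMeasurable ((ae_restrict_mem hO.measurableSet).mono hC)

/-- `v = z / η` with its weak derivatives `V` and `W` of first and second order. -/
structure IsQuotient (O : Set (Space d)) (η z : Space d → ℝ) (G : Fin d → Space d → ℝ)
    (H : Fin d → Fin d → Space d → ℝ) (v : Space d → ℝ) (V : Fin d → Space d → ℝ)
    (W : Fin d → Fin d → Space d → ℝ) : Prop where
  weak₁ : ∀ i, HasWeakPartial O i v (V i)
  weak₂ : ∀ i j, HasWeakPartial O i (V j) (W i j)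
  memLp : MemLp v 2 (volume.restrict O)
  memLp₁ : ∀ i, MemLp (V i) 2 (volume.restrict O)
  eq₀ : ∀ x ∈ O, η x * v x = z x
  eq₁ : ∀ i, ∀ x ∈ O, η x * V i x = G i x - pderiv i η x * v x
  eq₂ : ∀ i j, ∀ x ∈ O, η x * W i j x =
    H i j x - pderiv j η x * V i x - pderiv i η x * V j x - pderiv i (pderiv j η) x * v x
  support : ∀ x ∈ O, z x = 0 → (∀ i, G i x = 0) → v x = 0
  support₁ : ∀ x ∈ O, z x = 0 → (∀ i, G i x = 0) → ∀ i, V i x = 0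

/-- Differentiating `z = ηv` twice along `e'` shows that `Y = ∂_{e'} v` satisfies `η ∂_{e'} Y = h -
2(∂_{e'} η)Y` with `h = ∂_{e'}² z - (∂_{e'}² η)v`. This `h` is in `L²` because `v` is, and `ηY` is
in `L²` by the product rule. The second Hardy inequality then gives `∂_{e'} v ∈ L²` for every `e'`
in an open set of directions, which spans all directions. -/
theorem exists_isQuotient {O B : Set (Space d)} {η : Space d → ℝ} {e : Space d} {c κ : ℝ} (hκ : 0 < κ)
    (hP : ∀ e', ‖e' - e‖ ≤ κ → BoundaryPatch O η B e' c) {z : Space d → ℝ}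
    {G : Fin d → Space d → ℝ} {H : Fin d → Fin d → Space d → ℝ} (hz : IsH2 O z G H)
    (hv : MemLp (fun x => (η x)⁻¹ * z x) 2 (volume.restrict O))
    (hB : ∀ x ∈ O, x ∉ B → z x = 0 ∧ ∀ i, G i x = 0) :
    ∃ v V W, IsQuotient O η z G H v V W := by
  have P := hP e (by simpa using hκ.le)
  have hO := P.isOpen
  set m : Space d → ℝ := fun x => (η x)⁻¹ with hm
  have m3 : ContDiffOn ℝ 3 m O := P.contDiffOn_inv
  have m2 : ∀ i, ContDiffOn ℝ 2 (pderiv i m) O := fun i => contDiffOn_pderiv hO m3 (by norm_num) i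
  have m1 : ∀ i j, ContDiffOn ℝ 1 (pderiv i (pderiv j m)) O := fun i j =>
    contDiffOn_pderiv hO (m2 j) (by norm_num) i
  have η2 : ∀ i, ContDiff ℝ 2 (pderiv i η) := fun i => contDiff_pderiv P.smooth (by norm_num) i
  have dm : ∀ x ∈ O, DifferentiableAt ℝ m x := fun x hx =>
    (m3.contDiffAt (hO.mem_nhds hx)).differentiableAt (by simp)
  have dm1 : ∀ i, ∀ x ∈ O, DifferentiableAt ℝ (pderiv i m) x := fun i x hx =>
    ((m2 i).contDiffAt (hO.mem_nhds hx)).differentiableAt (by simp)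
  have dη : Differentiable ℝ η := P.smooth.differentiable (by simp)
  have dη1 : ∀ i, Differentiable ℝ (pderiv i η) := fun i => (η2 i).differentiable (by simp)
  have ηm : ∀ x ∈ O, η x * m x = 1 := fun x hx => mul_inv_cancel₀ (P.pos x hx).ne'
  have r1 : ∀ i, ∀ x ∈ O, pderiv i η x * m x + η x * pderiv i m x = 0 := fun i x hx => by
    rw [← pderiv_mul (dη x) (dm x hx) i]
    have : (fun y => η y * m y) =ᶠ[𝓝 x] fun _ => 1 := mem_of_superset (hO.mem_nhds hx) ηm
    rw [pderiv_congr_of_eventuallyEq this, pderiv_const]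
  have r2 : ∀ i j, ∀ x ∈ O, pderiv i (pderiv j η) x * m x + pderiv j η x * pderiv i m x
      + (pderiv i η x * pderiv j m x + η x * pderiv i (pderiv j m) x) = 0 := fun i j x hx => by
    rw [← pderiv_mul (dη1 j x) (dm x hx) i, ← pderiv_mul (dη x) (dm1 j x hx) i,
      ← pderiv_add ((dη1 j x).fun_mul (dm x hx)) ((dη x).fun_mul (dm1 j x hx)) i]
    have : (fun y => pderiv j η y * m y + η y * pderiv j m y) =ᶠ[𝓝 x] fun _ => 0 :=
      mem_of_superset (hO.mem_nhds hx) (r1 j)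
    rw [pderiv_congr_of_eventuallyEq this, pderiv_const]
  set v : Space d → ℝ := fun x => m x * z x with hvd
  set V : Fin d → Space d → ℝ := fun i x => pderiv i m x * z x + m x * G i x with hV
  set W : Fin d → Fin d → Space d → ℝ := fun i j x =>
    (pderiv i (pderiv j m) x * z x + pderiv j m x * G i x) + (pderiv i m x * G j x + m x * H i j x) with hW
  have w1 : ∀ i, HasWeakPartial O i v (V i) := fun i => (hz.weak₁ i).mul_left hO (m3.of_le (by norm_num))
  have w2 : ∀ i j, HasWeakPartial O i (V j) (W i j) := fun i j =>
    ((hz.weak₁ i).mul_left hO (m2 j)).add ((hz.weak₂ i j).mul_left hO (m3.of_le (by norm_num)))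
  have e1 : ∀ i, ∀ x ∈ O, η x * V i x = G i x - pderiv i η x * v x := fun i x hx => by
    simp only [hV, hvd]
    linear_combination (z x) * r1 i x hx + (G i x) * ηm x hx
  have e2 : ∀ i j, ∀ x ∈ O, η x * W i j x = H i j x - pderiv j η x * V i x - pderiv i η x * V j x
      - pderiv i (pderiv j η) x * v x := fun i j x hx => by
    simp only [hW, hV, hvd]
    linear_combination (z x) * r2 i j x hx + G i x * r1 j x hx + G j x * r1 i x hx + H i j x * ηm x hx
  have lV : ∀ i, ∀ C ⊆ O, IsCompact C → MemLp (V i) 2 (volume.restrict C) := fun i C hC hc =>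
    (memLp_mul_restrict_compact (m2 i).continuousOn hz.memLp hC hc).add
      (memLp_mul_restrict_compact m3.continuousOn (hz.memLp₁ i) hC hc)
  have lW : ∀ i j, ∀ C ⊆ O, IsCompact C → MemLp (W i j) 2 (volume.restrict C) := fun i j C hC hc =>
    ((memLp_mul_restrict_compact (m1 i j).continuousOn hz.memLp hC hc).add
      (memLp_mul_restrict_compact (m2 j).continuousOn (hz.memLp₁ i) hC hc)).add
    ((memLp_mul_restrict_compact (m2 i).continuousOn (hz.memLp₁ j) hC hc).add
      (memLp_mul_restrict_compact m3.continuousOn (hz.memLp₂ i j) hC hc))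
  have mηV : ∀ i, MemLp (fun x => η x * V i x) 2 (volume.restrict O) := fun i => by
    refine (memLp_congr_ae ?_).1 ((hz.memLp₁ i).sub (memLp_bdd_mul hO (η2 i).continuous hv (P.bounded₁ i)))
    filter_upwards [ae_restrict_mem hO.measurableSet] with x hx
    exact (e1 i x hx).symm
  have sV : ∀ x ∈ O, z x = 0 → (∀ i, G i x = 0) → ∀ i, V i x = 0 := fun x _ h0 h1 i => by
    simp only [hV, h0, h1]; ring
  have key : ∀ e', ‖e' - e‖ ≤ κ → MemLp (∑ k, e' k • V k) 2 (volume.restrict O) := fun e' he' => by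
    have P' := hP e' he'
    refine P'.memLp_radial (Y' := fun l => ∑ k, e' k • W l k)
      (h := ∑ l, ∑ k, (e' l * e' k) • (H l k - fun x => pderiv l (pderiv k η) x * v x))
      ⟨fun l => HasWeakPartial.sum_smul _ _ fun k => w2 l k, fun C hC hc =>
        memLp_finsetSum' _ fun k _ => (lV k C hC hc).const_smul _, fun l C hC hc =>
        memLp_finsetSum' _ fun k _ => (lW l k C hC hc).const_smul _, ?_,
        memLp_finsetSum' _ fun l _ => memLp_finsetSum' _ fun k _ => ((hz.memLp₂ l k).sub
          (memLp_bdd_mul hO (continuous_pderiv ((η2 k).of_le (by norm_num)) l) hv (P.bounded₂ l k))).const_smul _,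
        fun x hx => ?_, fun x hx hxB => ?_⟩
    · have := memLp_finsetSum' Finset.univ fun k _ => (mηV k).const_smul (e' k)
      refine (memLp_congr_ae (Eventually.of_forall fun x => ?_)).1 this
      simp only [Finset.sum_apply, Pi.smul_apply, smul_eq_mul, Finset.mul_sum]
      exact Finset.sum_congr rfl fun k _ => by ring
    · simp only [Finset.sum_apply, Pi.smul_apply, smul_eq_mul, Pi.sub_apply]
      have s1 : η x * ∑ l, e' l * ∑ k, e' k * W l k x = ∑ l, ∑ k, e' l * e' k * (η x * W l k x) := by
        simp only [Finset.mul_sum]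
        exact Finset.sum_congr rfl fun l _ => Finset.sum_congr rfl fun k _ => by ring
      have s2 : dirDeriv e' η x * ∑ k, e' k * V k x = ∑ l, ∑ k, e' l * e' k * (pderiv l η x * V k x) := by
        rw [dirDeriv, Finset.sum_mul_sum]
        exact Finset.sum_congr rfl fun l _ => Finset.sum_congr rfl fun k _ => by ring
      -- The two mixed terms of the Hessian of `ηv` coincide after contraction with `e'` in both
      -- slots, whence the factor `2`.
      have s3 : ∑ l, ∑ k, e' l * e' k * (pderiv l η x * V k x) =
          ∑ l, ∑ k, e' l * e' k * (pderiv k η x * V l x) := by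
        rw [Finset.sum_comm]
        exact Finset.sum_congr rfl fun l _ => Finset.sum_congr rfl fun k _ => by ring
      have s4 : 2 * dirDeriv e' η x * ∑ k, e' k * V k x = ∑ l, ∑ k, e' l * e' k * (pderiv l η x * V k x)
          + ∑ l, ∑ k, e' l * e' k * (pderiv k η x * V l x) := by
        rw [← s3, mul_assoc, s2]; ring
      rw [s1, s4]
      simp only [← Finset.sum_add_distrib, ← Finset.sum_sub_distrib]
      exact Finset.sum_congr rfl fun l _ => Finset.sum_congr rfl fun k _ => by rw [e2 l k x hx]; ring
    · obtain ⟨h0, h1⟩ := hB x hx hxB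
      simp [sV x hx h0 h1]
  refine ⟨v, V, W, w1, w2, hv, fun i => ?_, fun x hx => ?_, e1, e2, fun x _ h0 _ => ?_, sV⟩
  · have h1 := key e (by simpa using hκ.le)
    -- The partial derivative `V i` is the difference of the derivatives along `e + κ • bvec i` and
    -- `e`, divided by `κ`.
    have h2 := key (e + κ • bvec i) (by
      rw [add_sub_cancel_left, norm_smul, Real.norm_of_nonneg hκ.le]; simp [bvec])
    refine (memLp_congr_ae (Eventually.of_forall fun x => ?_)).1 ((h2.sub h1).const_smul κ⁻¹)
    simp only [Pi.smul_apply, Pi.sub_apply, Finset.sum_apply, smul_eq_mul, ← Finset.sum_sub_distrib]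
    have s : ∀ k, (e + κ • bvec i : Space d) k * V k x - e k * V k x = κ * ((bvec i : Space d) k * V k x) := fun k => by
      simp only [PiLp.add_apply, PiLp.smul_apply, smul_eq_mul]; ring
    simp only [s, ← Finset.mul_sum]
    have s' : ∑ k, (bvec i : Space d) k * V k x = V i x := by simp [bvec]
    rw [s', inv_mul_cancel_left₀ hκ.ne']
  · simp only [hvd]
    linear_combination (z x) * ηm x hx
  · simp only [hvd, h0, mul_zero]

end PINN

/-! ### One-sided mollification and approximation in `H²` at the boundary -/

namespace PINN

variable {d : ℕ}

theorem tendsto_eLpNorm_zero_of_dominated {α : Type*} [MeasurableSpace α] {μ : Measure α}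
    {f : ℕ → α → ℝ} {g : α → ℝ} (hf : ∀ n, AEStronglyMeasurable (f n) μ) (hg : MemLp g 2 μ)
    (hle : ∀ n, ∀ᵐ x ∂μ, |f n x| ≤ |g x|) (h : ∀ᵐ x ∂μ, Tendsto (fun n => f n x) atTop (𝓝 0)) :
    Tendsto (fun n => eLpNorm (f n) 2 μ) atTop (𝓝 0) := by
  have h1 : Tendsto (fun n => ∫⁻ x, ‖f n x‖ₑ ^ 2 ∂μ) atTop (𝓝 (∫⁻ _, 0 ∂μ)) := by
    refine tendsto_lintegral_of_dominated_convergence' (fun x => ‖g x‖ₑ ^ 2)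
      (fun n => (hf n).enorm.pow_const 2) (fun n => ?_) ?_ ?_
    · filter_upwards [hle n] with x hx
      have : ‖f n x‖ₑ ≤ ‖g x‖ₑ := enorm_le_iff_norm_le.2 hx
      gcongr
    · rw [← eLpNorm_two_sq]
      exact ENNReal.pow_ne_top hg.2.ne
    · filter_upwards [h] with x hx
      have h2 := ENNReal.Tendsto.pow (n := 2) hx.enorm
      simpa using h2
  rw [lintegral_zero] at h1
  have h2 := (ENNReal.continuous_rpow_const (y := (1 / 2 : ℝ))).tendsto 0 |>.comp h1
  simp only [Function.comp_def] at h2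
  rw [ENNReal.zero_rpow_of_pos (by norm_num)] at h2
  refine h2.congr fun n => ?_
  rw [← eLpNorm_two_sq, ← ENNReal.rpow_natCast, ← ENNReal.rpow_mul]
  norm_num

/-- Convergence of functions of class `C^2` in the Sobolev space `H^2(O)`. -/
structure H2Tendsto (O : Set (Space d)) (q : ℕ → Space d → ℝ) (z : Space d → ℝ)
    (G : Fin d → Space d → ℝ) (H : Fin d → Fin d → Space d → ℝ) : Prop where
  smooth : ∀ n, ContDiff ℝ 2 (q n)
  tendsto₀ : Tendsto (fun n => eLpNorm (q n - z) 2 (volume.restrict O)) atTop (𝓝 0)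
  tendsto₁ : ∀ i, Tendsto (fun n => eLpNorm (pderiv i (q n) - G i) 2 (volume.restrict O)) atTop (𝓝 0)
  tendsto₂ : ∀ i j, Tendsto (fun n => eLpNorm (pderiv i (pderiv j (q n)) - H i j) 2
    (volume.restrict O)) atTop (𝓝 0)

theorem tendsto_eLpNorm_mol_indicator {O : Set (Space d)} (hO : MeasurableSet O)
    {K : ℕ → Space d → ℝ} {R : ℕ → ℝ} (hK : ∀ n, IsMollifier (K n) (R n))
    (hR : Tendsto R atTop (𝓝 0)) {f : Space d → ℝ} (hf : MemLp f 2 (volume.restrict O)) :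
    Tendsto (fun n => eLpNorm (mol (K n) (O.indicator f) - f) 2 (volume.restrict O)) atTop (𝓝 0) := by
  have h1 := tendsto_eLpNorm_mol hK hR ((memLp_indicator_iff_restrict hO).2 hf)
  refine tendsto_of_tendsto_of_tendsto_of_le_of_le tendsto_const_nhds h1 (fun _ => zero_le) fun n => ?_
  have : eLpNorm (mol (K n) (O.indicator f) - f) 2 (volume.restrict O) =
      eLpNorm (mol (K n) (O.indicator f) - O.indicator f) 2 (volume.restrict O) := by
    refine eLpNorm_congr_ae ?_
    filter_upwards [ae_restrict_mem hO] with x hx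
    simp [hx]
  simp only [this]
  exact eLpNorm_mono_measure _ Measure.restrict_le_self

/-- A bump function centred at `-(scale n) e`. -/
noncomputable def sideBump (e : Space d) {κ : ℝ} (hκ : 0 < κ) (n : ℕ) : ContDiffBump (-(scale n • e)) where
  rIn := κ * scale n / 2
  rOut := κ * scale n
  rIn_pos := by unfold scale; positivity
  rIn_lt_rOut := by
    have : 0 < κ * scale n := by unfold scale; positivity
    linarith

/-- A mollifier with support on one side of the origin. -/
noncomputable def sideKernel (e : Space d) {κ : ℝ} (hκ : 0 < κ) (n : ℕ) : Space d → ℝ :=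
  (sideBump e hκ n).normed volume

theorem scale_pos (n : ℕ) : 0 < scale n := by unfold scale; positivity

/-- For `t` in the support, `x - t = x + scale n • e'` with `e'` in the cone about `e`.
Mollification at `x` thus samples only points further inside, so no extension across the boundary is
needed. -/
theorem exists_of_mem_tsupport_sideKernel {e : Space d} {κ : ℝ} (hκ : 0 < κ) {n : ℕ} {t : Space d}
    (ht : t ∈ tsupport (sideKernel e hκ n)) : ∃ e', ‖e' - e‖ ≤ κ ∧ -t = scale n • e' := by
  rw [sideKernel, ContDiffBump.tsupport_normed_eq, mem_closedBall_iff_norm] at ht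
  have hs := scale_pos n
  refine ⟨(scale n)⁻¹ • (-t), ?_, by rw [smul_inv_smul₀ hs.ne']⟩
  have e1 : (scale n)⁻¹ • (-t) - e = -((scale n)⁻¹ • (t - -(scale n • e))) := by
    rw [sub_neg_eq_add, smul_add, inv_smul_smul₀ hs.ne', smul_neg]; abel
  rw [e1, norm_neg, norm_smul, norm_inv, Real.norm_of_nonneg hs.le, inv_mul_le_iff₀ hs, mul_comm]
  exact ht

theorem isMollifier_sideKernel (e : Space d) {κ : ℝ} (hκ : 0 < κ) (n : ℕ) :
    IsMollifier (sideKernel e hκ n) (scale n * (‖e‖ + κ)) where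
  smooth := (sideBump e hκ n).contDiff_normed
  nonneg := (sideBump e hκ n).nonneg_normed
  integral_eq_one := (sideBump e hκ n).integral_normed
  support t ht := by
    obtain ⟨e', h1, h2⟩ := exists_of_mem_tsupport_sideKernel hκ (subset_tsupport _ ht)
    rw [← norm_neg, h2, norm_smul, Real.norm_of_nonneg (scale_pos n).le]
    have := norm_add_le e (e' - e)
    rw [add_sub_cancel] at this
    have := scale_pos n
    gcongr
    linarith

theorem tendsto_scale_mul (C : ℝ) : Tendsto (fun n => scale n * C) atTop (𝓝 0) := by
  simpa using tendsto_scale.mul_const C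

/-- On `B'` the set `O` is invariant under small translations in directions close to `e`, and `η`
grows at a rate of at least `c` along them. -/
def HasInwardCone (O : Set (Space d)) (η : Space d → ℝ) (B' : Set (Space d)) (e : Space d) (κ c : ℝ) :
    Prop :=
  ∃ ε₀ > 0, ∀ x ∈ O ∩ B', ∀ ε, 0 < ε → ε < ε₀ → ∀ e', ‖e' - e‖ ≤ κ →
    x + ε • e' ∈ O ∧ η x + c * ε ≤ η (x + ε • e')

section

variable {O B B' T : Set (Space d)} {η z v : Space d → ℝ} {e : Space d} {c κ L : ℝ}
  {G V : Fin d → Space d → ℝ} {H W : Fin d → Fin d → Space d → ℝ}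

theorem HasInwardCone.eventually (hg : HasInwardCone O η B' e κ c) (hκ : 0 < κ) :
    ∀ᶠ n in atTop, ∀ x ∈ O ∩ B', ∀ t ∈ tsupport (sideKernel e hκ n),
      x - t ∈ O ∧ η x + c * scale n ≤ η (x - t) := by
  obtain ⟨ε₀, hε, hg⟩ := hg
  filter_upwards [tendsto_scale.eventually_lt_const hε] with n hn x hx t ht
  obtain ⟨e', h1, h2⟩ := exists_of_mem_tsupport_sideKernel hκ ht
  rw [sub_eq_add_neg, h2]
  exact hg x hx _ (scale_pos n) hn e' h1

theorem mol_indicator_eq_zero {K : Space d → ℝ} {R : ℝ} (hK : IsMollifier K R) {f : Space d → ℝ}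
    (hT : ∀ x ∈ O, x ∉ T → f x = 0) (hB : Metric.cthickening R T ⊆ B') {x : Space d} (hx : x ∉ B') :
    mol K (O.indicator f) x = 0 := by
  refine mol_eq_zero_of_ball hK fun y hy => ?_
  by_cases hyO : y ∈ O
  · rw [indicator_of_mem hyO]
    refine hT y hyO fun hyT => hx (hB (Metric.mem_cthickening_of_dist_le x y R _ hyT ?_))
    rwa [dist_comm, ← Metric.mem_closedBall]
  · exact indicator_of_notMem hyO _

/-- The commutator of the one-sided mollification and the multiplication by `η`. -/
theorem tendsto_commutator (P : BoundaryPatch O η B e c) (hκ : 0 < κ)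
    (hL : ∀ x y, |η x - η y| ≤ L * ‖x - y‖) (hT : IsCompact T) (hB' : IsOpen B') (hTB : T ⊆ B')
    (hg : HasInwardCone O η B' e κ c) {w : Space d → ℝ} (hm : AEStronglyMeasurable w (volume.restrict O))
    (hw : MemLp (fun x => η x * w x) 2 (volume.restrict O)) (hw0 : ∀ x ∈ O, x ∉ T → w x = 0) :
    Tendsto (fun n => eLpNorm (fun x => η x * mol (sideKernel e hκ n) (O.indicator w) x
      - mol (sideKernel e hκ n) (O.indicator fun y => η y * w y) x) 2 (volume.restrict O)) atTop (𝓝 0) := by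
  classical
  have hO := P.isOpen.measurableSet
  have hK := fun n => isMollifier_sideKernel e hκ n
  -- An inward displacement of size `scale n` raises `η` by at least `c * scale n`, so near the
  -- boundary the kernel sees only points of `A n`. On `A n` the scale is at most `η / c`, which
  -- trades the missing integrability of `w` for that of `ηw`.
  set A : ℕ → Set (Space d) := fun n => O ∩ {x | c * scale n ≤ η x} with hA
  have hAm : ∀ n, MeasurableSet (A n) := fun n =>
    hO.inter (measurableSet_le measurable_const P.smooth.continuous.measurable)
  have hcs : ∀ n, 0 < c * scale n := fun n => mul_pos P.c_pos (scale_pos n)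
  set N : ℕ → Space d → ℝ := fun n => (A n).indicator fun x => scale n * |w x| with hN
  set g : Space d → ℝ := O.indicator fun x => c⁻¹ * (η x * w x) with hgd
  have hg2 : MemLp g 2 volume := (memLp_indicator_iff_restrict hO).2 (hw.const_mul _)
  have mN : ∀ n, AEStronglyMeasurable (N n) volume := fun n => by
    rw [aestronglyMeasurable_indicator_iff (hAm n)]
    exact (hm.mono_measure (Measure.restrict_mono inter_subset_left le_rfl)).norm.const_mul _
  have leN : ∀ n x, |N n x| ≤ |g x| := fun n x => by
    by_cases hx : x ∈ A n
    · have h1 : scale n ≤ c⁻¹ * η x := by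
        rw [← div_eq_inv_mul, le_div_iff₀ P.c_pos, mul_comm]; exact hx.2
      simp only [hN, hgd]
      rw [indicator_of_mem hx, indicator_of_mem hx.1, abs_mul, abs_abs, abs_mul, abs_mul,
        abs_of_pos (scale_pos n), abs_of_pos (inv_pos.2 P.c_pos), abs_of_pos (P.pos x hx.1), ← mul_assoc]
      gcongr
    · simp only [hN]
      rw [indicator_of_notMem hx, abs_zero]
      exact abs_nonneg _
  have N2 : ∀ n, MemLp (N n) 2 volume := fun n => hg2.mono (mN n) (Eventually.of_forall (leN n))
  -- `N n` is at most `scale n * |w|`, hence tends to zero pointwise, and is dominated by `c⁻¹ |ηw|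
  -- ∈ L²`.
  have tN : Tendsto (fun n => eLpNorm (N n) 2 volume) atTop (𝓝 0) := by
    refine tendsto_eLpNorm_zero_of_dominated mN hg2 (fun n => Eventually.of_forall (leN n))
      (Eventually.of_forall fun x => ?_)
    refine squeeze_zero_norm (fun n => ?_) (tendsto_scale_mul |w x|)
    by_cases hx : x ∈ A n
    · simp only [hN]
      rw [indicator_of_mem hx, norm_mul, Real.norm_of_nonneg (scale_pos n).le, Real.norm_eq_abs, abs_abs]
    · simp only [hN]
      rw [indicator_of_notMem hx, norm_zero]
      have := scale_pos n
      positivity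
  set D : ℝ := |L| * (‖e‖ + κ) with hD
  have tN' := ENNReal.Tendsto.const_mul tN (Or.inr (ENNReal.ofReal_ne_top (r := D)))
  rw [mul_zero] at tN'
  have hR : Tendsto (fun n => scale n * (‖e‖ + κ)) atTop (𝓝 0) := tendsto_scale_mul _
  obtain ⟨δ, hδ, hδB⟩ := hT.exists_cthickening_subset_open hB' hTB
  refine tendsto_of_tendsto_of_tendsto_of_le_of_le' tendsto_const_nhds tN' (Eventually.of_forall fun _ => zero_le) ?_
  filter_upwards [hg.eventually hκ, hR.eventually_le_const hδ] with n hn hRn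
  -- By the Lipschitz bound `|η(x) - η(x - t)| ≤ D * scale n` on the support of the kernel, so the
  -- commutator is at most `D` times the mollification of `N n`, and Young's inequality applies.
  refine (eLpNorm_le_mul_eLpNorm_of_ae_le_mul (g := mol (sideKernel e hκ n) (N n)) (c := D) ?_ 2).trans ?_
  · filter_upwards [ae_restrict_mem hO] with x hx
    have pos1 : 0 ≤ mol (sideKernel e hκ n) (N n) x := integral_nonneg fun t => by
      refine mul_nonneg ((hK n).nonneg t) (indicator_nonneg (fun y _ => ?_) _)
      have := scale_pos n
      positivity
    rw [Real.norm_of_nonneg pos1]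
    by_cases hxB : x ∈ B'
    · set K := sideKernel e hκ n
      set w' : Space d → ℝ := (A n).indicator w with hw'
      have w'2 : MemLp w' 2 volume := by
        refine (N2 n).of_le_mul (c := (scale n)⁻¹) ?_ (Eventually.of_forall fun y => ?_)
        · rw [aestronglyMeasurable_indicator_iff (hAm n)]
          exact hm.mono_measure (Measure.restrict_mono inter_subset_left le_rfl)
        · by_cases hy : y ∈ A n
          · simp only [hw', hN]
            rw [indicator_of_mem hy, indicator_of_mem hy, norm_mul, Real.norm_of_nonneg (scale_pos n).le,
              inv_mul_cancel_left₀ (scale_pos n).ne', Real.norm_eq_abs, Real.norm_eq_abs, abs_abs]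
          · simp only [hw', hN]
            rw [indicator_of_notMem hy, indicator_of_notMem hy]; simp
      have lw' : LocallyIntegrable w' := w'2.locallyIntegrable (by norm_num)
      have mem : ∀ t, K t ≠ 0 → x - t ∈ A n := fun t ht => by
        obtain ⟨h1, h2⟩ := hn x ⟨hx, hxB⟩ t (subset_tsupport _ ht)
        exact ⟨h1, by have := P.pos x hx; simp only [mem_ofPred_eq]; linarith⟩
      have ηw' : LocallyIntegrable fun y => η y * w' y := lw'.continuous_mul P.smooth.continuous
      have e1 : mol K (O.indicator w) x = mol K w' x := by
        refine integral_congr_ae (Eventually.of_forall fun t => ?_)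
        simp only
        by_cases ht : K t = 0
        · simp [ht]
        · rw [indicator_of_mem (mem t ht).1, hw', indicator_of_mem (mem t ht)]
      have e2 : mol K (O.indicator fun y => η y * w y) x = mol K (fun y => η y * w' y) x := by
        refine integral_congr_ae (Eventually.of_forall fun t => ?_)
        simp only
        by_cases ht : K t = 0
        · simp [ht]
        · rw [indicator_of_mem (mem t ht).1, hw', indicator_of_mem (mem t ht)]
      have e3 : η x * mol K w' x - mol K (fun y => η y * w' y) x =
          ∫ t, K t * ((η x - η (x - t)) * w' (x - t)) := by
        rw [mol, mol, ← integral_const_mul, ← integral_sub ((integrable_mol (hK n) lw' x).const_mul _)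
          (integrable_mol (hK n) ηw' x)]
        exact integral_congr_ae (Eventually.of_forall fun t => by simp only; ring)
      have e4 : D * mol K (N n) x = ∫ t, D * (K t * N n (x - t)) := (integral_const_mul _ _).symm
      rw [e1, e2, e3, e4]
      refine norm_integral_le_of_norm_le ((integrable_mol (hK n)
        ((N2 n).locallyIntegrable (by norm_num)) x).const_mul _) (Eventually.of_forall fun t => ?_)
      by_cases ht : K t = 0
      · simp [ht]
      · have h1 := mem t ht
        have h2 : |η x - η (x - t)| ≤ D * scale n := by
          have h3 := (hK n).support t ht
          calc _ ≤ L * ‖x - (x - t)‖ := hL _ _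
            _ ≤ |L| * (scale n * (‖e‖ + κ)) := by
              rw [sub_sub_cancel]
              exact mul_le_mul (le_abs_self _) h3 (norm_nonneg _) (abs_nonneg _)
            _ = _ := by rw [hD]; ring
        simp only [hN, hw']
        rw [indicator_of_mem h1, indicator_of_mem h1, norm_mul, norm_mul, Real.norm_of_nonneg ((hK n).nonneg t),
          Real.norm_eq_abs, Real.norm_eq_abs]
        calc K t * (|η x - η (x - t)| * |w (x - t)|) ≤ K t * (D * scale n * |w (x - t)|) := by
              have := (hK n).nonneg t
              gcongr
          _ = _ := by ring
    · have hsub := (Metric.cthickening_mono hRn T).trans hδB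
      rw [mol_indicator_eq_zero (hK n) hw0 hsub hxB,
        mol_indicator_eq_zero (hK n) (f := fun y => η y * w y) (fun y hy hyT => by rw [hw0 y hy hyT, mul_zero])
          hsub hxB]
      simp only [mul_zero, sub_zero, norm_zero]
      positivity
  · gcongr
    exact (eLpNorm_mono_measure _ Measure.restrict_le_self).trans (eLpNorm_mol_le (hK n) (mN n))

/-- Approximation near the boundary by `η` times smooth functions. -/
theorem exists_boundary_approx (P : BoundaryPatch O η B e c) (hκ : 0 < κ)
    (hL : ∀ x y, |η x - η y| ≤ L * ‖x - y‖) (hT : IsCompact T) (hB' : IsOpen B') (hTB : T ⊆ B')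
    (hg : HasInwardCone O η B' e κ c) (hz : IsH2 O z G H) (hQ : IsQuotient O η z G H v V W)
    (h0 : ∀ x ∈ O, x ∉ T → z x = 0 ∧ (∀ i, G i x = 0) ∧ ∀ i j, H i j x = 0) :
    ∃ p : ℕ → Space d → ℝ, (∀ n, ContDiff ℝ 2 (p n)) ∧ (∀ n, HasCompactSupport (p n)) ∧
      (∀ᶠ n in atTop, ∀ x ∉ B', p n x = 0) ∧ H2Tendsto O (fun n x => η x * p n x) z G H := by
  have hO := P.isOpen.measurableSet
  have hK := fun n => isMollifier_sideKernel e hκ n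
  have hR : Tendsto (fun n => scale n * (‖e‖ + κ)) atTop (𝓝 0) := tendsto_scale_mul _
  have v0 : ∀ x ∈ O, x ∉ T → v x = 0 := fun x hx hxT =>
    hQ.support x hx (h0 x hx hxT).1 (h0 x hx hxT).2.1
  have V0 : ∀ i, ∀ x ∈ O, x ∉ T → V i x = 0 := fun i x hx hxT =>
    hQ.support₁ x hx (h0 x hx hxT).1 (h0 x hx hxT).2.1 i
  have W0 : ∀ i j, ∀ x ∈ O, x ∉ T → W i j x = 0 := fun i j x hx hxT => by
    have := hQ.eq₂ i j x hx
    rw [(h0 x hx hxT).2.2, V0 i x hx hxT, V0 j x hx hxT, v0 x hx hxT] at this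
    simpa [(P.pos x hx).ne'] using this
  have η1 : ∀ i, Continuous (pderiv i η) := fun i => continuous_pderiv (P.smooth.of_le (by norm_num)) i
  have η2 : ∀ i j, Continuous (pderiv i (pderiv j η)) := fun i j =>
    continuous_pderiv (contDiff_pderiv P.smooth (by norm_num) j) i
  have mηV : ∀ i j, MemLp (fun x => pderiv i η x * V j x) 2 (volume.restrict O) := fun i j =>
    memLp_bdd_mul P.isOpen (η1 i) (hQ.memLp₁ j) (P.bounded₁ i)
  have mηv : ∀ i j, MemLp (fun x => pderiv i (pderiv j η) x * v x) 2 (volume.restrict O) := fun i j =>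
    memLp_bdd_mul P.isOpen (η2 i j) hQ.memLp (P.bounded₂ i j)
  -- The second derivatives `W` of `v` need not be square integrable, but the identity for the
  -- Hessian of `ηv` expresses `ηW` through functions in `L²`.
  have mηW : ∀ i j, MemLp (fun x => η x * W i j x) 2 (volume.restrict O) := fun i j => by
    refine (memLp_congr_ae ?_).1 ((((hz.memLp₂ i j).sub (mηV j i)).sub (mηV i j)).sub (mηv i j))
    filter_upwards [ae_restrict_mem hO] with x hx
    exact (hQ.eq₂ i j x hx).symm
  have mW : ∀ i j, AEStronglyMeasurable (W i j) (volume.restrict O) := fun i j => (hQ.weak₂ i j).2.1.aestronglyMeasurable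
  have lv : LocallyIntegrable (O.indicator v) :=
    ((memLp_indicator_iff_restrict hO).2 hQ.memLp).locallyIntegrable (by norm_num)
  have lV : ∀ i, LocallyIntegrable (O.indicator (V i)) := fun i =>
    ((memLp_indicator_iff_restrict hO).2 (hQ.memLp₁ i)).locallyIntegrable (by norm_num)
  set K := sideKernel e hκ with hKd
  set p : ℕ → Space d → ℝ := fun n => mol (K n) (O.indicator v) with hp
  have pinf : ∀ n, ContDiff ℝ ∞ (p n) := fun n => contDiff_mol (hK n) lv
  have p2 : ∀ n, ContDiff ℝ 2 (p n) := fun n => contDiff_infty.1 (pinf n) 2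
  have hc : HasCompactSupport (O.indicator v) := HasCompactSupport.intro hT fun x hx => by
    by_cases hxO : x ∈ O
    · rw [indicator_of_mem hxO, v0 x hxO hx]
    · exact indicator_of_notMem hxO _
  obtain ⟨δ, hδ, hδB⟩ := hT.exists_cthickening_subset_open hB' hTB
  have hδ2 : Metric.cthickening (δ / 2) T ⊆ interior (Metric.cthickening δ T) :=
    (Metric.cthickening_subset_thickening' hδ (half_lt_self hδ) T).trans
      (Metric.thickening_subset_interior_cthickening δ T)
  have hev : ∀ᶠ n in atTop, Metric.cthickening (scale n * (‖e‖ + κ)) T ⊆ Metric.cthickening (δ / 2) T := by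
    filter_upwards [hR.eventually_le_const (half_pos hδ)] with n hn
    exact Metric.cthickening_mono hn T
  -- On `B'` the cone condition keeps the points seen by the kernel in `O`, so derivatives commute
  -- with mollification. Off `B'` both sides vanish, since such points stay away from a
  -- neighbourhood of `T`.
  have d1 : ∀ᶠ n in atTop, ∀ x ∈ O, ∀ j, pderiv j (p n) x = mol (K n) (O.indicator (V j)) x := by
    filter_upwards [hg.eventually hκ, hev] with n hn hRn x hx j
    by_cases hxB : x ∈ B'
    · exact pderiv_mol (hK n) P.isOpen (hQ.weak₁ j) lv fun t ht => (hn x ⟨hx, hxB⟩ t ht).1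
    · have hxn : x ∉ Metric.cthickening (δ / 2) T := fun h => hxB (hδB (interior_subset (hδ2 h)))
      rw [mol_indicator_eq_zero (hK n) (V0 j) hRn hxn]
      have : p n =ᶠ[𝓝 x] fun _ => 0 := by
        filter_upwards [Metric.isClosed_cthickening.isOpen_compl.mem_nhds hxn] with y hy
        exact mol_indicator_eq_zero (hK n) v0 hRn hy
      rw [pderiv_congr_of_eventuallyEq this, pderiv_const]
  have d2 : ∀ᶠ n in atTop, ∀ x ∈ O, ∀ i j, pderiv i (pderiv j (p n)) x = mol (K n) (O.indicator (W i j)) x := by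
    filter_upwards [hg.eventually hκ, hev, d1] with n hn hRn hd x hx i j
    have e1 : pderiv j (p n) =ᶠ[𝓝 x] mol (K n) (O.indicator (V j)) :=
      mem_of_superset (P.isOpen.mem_nhds hx) fun y hy => hd y hy j
    rw [pderiv_congr_of_eventuallyEq e1]
    by_cases hxB : x ∈ B'
    · exact pderiv_mol (hK n) P.isOpen (hQ.weak₂ i j) (lV j) fun t ht => (hn x ⟨hx, hxB⟩ t ht).1
    · have hxn : x ∉ Metric.cthickening (δ / 2) T := fun h => hxB (hδB (interior_subset (hδ2 h)))
      rw [mol_indicator_eq_zero (hK n) (W0 i j) hRn hxn]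
      have : mol (K n) (O.indicator (V j)) =ᶠ[𝓝 x] fun _ => 0 := by
        filter_upwards [Metric.isClosed_cthickening.isOpen_compl.mem_nhds hxn] with y hy
        exact mol_indicator_eq_zero (hK n) (V0 j) hRn hy
      rw [pderiv_congr_of_eventuallyEq this, pderiv_const]
  have ηC2 : ContDiff ℝ 2 η := P.smooth.of_le (by norm_num)
  have dη : Differentiable ℝ η := P.smooth.differentiable (by simp)
  have tmul : ∀ (b f : Space d → ℝ), (∃ C, ∀ x ∈ O, |b x| ≤ C) → MemLp f 2 (volume.restrict O) →
      Tendsto (fun n => eLpNorm (b * mol (K n) (O.indicator f) - b * f) 2 (volume.restrict O)) atTop (𝓝 0) := by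
    rintro b f ⟨C, hC⟩ hf
    exact eLpNorm_tendsto_mul_bdd ((ae_restrict_mem hO).mono hC) (tendsto_eLpNorm_mol_indicator hO hK hR hf)
  have mmol : ∀ n (f : Space d → ℝ), LocallyIntegrable (O.indicator f) →
      AEStronglyMeasurable (mol (K n) (O.indicator f)) (volume.restrict O) := fun n f hf =>
    (contDiff_mol (hK n) hf).continuous.aestronglyMeasurable
  have mη : AEStronglyMeasurable η (volume.restrict O) := ηC2.continuous.aestronglyMeasurable
  have mη1 : ∀ i, AEStronglyMeasurable (pderiv i η) (volume.restrict O) := fun i => (η1 i).aestronglyMeasurable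
  have mη2 : ∀ i j, AEStronglyMeasurable (pderiv i (pderiv j η)) (volume.restrict O) := fun i j =>
    (η2 i j).aestronglyMeasurable
  refine ⟨p, p2, fun n => hasCompactSupport_mol (hK n) hc, ?_, fun n => ηC2.mul (p2 n), ?_, fun j => ?_, fun i j => ?_⟩
  · filter_upwards [hev] with n hRn x hx
    exact mol_indicator_eq_zero (hK n) v0 (hRn.trans (hδ2.trans (interior_subset.trans hδB))) hx
  · refine (tmul η v P.bounded hQ.memLp).congr fun n => eLpNorm_congr_ae ?_
    filter_upwards [ae_restrict_mem hO] with x hx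
    simp only [Pi.sub_apply, Pi.mul_apply]
    rw [hQ.eq₀ x hx]
  · have h1 := tmul (pderiv j η) v (P.bounded₁ j) hQ.memLp
    have h2 := tmul η (V j) P.bounded (hQ.memLp₁ j)
    have h3 := eLpNorm_tendsto_add (fun n => (mη1 j).mul (mmol n v lv)) (fun n => mη.mul (mmol n (V j) (lV j)))
      ((mη1 j).mul hQ.memLp.1) (mη.mul (hQ.memLp₁ j).1) h1 h2
    refine h3.congr' ?_
    filter_upwards [d1] with n hd
    refine eLpNorm_congr_ae ?_
    filter_upwards [ae_restrict_mem hO] with x hx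
    simp only [Pi.sub_apply, Pi.mul_apply, Pi.add_apply]
    rw [pderiv_mul (dη x) ((p2 n).differentiable (by simp) x), hd x hx, hQ.eq₁ j x hx]
    ring
  · have h1 := tmul (pderiv i (pderiv j η)) v (P.bounded₂ i j) hQ.memLp
    have h2 := tmul (pderiv j η) (V i) (P.bounded₁ j) (hQ.memLp₁ i)
    have h3 := tmul (pderiv i η) (V j) (P.bounded₁ i) (hQ.memLp₁ j)
    have lW : LocallyIntegrable (O.indicator fun y => η y * W i j y) :=
      ((memLp_indicator_iff_restrict hO).2 (mηW i j)).locallyIntegrable (by norm_num)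
    have h4 := tendsto_eLpNorm_mol_indicator hO hK hR (mηW i j)
    -- In the Hessian of `ηp` the term `η * mol W` is compared with `mol (ηW)`, which converges in
    -- `L²`; the error is the commutator. The other three terms carry a bounded derivative of `η`
    -- and a mollified `L²` function.
    have h5 := tendsto_commutator P hκ hL hT hB' hTB hg (mW i j) (mηW i j) (W0 i j)
    have a1 := eLpNorm_tendsto_add (fun n => (mη2 i j).mul (mmol n v lv)) (fun n => (mη1 j).mul (mmol n (V i) (lV i)))
      (mηv i j).1 (mηV j i).1 h1 h2
    have a2 := eLpNorm_tendsto_add (fun n => ((mη2 i j).mul (mmol n v lv)).add ((mη1 j).mul (mmol n (V i) (lV i))))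
      (fun n => (mη1 i).mul (mmol n (V j) (lV j))) ((mηv i j).1.add (mηV j i).1) (mηV i j).1 a1 h3
    have a3 := eLpNorm_tendsto_add (fun n => (((mη2 i j).mul (mmol n v lv)).add
      ((mη1 j).mul (mmol n (V i) (lV i)))).add ((mη1 i).mul (mmol n (V j) (lV j)))) (fun n => mmol n _ lW)
      (((mηv i j).1.add (mηV j i).1).add (mηV i j).1) (mηW i j).1 a2 h4
    have mcomm : ∀ᶠ n in atTop, AEStronglyMeasurable (fun x => η x * mol (K n) (O.indicator (W i j)) x
        - mol (K n) (O.indicator fun y => η y * W i j y) x) (volume.restrict O) := by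
      filter_upwards [d2] with n hd
      have : AEStronglyMeasurable (mol (K n) (O.indicator (W i j))) (volume.restrict O) := by
        have c2 : Continuous (pderiv i (pderiv j (p n))) :=
          continuous_pderiv (contDiff_pderiv (p2 n) (by norm_num) j) i
        refine c2.aestronglyMeasurable.congr ?_
        filter_upwards [ae_restrict_mem hO] with x hx
        exact hd x hx i j
      exact (mη.mul this).sub (mmol n _ lW)
    have a4 := a3.add h5
    rw [add_zero] at a4
    refine tendsto_of_tendsto_of_tendsto_of_le_of_le' tendsto_const_nhds a4 (Eventually.of_forall fun _ => zero_le) ?_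
    filter_upwards [d1, d2, mcomm] with n hd hd2 hmc
    refine le_trans (le_of_eq (eLpNorm_congr_ae ?_)) (eLpNorm_add_le ?_ hmc (by norm_num))
    · filter_upwards [ae_restrict_mem hO] with x hx
      have e2 := hQ.eq₂ i j x hx
      have e1 := pderiv₂_mul ηC2 (p2 n) i j x
      simp only [Pi.sub_apply, Pi.mul_apply, Pi.add_apply]
      rw [e1, hd x hx, hd x hx, hd2 x hx, e2]
      simp only [hp]
      ring
    · exact (((((mη2 i j).mul (mmol n v lv)).add ((mη1 j).mul (mmol n (V i) (lV i)))).add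
        ((mη1 i).mul (mmol n (V j) (lV j)))).add (mmol n _ lW)).sub
        ((((mηv i j).1.add (mηV j i).1).add (mηV i j).1).add (mηW i j).1)

end

end PINN

/-! ### Radial mollifiers and precise values -/

namespace PINN

variable {d : ℕ}

section Layer

variable {α : Type*} [MeasurableSpace α] {μ : Measure α} {k f g : α → ℝ}

theorem integrable_superlevel (hk : Measurable k) (hf : Integrable f μ) :
    Integrable (Function.uncurry fun (t : α) (l : ℝ) => if l < k t then f t else 0)
      (μ.prod (volume.restrict (Ioo (0 : ℝ) 1))) := by
  have hS : MeasurableSet {p : α × ℝ | p.2 < k p.1} :=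
    measurableSet_lt measurable_snd (hk.comp measurable_fst)
  have h1 : Integrable (fun p : α × ℝ => f p.1) (μ.prod (volume.restrict (Ioo (0 : ℝ) 1))) :=
    hf.comp_fst _
  refine (h1.indicator hS).congr (Eventually.of_forall fun p => ?_)
  simp [Function.uncurry, indicator_apply]

/-- The layer cake formula for a weight with values in `[0, 1]`. -/
theorem integral_mul_eq_superlevel [SFinite μ] (hk : Measurable k) (hk0 : ∀ t, 0 ≤ k t) (hk1 : ∀ t, k t ≤ 1)
    (hf : Integrable f μ) :
    ∫ t, k t * f t ∂μ = ∫ l in Ioo (0 : ℝ) 1, ∫ t, (if l < k t then f t else 0) ∂μ := by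
  rw [← integral_integral_swap (integrable_superlevel hk hf)]
  refine integral_congr_ae (Eventually.of_forall fun t => ?_)
  simp only
  have e : (fun l : ℝ => if l < k t then f t else 0) = (Iio (k t)).indicator fun _ => f t := by
    funext l; simp [indicator_apply]
  rw [e, integral_indicator measurableSet_Iio, Measure.restrict_restrict measurableSet_Iio,
    setIntegral_const, smul_eq_mul]
  congr 1
  have : Iio (k t) ∩ Ioo 0 1 = Ioo 0 (k t) := by
    ext l
    simp only [mem_inter_iff, mem_Iio, mem_Ioo]
    exact ⟨fun h => ⟨h.2.1, h.1⟩, fun h => ⟨h.2, h.1, h.2.trans_le (hk1 t)⟩⟩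
  rw [this, Real.volume_real_Ioo_of_le (hk0 t), sub_zero]

/-- By the layer cake formula an integral against `k` is an average over `l` of integrals over `{k >
l}`. An inequality known on these sets passes to the weight `k`. -/
theorem abs_integral_mul_le_of_superlevel [SFinite μ] (hk : Measurable k) (hk0 : ∀ t, 0 ≤ k t) (hk1 : ∀ t, k t ≤ 1)
    (hf : Integrable f μ) (hg : Integrable g μ)
    (h : ∀ l ∈ Ioo (0 : ℝ) 1, |∫ t, (if l < k t then f t else 0) ∂μ| ≤ ∫ t, (if l < k t then g t else 0) ∂μ) :
    |∫ t, k t * f t ∂μ| ≤ ∫ t, k t * g t ∂μ := by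
  rw [integral_mul_eq_superlevel hk hk0 hk1 hf, integral_mul_eq_superlevel hk hk0 hk1 hg]
  have hi := (integrable_superlevel hk hg).integral_prod_right
  simp only [Function.uncurry_apply_pair] at hi
  rw [← Real.norm_eq_abs]
  refine norm_integral_le_of_norm_le hi ?_
  filter_upwards [ae_restrict_mem measurableSet_Ioo] with l hl
  exact h l hl

end Layer

/-- A smooth radially decreasing weight supported in the ball of radius `2 R`. -/
noncomputable def radialWeight (R : ℝ) (t : Space d) : ℝ := Real.smoothTransition (2 - ‖t‖ ^ 2 / R ^ 2)

/-- The normalized weight `radialWeight R`. -/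
noncomputable def radialKernel (R : ℝ) (t : Space d) : ℝ := (∫ s : Space d, radialWeight R s)⁻¹ * radialWeight R t

theorem contDiff_radialWeight (R : ℝ) : ContDiff ℝ ∞ (radialWeight (d := d) R) :=
  (Real.smoothTransition.contDiff (n := ⊤)).comp (contDiff_const.sub ((contDiff_norm_sq ℝ).div_const _))

theorem radialWeight_eq_zero {R : ℝ} (hR : 0 < R) {t : Space d} (ht : 2 * R ≤ ‖t‖) : radialWeight R t = 0 := by
  refine Real.smoothTransition.zero_of_nonpos ?_
  rw [sub_nonpos, le_div_iff₀ (by positivity)]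
  nlinarith

theorem hasCompactSupport_radialWeight {R : ℝ} (hR : 0 < R) : HasCompactSupport (radialWeight (d := d) R) :=
  HasCompactSupport.intro (isCompact_closedBall (0 : Space d) (2 * R)) fun t ht =>
    radialWeight_eq_zero hR (by simpa using (not_le.1 (by simpa using ht)).le)

theorem integral_radialWeight_pos {R : ℝ} (hR : 0 < R) : 0 < ∫ s : Space d, radialWeight R s := by
  refine (contDiff_radialWeight R).continuous.integral_pos_of_hasCompactSupport_nonneg_nonzero (x := 0)
    (hasCompactSupport_radialWeight hR) (fun t => Real.smoothTransition.nonneg _) ?_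
  simp only [radialWeight, norm_zero]
  rw [Real.smoothTransition.one_of_one_le (by norm_num)]
  norm_num

theorem isMollifier_radialKernel {R : ℝ} (hR : 0 < R) : IsMollifier (radialKernel (d := d) R) (2 * R) where
  smooth := contDiff_const.mul (contDiff_radialWeight R)
  nonneg t := mul_nonneg (inv_nonneg.2 (integral_radialWeight_pos hR).le) (Real.smoothTransition.nonneg _)
  integral_eq_one := by
    simp only [radialKernel]
    rw [integral_const_mul, inv_mul_cancel₀ (integral_radialWeight_pos hR).ne']
  support t ht := by
    by_contra h
    exact ht (by rw [radialKernel, radialWeight_eq_zero hR (not_le.1 h).le, mul_zero])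

/-- The radial profile is decreasing and continuous, so its superlevel sets are open balls, with
radius the supremum of the admissible norms. If there are none, the convention `sSup ∅ = 0` gives
the empty ball. -/
theorem exists_superlevel_radialWeight {R : ℝ} (hR : 0 < R) {l : ℝ} (hl : 0 < l) :
    ∃ r, 0 ≤ r ∧ r ≤ 2 * R ∧ {t : Space d | l < radialWeight R t} = Metric.ball 0 r := by
  set κ : ℝ → ℝ := fun s => Real.smoothTransition (2 - s ^ 2 / R ^ 2) with hκ
  have hκc : Continuous κ := Real.smoothTransition.continuous.comp (by fun_prop)
  have hanti : ∀ s s', 0 ≤ s → s ≤ s' → κ s' ≤ κ s := fun s s' h0 h => by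
    refine Real.smoothTransition.monotone ?_
    gcongr
  set S : Set ℝ := {s | 0 ≤ s ∧ l < κ s} with hS
  have hb : ∀ s ∈ S, s ≤ 2 * R := fun s hs => by
    by_contra h
    have : κ s = 0 := by
      refine Real.smoothTransition.zero_of_nonpos ?_
      rw [sub_nonpos, le_div_iff₀ (by positivity)]
      nlinarith
    have := hs.2
    linarith
  have hbdd : BddAbove S := ⟨2 * R, hb⟩
  refine ⟨sSup S, Real.sSup_nonneg fun s hs => hs.1, Real.sSup_le hb (by positivity), ?_⟩
  ext t
  rw [mem_ball_zero_iff, mem_ofPred_eq]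
  constructor
  · intro ht
    have hev : ∀ᶠ s in 𝓝[>] ‖t‖, l < κ s :=
      (hκc.continuousAt.eventually_const_lt ht).filter_mono nhdsWithin_le_nhds
    obtain ⟨s, h1, h2⟩ := (hev.and self_mem_nhdsWithin).exists
    exact (show ‖t‖ < s from h2).trans_le (le_csSup hbdd ⟨(norm_nonneg t).trans (le_of_lt h2), h1⟩)
  · intro ht
    rcases S.eq_empty_or_nonempty with h0 | h0
    · rw [h0, Real.sSup_empty] at ht
      exact absurd ht (not_lt.2 (norm_nonneg t))
    · obtain ⟨s, hs, hts⟩ := exists_lt_of_lt_csSup h0 ht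
      exact hs.2.trans_le (hanti _ _ (norm_nonneg t) hts.le)

theorem integrableOn_comp_sub_left {z : Space d → ℝ} (hz : LocallyIntegrable z) (x : Space d) (r : ℝ) :
    IntegrableOn (fun t => z (x - t)) (Metric.closedBall 0 r) := by
  classical
  have h1 : Integrable ((Metric.closedBall x r).indicator z) :=
    (integrable_indicator_iff Metric.isClosed_closedBall.measurableSet).2
      (hz.integrableOn_isCompact (isCompact_closedBall x r))
  rw [← integrable_indicator_iff Metric.isClosed_closedBall.measurableSet]
  refine (h1.comp_sub_left x).congr (Eventually.of_forall fun t => ?_)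
  simp only [indicator_apply, mem_closedBall_iff_norm, sub_sub_cancel_left, norm_neg, sub_zero]

/-- Radial mollifications converge wherever the precise value exists. -/
theorem tendsto_mol_radialKernel {z : Space d → ℝ} (hz : LocallyIntegrable z) {x : Space d}
    (hx : HasPreciseValue z x) {R : ℕ → ℝ} (hR : ∀ n, 0 < R n) (hR0 : Tendsto R atTop (𝓝 0)) :
    Tendsto (fun n => mol (radialKernel (R n)) z x) atTop (𝓝 (z x)) := by
  rw [Metric.tendsto_nhds]
  intro ε hε
  have h1 := (Metric.tendsto_nhds.1 hx (ε / 2) (half_pos hε))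
  obtain ⟨r₀, hr₀, h2⟩ := mem_nhdsGT_iff_exists_Ioo_subset.1 h1
  rw [mem_Ioi] at hr₀
  filter_upwards [hR0.eventually_lt_const (show (0 : ℝ) < r₀ / 2 by linarith)] with n hn
  have hRn := hR n
  set k := radialWeight (d := d) (R n) with hk
  have hk0 : ∀ t, 0 ≤ k t := fun t => Real.smoothTransition.nonneg _
  have hk1 : ∀ t, k t ≤ 1 := fun t => Real.smoothTransition.le_one _
  have hkm : Measurable k := (contDiff_radialWeight (R n)).continuous.measurable
  set B := Metric.closedBall (0 : Space d) (2 * R n) with hB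
  have hBc : IsCompact B := isCompact_closedBall _ _
  have hBm : MeasurableSet B := hBc.measurableSet
  have hf : Integrable (B.indicator fun t => z (x - t) - z x) :=
    (integrable_indicator_iff hBm).2 ((integrableOn_comp_sub_left hz x _).sub (continuousOn_const.integrableOn_compact hBc))
  have hg : Integrable (B.indicator fun _ => ε / 2) :=
    (integrable_indicator_iff hBm).2 (continuousOn_const.integrableOn_compact hBc)
  -- The superlevel sets of the kernel are balls of radius `r ≤ 2 * R n < r₀`, for which the
  -- averages of `z` about `x` are within `ε / 2` of `z x`. Only averages over balls are known to
  -- converge, hence the choice of radial kernels.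
  have key := abs_integral_mul_le_of_superlevel hkm hk0 hk1 hf hg fun l hl => by
    obtain ⟨r, hr0, hr1, hr⟩ := exists_superlevel_radialWeight (d := d) hRn hl.1
    have hrB : Metric.ball (0 : Space d) r ⊆ B :=
      (Metric.ball_subset_ball hr1).trans Metric.ball_subset_closedBall
    have e : ∀ F : Space d → ℝ, ∫ t, (if l < k t then B.indicator F t else 0) =
        ∫ t in Metric.ball 0 r, F t := fun F => by
      rw [← hr, ← integral_indicator (measurableSet_lt measurable_const hkm)]
      refine integral_congr_ae (Eventually.of_forall fun t => ?_)
      simp only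
      by_cases ht : l < k t
      · rw [if_pos ht, indicator_of_mem (show t ∈ {t | l < k t} from ht),
          indicator_of_mem (hrB (hr ▸ (show t ∈ {t : Space d | l < radialWeight (R n) t} from ht)))]
      · rw [if_neg ht, indicator_of_notMem (show t ∉ {t | l < k t} from ht)]
    rw [e, e, setIntegral_const, smul_eq_mul]
    rcases hr0.eq_or_lt with h0 | h0
    · simp [← h0]
    have hvol : (volume : Measure (Space d)).real (Metric.ball 0 r) = volume.real (Metric.ball x r) := by
      rw [measureReal_def, measureReal_def, Measure.addHaar_ball_center volume x r]
    have hpos : 0 < (volume : Measure (Space d)).real (Metric.ball x r) :=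
      ENNReal.toReal_pos (Metric.measure_ball_pos volume x h0).ne' measure_ball_lt_top.ne
    have hav := h2 ⟨h0, show r < r₀ by linarith⟩
    rw [mem_ofPred_eq, Real.dist_eq, setAverage_eq, smul_eq_mul] at hav
    have e2 : ∫ t in Metric.ball 0 r, (z (x - t) - z x) =
        (∫ y in Metric.ball x r, z y) - volume.real (Metric.ball x r) * z x := by
      rw [integral_sub ((integrableOn_comp_sub_left hz x r).mono_set Metric.ball_subset_closedBall)
        ((continuousOn_const.integrableOn_compact (isCompact_closedBall 0 r)).mono_set
        Metric.ball_subset_closedBall), setIntegral_const, smul_eq_mul, hvol]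
      congr 1
      rw [← integral_indicator Metric.isOpen_ball.measurableSet, ← integral_indicator Metric.isOpen_ball.measurableSet,
        ← integral_sub_left_eq_self _ volume x]
      refine integral_congr_ae (Eventually.of_forall fun t => ?_)
      classical
      simp only [indicator_apply, mem_ball_iff_norm, sub_sub_cancel]
      rw [sub_zero, norm_sub_rev]
    rw [e2, hvol]
    set b := (volume : Measure (Space d)).real (Metric.ball x r)
    have e3 : (∫ y in Metric.ball x r, z y) - b * z x = b * (b⁻¹ * (∫ y in Metric.ball x r, z y) - z x) := by
      field_simp
    rw [e3, abs_mul, abs_of_pos hpos]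
    gcongr
  have hkB : ∀ F : Space d → ℝ, ∫ t, k t * B.indicator F t = ∫ t, k t * F t := fun F => by
    refine integral_congr_ae (Eventually.of_forall fun t => ?_)
    simp only
    by_cases ht : t ∈ B
    · rw [indicator_of_mem ht]
    · rw [hk, radialWeight_eq_zero hRn (by simpa [hB] using (not_le.1 (by simpa [hB] using ht)).le), zero_mul, zero_mul]
  rw [hkB, hkB, integral_mul_const] at key
  have hZ := integral_radialWeight_pos (d := d) hRn
  set Z := ∫ t : Space d, k t with hZd
  have hmol := isMollifier_radialKernel (d := d) hRn
  have e4 : mol (radialKernel (R n)) z x - z x = Z⁻¹ * ∫ t, k t * (z (x - t) - z x) := by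
    have h3 : z x = ∫ t : Space d, radialKernel (R n) t * z x := by rw [integral_mul_const, hmol.integral_eq_one, one_mul]
    conv_lhs => rw [h3]
    rw [mol, ← integral_sub (integrable_mol hmol hz x) (hmol.integrable.mul_const _), ← integral_const_mul]
    refine integral_congr_ae (Eventually.of_forall fun t => ?_)
    simp only [radialKernel]
    ring
  rw [Real.dist_eq, e4, abs_mul, abs_of_pos (inv_pos.2 hZ), inv_mul_lt_iff₀ hZ]
  refine key.trans_lt ?_
  have hZ' : 0 < Z := hZ
  nlinarith

end PINN

/-! ### The functional on `𝓗²` and the interior pieces of `u` -/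

namespace PINN

variable {d M : ℕ}

/-- The gradient of `χ f`. -/
noncomputable def cutGrad (χ f : Space d → ℝ) (G : Fin d → Space d → ℝ) (i : Fin d) (x : Space d) : ℝ :=
  pderiv i χ x * f x + χ x * G i x

/-- The Hessian of `χ f`. -/
noncomputable def cutHess (χ f : Space d → ℝ) (G : Fin d → Space d → ℝ) (H : Fin d → Fin d → Space d → ℝ)
    (i j : Fin d) (x : Space d) : ℝ :=
  (pderiv i (pderiv j χ) x * f x + pderiv j χ x * G i x) + (pderiv i χ x * G j x + χ x * H i j x)

section Cut

variable {χ f : Space d → ℝ} {G : Fin d → Space d → ℝ} {H : Fin d → Fin d → Space d → ℝ}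

theorem IsH2.mul_smooth {Ω : Set (Space d)} (hΩ : IsCompact Ω) (h : IsH2 (interior Ω) f G H)
    (hχ : ContDiff ℝ ∞ χ) :
    IsH2 (interior Ω) (fun x => χ x * f x) (cutGrad χ f G) (cutHess χ f G H) := by
  have h1 : ∀ i, ContDiff ℝ ∞ (pderiv i χ) := fun i => contDiff_pderiv hχ (by simp) i
  have h2 : ∀ i j, ContDiff ℝ ∞ (pderiv i (pderiv j χ)) := fun i j => contDiff_pderiv (h1 j) (by simp) i
  have hO : IsOpen (interior Ω) := isOpen_interior
  have c : ∀ {q : Space d → ℝ}, ContDiff ℝ ∞ q → ContDiffOn ℝ 2 q (interior Ω) := fun hq =>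
    (contDiff_infty.1 hq 2).contDiffOn
  have m : ∀ {q v : Space d → ℝ}, ContDiff ℝ ∞ q → MemLp v 2 (volume.restrict (interior Ω)) →
      MemLp (fun x => q x * v x) 2 (volume.restrict (interior Ω)) := fun hq hv => by
    obtain ⟨C, -, hC⟩ := exists_bound_of_isCompact hΩ hq.continuous
    exact memLp_bdd_mul hO hq.continuous hv ⟨C, fun x hx => hC x (interior_subset hx)⟩
  exact ⟨m hχ h.memLp, fun i => (m (h1 i) h.memLp).add (m hχ (h.memLp₁ i)),
    fun i j => ((m (h2 i j) h.memLp).add (m (h1 j) (h.memLp₁ i))).add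
      ((m (h1 i) (h.memLp₁ j)).add (m hχ (h.memLp₂ i j))),
    fun i => (h.weak₁ i).mul_left hO (c hχ),
    fun i j => ((h.weak₁ i).mul_left hO (c (h1 j))).add ((h.weak₂ i j).mul_left hO (c hχ))⟩

theorem IsH2.mul_test {O : Set (Space d)} (hO : IsOpen O) (h : IsH2 O f G H) (hχ : IsTest O χ) :
    IsH2 univ (fun x => χ x * f x) (cutGrad χ f G) (cutHess χ f G H) := by
  have c : ∀ {q v w : Space d → ℝ} {i : Fin d}, IsTest O q → HasWeakPartial O i v w →
      HasWeakPartial univ i (fun x => q x * v x) (fun x => pderiv i q x * v x + q x * w x) := fun hq hv =>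
    hv.test_mul hO (contDiff_infty.1 hq.1 2) hq.2.1 hq.2.2
  have m : ∀ {q v : Space d → ℝ}, IsTest O q → MemLp v 2 (volume.restrict O) →
      MemLp (fun x => q x * v x) 2 (volume.restrict univ) := fun hq hv => by
    rw [Measure.restrict_univ]
    exact memLp_mul_of_compact (fun C hC _ => hv.mono_measure (Measure.restrict_mono hC le_rfl))
      hq.1.continuous hq.2.1 hq.2.2
  exact ⟨m hχ h.memLp, fun i => (m (hχ.pderiv i) h.memLp).add (m hχ (h.memLp₁ i)),
    fun i j => ((m ((hχ.pderiv j).pderiv i) h.memLp).add (m (hχ.pderiv j) (h.memLp₁ i))).add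
      ((m (hχ.pderiv i) (h.memLp₁ j)).add (m hχ (h.memLp₂ i j))),
    fun i => c hχ (h.weak₁ i), fun i j => (c (hχ.pderiv j) (h.weak₁ i)).add (c hχ (h.weak₂ i j))⟩

theorem cut_eq_zero {x : Space d} (hx : x ∉ tsupport χ) :
    χ x * f x = 0 ∧ (∀ i, cutGrad χ f G i x = 0) ∧ ∀ i j, cutHess χ f G H i j x = 0 := by
  have h0 := image_eq_zero_of_notMem_tsupport hx
  have h1 : ∀ i, pderiv i χ x = 0 := pderiv_eq_zero_of_notMem_tsupport hx
  have h2 : ∀ i j, pderiv i (pderiv j χ) x = 0 := fun i j =>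
    pderiv_eq_zero_of_notMem_tsupport (fun h => hx (tsupport_pderiv_subset χ j h)) i
  simp [cutGrad, cutHess, h0, h1, h2]

end Cut

theorem hasPreciseValue_congr {u v : Space d → ℝ} {x : Space d} (h : u =ᶠ[𝓝 x] v)
    (hu : HasPreciseValue u x) : HasPreciseValue v x := by
  obtain ⟨r, hr, hB⟩ := Metric.mem_nhds_iff.1 h
  unfold HasPreciseValue
  rw [← h.eq_of_nhds]
  refine hu.congr' ?_
  filter_upwards [Ioo_mem_nhdsGT hr] with s hs
  rw [setAverage_eq, setAverage_eq]
  congr 1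
  exact setIntegral_congr_fun Metric.isOpen_ball.measurableSet fun y hy =>
    hB (Metric.ball_subset_ball hs.2.le hy)

/-- Interior approximation: mollification of a compactly supported function in `H²`. -/
theorem exists_interior_approx {O : Set (Space d)} {z : Space d → ℝ} {G : Fin d → Space d → ℝ}
    {H : Fin d → Fin d → Space d → ℝ} (hO : IsOpen O) (hz : IsH2 univ z G H) (hc : HasCompactSupport z)
    (hs : tsupport z ⊆ O) :
    ∃ q : ℕ → Space d → ℝ, (∀ n, HasCompactSupport (q n)) ∧ (∀ n, tsupport (q n) ⊆ O) ∧ H2Tendsto O q z G H ∧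
      ∀ x, HasPreciseValue z x → Tendsto (fun n => q n x) atTop (𝓝 (z x)) := by
  obtain ⟨δ, hδ, hδO⟩ := hc.exists_cthickening_subset_open hO hs
  -- The radial kernel of parameter `R` has support of radius `2R`, and `scale n ≤ 1`, so supports
  -- spread by at most `δ` and stay in `O` for every `n`.
  have hR : ∀ n, 0 < scale n * (δ / 2) := fun n => mul_pos (scale_pos n) (half_pos hδ)
  have hR0 := tendsto_scale_mul (δ / 2)
  have hK := fun n => isMollifier_radialKernel (d := d) (hR n)
  have hR2 : Tendsto (fun n => 2 * (scale n * (δ / 2))) atTop (𝓝 0) := by simpa using hR0.const_mul 2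
  have m : ∀ {f : Space d → ℝ}, MemLp f 2 (volume.restrict univ) → MemLp f 2 volume := fun h => by
    rwa [Measure.restrict_univ] at h
  have lz : LocallyIntegrable z := (m hz.memLp).locallyIntegrable (by norm_num)
  have lG : ∀ i, LocallyIntegrable (G i) := fun i => (m (hz.memLp₁ i)).locallyIntegrable (by norm_num)
  have dm : ∀ {i : Fin d} {f g : Space d → ℝ} (n : ℕ), HasWeakPartial univ i f g → LocallyIntegrable f →
      pderiv i (mol (radialKernel (scale n * (δ / 2))) f) = mol (radialKernel (scale n * (δ / 2))) g :=
    fun {i f g} n h hf => by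
    funext x
    have := pderiv_mol (hK n) isOpen_univ h (by simpa using hf) (x := x) (by simp)
    simpa only [indicator_univ] using this
  have t : ∀ {f : Space d → ℝ}, MemLp f 2 volume → Tendsto (fun n =>
      eLpNorm (mol (radialKernel (scale n * (δ / 2))) f - f) 2 (volume.restrict O)) atTop (𝓝 0) := fun hf =>
    tendsto_of_tendsto_of_tendsto_of_le_of_le tendsto_const_nhds (tendsto_eLpNorm_mol hK hR2 hf)
      (fun _ => zero_le) fun n => eLpNorm_mono_measure _ Measure.restrict_le_self
  refine ⟨fun n => mol (radialKernel (scale n * (δ / 2))) z, fun n => hasCompactSupport_mol (hK n) hc, fun n => ?_,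
    ⟨fun n => contDiff_infty.1 (contDiff_mol (hK n) lz) 2, t (m hz.memLp), fun i => ?_, fun i j => ?_⟩,
    fun x hx => tendsto_mol_radialKernel lz hx hR hR0⟩
  · refine (tsupport_mol_subset (hK n)).trans ((Metric.cthickening_mono ?_ _).trans hδO)
    have : scale n ≤ 1 := by
      unfold scale
      rw [div_le_one (by positivity)]
      have : (0 : ℝ) ≤ n := n.cast_nonneg
      linarith
    nlinarith
  · simp only [dm _ (hz.weak₁ i) lz]
    exact t (m (hz.memLp₁ i))
  · simp only [dm _ (hz.weak₁ j) lz, dm _ (hz.weak₂ i j) (lG j)]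
    exact t (m (hz.memLp₂ i j))

section Functional

variable {Ω : Set (Space d)} {μ : Measure (Space d)} {A : DiffOp d} {η : Space d → ℝ}
    {σ : ℝ → ℝ} {ν : Measure (Param d)} {X : Fin M → Space d} {F : (Space d → ℝ) × (Fin M → ℝ)}

/-- The functional on `H²` represented by the pair `F`. -/
noncomputable def pairing (A : DiffOp d) (Ω : Set (Space d)) (μ : Measure (Space d)) (X : Fin M → Space d)
    (F : (Space d → ℝ) × (Fin M → ℝ)) (z : Space d → ℝ) : ℝ :=
  couple μ F (A.weak Ω z, fun i => z (X i))

namespace Setting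

theorem pairing_classical (S : Setting Ω μ A η σ ν) {q : Space d → ℝ} (hq : ContDiff ℝ 2 q) :
    pairing A Ω μ X F q = testFun A μ X F q :=
  couple_congr EventuallyEq.rfl rfl (G' := (A.classical q, fun i => q (X i)))
    (S.comparable.ac.ae_le (A.weak_ae_classical S.compact hq)) rfl

theorem pairing_sub (S : Setting Ω μ A η σ ν) (hF : MemLp F.1 2 μ) {f₁ f₂ : Space d → ℝ}
    {G₁ G₂ : Fin d → Space d → ℝ} {H₁ H₂ : Fin d → Fin d → Space d → ℝ}
    (h₁ : IsH2 (interior Ω) f₁ G₁ H₁) (h₂ : IsH2 (interior Ω) f₂ G₂ H₂) :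
    pairing A Ω μ X F (f₁ - f₂) = pairing A Ω μ X F f₁ - pairing A Ω μ X F f₂ := by
  have e := S.comparable.ac.ae_le (A.weak_sub h₁ h₂)
  have m1 := S.adm.memLp_weak S.comparable h₁
  have m2 := S.adm.memLp_weak S.comparable h₂
  have i1 := hF.integrable_mul m1
  have i2 := hF.integrable_mul m2
  have e1 : ∫ x, F.1 x * A.weak Ω (f₁ - f₂) x ∂μ =
      ∫ x, F.1 x * A.weak Ω f₁ x ∂μ - ∫ x, F.1 x * A.weak Ω f₂ x ∂μ := by
    have s := integral_sub i1 i2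
    simp only [Pi.mul_apply] at s
    rw [← s]
    refine integral_congr_ae ?_
    filter_upwards [e] with x hx
    rw [hx, Pi.sub_apply, mul_sub]
  simp only [pairing, couple]
  rw [e1]
  simp only [Pi.sub_apply, mul_sub, Finset.sum_sub_distrib]
  ring

theorem pairing_congr (S : Setting Ω μ A η σ ν) (hX : ∀ i, X i ∈ interior Ω) {f f' : Space d → ℝ}
    {G : Fin d → Space d → ℝ} {H : Fin d → Fin d → Space d → ℝ} (h : IsH2 (interior Ω) f G H)
    (he : ∀ x ∈ interior Ω, f x = f' x) : pairing A Ω μ X F f = pairing A Ω μ X F f' := by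
  have hO : IsOpen (interior Ω) := isOpen_interior
  have h' : IsH2 (interior Ω) f' G H := h.congr hO ((ae_restrict_mem hO.measurableSet).mono he)
  refine couple_congr EventuallyEq.rfl rfl (S.comparable.ac.ae_le ?_) (funext fun i => he _ (hX i))
  filter_upwards [A.weak_ae h, A.weak_ae h', ae_restrict_mem hO.measurableSet] with x h1 h2 hx
  rw [h1, h2, he x hx]

/-- The functional is continuous along approximations in `H²` that converge at the observation
points. -/
theorem pairing_eq_zero_of_tendsto (S : Setting Ω μ A η σ ν) (hF : MemLp F.1 2 μ) {z : Space d → ℝ}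
    {G : Fin d → Space d → ℝ} {H : Fin d → Fin d → Space d → ℝ} {q : ℕ → Space d → ℝ}
    (hz : IsH2 (interior Ω) z G H) (hq : H2Tendsto (interior Ω) q z G H)
    (hX : ∀ i, Tendsto (fun n => q n (X i)) atTop (𝓝 (z (X i))))
    (h0 : ∀ᶠ n in atTop, testFun A μ X F (q n) = 0) : pairing A Ω μ X F z = 0 := by
  obtain ⟨k, hk⟩ := S.adm.exists_eLpNorm_weak_le S.comparable
  have hqn := fun n => IsH2.of_contDiff S.compact (hq.smooth n)
  have t0 := S.comparable.symm.tendsto hq.tendsto₀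
  have t1 := fun i => S.comparable.symm.tendsto (hq.tendsto₁ i)
  have t2 := fun i j => S.comparable.symm.tendsto (hq.tendsto₂ i j)
  have tw : Tendsto (fun n => eLpNorm (A.weak Ω (q n) - A.weak Ω z) 2 μ) atTop (𝓝 0) := by
    have t3 := (t0.add (tendsto_finsetSum Finset.univ fun i _ => t1 i)).add
      (tendsto_finsetSum Finset.univ fun i _ => tendsto_finsetSum Finset.univ fun j _ => t2 i j)
    have t4 := ENNReal.Tendsto.const_mul t3 (Or.inr (ENNReal.coe_ne_top (r := k)))
    simp only [Finset.sum_const_zero, add_zero, mul_zero] at t4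
    refine tendsto_of_tendsto_of_tendsto_of_le_of_le tendsto_const_nhds t4 (fun _ => zero_le) fun n => ?_
    have e := S.comparable.ac.ae_le (A.weak_sub (hqn n) hz)
    simp only
    rw [← eLpNorm_congr_ae e]
    exact hk _ _ _ ((hqn n).sub hz)
  have t5 := tendsto_integral_mul_of_eLpNorm (fun n => S.adm.memLp_weak S.comparable (hqn n))
    (S.adm.memLp_weak S.comparable hz) hF tw
  have t6 : Tendsto (fun n => pairing A Ω μ X F (q n)) atTop (𝓝 (pairing A Ω μ X F z)) := by
    simp only [pairing, couple]
    refine Tendsto.add (by simpa only [mul_comm] using t5) (Tendsto.const_mul _ ?_)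
    exact tendsto_finsetSum _ fun i _ => (hX i).const_mul _
  refine tendsto_nhds_unique t6 (tendsto_const_nhds.congr' ?_)
  filter_upwards [h0] with n hn
  rw [S.pairing_classical (hq.smooth n), hn]

/-- Away from the boundary `η` is positive, so every `C²` function `q` with compact support in the
interior has the form `ηp` with `p = q/η` in `C_c²`, and is annihilated. Radial mollification
supplies such `q` with convergence both in `H²` and at the observation points. -/
theorem pairing_interior (S : Setting Ω μ A η σ ν) (hη : ∀ x ∈ interior Ω, 0 < η x) (hF : MemLp F.1 2 μ)
    (hker : ∀ p : Space d → ℝ, ContDiff ℝ 2 p → HasCompactSupport p → Annihilates A η μ X F p)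
    {u : Space d → ℝ} {G : Fin d → Space d → ℝ} {H : Fin d → Fin d → Space d → ℝ}
    (hu : IsH2 (interior Ω) u G H) {χ : Space d → ℝ} (hχ : IsTest (interior Ω) χ)
    (hpv : ∀ i, HasPreciseValue (fun x => χ x * u x) (X i)) :
    pairing A Ω μ X F (fun x => χ x * u x) = 0 := by
  have hO : IsOpen (interior Ω) := isOpen_interior
  have ts : tsupport (fun x => χ x * u x) ⊆ tsupport χ := tsupport_mul_subset_left
  obtain ⟨q, qc, qs, hq, hqx⟩ := exists_interior_approx hO (hu.mul_test hO hχ)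
    (hχ.2.1.of_isClosed_subset (isClosed_tsupport _) ts) (ts.trans hχ.2.2)
  refine S.pairing_eq_zero_of_tendsto hF (hu.mul_smooth S.compact hχ.1) hq (fun i => hqx _ (hpv i))
    (Eventually.of_forall fun n => ?_)
  have hinv : ContDiffOn ℝ 2 (fun x => (η x)⁻¹) (interior Ω) :=
    S.aux₂.contDiffOn.inv fun x hx => (hη x hx).ne'
  have h1 := (hker (fun x => (η x)⁻¹ * q n x) (contDiff_mul_of_tsupport_subset hO hinv (hq.smooth n) (qs n))
    ((qc n).of_isClosed_subset (isClosed_tsupport _) (tsupport_mul_subset_right' _ _))).eq_zero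
  have e : q n = fun x => η x * ((η x)⁻¹ * q n x) := funext fun x => by
    by_cases hx : x ∈ interior Ω
    · rw [mul_inv_cancel_left₀ (hη x hx).ne']
    · rw [image_eq_zero_of_notMem_tsupport fun h => hx (qs n h), mul_zero, mul_zero]
  exact (congrArg (testFun A μ X F) e).trans h1

end Setting

end Functional

end PINN

/-! ### The boundary pieces of `u` and the gluing -/

namespace PINN

variable {d M : ℕ}

namespace IsAuxiliary

variable {Ω : Set (Space d)} {η : Space d → ℝ} {p e : Space d} {c r κ : ℝ}

theorem differentiable (hη : IsAuxiliary Ω η) : Differentiable ℝ η := hη.isCb.1.differentiable (by norm_num)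

theorem exists_lipschitz (hη : IsAuxiliary Ω η) : ∃ L, ∀ x y, |η x - η y| ≤ L * ‖x - y‖ := by
  obtain ⟨C, hC⟩ := hη.isCb.2 1 (by norm_num)
  refine ⟨C, fun x y => ?_⟩
  exact Convex.norm_image_sub_le_of_norm_fderiv_le (𝕜 := ℝ) (f := η) (s := univ) (C := C)
    (fun x _ => hη.differentiable x)
    (fun x _ => by rw [← norm_iteratedFDeriv_one]; exact hC x) convex_univ (mem_univ y) (mem_univ x)

/-- Near a boundary point `η` increases along an open cone of directions. -/
theorem exists_cone (hη : IsAuxiliary Ω η) (hp : p ∈ frontier Ω) :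
    ∃ e : Space d, ∃ δ > 0, ∀ x ∈ Metric.ball p δ, ∀ e', ‖e' - e‖ < δ → 1 / 2 ≤ fderiv ℝ η x e' := by
  obtain ⟨v, hv⟩ : ∃ v, fderiv ℝ η p v ≠ 0 := by
    by_contra! h
    exact hη.fderiv_ne_zero p hp (ContinuousLinearMap.ext h)
  have hc : Continuous fun q : Space d × Space d => fderiv ℝ η q.1 q.2 :=
    hη.isCb.1.continuous_fderiv_apply (by norm_num)
  have h1 : ∀ᶠ q in 𝓝 (p, (fderiv ℝ η p v)⁻¹ • v), (1 / 2 : ℝ) < fderiv ℝ η q.1 q.2 :=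
    hc.continuousAt.eventually_const_lt (by simp [hv]; norm_num)
  obtain ⟨δ, hδ, hB⟩ := Metric.mem_nhds_iff.1 h1
  refine ⟨(fderiv ℝ η p v)⁻¹ • v, δ, hδ, fun x hx e' he => ?_⟩
  have : (x, e') ∈ Metric.ball (p, (fderiv ℝ η p v)⁻¹ • v) δ := by
    rw [Metric.mem_ball, Prod.dist_eq, max_lt_iff, dist_eq_norm e']
    exact ⟨hx, he⟩
  exact le_of_lt (hB this)

theorem boundaryPatch (hη : IsAuxiliary Ω η) (hΩ : IsCompact Ω) (hc : 0 < c) {B : Set (Space d)}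
    (h : ∀ x ∈ B, c ≤ fderiv ℝ η x e) : BoundaryPatch (interior Ω) η B e c where
  isOpen := isOpen_interior
  smooth := hη.isCb.1
  pos := hη.pos
  compact δ hδ := by
    -- On the frontier `η` is zero, so a superlevel set in `Ω` with positive level already lies in
    -- the interior, and it is compact as a closed subset of `Ω`.
    have : interior Ω ∩ {x | δ ≤ η x} = Ω ∩ {x | δ ≤ η x} := by
      refine subset_antisymm (inter_subset_inter_left _ interior_subset) fun x hx => ⟨?_, hx.2⟩
      by_contra hi
      have h0 := hη.zero x (hΩ.isClosed.frontier_eq ▸ ⟨hx.1, hi⟩)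
      have h1 : δ ≤ η x := hx.2
      linarith
    rw [this]
    exact hΩ.inter_right (isClosed_le continuous_const hη.isCb.1.continuous)
  bounded := by
    obtain ⟨C, -, hC⟩ := exists_bound_of_isCompact hΩ hη.isCb.1.continuous
    exact ⟨C, fun x hx => hC x (interior_subset hx)⟩
  bounded₁ i := by
    have h1 : ContDiff ℝ 2 (pderiv i η) := contDiff_pderiv hη.isCb.1 (by norm_num) i
    obtain ⟨C, -, hC⟩ := exists_bound_of_isCompact hΩ h1.continuous
    exact ⟨C, fun x hx => hC x (interior_subset hx)⟩
  bounded₂ i j := by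
    have h1 : ContDiff ℝ 2 (pderiv j η) := contDiff_pderiv hη.isCb.1 (by norm_num) j
    have h2 : ContDiff ℝ 1 (pderiv i (pderiv j η)) := contDiff_pderiv h1 (by norm_num) i
    obtain ⟨C, -, hC⟩ := exists_bound_of_isCompact hΩ h2.continuous
    exact ⟨C, fun x hx => hC x (interior_subset hx)⟩
  c_pos := hc
  le_dirDeriv x hx := by
    rw [dirDeriv_eq_fderiv (hη.differentiable x)]
    exact h x hx

/-- Integrating the lower bound on the directional derivative along the segment gives the growth of
`η`. The segment cannot leave the interior, because at an exit point `η` would be zero while it has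
only increased from a positive value. -/
theorem hasInwardCone (hη : IsAuxiliary Ω η) (hr : 0 < r) (hκ : 0 < κ) (hc : 0 < c)
    (h : ∀ x ∈ Metric.ball p r, ∀ e', ‖e' - e‖ ≤ κ → c ≤ fderiv ℝ η x e') :
    HasInwardCone (interior Ω) η (Metric.ball p (r / 2)) e κ c := by
  have hD : 0 < ‖e‖ + κ + 1 := by positivity
  -- This bounds the displacement by `r / 2`, so that a segment started in the ball of radius `r /
  -- 2` stays in that of radius `r`.
  refine ⟨r / 2 / (‖e‖ + κ + 1), by positivity, fun x hx ε hε hε' e' he => ?_⟩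
  have hB : ∀ s ∈ Icc 0 ε, x + s • e' ∈ Metric.ball p r := fun s hs => by
    have h1 : ‖e'‖ ≤ ‖e‖ + κ := by
      have := norm_add_le e (e' - e)
      rw [add_sub_cancel] at this
      linarith
    have h2 : s * ‖e'‖ ≤ ε * (‖e‖ + κ + 1) :=
      mul_le_mul hs.2 (h1.trans (by linarith)) (norm_nonneg _) hε.le
    have h3 := (lt_div_iff₀ hD).1 hε'
    have h4 := hx.2
    rw [mem_ball_iff_norm] at h4 ⊢
    calc _ = ‖(x - p) + s • e'‖ := by congr 1; abel
      _ ≤ ‖x - p‖ + s * ‖e'‖ := by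
        refine (norm_add_le _ _).trans_eq ?_
        rw [norm_smul, Real.norm_of_nonneg hs.1]
      _ < r := by linarith
  have hd : ∀ s : ℝ, HasDerivAt (fun s : ℝ => η (x + s • e')) (fderiv ℝ η (x + s • e') e') s := fun s => by
    have h1 : HasDerivAt (fun s : ℝ => x + s • e') e' s := by
      simpa using ((hasDerivAt_id s).smul_const e').const_add x
    exact (hη.differentiable (x + s • e')).hasFDerivAt.comp_hasDerivAt s h1
  have hm : ∀ s ∈ Icc 0 ε, η x + c * s ≤ η (x + s • e') := fun s hs => by
    have h1 := Convex.mul_sub_le_image_sub_of_le_deriv (convex_Icc 0 ε) (C := c)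
      (fun s _ => (hd s).continuousAt.continuousWithinAt)
      (fun s _ => (hd s).differentiableAt.differentiableWithinAt)
      (fun s hs => by rw [(hd s).deriv]; exact h _ (hB s (interior_subset hs)) _ he)
      0 ⟨le_rfl, hε.le⟩ s hs hs.1
    simp only [zero_smul, add_zero, sub_zero] at h1
    linarith
  refine ⟨?_, hm ε ⟨hε.le, le_rfl⟩⟩
  -- The connected segment is covered by the interior and the complement of its closure, as `η > 0`
  -- excludes frontier points; since it starts in the interior, it remains there.
  have hpre : IsPreconnected ((fun s : ℝ => x + s • e') '' Icc 0 ε) :=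
    isPreconnected_Icc.image _ (by fun_prop)
  refine hpre.subset_left_of_subset_union (u := interior Ω) (v := (closure (interior Ω))ᶜ) isOpen_interior
    isClosed_closure.isOpen_compl (disjoint_compl_right.mono_left subset_closure) ?_
    ⟨x, (mem_image _ _ _).2 ⟨0, left_mem_Icc.2 hε.le, by simp⟩, hx.1⟩ (mem_image_of_mem _ (right_mem_Icc.2 hε.le))
  rintro _ ⟨s, hs, rfl⟩
  by_contra hcon
  rw [mem_union, not_or, notMem_compl_iff] at hcon
  have h0 := hη.zero (x + s • e') (frontier_interior_subset (by
    rw [isOpen_interior.frontier_eq]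
    exact ⟨hcon.2, hcon.1⟩))
  have h1 := hm s hs
  have h2 := hη.pos x hx.1
  have h3 := mul_nonneg hc.le hs.1
  linarith

end IsAuxiliary

theorem MemH10.exists_cut_approx {Ω : Set (Space d)} {μ : Measure (Space d)}
    (hΩ : IsCompact Ω) (hμ : Comparable μ (volume.restrict (interior Ω))) {u χ : Space d → ℝ}
    (h : MemH10 Ω μ u) (hu : MemH2 Ω μ u) (hχ : ContDiff ℝ ∞ χ) :
    ∃ φ : ℕ → Space d → ℝ, (∀ n, IsTest (interior Ω) (φ n)) ∧ (∀ n, tsupport (φ n) ⊆ tsupport χ) ∧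
      Tendsto (fun n => eLpNorm (φ n - fun x => χ x * u x) 2 (volume.restrict (interior Ω))) atTop (𝓝 0) ∧
      ∀ i, Tendsto (fun n => eLpNorm (pderiv i (φ n) -
        cutGrad χ u (fun i => weakPartial (interior Ω) i u) i) 2 (volume.restrict (interior Ω))) atTop (𝓝 0) := by
  obtain ⟨-, φ, hφ, h0, h1⟩ := h
  have hu2 := hu.isH2 hμ
  have t0 := hμ.tendsto h0
  have t1 := fun i => hμ.tendsto (h1 i)
  have hb : ∀ {q : Space d → ℝ}, Continuous q →
      ∃ C, ∀ᵐ x ∂(volume.restrict (interior Ω)), |q x| ≤ C := fun hq => by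
    obtain ⟨C, -, hC⟩ := exists_bound_of_isCompact hΩ hq
    exact ⟨C, (ae_restrict_mem isOpen_interior.measurableSet).mono fun x hx => hC x (interior_subset hx)⟩
  have ts : ∀ n, tsupport (fun x => χ x * φ n x) ⊆ tsupport (φ n) := fun n => tsupport_mul_subset_right' _ _
  have cχ : ∀ i, Continuous (pderiv i χ) := fun i => (contDiff_pderiv (contDiff_infty.1 hχ 2) (m := 1) (by norm_num) i).continuous
  refine ⟨fun n x => χ x * φ n x, fun n => ⟨hχ.mul (hφ n).1,
    (hφ n).2.1.of_isClosed_subset (isClosed_tsupport _) (ts n), (ts n).trans (hφ n).2.2⟩,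
    fun n => tsupport_mul_subset_left, ?_, fun i => ?_⟩
  · obtain ⟨C, hC⟩ := hb hχ.continuous
    exact eLpNorm_tendsto_mul_bdd hC t0
  · obtain ⟨C, hC⟩ := hb hχ.continuous
    obtain ⟨C', hC'⟩ := hb (cχ i)
    have t2 := eLpNorm_tendsto_add (fun n => (cχ i).aestronglyMeasurable.mul (hφ n).1.continuous.aestronglyMeasurable)
      (fun n => hχ.continuous.aestronglyMeasurable.mul ((hφ n).pderiv i).1.continuous.aestronglyMeasurable)
      ((cχ i).aestronglyMeasurable.mul hu2.memLp.1)
      (hχ.continuous.aestronglyMeasurable.mul (hu2.memLp₁ i).1)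
      (eLpNorm_tendsto_mul_bdd hC' t0) (eLpNorm_tendsto_mul_bdd hC (t1 i))
    have e : ∀ n, pderiv i (fun x => χ x * φ n x) = pderiv i χ * φ n + χ * pderiv i (φ n) := fun n =>
      funext fun x => pderiv_mul (hχ.differentiable (by simp) x) ((hφ n).1.differentiable (by simp) x) i
    simp only [e]
    exact t2

namespace Setting

variable {Ω : Set (Space d)} {μ : Measure (Space d)} {A : DiffOp d} {η : Space d → ℝ}
    {σ : ℝ → ℝ} {ν : Measure (Param d)} {X : Fin M → Space d} {F : (Space d → ℝ) × (Fin M → ℝ)}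

/-- Near `p` the cut-off function is divided by `η` and approximated in `H²` by `ηp_n` with `p_n ∈
C_c²`, which are annihilated. The neighbourhood is chosen free of observation points, so convergence
of the point values is trivial there. -/
theorem pairing_boundary (S : Setting Ω μ A η σ ν) (hη : IsAuxiliary Ω η) (hF : MemLp F.1 2 μ)
    (hker : ∀ p : Space d → ℝ, ContDiff ℝ 2 p → HasCompactSupport p → Annihilates A η μ X F p)
    (hX : ∀ i, X i ∈ interior Ω) {u : Space d → ℝ} (hu : MemH2Zero Ω μ u) {p : Space d}
    (hp : p ∈ frontier Ω) :
    ∃ r > 0, (∀ i, X i ∉ Metric.closedBall p r) ∧ ∀ χ : Space d → ℝ, ContDiff ℝ ∞ χ →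
      tsupport χ ⊆ Metric.closedBall p r → pairing A Ω μ X F (fun x => χ x * u x) = 0 := by
  obtain ⟨e, δ, hδ, hcone⟩ := hη.exists_cone hp
  obtain ⟨δ', hδ', hXB⟩ := Metric.isOpen_iff.1 (finite_range X).isClosed.isOpen_compl p
    (by rintro ⟨i, rfl⟩; exact hp.2 (hX i))
  obtain ⟨L, hL⟩ := hη.exists_lipschitz
  set r := min δ δ' with hr
  have hr0 : 0 < r := lt_min hδ hδ'
  have hXr : ∀ i, X i ∉ Metric.ball p r := fun i hi =>
    hXB (Metric.ball_subset_ball (min_le_right _ _) hi) ⟨i, rfl⟩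
  have hκ : 0 < δ / 2 := half_pos hδ
  have hc : ∀ x ∈ Metric.ball p r, ∀ e', ‖e' - e‖ ≤ δ / 2 → 1 / 2 ≤ fderiv ℝ η x e' := fun x hx e' he =>
    hcone x (Metric.ball_subset_ball (min_le_left _ _) hx) e' (by linarith)
  have hP : ∀ e', ‖e' - e‖ ≤ δ / 2 → BoundaryPatch (interior Ω) η (Metric.ball p r) e' (1 / 2) := fun e' he =>
    hη.boundaryPatch S.compact (by norm_num) fun x hx => hc x hx e' he
  have P := hP e (by simpa using hκ.le)
  have hg : HasInwardCone (interior Ω) η (Metric.ball p (r / 2)) e (δ / 2) (1 / 2) :=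
    hη.hasInwardCone hr0 hκ (by norm_num) hc
  -- Three nested balls: the cutoff lives within `r / 4`, its mollifications within `r / 2`, and the
  -- monotonicity of `η` holds within `r`.
  have b1 : Metric.closedBall p (r / 4) ⊆ Metric.ball p (r / 2) := Metric.closedBall_subset_ball (by linarith)
  have b2 : Metric.ball p (r / 2) ⊆ Metric.ball p r := Metric.ball_subset_ball (by linarith)
  refine ⟨r / 4, by positivity, fun i hi => hXr i (b2 (b1 hi)), fun χ hχ hs => ?_⟩
  have hz := (hu.1.isH2 S.comparable).mul_smooth S.compact hχ
  obtain ⟨φ, hφ, hφs, h0, h1⟩ := hu.2.exists_cut_approx S.compact S.comparable hu.1 hχ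
  have hv := P.memLp_div hφ (fun n => ((hφs n).trans hs).trans (b1.trans b2)) hz.memLp hz.memLp₁ h0 h1
  have hcut := fun {x : Space d} (hx : x ∉ tsupport χ) =>
    cut_eq_zero (f := u) (G := fun i => weakPartial (interior Ω) i u)
      (H := fun i j => weakPartial (interior Ω) i (weakPartial (interior Ω) j u)) hx
  obtain ⟨v, V, W, hQ⟩ := exists_isQuotient hκ hP hz hv fun x _ hx =>
    have h := hcut fun h => hx (b2 (b1 (hs h)))
    ⟨h.1, h.2.1⟩
  obtain ⟨q, q2, qc, qB, hq⟩ := exists_boundary_approx P hκ hL (isCompact_closedBall p (r / 4))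
    Metric.isOpen_ball b1 hg hz hQ fun x _ hx => hcut fun h => hx (hs h)
  refine S.pairing_eq_zero_of_tendsto hF hz hq (fun i => ?_)
    (Eventually.of_forall fun n => (hker _ (q2 n) (qc n)).eq_zero)
  refine tendsto_const_nhds.congr' ?_
  filter_upwards [qB] with n hn
  rw [hn _ fun h => hXr i (b2 h), mul_zero, (hcut fun h => hXr i (b2 (b1 (hs h)))).1]

/-- Each new factor `1 - f_k` changes the function by `f_k` times the earlier product times `u`.
That change is cut off within the support of `f_k`, where the functional vanishes. -/
theorem pairing_prod (S : Setting Ω μ A η σ ν) (hF : MemLp F.1 2 μ) {u : Space d → ℝ} (hu : MemH2 Ω μ u)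
    {ι : Type*} {f : ι → Space d → ℝ} (hf : ∀ k, ContDiff ℝ ∞ (f k)) (s : Finset ι)
    (h : ∀ k ∈ s, ∀ χ : Space d → ℝ, ContDiff ℝ ∞ χ → tsupport χ ⊆ tsupport (f k) →
      pairing A Ω μ X F (fun x => χ x * u x) = 0) :
    pairing A Ω μ X F (fun x => (∏ k ∈ s, (1 - f k x)) * u x) = pairing A Ω μ X F u := by
  classical
  have hψ : ∀ s : Finset ι, ContDiff ℝ ∞ fun x => ∏ k ∈ s, (1 - f k x) := fun s =>
    contDiff_prod fun k _ => contDiff_const.sub (hf k)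
  induction s using Finset.induction_on with
  | empty => simp
  | insert a s ha ih =>
    have hc : ContDiff ℝ ∞ fun x => f a x * ∏ k ∈ s, (1 - f k x) := (hf a).mul (hψ s)
    have h1 := h a (Finset.mem_insert_self a s) _ hc tsupport_mul_subset_left
    have hu2 := hu.isH2 S.comparable
    have h2 := S.pairing_sub (X := X) hF (hu2.mul_smooth S.compact (hψ s)) (hu2.mul_smooth S.compact hc)
    rw [h1, sub_zero, ih fun k hk => h k (Finset.mem_insert_of_mem hk)] at h2
    rw [← h2]
    congr 1
    funext x
    rw [Pi.sub_apply, Finset.prod_insert ha]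
    ring

/-- A functional that annihilates all products of `η` with compactly supported `C²` functions
vanishes on `𝓗²₍₀₎`. -/
theorem pairing_eq_zero (S : Setting Ω μ A η σ ν) (hη : IsAuxiliary Ω η) (hF : MemLp F.1 2 μ)
    (hker : ∀ p : Space d → ℝ, ContDiff ℝ 2 p → HasCompactSupport p → Annihilates A η μ X F p)
    (hX : ∀ i, X i ∈ interior Ω) {u : Space d → ℝ} (hu : MemH2Zero Ω μ u)
    (hobs : ∀ i, HasPreciseValue u (X i)) : pairing A Ω μ X F u = 0 := by
  classical
  have hcl := S.compact.isClosed
  have hfc : IsCompact (frontier Ω) := S.compact.of_isClosed_subset isClosed_frontier hcl.frontier_subset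
  choose r hr hXr hpair using fun p : frontier Ω => S.pairing_boundary hη hF hker hX hu p.2
  let f : ∀ p : frontier Ω, ContDiffBump (p : Space d) := fun p => ⟨r p / 2, r p, half_pos (hr p), half_lt_self (hr p)⟩
  obtain ⟨t, ht⟩ := hfc.elim_nhds_subcover' (fun p hp => Metric.ball p (r ⟨p, hp⟩ / 2)) fun p hp =>
    Metric.ball_mem_nhds p (half_pos (hr ⟨p, hp⟩))
  -- This product vanishes on a neighbourhood of the frontier, equals one near the observation
  -- points, and by `pairing_prod` may multiply `u` without changing the functional.
  set ψ : Space d → ℝ := fun x => ∏ p ∈ t, (1 - f p x) with hψ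
  have hψ0 : ∀ x ∈ ⋃ p ∈ t, Metric.ball (p : Space d) (r p / 2), ψ x = 0 := fun x hx => by
    obtain ⟨p, hpt, hp⟩ := mem_iUnion₂.1 hx
    refine Finset.prod_eq_zero hpt ?_
    rw [(f p).one_of_mem_closedBall (Metric.ball_subset_closedBall hp), sub_self]
  have hψs : ContDiff ℝ ∞ ψ := contDiff_prod fun p _ => contDiff_const.sub (f p).contDiff
  have hU : IsOpen (⋃ p ∈ t, Metric.ball (p : Space d) (r p / 2)) :=
    isOpen_biUnion fun p _ => Metric.isOpen_ball
  -- `ψ` itself is not supported in the interior of `Ω`, as it need not vanish outside `Ω`. The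
  -- cutoff `ζ` repairs this without changing `ψ` on the interior.
  obtain ⟨ζ, hζ, hζ1, -⟩ := exists_isTest_one_nhds (S.compact.diff hU) isOpen_interior
    fun x hx => by
      by_contra hi
      exact hx.2 (ht (hcl.frontier_eq ▸ ⟨hx.1, hi⟩))
  have hχ : IsTest (interior Ω) fun x => ζ x * ψ x := ⟨hζ.1.mul hψs,
    hζ.2.1.of_isClosed_subset (isClosed_tsupport _) tsupport_mul_subset_left,
    tsupport_mul_subset_left.trans hζ.2.2⟩
  have heq : ∀ x ∈ interior Ω, ζ x * ψ x = ψ x := fun x hx => by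
    by_cases hxU : x ∈ ⋃ p ∈ t, Metric.ball (p : Space d) (r p / 2)
    · rw [hψ0 x hxU, mul_zero]
    · rw [hζ1.self_of_nhdsSet x ⟨interior_subset hx, hxU⟩, one_mul]
  have hX1 : ∀ i, ∀ᶠ x in 𝓝 (X i), ψ x = 1 := fun i => by
    have h1 : ∀ p ∈ t, ∀ᶠ x in 𝓝 (X i), f p x = 0 := fun p _ =>
      notMem_tsupport_iff_eventuallyEq.1 (by rw [(f p).tsupport_eq]; exact hXr p i)
    filter_upwards [(Filter.eventually_all_finset t).2 h1] with x hx
    exact Finset.prod_eq_one fun p hp => by rw [hx p hp, sub_zero]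
  have h1 := S.pairing_interior hη.pos hF hker (hu.1.isH2 S.comparable) hχ fun i =>
    hasPreciseValue_congr (by
      filter_upwards [hX1 i, isOpen_interior.mem_nhds (hX i)] with x hx hxi
      rw [heq x hxi, hx, one_mul]) (hobs i)
  rw [← S.pairing_prod hF hu.1 (fun p => (f p).contDiff) t fun p _ χ hχ hs =>
    hpair p χ hχ (by rwa [(f p).tsupport_eq] at hs), ← h1]
  exact S.pairing_congr hX ((hu.1.isH2 S.comparable).mul_smooth S.compact hψs) fun x hx => by
    rw [heq x hx]

end Setting

end PINN

/-! ### Conclusion -/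

theorem mainTheorem4 {d M : ℕ} (Ω : Set (PINN.Space d)) (hΩ : IsCompact Ω)
    (hbdry : PINN.HasC3HolderBoundary Ω)
    (η : PINN.Space d → ℝ) (hη : PINN.IsAuxiliary Ω η)
    (μ : Measure (PINN.Space d)) (hμ : PINN.IsSampling Ω μ)
    (A : PINN.DiffOp d) (hA : A.IsAdmissible Ω μ)
    (σ : ℝ → ℝ) (hσ : PINN.IsCb 4 σ) (hσ_nonconst : ¬ ∃ a, ∀ z, σ z = a)
    (ν : Measure (PINN.Param d)) (hν : PINN.IsInitialLaw ν)
    (X : Fin M → PINN.Space d) (hX : ∀ i, X i ∈ interior Ω)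
    (g u : PINN.Space d → ℝ) (hu : PINN.IsSolution A Ω μ g u)
    (hobs : ∀ i, PINN.HasPreciseValue u (X i))
    (Q : ℝ → PINN.Space d → ℝ) (hQ : PINN.IsWideLimit A Ω η σ ν μ X g u Q) :
    (∀ t, 0 ≤ t →
      PINN.HasL2Deriv μ (fun s => PINN.residual A Ω X g u (Q s))
        (- PINN.opV A η σ ν μ X (PINN.residual A Ω X g u (Q t))) t) ∧
    Tendsto (fun t => eLpNorm (A.weak Ω (Q t) - g) 2 μ ^ 2
        + eLpNorm (Q t - u) 2 (PINN.obsMeasure X) ^ 2) atTop (𝓝 0) := by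
  have h0 := hη.volume_frontier
  have S : PINN.Setting Ω μ A η σ ν := ⟨hΩ, hμ.finite, hμ.comparable h0, hA, hη.isCb.1, hσ, hν⟩
  refine ⟨fun t ht => S.hasL2Deriv_residual hX hu hQ ht, S.tendsto_residual hX hu hQ fun F hF h => ?_⟩
  exact S.pairing_eq_zero hη hF (fun p hp hc => S.annihilates_of_hasCompactSupport hX hF hσ_nonconst h hp hc)
    hX hu.1 hobs
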